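/- **Conventions.** Let $\mathcal P$ be a bounded additive theory: a (locally small) additive category with small coproducts such that every object is a retract of a small coproduct of objects from a fixed small set. Let $\mathcal M$ be the abelian category of models of $\mathcal P$, i.e. presheaves of abelian groups $X$ on $\mathcal P$ with $X(\coprod_i Q_i)\cong\prod_i X(Q_i)$; regard $\mathcal P\subset\mathcal M$ by the Yoneda embedding. A *bimodule* is a colimit-preserving endofunctor of $\mathcal M$ (equivalently, a coproduct-preserving functor $\mathcal P\to\mathcal M$); kernels and monomorphisms of bimodules are formed by evaluating on objects of $\mathcal P$, and cokernels on all of $\mathcal M$. The composition product of bimodules is written $\circ$ and its unit is $I$. An *algebra* is a monoid for $\circ$, i.e. a colimit-preserving monad on $\mathcal M$; it is *projective* if $F(Q)$ is projective in $\mathcal M$ for all $Q\in\mathcal P$. An *augmentation* of $F$ is an algebra map $F\to I$; it makes every $X\in\mathcal M$ into an $F$-module $\overline X$. A *filtered algebra* is an algebra $F$ with subbimodules $I=F_{\le 0}\subset F_{\le 1}\subset\cdots$, $F=\operatorname{colim}_n F_{\le n}$, whose multiplication restricts to $F_{\le i}\circ F_{\le j}\to F_{\le i+j}$; $\operatorname{gr}F=\bigoplus_n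 F_{\le n}/F_{\le n-1}$ is its associated graded algebra, with $F_{\le -1}=0$. A *graded algebra* is an algebra $G=\bigoplus_{n\ge 0}G[n]$ with $G[0]=I$ and products $G[i]\circ G[j]\to G[i+j]$; it is augmented by killing $G[n]$ for $n\geq1$, and filtered by $G_{\le n}=\bigoplus_{m\leq n}G[m]$. For an algebra $F$ and an $F$-module $M$ let $F_+=\operatorname{coker}(I\to F)$, and let $C(F,F,M)$, $C_n(F,F,M)=F\circ F_+^{\circ n}(M)$, be the reduced bar resolution. For a module $N$ the reduced cobar complex is $C_F(M,N)=\operatorname{Hom}_F(C(F,F,M),N)$, so that $C_F^n(M,N)=\operatorname{Hom}_{\mathcal M}(F_+^{\circ n}M,N)$. A graded algebra $G$ is *homogeneous Koszul* if it is projective and, for all $Q\in\mathcal P$, the homology of the reduced bar complex $C(I,G,\overline Q)$, $C_n=G_+^{\circ n}Q$, is zero in homological degree $n$ and weight $m$ whenever $n\ne m$. A filtered algebra $F$ is *Koszul* (possibly nonhomogeneous) if it is projective and $\operatorname{gr}F$ is homogeneous Koszul. For an augmented algebra $G$, the cohomology $H^n(G)$ is the functor $\mathcal P^{\mathrm{op}}\times\mathcal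 M\to\mathrm{Ab}$, $(Q,N)\mapsto\operatorname{Ext}^n_G(\overline Q,\overline N)$. For a filtered (or graded) algebra $F$ let $C_n(F,F,M)[\le m]\subset C_n(F,F,M)$ be the sum of the images of $F\circ F_{\le m_1}\circ\cdots\circ F_{\le m_n}(M)$ over $m_1+\cdots+m_n\le m$ (for a graded algebra one may use $F\circ F[m_1]\circ\cdots\circ F[m_n](M)$), and let $K_n(F,F,M)=\{x\in C_n[\le n] : dx\in C_{n-1}[\le n-1]\}$. This is a subcomplex, and the *Koszul complex* is $K_F(M,N)=\operatorname{Hom}_F(K(F,F,M),N)$; restriction is a map of complexes $C_F(M,N)\to K_F(M,N)$. For cobar cochains $c\in C^n_F(M,N)$ and $c'\in C^m_F(N,L)$ put $c\wr c'=(-1)^{nm}\,c'\circ F_+^{\circ m}(c)\in C_F^{n+m}(M,L)$. If $F$ is graded, $Q^M\in K^1_F(M,M)$ denotes the class of $-a_M$, where $a_M\colon F_+M\to M$ is the restriction of the action to the augmentation ideal $F_+=\bigoplus_{n\ge1}F[n]$. For bimodules $H,R$ and a map $r\colon R\to H\circ H$, the *quadratic algebra* $T(H,R)$ is the tensor algebra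 on $H$ modulo the two-sided ideal generated by the image of $R$; its $n$-th component is the cokernel of $\bigoplus_{a+b+2=n}H^{\circ a}\circ R\circ H^{\circ b}\to H^{\circ n}$. **Theorem.** Let $F$ be a Koszul filtered algebra over $\mathcal P$. The bimodule $qR=\ker(F_{\le 1}\circ F_{\le 1}\to F_{\le 2})$ exists, in the sense that there are a bimodule $qR$ and a map of bimodules $qR\to F_{\leq 1}\circ F_{\leq 1}$ which is the kernel of the multiplication on each object of $\mathcal P$. Put $T=T(F_{\le1},qR)$. There is a unique homomorphism of graded algebras $\Phi\colon T\to\bigoplus_{m\ge 0}F_{\le m}$ which extends the identity of $F_{\le1}$, and the following hold. 1. $\Phi$ is an isomorphism of graded algebras. 2. $T$ is homogeneous Koszul. 3. The homomorphism $T\to F$ given by $\Phi$ and the inclusions $F_{\le m}\subset F$ is surjective. Restriction of modules along the homomorphism $T\to\operatorname{gr}F$ given by $\Phi$ and the projections $F_{\le m}\to F_{\le m}/F_{\le m-1}$ induces an isomorphism $H^0(\operatorname{gr}F)\cong H^0(T)$ and is the first map in short exact sequences of functors on $\mathcal P^{\mathrm{op}}\times\mathcal M$ $$0\to H^{n}(\operatorname{gr}F)\to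 H^{n}(T)\to H^{n-1}(\operatorname{gr}F)\to 0\qquad(n\ge1).$$ If $F$ admits an augmentation, these sequences split as sequences of functors. 4. Let $M,N$ be $F$-modules, also regarded as $T$-modules along $T\to F$, with $M$ projective in $\mathcal M$. The map $C_F(M,N)\to K_F(M,N)$ is surjective, and there is an injective map of complexes $K_F(M,N)\to K_T(M,N)$ which is compatible with the map of cobar complexes $C_F(M,N)\to C_T(M,N)$ given by restriction along $T\to F$. Thus $K_F(M,N)$ is a subcomplex of $K_T(M,N)$. 5. For $T$-modules $M,N$ with $M$ projective in $\mathcal M$, the map $C_T(M,N)\to K_T(M,N)$ is surjective. There are biadditive pairings $\wr\colon K_T^n(M,N)\times K_T^m(N,L)\to K_T^{n+m}(M,L)$ (for all $T$-modules $M,N,L$) which, whenever $M$ is projective in $\mathcal M$, are induced by the pairing $\wr$ of cobar cochains, and for $M$ projective in $\mathcal M$ the differential of $K_T(M,N)$ is $$\delta(f)=Q^M\wr f-(-1)^n\,f\wr Q^N\qquad(f\in K_T^n(M,N)).$$ -/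

import Mathlib

set_option linter.unusedSectionVars false
set_option linter.unusedVariables false

open CategoryTheory CategoryTheory.Limits Opposite

universe w v u

namespace Koszul

section Theory

variable (P : Type u) [Category.{w} P] [Preadditive P] [HasCoproducts.{w} P]

/-- Additive theories `P` are preadditive categories with small coproducts. Such a theory is bounded
if every object is a retract of a coproduct of objects from a small family. -/
class IsBoundedTheory : Prop where
  exists_generators : ∃ (S : Type w) (g : S → P), ∀ X : P, ∃ (J : Type w) (s : J → S),
    Nonempty (Retract X (∐ fun j => g (s j)))

/-- A presheaf `X` is a model if the maps `X (∐ p) ⟶ ∏ X (p j)` are bijective. On an additive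
theory a presheaf of sets with this property is the same as a presheaf of abelian groups with this
property. -/
def IsModel : ObjectProperty (Pᵒᵖ ⥤ AddCommGrpCat.{w}) := fun X =>
  ∀ (J : Type w) (p : J → P), Function.Bijective
    (fun (x : X.obj (op (∐ p))) (j : J) => X.map (Sigma.ι p j).op x)

variable {P}

lemma ab_exact_app {X Y Z : Pᵒᵖ ⥤ AddCommGrpCat.{w}} {f : X ⟶ Y} {g : Y ⟶ Z} {h : f ≫ g = 0}
    (H : (ShortComplex.mk f g h).Exact) (Q : Pᵒᵖ) (y : Y.obj Q) (hy : g.app Q y = 0) :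
    ∃ x, f.app Q x = y :=
  (ShortComplex.ab_exact_iff _).1 (H.map ((evaluation _ _).obj Q)) y hy

lemma ab_comp_app {X Y Z : Pᵒᵖ ⥤ AddCommGrpCat.{w}} {f : X ⟶ Y} {g : Y ⟶ Z} (h : f ≫ g = 0)
    (Q : Pᵒᵖ) (x : X.obj Q) : g.app Q (f.app Q x) = 0 := by
  have := congr_arg (fun a => (a.app Q) x) h
  simpa using this

lemma ab_nat {X Y : Pᵒᵖ ⥤ AddCommGrpCat.{w}} (f : X ⟶ Y) {Q Q' : Pᵒᵖ} (a : Q ⟶ Q')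
    (x : X.obj Q) : f.app Q' (X.map a x) = Y.map a (f.app Q x) := by
  have := congr_arg (fun a => a x) (f.naturality a)
  simpa using this

instance : (IsModel P).IsClosedUnderKernels where
  kernels_le := by
    rintro _ ⟨f, k, hk, hX, hY⟩ J p
    have hm : Mono k.ι := Fork.IsLimit.mono hk
    have hm' : ∀ Q, Function.Injective (k.ι.app Q) := fun Q =>
      (AddCommGrpCat.mono_iff_injective _).1 inferInstance
    have hex : (ShortComplex.mk k.ι f k.condition).Exact :=
      ShortComplex.exact_of_f_is_kernel _ (IsLimit.ofIsoLimit hk (Fork.ext (Iso.refl _)))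
    constructor
    · intro x y hxy
      apply hm'
      apply (hX J p).1
      funext j
      have := congr_fun hxy j
      dsimp only at this ⊢
      rw [← ab_nat, ← ab_nat]
      exact congr_arg _ this
    · intro x
      obtain ⟨y, hy⟩ := (hX J p).2 (fun j => k.ι.app _ (x j))
      have hy' : ∀ j, _ := fun j => congr_fun hy j
      dsimp only at hy'
      have : f.app _ y = 0 := by
        apply (hY J p).1
        funext j
        dsimp only
        rw [← ab_nat, hy' j, ab_comp_app k.condition, map_zero]
      obtain ⟨z, hz⟩ := ab_exact_app hex _ y this
      refine ⟨z, ?_⟩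
      funext j
      apply hm'
      dsimp only
      rw [ab_nat, ← hy' j]
      exact congr_arg _ hz

instance : (IsModel P).IsClosedUnderCokernels where
  cokernels_le := by
    rintro _ @⟨X₁, X₂, f, k, hk, hX, hY⟩ J p
    have hm : Epi k.π := Cofork.IsColimit.epi hk
    have hm' : ∀ Q, Function.Surjective (k.π.app Q) := fun Q =>
      (AddCommGrpCat.epi_iff_surjective _).1 inferInstance
    have hex : (ShortComplex.mk f k.π k.condition).Exact :=
      ShortComplex.exact_of_g_is_cokernel _ (IsColimit.ofIsoColimit hk (Cofork.ext (Iso.refl _)))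
    constructor
    · intro x x' hxx
      obtain ⟨y, rfl⟩ := hm' _ x
      obtain ⟨y', rfl⟩ := hm' _ x'
      have hj : ∀ j, ∃ z, f.app _ z = _ := fun j => ab_exact_app hex (op (p j))
        (X₂.map (Sigma.ι p j).op (y - y')) (by
          have := congr_fun hxx j
          dsimp only at this
          dsimp only
          rw [ab_nat, map_sub, map_sub, sub_eq_zero]
          exact this)
      choose z hz using hj
      obtain ⟨t, ht⟩ := (hX J p).2 z
      have : f.app _ t = y - y' := by
        apply (hY J p).1
        funext j
        dsimp only
        rw [← ab_nat, ← hz j]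
        exact congr_arg _ (congr_fun ht j)
      rw [← sub_eq_zero, ← map_sub, ← this]
      exact ab_comp_app k.condition _ _
    · intro x
      choose y hy using fun j => hm' _ (x j)
      obtain ⟨z, hz⟩ := (hY J p).2 y
      refine ⟨k.π.app _ z, ?_⟩
      funext j
      dsimp only
      rw [← ab_nat, ← hy j]
      exact congr_arg _ (congr_fun hz j)


instance : (IsModel P).ContainsZero where
  exists_zero := by
    refine ⟨(Functor.const _).obj (AddCommGrpCat.of PUnit), ?_, ?_⟩
    · rw [IsZero.iff_id_eq_zero]
      ext
      rfl
    · intro J p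
      exact ⟨fun _ _ _ => rfl, fun x => ⟨0, rfl⟩⟩

lemma isModel_of_isLimit {J : Type w} (D : Discrete J ⥤ Pᵒᵖ ⥤ AddCommGrpCat.{w}) (c : Cone D)
    (hc : IsLimit c) (hD : ∀ j, IsModel P (D.obj j)) : IsModel P c.pt := by
  have hQ : ∀ Q : Pᵒᵖ, IsLimit
      (((evaluation _ _).obj Q ⋙ forget AddCommGrpCat.{w}).mapCone c) := fun Q =>
    isLimitOfPreserves _ hc
  have inj : ∀ (Q : Pᵒᵖ) (x y : c.pt.obj Q),
      (∀ i, (c.π.app i).app Q x = (c.π.app i).app Q y) → x = y := fun Q x y h =>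
    (Types.isLimitEquivSections (hQ Q)).injective (Subtype.ext (funext h))
  have surj : ∀ (Q : Pᵒᵖ) (x : ∀ i, (D.obj i).obj Q), ∃ y : c.pt.obj Q, 
      (∀ i, (c.π.app i).app Q y = x i) := by
    intro Q x
    refine ⟨(Types.isLimitEquivSections (hQ Q)).symm ⟨x, ?_⟩, ?_⟩
    · rintro ⟨i⟩ ⟨j⟩ ⟨⟨rfl : i = j⟩⟩
      have : D.map (𝟙 (Discrete.mk i)) = 𝟙 _ := D.map_id _
      exact congr_arg (fun a => a.app Q (x _)) this
    · intro i
      exact Types.isLimitEquivSections_symm_apply (hQ Q) _ i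
  intro K p
  constructor
  · intro x y hxy
    refine inj _ _ _ (fun i => ?_)
    apply (hD i K p).1
    funext k
    have := congr_fun hxy k
    dsimp only at this ⊢
    rw [← ab_nat, ← ab_nat]
    exact congr_arg _ this
  · intro x
    choose y hy using fun i => (hD i K p).2 (fun k => (c.π.app i).app _ (x k))
    obtain ⟨z, hz⟩ := surj _ y
    refine ⟨z, ?_⟩
    funext k
    refine inj _ _ _ (fun i => ?_)
    refine (ab_nat (c.π.app i) _ z).trans ?_
    rw [hz]
    exact congr_fun (hy i) k

instance : (IsModel P).IsClosedUnderFiniteProducts :=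
  .of_isClosedUnderLimitsOfShape.{w} (fun J _ => ⟨by
    rintro X ⟨h⟩
    exact isModel_of_isLimit h.diag _ h.isLimit h.prop_diag_obj⟩)

variable (P) in
/-- The abelian category of discrete models of an additive theory. -/
abbrev Model := (IsModel P).FullSubcategory

noncomputable instance : Abelian (Model P) := inferInstance

lemma isModel_preadditiveYoneda (Q : P) : IsModel P (preadditiveYoneda.obj Q) := fun _ _ =>
  ⟨fun _ _ h => Sigma.hom_ext _ _ (fun j => congr_fun h j),
    fun f => ⟨Sigma.desc f, funext fun _ => Sigma.ι_desc _ _⟩⟩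

variable (P) in
/-- The embedding of a theory into its category of models, by representable models. -/
def embedding : P ⥤ Model P where
  obj Q := ⟨preadditiveYoneda.obj Q, isModel_preadditiveYoneda Q⟩
  map f := ObjectProperty.homMk (preadditiveYoneda.map f)

lemma IsModel.map_zero_apply {X : Pᵒᵖ ⥤ AddCommGrpCat.{w}} (hX : IsModel P X) {Q R : P}
    (x : X.obj (op Q)) : X.map (0 : R ⟶ Q).op x = 0 := by
  let p : PEmpty.{w+1} → P := fun e => e.elim
  have h : (0 : R ⟶ Q) = (0 : R ⟶ ∐ p) ≫ (0 : ∐ p ⟶ Q) := by simp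
  have h0 : X.map (0 : ∐ p ⟶ Q).op x = 0 := (hX _ p).1 (funext fun e => e.elim)
  rw [h, op_comp, Functor.map_comp]
  exact (congr_arg (X.map (0 : R ⟶ ∐ p).op) h0).trans (map_zero _)

lemma IsModel.map_add_apply {X : Pᵒᵖ ⥤ AddCommGrpCat.{w}} (hX : IsModel P X) {Q R : P}
    (f g : R ⟶ Q) (x : X.obj (op Q)) :
    X.map (f + g).op x = X.map f.op x + X.map g.op x := by
  let p : ULift.{w} Bool → P := fun _ => R
  let h : ∐ p ⟶ Q := Sigma.desc fun b => cond b.down f g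
  let q (b : Bool) : ∐ p ⟶ R := Sigma.desc fun c => if b = c.down then 𝟙 R else 0
  let d : R ⟶ ∐ p := Sigma.ι p ⟨true⟩ + Sigma.ι p ⟨false⟩
  have comp : ∀ {A B C : P} (a : A ⟶ B) (b : B ⟶ C) (y : X.obj (op C)),
      X.map a.op (X.map b.op y) = X.map (a ≫ b).op y := fun a b y => by simp
  have h1 : d ≫ h = f + g := by simp [d, h, p]
  have h2 : ∀ b, d ≫ q b = 𝟙 R := by intro b; cases b <;> simp [d, q, p]
  have key : X.map h.op x = X.map (q true ≫ f).op x + X.map (q false ≫ g).op x := by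
    apply (hX _ p).1
    funext ⟨b⟩
    have e1 : Sigma.ι p ⟨b⟩ ≫ h = cond b f g := Sigma.ι_desc _ _
    have e2 : ∀ c, Sigma.ι p ⟨b⟩ ≫ q c = if c = b then 𝟙 R else 0 := fun c => Sigma.ι_desc _ _
    have e3 : Sigma.ι p ⟨b⟩ ≫ q true ≫ f = if true = b then f else 0 := by
      rw [← Category.assoc, e2]; cases b <;> first | exact zero_comp | exact Category.id_comp _
    have e4 : Sigma.ι p ⟨b⟩ ≫ q false ≫ g = if false = b then g else 0 := by
      rw [← Category.assoc, e2]; cases b <;> first | exact zero_comp | exact Category.id_comp _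
    refine (comp _ _ _).trans ?_
    refine Eq.trans ?_ (map_add (X.map (Sigma.ι p ⟨b⟩).op).hom _ _).symm
    refine Eq.trans ?_ (congr_arg₂ _ (comp _ _ _).symm (comp _ _ _).symm)
    rw [e1, e3, e4]
    cases b
    · exact ((congr_arg (· + _) (hX.map_zero_apply x)).trans (zero_add _)).symm
    · exact ((congr_arg (_ + ·) (hX.map_zero_apply x)).trans (add_zero _)).symm
  have h3 : X.map (f + g).op x = X.map d.op (X.map h.op x) := by rw [comp, h1]
  rw [h3, key, map_add, comp, comp, ← Category.assoc, h2, ← Category.assoc, h2]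
  simp

/-- The morphism out of a representable model which corresponds to an element by the Yoneda
lemma. -/
def ofElement {Q : P} {X : Model P} (x : X.obj.obj (op Q)) : (embedding P).obj Q ⟶ X :=
  ObjectProperty.homMk
   { app R := AddCommGrpCat.ofHom (AddMonoidHom.mk' (fun f : R.unop ⟶ Q => X.obj.map f.op x)
       (fun f g => X.property.map_add_apply f g x))
     naturality R S a := by
       ext f
       exact ConcreteCategory.congr_hom (X.obj.map_comp f.op a) x }

lemma ofElement_apply {Q R : P} {X : Model P} (x : X.obj.obj (op Q)) (f : R ⟶ Q) :
    (ofElement x).hom.app (op R) f = X.obj.map f.op x := rfl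

lemma ofElement_apply_id {Q : P} {X : Model P} (x : X.obj.obj (op Q)) :
    (ofElement x).hom.app (op Q) (𝟙 Q) = x := by
  exact ConcreteCategory.congr_hom (X.obj.map_id (op Q)) x

lemma hom_ext_embedding {Q : P} {X : Model P} {f g : (embedding P).obj Q ⟶ X}
    (h : f.hom.app (op Q) (𝟙 Q) = g.hom.app (op Q) (𝟙 Q)) : f = g := by
  ext R a
  have h1 := ab_nat f.hom (Quiver.Hom.op a) (𝟙 Q)
  have h2 := ab_nat g.hom (Quiver.Hom.op a) (𝟙 Q)
  rw [h, ← h2] at h1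
  have h3 : ((embedding P).obj Q).obj.map (Quiver.Hom.op a) (𝟙 Q) = a := Category.comp_id a
  rw [h3] at h1
  exact h1

lemma epi_of_surjective {X Y : Model P} (f : X ⟶ Y)
    (h : ∀ Q, Function.Surjective (f.hom.app Q)) : Epi f := by
  refine ⟨fun a b hab => ?_⟩
  ext Q y
  obtain ⟨x, rfl⟩ := h Q y
  have := congr_arg (fun c => c.hom.app Q x) hab
  simpa using this

lemma exists_epi [IsBoundedTheory P] (X : Model P) : ∃ (Q : P) (f : (embedding P).obj Q ⟶ X), Epi f := by
  obtain ⟨S, g, hg⟩ := IsBoundedTheory.exists_generators (P := P)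
  let I := Σ s : S, X.obj.obj (op (g s))
  let p : I → P := fun i => g i.1
  obtain ⟨x, hx⟩ := (X.property _ p).2 (fun i => i.2)
  refine ⟨_, ofElement x, epi_of_surjective _ ?_⟩
  rintro ⟨R⟩ y
  obtain ⟨J, s, ⟨r⟩⟩ := hg R
  let z := X.obj.map r.r.op y
  let e : (∐ fun j => g (s j)) ⟶ ∐ p :=
    Sigma.desc fun j => Sigma.ι p ⟨s j, X.obj.map (Sigma.ι (fun j => g (s j)) j).op z⟩
  have he : X.obj.map e.op x = z := by
    apply (X.property _ _).1
    funext j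
    dsimp only
    have := ConcreteCategory.congr_hom (X.obj.map_comp e.op (Sigma.ι (fun j => g (s j)) j).op) x
    refine this.symm.trans ?_
    rw [← op_comp, Sigma.ι_desc]
    exact congr_fun hx _
  refine ⟨r.i ≫ e, ?_⟩
  rw [ofElement_apply]
  rw [op_comp, Functor.map_comp]
  refine (congr_arg (X.obj.map r.i.op) he).trans ?_
  have := ConcreteCategory.congr_hom (X.obj.map_comp r.r.op r.i.op) y
  refine this.symm.trans ?_
  rw [← op_comp, r.retract]
  simp


/-- The embedding of a theory into its models preserves coproducts. -/
noncomputable def isColimitEmbedding {J : Type w} (p : J → P) :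
    IsColimit (Cofan.mk ((embedding P).obj (∐ p)) fun j => (embedding P).map (Sigma.ι p j)) :=
  mkCofanColimit _
    (fun s => ofElement ((s.pt.property _ p).2 (fun j => (s.inj j).hom.app _ (𝟙 (p j)))).choose)
    (fun s j => hom_ext_embedding (by
      have := congr_fun ((s.pt.property _ p).2
        (fun j => (s.inj j).hom.app _ (𝟙 (p j)))).choose_spec j
      dsimp only at this
      refine Eq.trans ?_ this
      exact congr_arg (fun a => s.pt.obj.map (Quiver.Hom.op a) _) (Category.id_comp _)))
    (fun s m hm => hom_ext_embedding (by
      apply (s.pt.property _ p).1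
      funext j
      have h1 := ab_nat m.hom (Sigma.ι p j).op (𝟙 (∐ p))
      have h2 := congr_arg (fun a => a.hom.app _ (𝟙 (p j))) (hm j)
      have h3 := congr_fun ((s.pt.property _ p).2
        (fun j => (s.inj j).hom.app _ (𝟙 (p j)))).choose_spec j
      refine h1.symm.trans (Eq.trans ?_ (h2.trans (h3.symm.trans ?_)))
      · exact congr_arg (fun a => m.hom.app _ a)
          ((Category.comp_id (Sigma.ι p j)).trans (Category.id_comp (Sigma.ι p j)).symm)
      · exact congr_arg (fun a => s.pt.obj.map (Sigma.ι p j).op a)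
          (ofElement_apply_id _).symm))

instance [IsBoundedTheory P] : HasCoproducts.{w} (Model P) := by
  intro J
  have : ∀ X : J → Model P, HasColimit (Discrete.functor X) := by
    intro X
    choose Q0 e he using fun j => exists_epi (X j)
    choose Q1 e' he' using fun j => exists_epi (kernel (e j))
    let φ : (embedding P).obj (∐ Q1) ⟶ (embedding P).obj (∐ Q0) :=
      Cofan.IsColimit.desc (isColimitEmbedding Q1)
        fun j => e' j ≫ kernel.ι (e j) ≫ (embedding P).map (Sigma.ι Q0 j)
    have hφ : ∀ j, (embedding P).map (Sigma.ι Q1 j) ≫ φ =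
        e' j ≫ kernel.ι (e j) ≫ (embedding P).map (Sigma.ι Q0 j) := fun j =>
      Cofan.IsColimit.fac (isColimitEmbedding Q1) _ j
    let inj : ∀ j, X j ⟶ cokernel φ := fun j =>
      Abelian.epiDesc (e j) ((embedding P).map (Sigma.ι Q0 j) ≫ cokernel.π φ) (by
        rw [← cancel_epi (e' j), comp_zero]
        have := congr_arg (fun a => a ≫ cokernel.π φ) (hφ j)
        simp only [Category.assoc, cokernel.condition, comp_zero] at this
        exact this.symm)
    have hinj : ∀ j, e j ≫ inj j = (embedding P).map (Sigma.ι Q0 j) ≫ cokernel.π φ := fun j =>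
      Abelian.comp_epiDesc _ _ _
    let d : ∀ s : Cofan X, (embedding P).obj (∐ Q0) ⟶ s.pt := fun s =>
      Cofan.IsColimit.desc (isColimitEmbedding Q0) fun j => e j ≫ s.inj j
    have hd : ∀ s j, (embedding P).map (Sigma.ι Q0 j) ≫ d s = e j ≫ s.inj j := fun s j =>
      Cofan.IsColimit.fac (isColimitEmbedding Q0) _ j
    have hd0 : ∀ s, φ ≫ d s = 0 := fun s => by
      refine Cofan.IsColimit.hom_ext (isColimitEmbedding Q1) _ _ (fun j => ?_)
      rw [comp_zero]
      change (embedding P).map (Sigma.ι Q1 j) ≫ _ = 0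
      rw [← Category.assoc, hφ]
      simp [hd]
    exact ⟨⟨⟨_, mkCofanColimit (Cofan.mk _ inj) (fun s => cokernel.desc φ (d s) (hd0 s))
      (fun s j => by
        rw [← cancel_epi (e j)]
        change e j ≫ inj j ≫ _ = _
        rw [← Category.assoc, hinj]
        simp [hd]) 
      (fun s m hm => by
        rw [← cancel_epi (cokernel.π φ), cokernel.π_desc]
        refine Cofan.IsColimit.hom_ext (isColimitEmbedding Q0) _ _ (fun j => ?_)
        change (embedding P).map (Sigma.ι Q0 j) ≫ _ = (embedding P).map (Sigma.ι Q0 j) ≫ _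
        rw [hd, ← hm j, ← Category.assoc, ← hinj, Category.assoc]
        rfl)⟩⟩⟩
  exact ⟨fun D => hasColimit_of_iso Discrete.natIsoFunctor⟩

instance [IsBoundedTheory P] : HasColimitsOfSize.{w, w} (Model P) :=
  has_colimits_of_hasCoequalizers_and_coproducts

end Theory

section Alg
variable {A : Type u} [Category.{v} A] [Abelian A]

lemma additive_of_preservesFiniteColimits (F : A ⥤ A) [PreservesFiniteColimits F] :
    F.Additive := by
  have := preservesBinaryBiproducts_of_preservesBinaryCoproducts F
  exact Functor.additive_of_preservesBinaryBiproducts F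

variable (T : Monad A) [PreservesFiniteColimits (T : A ⥤ A)]

instance : (T : A ⥤ A).Additive := additive_of_preservesFiniteColimits _

lemma hasFiniteLimits_algebra : HasFiniteLimits T.Algebra :=
  ⟨fun _ _ _ => ⟨fun D => hasLimit_of_created D T.forget⟩⟩

lemma hasFiniteColimits_algebra : HasFiniteColimits T.Algebra :=
  ⟨fun _ _ _ => ⟨fun D => hasColimit_of_created D T.forget⟩⟩

instance : PreservesFiniteColimits T.forget :=
  ⟨fun _ _ _ => ⟨fun {D} => preservesColimit_of_createsColimit_and_hasColimit D T.forget⟩⟩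

instance : Abelian T.Algebra :=
  have := hasFiniteLimits_algebra T
  have := hasFiniteColimits_algebra T
  { has_finite_products := inferInstance
    has_kernels := inferInstance
    has_cokernels := inferInstance
    normalMonoOfMono := fun f => ⟨
     { Z := cokernel f
       g := cokernel.π f
       w := cokernel.condition f
       isLimit := isLimitOfReflects T.forget ((KernelFork.isLimitMapConeEquiv _ _).symm
        (Abelian.monoIsKernelOfCokernel _ ((CokernelCofork.ofπ _ (cokernel.condition f)).mapIsColimit (cokernelIsCokernel f) T.forget))) }⟩
    normalEpiOfEpi := fun f => ⟨
     { W := kernel f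
       g := kernel.ι f
       w := kernel.condition f
       isColimit := isColimitOfReflects T.forget ((CokernelCofork.isColimitMapCoconeEquiv _ _).symm
        (Abelian.epiIsCokernelOfKernel _ ((KernelFork.ofι _ (kernel.condition f)).mapIsLimit (kernelIsKernel f) T.forget))) }⟩ }

end Alg

section Bimodules
variable {A : Type u} [Category.{v} A] [Abelian A]

lemma preservesColimitsOfShape_of_isColimit {K I : Type*} [Category* K] [Category* I]
    [HasColimitsOfShape I A] {D : I ⥤ A ⥤ A} {c : Cocone D} (hc : IsColimit c)
    (h : ∀ i, PreservesColimitsOfShape K (D.obj i)) : PreservesColimitsOfShape K c.pt := by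
  have : PreservesColimitsOfShape K D.flip := ⟨fun {F} => ⟨fun {c} hc =>
    ⟨evaluationJointlyReflectsColimits _ (fun i => isColimitOfPreserves (D.obj i) hc)⟩⟩⟩
  let e : D.flip ⋙ colim ≅ c.pt :=
    NatIso.ofComponents
      (fun X => (colimit.isColimit (D.flip.obj X)).coconePointUniqueUpToIso
        (isColimitOfPreserves ((evaluation _ _).obj X) hc))
      (fun f => colimit.hom_ext fun i => by simp)
  exact preservesColimitsOfShape_of_natIso e

lemma cocontinuous_of_isColimit {I : Type*} [Category* I] [HasColimitsOfShape I A]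
    {D : I ⥤ A ⥤ A} {c : Cocone D} (hc : IsColimit c)
    (h : ∀ i, PreservesColimitsOfSize.{w, w} (D.obj i)) : PreservesColimitsOfSize.{w, w} c.pt :=
  ⟨fun {K} _ => preservesColimitsOfShape_of_isColimit hc fun i => inferInstance⟩

lemma preservesFiniteColimits_of_cocontinuous (F : A ⥤ A) [PreservesColimitsOfSize.{w, w} F] :
    PreservesFiniteColimits F := by
  have := preservesSmallestColimits_of_preservesColimits F
  infer_instance

lemma cocontinuous_cokernel {F G : A ⥤ A} (s : F ⟶ G) (hF : PreservesColimitsOfSize.{w, w} F)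
    (hG : PreservesColimitsOfSize.{w, w} G) : PreservesColimitsOfSize.{w, w} (cokernel s) :=
  cocontinuous_of_isColimit (colimit.isColimit (parallelPair s 0)) (by
    rintro (_ | _)
    · exact hF
    · exact hG)

lemma cocontinuous_sigma [HasCountableCoproducts A] {I : Type} [Countable I] (F : I → A ⥤ A)
    (hF : ∀ i, PreservesColimitsOfSize.{w, w} (F i)) : PreservesColimitsOfSize.{w, w} (∐ F) :=
  cocontinuous_of_isColimit (colimit.isColimit (Discrete.functor F)) (fun ⟨i⟩ => hF i)

/-- Evaluation of a coproduct of endofunctors, followed by a cocontinuous functor. -/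
noncomputable def isColimitSigmaMap [HasCountableCoproducts A] {I : Type} [Countable I]
    (F : I → A ⥤ A) (G : A ⥤ A) [PreservesColimitsOfSize.{w, w} G] (X : A) :
    IsColimit (Cofan.mk (G.obj ((∐ F).obj X)) fun i => G.map ((Sigma.ι F i).app X)) :=
  have := preservesSmallestColimits_of_preservesColimits G
  isColimitCofanMkObjOfIsColimit ((evaluation A A).obj X ⋙ G) F _ (coproductIsCoproduct F)

noncomputable def isColimitSigma [HasCountableCoproducts A] {I : Type} [Countable I]
    (F : I → A ⥤ A) (X : A) :
    IsColimit (Cofan.mk ((∐ F).obj X) fun i => (Sigma.ι F i).app X) :=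
  isColimitCofanMkObjOfIsColimit ((evaluation A A).obj X) F _ (coproductIsCoproduct F)

lemma sigma_map_hom_ext [HasCountableCoproducts A] {I : Type} [Countable I]
    (F : I → A ⥤ A) (G : A ⥤ A) [PreservesColimitsOfSize.{w, w} G] {X Z : A}
    {f g : G.obj ((∐ F).obj X) ⟶ Z}
    (h : ∀ i, G.map ((Sigma.ι F i).app X) ≫ f = G.map ((Sigma.ι F i).app X) ≫ g) : f = g :=
  Cofan.IsColimit.hom_ext (isColimitSigmaMap F G X) _ _ h

lemma sigma_hom_ext [HasCountableCoproducts A] {I : Type} [Countable I]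
    (F : I → A ⥤ A) {X Z : A} {f g : (∐ F).obj X ⟶ Z}
    (h : ∀ i, (Sigma.ι F i).app X ≫ f = (Sigma.ι F i).app X ≫ g) : f = g :=
  Cofan.IsColimit.hom_ext (isColimitSigma F X) _ _ h

lemma map_epi_of_cocontinuous (G : A ⥤ A) (hG : PreservesColimitsOfSize.{w, w} G) {X Y : A}
    (f : X ⟶ Y) [Epi f] : Epi (G.map f) := by
  have := preservesFiniteColimits_of_cocontinuous.{w} G
  infer_instance

end Bimodules

/-- A graded algebra `⨁ₙ G[n]` in endofunctors which preserve colimits (bimodules). The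
multiplication `G[i] ∘ G[j] ⟶ G[k]` is given for `i + j = k`, and `G[0]` is the identity functor
by means of the unit. -/
structure GradedAlgebra (A : Type u) [Category.{v} A] where
  pc : ℕ → A ⥤ A
  cocontinuous : ∀ n, PreservesColimitsOfSize.{w, w} (pc n)
  one : 𝟭 A ⟶ pc 0
  isIso_one : IsIso one
  mul : ∀ {i j k : ℕ}, i + j = k → (pc j ⋙ pc i ⟶ pc k)
  one_mul : ∀ (n : ℕ) (X : A), one.app ((pc n).obj X) ≫ (mul (zero_add n)).app X = 𝟙 _
  mul_one : ∀ (n : ℕ) (X : A), (pc n).map (one.app X) ≫ (mul (add_zero n)).app X = 𝟙 _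
  assoc : ∀ {i j k ij jk n : ℕ} (h₁ : i + j = ij) (h₂ : ij + k = n) (h₃ : j + k = jk)
    (h₄ : i + jk = n) (X : A), (mul h₁).app ((pc k).obj X) ≫ (mul h₂).app X =
      (pc i).map ((mul h₃).app X) ≫ (mul h₄).app X

namespace GradedAlgebra

attribute [instance] cocontinuous isIso_one

variable {A : Type u} [Category.{v} A]

/-- A homomorphism of graded algebras. -/
@[ext]
structure Hom (G G' : GradedAlgebra.{w} A) where
  app : ∀ n, G.pc n ⟶ G'.pc n
  one : G.one ≫ app 0 = G'.one
  mul : ∀ {i j k : ℕ} (h : i + j = k) (X : A), (G.mul h).app X ≫ (app k).app X =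
    (G.pc i).map ((app j).app X) ≫ (app i).app ((G'.pc j).obj X) ≫ (G'.mul h).app X

variable [Abelian A] [HasCountableCoproducts A]

noncomputable def totalMul (G : GradedAlgebra.{w} A) (X : A) :
    (∐ G.pc).obj ((∐ G.pc).obj X) ⟶ (∐ G.pc).obj X :=
  Cofan.IsColimit.desc (isColimitSigma G.pc _) fun i =>
    Cofan.IsColimit.desc (isColimitSigmaMap.{w} G.pc (G.pc i) X) fun j =>
      (G.mul rfl).app X ≫ (Sigma.ι G.pc (i + j)).app X

lemma ι_totalMul (G : GradedAlgebra.{w} A) (X : A) {i j k : ℕ} (h : i + j = k) :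
    (G.pc i).map ((Sigma.ι G.pc j).app X) ≫ (Sigma.ι G.pc i).app _ ≫ G.totalMul X =
      (G.mul h).app X ≫ (Sigma.ι G.pc k).app X := by
  subst h
  have h1 : (Sigma.ι G.pc i).app _ ≫ G.totalMul X = _ :=
    Cofan.IsColimit.fac (isColimitSigma G.pc _) _ i
  rw [h1]
  exact Cofan.IsColimit.fac (isColimitSigmaMap.{w} G.pc (G.pc i) X) _ j

/-- The algebra `⨁ₙ G[n]`. -/
noncomputable def total (G : GradedAlgebra.{w} A) : Monad A where
  toFunctor := ∐ G.pc
  η := G.one ≫ Sigma.ι G.pc 0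
  μ :=
    { app := G.totalMul
      naturality := fun X Y f => by
        refine sigma_hom_ext G.pc fun i => sigma_map_hom_ext.{w} G.pc (G.pc i) fun j => ?_
        have h1 := (Sigma.ι G.pc i).naturality ((∐ G.pc).map f)
        have h2 := (Sigma.ι G.pc j).naturality f
        have h3 := (Sigma.ι G.pc (i + j)).naturality f
        have h4 := (G.mul (rfl : i + j = _)).naturality f
        dsimp at h1 h2 h3 h4 ⊢
        rw [← reassoc_of% h1, ← Functor.map_comp_assoc, ← h2, Functor.map_comp_assoc,
          ι_totalMul _ _ rfl, reassoc_of% (G.ι_totalMul X (rfl : i + j = _)), ← h3,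
          reassoc_of% h4] }
  assoc X := by
    refine sigma_hom_ext G.pc fun i => sigma_map_hom_ext.{w} G.pc (G.pc i) fun j => ?_
    refine sigma_map_hom_ext.{w} G.pc (G.pc j ⋙ G.pc i) fun k => ?_
    have h1 := (Sigma.ι G.pc i).naturality (G.totalMul X)
    have h2 := (Sigma.ι G.pc i).naturality ((Sigma.ι G.pc j).app ((∐ G.pc).obj X))
    have h3 := (G.mul (rfl : i + j = _)).naturality ((Sigma.ι G.pc k).app X)
    dsimp at h1 h2 h3 ⊢
    rw [← reassoc_of% h1, ← Functor.map_comp_assoc, ← Functor.map_comp_assoc]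
    rw [Category.assoc, G.ι_totalMul X (rfl : j + k = _), Functor.map_comp_assoc,
      G.ι_totalMul X (rfl : i + (j + k) = _),
      reassoc_of% (G.ι_totalMul ((∐ G.pc).obj X) (rfl : i + j = _)),
      reassoc_of% h3, G.ι_totalMul X (show i + j + k = i + (j + k) by omega),
      reassoc_of% (G.assoc (rfl : i + j = _) (show i + j + k = i + (j + k) by omega) rfl rfl X)]
  left_unit X := by
    refine sigma_hom_ext G.pc fun i => ?_
    have h1 := G.one.naturality ((Sigma.ι G.pc i).app X)
    dsimp at h1 ⊢
    rw [Category.assoc, reassoc_of% h1, G.ι_totalMul X (zero_add i), reassoc_of% (G.one_mul i X)]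
    simp
  right_unit X := by
    refine sigma_hom_ext G.pc fun i => ?_
    have h1 := (Sigma.ι G.pc i).naturality ((G.one ≫ Sigma.ι G.pc 0).app X)
    dsimp at h1 ⊢
    rw [← reassoc_of% h1, Functor.map_comp_assoc, G.ι_totalMul X (add_zero i),
      reassoc_of% (G.mul_one i X)]
    simp

instance (G : GradedAlgebra.{w} A) : PreservesColimitsOfSize.{w, w} (G.total : A ⥤ A) :=
  cocontinuous_sigma.{w} G.pc G.cocontinuous

instance (G : GradedAlgebra.{w} A) : PreservesFiniteColimits (G.total : A ⥤ A) :=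
  preservesFiniteColimits_of_cocontinuous.{w} _

/-- The inclusion of a homogeneous component. -/
noncomputable def ι (G : GradedAlgebra.{w} A) (n : ℕ) : G.pc n ⟶ (G.total : A ⥤ A) :=
  Sigma.ι G.pc n

/-- The homomorphism of monads induced by a homomorphism of graded algebras. -/
noncomputable def totalMap {G G' : GradedAlgebra.{w} A} (φ : Hom G G') : G.total ⟶ G'.total where
  toNatTrans := Limits.Sigma.map φ.app
  app_η X := by
    have h : (Sigma.ι G.pc 0) ≫ Limits.Sigma.map φ.app = φ.app 0 ≫ Sigma.ι G'.pc 0 :=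
      Sigma.ι_map φ.app 0
    change (G.one ≫ Sigma.ι G.pc 0).app X ≫ (Limits.Sigma.map φ.app).app X =
      (G'.one ≫ Sigma.ι G'.pc 0).app X
    rw [← φ.one, ← NatTrans.comp_app, Category.assoc, h, Category.assoc]
  app_μ X := by
    have h : ∀ i (X : A), (Sigma.ι G.pc i).app X ≫ (Limits.Sigma.map φ.app).app X =
        (φ.app i).app X ≫ (Sigma.ι G'.pc i).app X := fun i X =>
      congr_arg (fun a => a.app X) (Sigma.ι_map φ.app i)
    change G.totalMul X ≫ (Limits.Sigma.map φ.app).app X =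
      ((∐ G.pc).map ((Limits.Sigma.map φ.app).app X) ≫
        (Limits.Sigma.map φ.app).app ((∐ G'.pc).obj X)) ≫ G'.totalMul X
    refine sigma_hom_ext G.pc fun i => sigma_map_hom_ext.{w} G.pc (G.pc i) fun j => ?_
    have h1 := (Sigma.ι G.pc i).naturality ((Limits.Sigma.map φ.app).app X)
    have h2 := (φ.app i).naturality ((Sigma.ι G'.pc j).app X)
    rw [reassoc_of% (G.ι_totalMul X (rfl : i + j = _)), h, reassoc_of% (φ.mul rfl X),
      ← G'.ι_totalMul X (rfl : i + j = _)]
    simp only [Category.assoc]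
    rw [← reassoc_of% h1, ← Functor.map_comp_assoc, h, Functor.map_comp_assoc, reassoc_of% h,
      reassoc_of% h2]

end GradedAlgebra

namespace GradedAlgebra

variable {A : Type u} [Category.{v} A] [Abelian A]

/-- A family of maps `s n : S n ⟶ G.pc n` of bimodules whose images form a two-sided
homogeneous ideal which is zero in degree zero. -/
structure IdealData (G : GradedAlgebra.{w} A) where
  S : ℕ → A ⥤ A
  cocontinuous : ∀ n, PreservesColimitsOfSize.{w, w} (S n)
  s : ∀ n, S n ⟶ G.pc n
  zero : s 0 = 0
  left : ∀ {i j k : ℕ} (h : i + j = k) (X : A), (G.pc i).map ((s j).app X) ≫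
    (G.mul h).app X ≫ (cokernel.π (s k)).app X = 0
  right : ∀ {i j k : ℕ} (h : i + j = k) (X : A), (s i).app ((G.pc j).obj X) ≫
    (G.mul h).app X ≫ (cokernel.π (s k)).app X = 0

namespace IdealData

variable {G : GradedAlgebra.{w} A} (J : G.IdealData)

/-- The components of the quotient. -/
noncomputable def Q (n : ℕ) : A ⥤ A := cokernel (J.s n)

/-- The projection to the quotient. -/
noncomputable def π (n : ℕ) : G.pc n ⟶ J.Q n := cokernel.π (J.s n)

instance (n : ℕ) : Epi (J.π n) := inferInstanceAs (Epi (cokernel.π _))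

instance (n : ℕ) (X : A) : Epi ((J.π n).app X) := inferInstance

instance (n : ℕ) : PreservesFiniteColimits (G.pc n) := preservesFiniteColimits_of_cocontinuous.{w} _

instance (n : ℕ) : (G.pc n).Additive :=
  have := preservesBinaryBiproducts_of_preservesBinaryCoproducts (G.pc n)
  Functor.additive_of_preservesBinaryBiproducts (G.pc n)

instance (n : ℕ) (X Y : A) (f : X ⟶ Y) [Epi f] : Epi ((J.S n).map f) :=
  map_epi_of_cocontinuous.{w} _ (J.cocontinuous n) f

lemma condition (n : ℕ) (X : A) : (J.s n).app X ≫ (J.π n).app X = 0 := by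
  rw [← NatTrans.comp_app]
  exact congr_arg (fun a => a.app X) (cokernel.condition (J.s n))

/-- The quotient is computed pointwise. -/
noncomputable def isColimit (n : ℕ) (X : A) :
    IsColimit (CokernelCofork.ofπ ((J.π n).app X) (J.condition n X)) :=
  (CokernelCofork.ofπ (cokernel.π (J.s n)) (cokernel.condition _)).mapIsColimit
    (cokernelIsCokernel _) ((evaluation A A).obj X)

lemma map_condition (i n : ℕ) (X : A) :
    (G.pc i).map ((J.s n).app X) ≫ (G.pc i).map ((J.π n).app X) = 0 := by
  rw [← Functor.map_comp, J.condition, Functor.map_zero]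

noncomputable def isColimitMap (i n : ℕ) (X : A) :
    IsColimit (CokernelCofork.ofπ ((G.pc i).map ((J.π n).app X)) (J.map_condition i n X)) :=
  (CokernelCofork.ofπ ((J.π n).app X) (J.condition n X)).mapIsColimit
    (J.isColimit n X) (G.pc i)

noncomputable def mulAux {i j k : ℕ} (h : i + j = k) (X : A) :
    (G.pc i).obj ((J.Q j).obj X) ⟶ (J.Q k).obj X :=
  (CokernelCofork.IsColimit.desc' (J.isColimitMap i j X) ((G.mul h).app X ≫ (J.π k).app X)
    (J.left h X)).1

lemma map_π_mulAux {i j k : ℕ} (h : i + j = k) (X : A) :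
    (G.pc i).map ((J.π j).app X) ≫ J.mulAux h X = (G.mul h).app X ≫ (J.π k).app X :=
  (CokernelCofork.IsColimit.desc' (J.isColimitMap i j X) ((G.mul h).app X ≫ (J.π k).app X)
    (J.left h X)).2

lemma s_mulAux {i j k : ℕ} (h : i + j = k) (X : A) :
    (J.s i).app ((J.Q j).obj X) ≫ J.mulAux h X = 0 := by
  rw [← cancel_epi ((J.S i).map ((J.π j).app X)), comp_zero,
    reassoc_of% ((J.s i).naturality ((J.π j).app X)), map_π_mulAux]
  exact J.right h X

noncomputable def mulApp {i j k : ℕ} (h : i + j = k) (X : A) :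
    (J.Q i).obj ((J.Q j).obj X) ⟶ (J.Q k).obj X :=
  (CokernelCofork.IsColimit.desc' (J.isColimit i ((J.Q j).obj X)) (J.mulAux h X)
    (J.s_mulAux h X)).1

lemma π_mulApp {i j k : ℕ} (h : i + j = k) (X : A) :
    (J.π i).app ((J.Q j).obj X) ≫ J.mulApp h X = J.mulAux h X :=
  (CokernelCofork.IsColimit.desc' (J.isColimit i ((J.Q j).obj X)) (J.mulAux h X)
    (J.s_mulAux h X)).2

lemma π_π_mulApp {i j k : ℕ} (h : i + j = k) (X : A) :
    (G.pc i).map ((J.π j).app X) ≫ (J.π i).app ((J.Q j).obj X) ≫ J.mulApp h X =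
      (G.mul h).app X ≫ (J.π k).app X := by
  rw [π_mulApp, map_π_mulAux]

lemma π_π_mulApp' {i j k : ℕ} (h : i + j = k) (X : A) :
    (J.π i).app ((G.pc j).obj X) ≫ (J.Q i).map ((J.π j).app X) ≫ J.mulApp h X =
      (G.mul h).app X ≫ (J.π k).app X := by
  rw [← reassoc_of% ((J.π i).naturality ((J.π j).app X)), π_π_mulApp]

instance (i n : ℕ) (X : A) : Epi ((J.Q i).map ((J.π n).app X)) :=
  map_epi_of_cocontinuous.{w} _ (cocontinuous_cokernel.{w} _ (J.cocontinuous i)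
    (G.cocontinuous i)) _

/-- The quotient of a graded algebra by a homogeneous two-sided ideal. -/
noncomputable def quot : GradedAlgebra.{w} A where
  pc := J.Q
  cocontinuous n := cocontinuous_cokernel.{w} _ (J.cocontinuous n) (G.cocontinuous n)
  one := G.one ≫ J.π 0
  isIso_one := by
    have : IsIso (J.π 0) := coequalizer.π_of_eq J.zero
    infer_instance
  mul {i j k} h :=
    { app := J.mulApp h
      naturality X Y f := by
        rw [← cancel_epi ((G.pc i).map ((J.π j).app X) ≫ (J.π i).app ((J.Q j).obj X))]
        have h1 := (J.π i).naturality ((J.Q j).map f)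
        have h2 := (J.π j).naturality f
        have h3 := (J.π k).naturality f
        have h4 := (G.mul h).naturality f
        dsimp at h1 h2 h3 h4 ⊢
        simp only [Category.assoc]
        rw [← reassoc_of% h1, ← Functor.map_comp_assoc, ← h2, Functor.map_comp_assoc,
          π_π_mulApp, reassoc_of% (J.π_π_mulApp h X), ← h3, reassoc_of% h4] }
  one_mul n X := by
    rw [← cancel_epi ((J.π n).app X)]
    have h1 := G.one.naturality ((J.π n).app X)
    dsimp at h1 ⊢
    rw [Category.assoc, reassoc_of% h1, π_π_mulApp, reassoc_of% (G.one_mul n X), Category.comp_id]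
  mul_one n X := by
    rw [← cancel_epi ((J.π n).app X)]
    have h1 := (J.π n).naturality ((G.one ≫ J.π 0).app X)
    dsimp at h1 ⊢
    rw [← reassoc_of% h1, Functor.map_comp_assoc, π_π_mulApp, reassoc_of% (G.mul_one n X),
      Category.comp_id]
  assoc {i j k ij jk n} h₁ h₂ h₃ h₄ X := by
    rw [← cancel_epi ((J.π i).app _), ← cancel_epi ((G.pc i).map ((J.π j).app _)),
      ← cancel_epi ((G.pc i).map ((G.pc j).map ((J.π k).app _)))]
    have h1 := (G.mul h₁).naturality ((J.π k).app X)
    have h2 := (J.π i).naturality (J.mulApp h₃ X)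
    dsimp at h1 h2 ⊢
    rw [reassoc_of% (J.π_π_mulApp h₁ ((J.Q k).obj X)), reassoc_of% h1,
      π_π_mulApp, reassoc_of% (G.assoc h₁ h₂ h₃ h₄ X), ← reassoc_of% h2,
      ← Functor.map_comp_assoc, ← Functor.map_comp_assoc, Category.assoc, π_π_mulApp,
      Functor.map_comp_assoc, π_π_mulApp]

/-- The projection to the quotient. -/
@[simps]
noncomputable def proj : Hom G J.quot where
  app := J.π
  one := rfl
  mul h X := (J.π_π_mulApp h X).symm

end IdealData

end GradedAlgebra

section Tensor

variable {A : Type u} [Category.{v} A]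

/-- The `n`-fold composite of an endofunctor with itself. -/
def pow (H : A ⥤ A) : ℕ → A ⥤ A
  | 0 => 𝟭 A
  | n + 1 => pow H n ⋙ H

lemma cocontinuous_pow (H : A ⥤ A) [PreservesColimitsOfSize.{w, w} H] :
    ∀ n, PreservesColimitsOfSize.{w, w} (pow H n)
  | 0 => inferInstanceAs (PreservesColimitsOfSize.{w, w} (𝟭 A))
  | n + 1 =>
    have := cocontinuous_pow H n
    inferInstanceAs (PreservesColimitsOfSize.{w, w} (pow H n ⋙ H))

/-- The canonical identification of `H^i ∘ H^j` with `H^k` for `i + j = k`. -/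
def powMul (H : A ⥤ A) : ∀ (i j k : ℕ), i + j = k → (pow H j ⋙ pow H i ⟶ pow H k)
  | 0, j, _, h => eqToHom (by obtain rfl : j = _ := by simpa using h
                              rfl)
  | i + 1, j, 0, h => absurd h (by omega)
  | i + 1, j, k + 1, h => Functor.whiskerRight (powMul H i j k (by omega)) H

lemma powMul_zero (H : A ⥤ A) (j : ℕ) (h : 0 + j = j) (X : A) :
    (powMul H 0 j j h).app X = 𝟙 ((pow H j).obj X) := rfl

lemma powMul_succ (H : A ⥤ A) (i j k : ℕ) (h : i + 1 + j = k + 1) (X : A) :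
    (powMul H (i + 1) j (k + 1) h).app X = H.map ((powMul H i j k (by omega)).app X) := rfl

lemma powMul_assoc (H : A ⥤ A) : ∀ (i j k ij jk n : ℕ) (h₁ : i + j = ij) (h₂ : ij + k = n)
    (h₃ : j + k = jk) (h₄ : i + jk = n) (X : A),
    (powMul H i j ij h₁).app ((pow H k).obj X) ≫ (powMul H ij k n h₂).app X =
      (pow H i).map ((powMul H j k jk h₃).app X) ≫ (powMul H i jk n h₄).app X
  | 0, j, k, ij, jk, n, h₁, h₂, h₃, h₄, X => by
    obtain rfl : j = ij := by omega
    obtain rfl : jk = n := by omega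
    rw [powMul_zero, powMul_zero]
    exact (Category.id_comp _).trans (Category.comp_id _).symm
  | i + 1, j, k, 0, jk, n, h₁, h₂, h₃, h₄, X => absurd h₁ (by omega)
  | i + 1, j, k, ij + 1, jk, 0, h₁, h₂, h₃, h₄, X => absurd h₂ (by omega)
  | i + 1, j, k, ij + 1, jk, n + 1, h₁, h₂, h₃, h₄, X => by
    have := powMul_assoc H i j k ij jk n (by omega) (by omega) h₃ (by omega) X
    rw [powMul_succ, powMul_succ, powMul_succ]
    change _ = H.map ((pow H i).map _) ≫ _
    refine (H.map_comp _ _).symm.trans (Eq.trans ?_ (H.map_comp _ _))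
    exact congr_arg (fun a => H.map a) this

lemma powMul_self (H : A ⥤ A) : ∀ (n : ℕ) (h : n + 0 = n) (X : A),
    (powMul H n 0 n h).app X = 𝟙 ((pow H n).obj X)
  | 0, _, _ => rfl
  | n + 1, h, X => by
    rw [powMul_succ]
    refine Eq.trans ?_ (H.map_id _)
    exact congr_arg (fun a => H.map a) (powMul_self H n _ X)

/-- The tensor algebra on a bimodule. -/
def tensorAlgebra (H : A ⥤ A) [PreservesColimitsOfSize.{w, w} H] : GradedAlgebra.{w} A where
  pc := pow H
  cocontinuous := cocontinuous_pow.{w} H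
  one := 𝟙 _
  isIso_one := inferInstanceAs (IsIso (𝟙 (𝟭 A)))
  mul {i j k} h := powMul H i j k h
  one_mul n X := by
    rw [powMul_zero]
    exact Category.comp_id _
  mul_one n X := by
    rw [powMul_self]
    refine (Category.comp_id _).trans ?_
    exact (pow H n).map_id _
  assoc h₁ h₂ h₃ h₄ X := powMul_assoc H _ _ _ _ _ _ h₁ h₂ h₃ h₄ X

/-- The map from `H^a ∘ R ∘ H^b` to `H^n`, `n = a + b + 2`, induced by a map from `R`
to `H ∘ H`. -/
def rel {H R : A ⥤ A} (r : R ⟶ H ⋙ H) (a b n : ℕ) (h : a + b + 2 = n) :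
    pow H b ⋙ R ⋙ pow H a ⟶ pow H n :=
  Functor.whiskerLeft (pow H b) (Functor.whiskerRight r (pow H a)) ≫
    powMul H a (b + 2) n (by omega)

lemma rel_app {H R : A ⥤ A} (r : R ⟶ H ⋙ H) (a b n : ℕ) (h : a + b + 2 = n) (X : A) :
    (rel r a b n h).app X = (pow H a).map (r.app ((pow H b).obj X)) ≫
      (powMul H a (b + 2) n (by omega)).app X := rfl

lemma map_rel {H R : A ⥤ A} (r : R ⟶ H ⋙ H) (a b i j k : ℕ) (h : a + b + 2 = j)
    (hk : i + j = k) (X : A) :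
    (pow H i).map ((rel r a b j h).app X) ≫ (powMul H i j k hk).app X =
      (powMul H i a (i + a) rfl).app (R.obj ((pow H b).obj X)) ≫
        (rel r (i + a) b k (by omega)).app X := by
  have h1 := (powMul H i a (i + a) rfl).naturality (r.app ((pow H b).obj X))
  have h2 := powMul_assoc H i a (b + 2) (i + a) j k rfl (by omega) (by omega) hk X
  rw [rel_app, rel_app]
  refine (congr_arg (fun a => a ≫ (powMul H i j k hk).app X) ((pow H i).map_comp _ _)).trans ?_
  refine (Category.assoc _ _ _).trans ?_
  refine (congr_arg (fun x => (pow H i).map ((pow H a).map _) ≫ x) h2.symm).trans ?_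
  refine (Category.assoc _ _ _).symm.trans (Eq.trans ?_ (Category.assoc _ _ _))
  exact congr_arg (fun x => x ≫ (powMul H (i + a) (b + 2) k (by omega)).app X) h1

lemma rel_mul {H R : A ⥤ A} (r : R ⟶ H ⋙ H) (a b i j k : ℕ) (h : a + b + 2 = i)
    (hk : i + j = k) (X : A) :
    (rel r a b i h).app ((pow H j).obj X) ≫ (powMul H i j k hk).app X =
      (pow H a).map (R.map ((powMul H b j (b + j) rfl).app X)) ≫
        (rel r a (b + j) k (by omega)).app X := by
  have h1 := r.naturality ((powMul H b j (b + j) rfl).app X)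
  have h2 := powMul_assoc H a (b + 2) j i (b + j + 2) k (by omega) hk (by omega) (by omega) X
  rw [rel_app, rel_app]
  refine (Category.assoc _ _ _).trans ?_
  refine (congr_arg (fun x => (pow H a).map _ ≫ x) h2).trans ?_
  refine (Category.assoc _ _ _).symm.trans (Eq.trans ?_ (Category.assoc _ _ _))
  refine congr_arg (fun x => x ≫ (powMul H a (b + j + 2) k (by omega)).app X) ?_
  refine ((pow H a).map_comp _ _).symm.trans (Eq.trans ?_ ((pow H a).map_comp _ _))
  exact congr_arg (fun x => (pow H a).map x) h1.symm

end Tensor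

section Quadratic

variable {A : Type u} [Category.{v} A] [Abelian A] [HasCountableCoproducts A]
  {H R : A ⥤ A} [PreservesColimitsOfSize.{w, w} H] [PreservesColimitsOfSize.{w, w} R]

/-- The bimodules `H^a ∘ R ∘ H^b` with `a + b + 2 = n`. -/
abbrev relFamily (H R : A ⥤ A) (n : ℕ) (p : {p : ℕ × ℕ // p.1 + p.2 + 2 = n}) : A ⥤ A :=
  pow H p.1.2 ⋙ R ⋙ pow H p.1.1

/-- The map from the coproduct of the `H^a ∘ R ∘ H^b`, `a + b + 2 = n`, to `H^n`. -/
noncomputable def relSum (r : R ⟶ H ⋙ H) (n : ℕ) : ∐ relFamily H R n ⟶ pow H n :=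
  Sigma.desc fun p => rel r p.1.1 p.1.2 n p.2

lemma ι_relSum_app (r : R ⟶ H ⋙ H) (n : ℕ) (p : {p : ℕ × ℕ // p.1 + p.2 + 2 = n}) (X : A) :
    (Sigma.ι (relFamily H R n) p).app X ≫ (relSum r n).app X =
      (rel r p.1.1 p.1.2 n p.2).app X := by
  have h : Sigma.ι (relFamily H R n) p ≫ relSum r n = rel r p.1.1 p.1.2 n p.2 := Sigma.ι_desc _ _
  rw [← NatTrans.comp_app, h]

lemma rel_π (r : R ⟶ H ⋙ H) (a b n : ℕ) (h : a + b + 2 = n) (X : A) :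
    (rel r a b n h).app X ≫ (cokernel.π (relSum r n)).app X = 0 := by
  refine (congr_arg (fun x => x ≫ _) (ι_relSum_app r n ⟨(a, b), h⟩ X).symm).trans ?_
  rw [Category.assoc, ← NatTrans.comp_app, cokernel.condition,
    zero_app, comp_zero]

/-- The homogeneous ideal of the tensor algebra on `H` which is generated by the image of a map
from `R` to `H ∘ H`. -/
noncomputable def quadraticIdeal (r : R ⟶ H ⋙ H) :
    (tensorAlgebra.{w} H).IdealData where
  S n := ∐ relFamily H R n
  cocontinuous n := cocontinuous_sigma.{w} _ fun p =>
    have := cocontinuous_pow.{w} H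
    inferInstanceAs (PreservesColimitsOfSize.{w, w} (pow H p.1.2 ⋙ R ⋙ pow H p.1.1))
  s n := relSum r n
  zero := Limits.Sigma.hom_ext _ _ fun p => absurd p.2 (by omega)
  left {i j k} h X := by
    refine sigma_map_hom_ext.{w} _ ((tensorAlgebra.{w} H).pc i) fun p => ?_
    change (pow H i).map ((Sigma.ι (relFamily H R j) p).app X) ≫
      (pow H i).map ((relSum r j).app X) ≫ (powMul H i j k h).app X ≫
        (cokernel.π (relSum r k)).app X = _
    rw [comp_zero, ← Functor.map_comp_assoc, ι_relSum_app]
    refine (Category.assoc _ _ _).symm.trans ?_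
    refine (congr_arg (fun x => x ≫ _) (map_rel r p.1.1 p.1.2 i j k p.2 h X)).trans ?_
    refine (Category.assoc _ _ _).trans ?_
    exact (congr_arg (fun x => _ ≫ x) (rel_π r _ _ k _ X)).trans comp_zero
  right {i j k} h X := by
    refine sigma_hom_ext _ fun p => ?_
    change (Sigma.ι (relFamily H R i) p).app ((pow H j).obj X) ≫
      (relSum r i).app ((pow H j).obj X) ≫ (powMul H i j k h).app X ≫
        (cokernel.π (relSum r k)).app X = _
    rw [comp_zero, ← Category.assoc, ι_relSum_app]
    refine (Category.assoc _ _ _).symm.trans ?_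
    refine (congr_arg (fun x => x ≫ _) (rel_mul r p.1.1 p.1.2 i j k p.2 h X)).trans ?_
    refine (Category.assoc _ _ _).trans ?_
    exact (congr_arg (fun x => _ ≫ x) (rel_π r _ _ k _ X)).trans comp_zero

/-- The quadratic algebra `T(H, R)`. -/
noncomputable def quadraticAlgebra (r : R ⟶ H ⋙ H) : GradedAlgebra.{w} A :=
  (quadraticIdeal.{w} r).quot

/-- The inclusion of the generators. -/
noncomputable def quadraticAlgebra.gen (r : R ⟶ H ⋙ H) : H ⟶ (quadraticAlgebra.{w} r).pc 1 :=
  (Functor.leftUnitor H).inv ≫ (quadraticIdeal.{w} r).π 1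

end Quadratic

/-- Every object is a quotient of an object with property `W`. -/
class HasCovers {A : Type u} [Category.{v} A] (W : ObjectProperty A) : Prop where
  exists_epi : ∀ X : A, ∃ Q : A, W Q ∧ ∃ f : Q ⟶ X, Epi f

/-- A filtered algebra: a monad `T` which preserves colimits, with a filtration
`T = colim fil n` by subbimodules such that `fil 0` is the unit and the multiplication
restricts to `fil i ∘ fil j ⟶ fil k` for `i + j = k`. A map of bimodules is an inclusion if it is
a monomorphism on the objects with property `W` (the objects of the theory). -/
structure FilteredAlgebra {A : Type u} [Category.{v} A] (W : ObjectProperty A) where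
  T : Monad A
  cocontinuous : PreservesColimitsOfSize.{w, w} (T : A ⥤ A)
  fil : ℕ ⥤ A ⥤ A
  fil_cocontinuous : ∀ n, PreservesColimitsOfSize.{w, w} (fil.obj n)
  cocone : fil ⟶ (Functor.const ℕ).obj (T : A ⥤ A)
  isColimit : Nonempty (IsColimit (Cocone.mk (T : A ⥤ A) cocone))
  mono : ∀ (n : ℕ) (Q : A), W Q → Mono ((cocone.app n).app Q)
  one : 𝟭 A ⟶ fil.obj 0
  isIso_one : IsIso one
  one_cocone : ∀ X : A, one.app X ≫ (cocone.app 0).app X = T.η.app X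
  mul : ∀ {i j k : ℕ}, i + j = k → (fil.obj j ⋙ fil.obj i ⟶ fil.obj k)
  mul_cocone : ∀ {i j k : ℕ} (h : i + j = k) (X : A), (mul h).app X ≫ (cocone.app k).app X =
    (fil.obj i).map ((cocone.app j).app X) ≫ (cocone.app i).app (T.obj X) ≫ T.μ.app X

namespace FilteredAlgebra

variable {A : Type u} [Category.{v} A] {W : ObjectProperty A} (F : FilteredAlgebra.{w} W)

/-- The inclusion of a filtration step. -/
abbrev ι (n : ℕ) : F.fil.obj n ⟶ (F.T : A ⥤ A) := F.cocone.app n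

lemma map_ι {m n : ℕ} (h : m ⟶ n) (X : A) :
    (F.fil.map h).app X ≫ (F.ι n).app X = (F.ι m).app X := by
  rw [← NatTrans.comp_app, F.cocone.naturality]
  simp

instance (n : ℕ) : PreservesColimitsOfSize.{w, w} (F.fil.obj n) := F.fil_cocontinuous n

instance : PreservesColimitsOfSize.{w, w} (F.T : A ⥤ A) := F.cocontinuous

variable [Abelian A]

instance : PreservesFiniteColimits (F.T : A ⥤ A) :=
  preservesFiniteColimits_of_cocontinuous.{w} _

instance (n : ℕ) : PreservesFiniteColimits (F.fil.obj n) :=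
  preservesFiniteColimits_of_cocontinuous.{w} _

instance (n : ℕ) : (F.fil.obj n).Additive :=
  have := preservesBinaryBiproducts_of_preservesBinaryCoproducts (F.fil.obj n)
  Functor.additive_of_preservesBinaryBiproducts _

variable [HasCovers W]

lemma hom_ext {S : A ⥤ A} [PreservesColimitsOfSize.{w, w} S] {n : ℕ} {α β : S ⟶ F.fil.obj n}
    (h : ∀ X, α.app X ≫ (F.ι n).app X = β.app X ≫ (F.ι n).app X) : α = β := by
  ext X
  obtain ⟨Q, hQ, f, hf⟩ := HasCovers.exists_epi (W := W) X
  have := F.mono n Q hQ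
  have := map_epi_of_cocontinuous.{w} S inferInstance f
  rw [← cancel_epi (S.map f), α.naturality, β.naturality]
  congr 1
  rw [← cancel_mono ((F.ι n).app Q)]
  exact h Q

/-- The graded algebra `⨁ₙ F≤ₙ` of a filtered algebra. -/
abbrev rees : GradedAlgebra.{w} A where
  pc n := F.fil.obj n
  cocontinuous n := F.fil_cocontinuous n
  one := F.one
  isIso_one := F.isIso_one
  mul h := F.mul h
  one_mul n X := by
    have : Functor.whiskerLeft (F.fil.obj n) F.one ≫ F.mul (zero_add n) =
        (Functor.rightUnitor (F.fil.obj n)).hom := F.hom_ext fun X => by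
      have h1 := F.one.naturality ((F.ι n).app X)
      dsimp at h1 ⊢
      rw [Category.assoc, F.mul_cocone, ← reassoc_of% h1, reassoc_of% (F.one_cocone (F.T.obj X)),
        F.T.left_unit, Category.id_comp]
      exact Category.comp_id _
    exact congr_arg (fun a => NatTrans.app a X) this
  mul_one n X := by
    have : Functor.whiskerRight F.one (F.fil.obj n) ≫ F.mul (add_zero n) =
        (Functor.leftUnitor (F.fil.obj n)).hom := F.hom_ext fun X => by
      have h1 := (F.ι n).naturality (F.T.η.app X)
      dsimp at h1 ⊢
      rw [Category.assoc, F.mul_cocone, ← Functor.map_comp_assoc, F.one_cocone, reassoc_of% h1,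
        F.T.right_unit, Category.id_comp]
      exact Category.comp_id _
    exact congr_arg (fun a => NatTrans.app a X) this
  assoc {i j k ij jk n} h₁ h₂ h₃ h₄ X := by
    have : Functor.whiskerLeft (F.fil.obj k) (F.mul h₁) ≫ F.mul h₂ =
        Functor.whiskerRight (F.mul h₃) (F.fil.obj i) ≫ F.mul h₄ := F.hom_ext fun X => by
      have h1 := (F.mul h₁).naturality ((F.ι k).app X)
      have h2 := (F.ι i).naturality (F.T.μ.app X)
      have h3 := (F.ι i).naturality ((F.ι j).app (F.T.obj X))
      have h5 : (F.fil.obj i).map ((F.mul h₃).app X) ≫ (F.fil.obj i).map ((F.ι jk).app X) =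
          (F.fil.obj i).map ((F.fil.obj j).map ((F.ι k).app X)) ≫
            (F.fil.obj i).map ((F.ι j).app (F.T.obj X)) ≫ (F.fil.obj i).map (F.T.μ.app X) := by
        rw [← Functor.map_comp, F.mul_cocone, Functor.map_comp, Functor.map_comp]
      dsimp at h1 h2 h3 ⊢
      rw [Category.assoc, Category.assoc, F.mul_cocone, F.mul_cocone, ← reassoc_of% h1,
        reassoc_of% (F.mul_cocone h₁ (F.T.obj X)), reassoc_of% h5, reassoc_of% h2, F.T.assoc]
    exact congr_arg (fun a => NatTrans.app a X) this

/-- The homomorphism `⨁ₙ F≤ₙ ⟶ F`. -/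
noncomputable def reesMap [HasCountableCoproducts A] : F.rees.total ⟶ F.T where
  toNatTrans := Sigma.desc F.ι
  app_η X := by
    have h : Sigma.ι F.rees.pc 0 ≫ Sigma.desc F.ι = F.ι 0 := Sigma.ι_desc _ _
    change (F.one ≫ Sigma.ι F.rees.pc 0).app X ≫ (Sigma.desc F.ι : ∐ F.rees.pc ⟶ _).app X = _
    rw [← NatTrans.comp_app, Category.assoc, h]
    exact F.one_cocone X
  app_μ X := by
    have h : ∀ i (X : A), (Sigma.ι F.rees.pc i).app X ≫ (Sigma.desc F.ι : ∐ F.rees.pc ⟶ _).app X =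
        (F.ι i).app X := fun i X => by
      rw [← NatTrans.comp_app, Sigma.ι_desc]
    change F.rees.totalMul X ≫ (Sigma.desc F.ι : ∐ F.rees.pc ⟶ _).app X =
      ((∐ F.rees.pc).map ((Sigma.desc F.ι : ∐ F.rees.pc ⟶ _).app X) ≫
        (Sigma.desc F.ι : ∐ F.rees.pc ⟶ _).app (F.T.obj X)) ≫ F.T.μ.app X
    refine sigma_hom_ext F.rees.pc fun i => sigma_map_hom_ext.{w} F.rees.pc (F.rees.pc i)
      fun j => ?_
    have h1 := (Sigma.ι F.rees.pc i).naturality ((Sigma.desc F.ι : ∐ F.rees.pc ⟶ _).app X)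
    rw [reassoc_of% (F.rees.ι_totalMul X (rfl : i + j = _)), h]
    simp only [Category.assoc]
    rw [← reassoc_of% h1, ← Functor.map_comp_assoc, h, reassoc_of% h]
    exact F.mul_cocone rfl X

lemma map_mul {i m k k' : ℕ} (h : i + (m + 1) = k) (h' : i + m = k') (hk : k' + 1 = k) (X : A) :
    (F.fil.obj i).map ((F.fil.map (homOfLE (Nat.le_succ m))).app X) ≫ (F.mul h).app X =
      (F.mul h').app X ≫ (F.fil.map (homOfLE (show k' ≤ k by omega))).app X := by
  have : Functor.whiskerRight (F.fil.map (homOfLE (Nat.le_succ m))) (F.fil.obj i) ≫ F.mul h =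
      F.mul h' ≫ F.fil.map (homOfLE (show k' ≤ k by omega)) := F.hom_ext fun X => by
    dsimp
    rw [Category.assoc, Category.assoc, F.map_ι, F.mul_cocone, F.mul_cocone,
      ← Functor.map_comp_assoc, F.map_ι]
  exact congr_arg (fun a => NatTrans.app a X) this

lemma mul_map {m j k k' : ℕ} (h : (m + 1) + j = k) (h' : m + j = k') (hk : k' + 1 = k) (X : A) :
    (F.fil.map (homOfLE (Nat.le_succ m))).app ((F.fil.obj j).obj X) ≫ (F.mul h).app X =
      (F.mul h').app X ≫ (F.fil.map (homOfLE (show k' ≤ k by omega))).app X := by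
  have : Functor.whiskerLeft (F.fil.obj j) (F.fil.map (homOfLE (Nat.le_succ m))) ≫ F.mul h =
      F.mul h' ≫ F.fil.map (homOfLE (show k' ≤ k by omega)) := F.hom_ext fun X => by
    have h1 := (F.fil.map (homOfLE (Nat.le_succ m))).naturality ((F.ι j).app X)
    dsimp at h1 ⊢
    rw [Category.assoc, Category.assoc, F.map_ι, F.mul_cocone, F.mul_cocone,
      ← reassoc_of% h1, reassoc_of% (F.map_ι (homOfLE (Nat.le_succ m)))]
  exact congr_arg (fun a => NatTrans.app a X) this

/-- The inclusion `F≤ₙ₋₁ ⟶ F≤ₙ`; in degree zero, where `F≤₋₁ = 0`, it is replaced by a zero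
map. -/
noncomputable def incl : ∀ n : ℕ, F.fil.obj (n - 1) ⟶ F.fil.obj n
  | 0 => 0
  | m + 1 => F.fil.map (homOfLE (Nat.le_succ m))

lemma fil_map_π {m n : ℕ} (h : m + 1 = n) (X : A) :
    (F.fil.map (homOfLE (show m ≤ n by omega))).app X ≫ (cokernel.π (F.incl n)).app X = 0 := by
  subst h
  rw [← NatTrans.comp_app]
  exact congr_arg (fun a => NatTrans.app a X) (cokernel.condition (F.incl (m + 1)))

/-- The ideal of the algebra `⨁ₙ F≤ₙ` with quotient the associated graded algebra. -/
noncomputable def grIdeal : F.rees.IdealData where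
  S n := F.fil.obj (n - 1)
  cocontinuous n := F.fil_cocontinuous _
  s := F.incl
  zero := rfl
  left {i j k} h X := by
    cases j with
    | zero =>
      change (F.fil.obj i).map ((0 : F.fil.obj 0 ⟶ F.fil.obj 0).app X) ≫ _ = 0
      rw [zero_app, Functor.map_zero]
      exact zero_comp
    | succ m =>
      refine (Category.assoc _ _ _).symm.trans ?_
      refine (congr_arg (fun x => x ≫ _) (F.map_mul h rfl (by omega) X)).trans ?_
      refine (Category.assoc _ _ _).trans ?_
      exact (congr_arg (fun x => _ ≫ x) (F.fil_map_π (by omega) X)).trans comp_zero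
  right {i j k} h X := by
    cases i with
    | zero =>
      change (0 : F.fil.obj 0 ⟶ F.fil.obj 0).app _ ≫ _ = 0
      rw [zero_app]
      exact zero_comp
    | succ m =>
      refine (Category.assoc _ _ _).symm.trans ?_
      refine (congr_arg (fun x => x ≫ _) (F.mul_map h rfl (by omega) X)).trans ?_
      refine (Category.assoc _ _ _).trans ?_
      exact (congr_arg (fun x => _ ≫ x) (F.fil_map_π (by omega) X)).trans comp_zero

/-- The associated graded algebra, with `gr F [n]` the cokernel of `F≤ₙ₋₁ ⟶ F≤ₙ`. -/
noncomputable def gr : GradedAlgebra.{w} A := F.grIdeal.quot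

end FilteredAlgebra

namespace GradedAlgebra

variable {A : Type u} [Category.{v} A] [Abelian A] (G : GradedAlgebra.{w} A)

/-- The components of the augmentation. -/
noncomputable def augApp : ∀ n, G.pc n ⟶ 𝟭 A
  | 0 => inv G.one
  | _ + 1 => 0

lemma mul_augApp : ∀ {i j k : ℕ} (h : i + j = k) (X : A),
    (G.mul h).app X ≫ (G.augApp k).app X =
      (G.pc i).map ((G.augApp j).app X) ≫ (G.augApp i).app X
  | 0, 0, k, h, X => by
    obtain rfl : k = 0 := by omega
    change _ ≫ (inv G.one).app X = (G.pc 0).map ((inv G.one).app X) ≫ (inv G.one).app X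
    have h1 := G.one.naturality ((inv G.one).app X)
    dsimp at h1
    rw [← cancel_epi (G.one.app ((G.pc 0).obj X)), reassoc_of% (G.one_mul 0 X),
      ← reassoc_of% h1, ← NatTrans.comp_app G.one (inv G.one), IsIso.hom_inv_id]
    simp
  | 0, j + 1, k, h, X => by
    obtain rfl : k = j + 1 := by omega
    change _ ≫ (0 : G.pc _ ⟶ 𝟭 A).app X = (G.pc 0).map ((0 : G.pc _ ⟶ 𝟭 A).app X) ≫ _
    rw [zero_app, Functor.map_zero, comp_zero, zero_comp]
  | i + 1, j, k, h, X => by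
    obtain ⟨k, rfl⟩ : ∃ l, k = l + 1 := ⟨i + j, by omega⟩
    change _ ≫ (0 : G.pc _ ⟶ 𝟭 A).app X = _ ≫ (0 : G.pc _ ⟶ 𝟭 A).app X
    rw [zero_app, comp_zero, zero_app, comp_zero]

/-- The augmentation of a graded algebra, which kills the components of positive degree. -/
noncomputable def aug [HasCountableCoproducts A] : G.total ⟶ Monad.id A where
  toNatTrans := Sigma.desc G.augApp
  app_η X := by
    have h : Sigma.ι G.pc 0 ≫ Sigma.desc G.augApp = inv G.one := Sigma.ι_desc _ _
    change (G.one ≫ Sigma.ι G.pc 0).app X ≫ (Sigma.desc G.augApp : ∐ G.pc ⟶ _).app X =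
      𝟙 X
    rw [← NatTrans.comp_app, Category.assoc, h, IsIso.hom_inv_id]
    rfl
  app_μ X := by
    have h : ∀ i (X : A), (Sigma.ι G.pc i).app X ≫ (Sigma.desc G.augApp : ∐ G.pc ⟶ _).app X =
        (G.augApp i).app X := fun i X => by
      rw [← NatTrans.comp_app, Sigma.ι_desc]
    change G.totalMul X ≫ (Sigma.desc G.augApp : ∐ G.pc ⟶ _).app X =
      ((∐ G.pc).map ((Sigma.desc G.augApp : ∐ G.pc ⟶ _).app X) ≫
        (Sigma.desc G.augApp : ∐ G.pc ⟶ _).app X) ≫ 𝟙 X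
    refine sigma_hom_ext G.pc fun i => sigma_map_hom_ext.{w} G.pc (G.pc i) fun j => ?_
    have h1 := (Sigma.ι G.pc i).naturality ((Sigma.desc G.augApp : ∐ G.pc ⟶ _).app X)
    rw [reassoc_of% (G.ι_totalMul X (rfl : i + j = _)), h]
    refine Eq.trans ?_ (congr_arg (fun x => (G.pc i).map ((Sigma.ι G.pc j).app X) ≫
      (Sigma.ι G.pc i).app ((∐ G.pc).obj X) ≫ x) (Category.comp_id _).symm)
    rw [← reassoc_of% h1, ← Functor.map_comp_assoc, h, h]
    exact G.mul_augApp rfl X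

end GradedAlgebra

/-- The modules `M̄` with trivial action, for an augmented algebra. -/
@[simps]
def trivialModule {A : Type u} [Category.{v} A] {T : Monad A} (ε : T ⟶ Monad.id A) :
    A ⥤ T.Algebra where
  obj M :=
    { A := M
      a := ε.app M
      unit := ε.app_η M
      assoc := by
        have h1 := ε.app_μ M
        refine h1.trans ?_
        exact Category.comp_id _ }
  map f :=
    { f := f
      h := ε.naturality f }

section Bar

variable {A : Type u} [Category.{v} A] [Abelian A]

/-- The functor `F₊`, the cokernel of the unit of `F`. -/
noncomputable def plus (T : Monad A) : A ⥤ A := cokernel T.η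

/-- The projection from `F` to `F₊`. -/
noncomputable def plusπ (T : Monad A) : (T : A ⥤ A) ⟶ plus T := cokernel.π T.η

instance (T : Monad A) (X : A) : Epi ((plusπ T).app X) :=
  inferInstanceAs (Epi ((cokernel.π T.η).app X))

lemma plus_condition (T : Monad A) (X : A) : T.η.app X ≫ (plusπ T).app X = 0 := by
  rw [← NatTrans.comp_app]
  exact congr_arg (fun a => NatTrans.app a X) (cokernel.condition T.η)

/-- `F₊ X` is the cokernel of the unit `X ⟶ F X`. -/
noncomputable def isColimitPlus (T : Monad A) (X : A) :
    IsColimit (CokernelCofork.ofπ ((plusπ T).app X) (plus_condition T X)) :=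
  (CokernelCofork.ofπ (cokernel.π T.η) (cokernel.condition _)).mapIsColimit
    (cokernelIsCokernel _) ((evaluation A A).obj X)

/-- The map out of `F₊ X` induced by a map out of `F X` which vanishes on the unit. -/
noncomputable def plusDesc (T : Monad A) {X Z : A} (f : T.obj X ⟶ Z) (h : T.η.app X ≫ f = 0) :
    (plus T).obj X ⟶ Z :=
  (CokernelCofork.IsColimit.desc' (isColimitPlus T X) f h).1

lemma π_plusDesc (T : Monad A) {X Z : A} (f : T.obj X ⟶ Z) (h : T.η.app X ≫ f = 0) :
    (plusπ T).app X ≫ plusDesc T f h = f :=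
  (CokernelCofork.IsColimit.desc' (isColimitPlus T X) f h).2

/-- The map `F₊ ⟶ F'₊` induced by a homomorphism `F ⟶ F'`. -/
noncomputable def plusMap {T T' : Monad A} (φ : T ⟶ T') : plus T ⟶ plus T' :=
  cokernel.map T.η T'.η (𝟙 _) φ.toNatTrans (by ext X; simp)

/-- A stage `Y` in the construction of the reduced bar resolution, with the map from `F Y`
which induces the next differential. -/
structure Stage (T : Monad A) where
  Y : A
  b : T.obj Y ⟶ Y
  unit : T.η.app Y ≫ b = 𝟙 Y

namespace Stage

variable {T : Monad A} (s : Stage T)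

/-- The restriction of the differential `F F₊ Y ⟶ F Y` to `F₊ Y`: on `F Y` it is the identity
minus the composite `F Y ⟶ Y ⟶ F Y`. -/
noncomputable def bd : (plus T).obj s.Y ⟶ T.obj s.Y :=
  plusDesc T (𝟙 _ - s.b ≫ T.η.app s.Y) (by
    rw [Preadditive.comp_sub, ← Category.assoc, s.unit]
    simp)

lemma π_bd : (plusπ T).app s.Y ≫ s.bd = 𝟙 _ - s.b ≫ T.η.app s.Y := π_plusDesc _ _ _

lemma bd_π : s.bd ≫ (plusπ T).app s.Y = 𝟙 _ := by
  rw [← cancel_epi ((plusπ T).app s.Y), ← Category.assoc, π_bd, Preadditive.sub_comp,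
    Category.assoc, plus_condition]
  simp

/-- The differential `F F₊ Y ⟶ F Y`. -/
noncomputable def d : T.obj ((plus T).obj s.Y) ⟶ T.obj s.Y := T.map s.bd ≫ T.μ.app s.Y

lemma η_d : T.η.app _ ≫ s.d = s.bd := by
  have h := T.η.naturality s.bd
  dsimp at h
  rw [d, ← reassoc_of% h, T.left_unit]
  exact Category.comp_id _

/-- The next stage. -/
noncomputable abbrev next : Stage T where
  Y := (plus T).obj s.Y
  b := s.d ≫ (plusπ T).app s.Y
  unit := by rw [← Category.assoc, η_d, bd_π]

lemma next_bd_d (h : s.d ≫ s.b = 0) : s.next.bd ≫ s.d = 0 := by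
  rw [← cancel_epi ((plusπ T).app s.next.Y), ← Category.assoc, π_bd, Preadditive.sub_comp,
    Category.assoc, comp_zero]
  dsimp
  rw [η_d, Category.assoc, π_bd, Preadditive.comp_sub, reassoc_of% h]
  simp

lemma next_d_d [(T : A ⥤ A).Additive] (h : s.d ≫ s.b = 0) : s.next.d ≫ s.d = 0 := by
  have h1 := T.μ.naturality s.bd
  dsimp at h1
  have h2 : s.next.d ≫ s.d = T.map (s.next.bd ≫ s.d) ≫ T.μ.app s.Y := by
    change (T.map s.next.bd ≫ T.μ.app _) ≫ T.map s.bd ≫ T.μ.app s.Y =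
      T.map (s.next.bd ≫ T.map s.bd ≫ T.μ.app s.Y) ≫ T.μ.app s.Y
    rw [Functor.map_comp, Functor.map_comp, Category.assoc, Category.assoc, Category.assoc,
      T.assoc, reassoc_of% h1]
  rw [h2, s.next_bd_d h, Functor.map_zero, zero_comp]

lemma d_b_of_assoc [PreservesFiniteColimits (T : A ⥤ A)]
    (h : T.μ.app s.Y ≫ s.b = T.map s.b ≫ s.b) : s.d ≫ s.b = 0 := by
  rw [← cancel_epi (T.map ((plusπ T).app s.Y)), d, ← Category.assoc, ← Functor.map_comp_assoc,
    π_bd, Functor.map_sub, Preadditive.sub_comp, Preadditive.sub_comp, comp_zero, sub_eq_zero,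
    T.map_id, T.map_comp, Category.assoc, Category.assoc, Category.assoc, Category.id_comp, h]
  have e : T.map (T.η.app s.Y) ≫ T.map s.b = 𝟙 _ := by
    rw [← T.map_comp, s.unit]
    exact T.map_id _
  rw [reassoc_of% e]

lemma next_d_b [(T : A ⥤ A).Additive] (h : s.d ≫ s.b = 0) : s.next.d ≫ s.next.b = 0 := by
  change s.next.d ≫ s.d ≫ (plusπ T).app s.Y = 0
  rw [← Category.assoc, s.next_d_d h, zero_comp]

/-- The differential as a map of free modules. -/
@[simps]
noncomputable def dFree : T.free.obj ((plus T).obj s.Y) ⟶ T.free.obj s.Y where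
  f := s.d
  h := by
    have h1 := T.μ.naturality s.bd
    dsimp at h1
    change T.map (T.map s.bd ≫ T.μ.app s.Y) ≫ T.μ.app s.Y =
      T.μ.app _ ≫ T.map s.bd ≫ T.μ.app s.Y
    rw [Functor.map_comp, Category.assoc, T.assoc, reassoc_of% h1]

end Stage

section

variable {T : Monad A}

/-- The stages of the reduced bar resolution of a module `M`; the object of stage `n` is
`F₊ⁿ M`. -/
noncomputable def stage (M : T.Algebra) : ℕ → Stage T
  | 0 => ⟨M.A, M.a, M.unit⟩
  | n + 1 => (stage M n).next

variable [PreservesFiniteColimits (T : A ⥤ A)]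

lemma stage_d_b (M : T.Algebra) : ∀ n, (stage M n).d ≫ (stage M n).b = 0
  | 0 => (stage M 0).d_b_of_assoc M.assoc
  | n + 1 => (stage M n).next_d_b (stage_d_b M n)

/-- The reduced bar resolution `C(F, F, M)`. -/
noncomputable def barComplex (M : T.Algebra) : ChainComplex T.Algebra ℕ :=
  ChainComplex.of (fun n => T.free.obj (stage M n).Y) (fun n => (stage M n).dFree) fun n => by
    ext
    exact (stage M n).next_d_d (stage_d_b M n)

/-- For an augmented algebra, the differential `F₊ⁿ⁺¹ X ⟶ F₊ⁿ X` of the complex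
`C(I, F, X̄)`. -/
noncomputable def barDiff (ε : T ⟶ Monad.id A) (X : A) (n : ℕ) :
    (stage ((trivialModule ε).obj X) (n + 1)).Y ⟶ (stage ((trivialModule ε).obj X) n).Y :=
  (stage ((trivialModule ε).obj X) n).bd ≫ ε.app _

/-- The cobar cochain `F₊ⁿ M ⟶ N`, as a morphism of modules out of the bar resolution. -/
noncomputable def cobar (M N : T.Algebra) (n : ℕ) (c : (stage M n).Y ⟶ N.A) :
    T.free.obj (stage M n).Y ⟶ N :=
  (T.adj.homEquiv _ _).symm c

/-- The map `F₊ᵐ c`, for a cochain `c`. -/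
noncomputable def cochainMap {M N : T.Algebra} {n : ℕ} (c : (stage M n).Y ⟶ N.A) :
    ∀ m, (stage M (n + m)).Y ⟶ (stage N m).Y
  | 0 => c
  | m + 1 => (plus T).map (cochainMap c m)

/-- The pairing `c ≀ c' = (-1)^(nm) • (c' ∘ F₊ᵐ c)` of cobar cochains. -/
noncomputable def cochainMul {M N L : T.Algebra} {n m k : ℕ} (h : n + m = k)
    (c : (stage M n).Y ⟶ N.A) (c' : (stage N m).Y ⟶ L.A) : (stage M k).Y ⟶ L.A :=
  eqToHom (by rw [h]) ≫ ((-1 : ℤ) ^ (n * m) • (cochainMap c m ≫ c'))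

end

/-- The comparison `F₊ⁿ M ⟶ F'₊ⁿ M` for a homomorphism `F ⟶ F'` and an `F'`-module `M`. -/
noncomputable def stageMap {T T' : Monad A} (φ : T ⟶ T') (M : T'.Algebra) :
    ∀ n, (stage ((Monad.algebraFunctorOfMonadHom φ).obj M) n).Y ⟶ (stage M n).Y
  | 0 => 𝟙 M.A
  | n + 1 => (plus T).map (stageMap φ M n) ≫ (plusMap φ).app _

end Bar

section Subcomplex

variable {B : Type u} [Category.{v} B] [Abelian B] (C : ChainComplex B ℕ)
  (Φ : ∀ n, Subobject (C.X n))

/-- The largest subcomplex of a chain complex which is contained in given subobjects: in degree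
`n`, the part of `Φ n` which the differential maps to `Φ (n - 1)`. -/
noncomputable def subcomplexObj (n : ℕ) : Subobject (C.X n) :=
  Φ n ⊓ (Subobject.pullback (C.d n (n - 1))).obj (Φ (n - 1))

lemma pullback_factors {X Y Z : B} (f : X ⟶ Y) (S : Subobject Y) (g : Z ⟶ X) :
    ((Subobject.pullback f).obj S).Factors g ↔ S.Factors (g ≫ f) := by
  constructor
  · intro h
    refine (Subobject.factors_iff _ _).2
      ⟨((Subobject.pullback f).obj S).factorThru g h ≫ Subobject.pullbackπ f S, ?_⟩
    refine (Category.assoc _ _ _).trans ?_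
    refine (congr_arg (fun x => _ ≫ x) (Subobject.isPullback f S).w).trans ?_
    exact Subobject.factorThru_arrow_assoc _ _ _ _
  · intro h
    refine (Subobject.factors_iff _ _).2
      ⟨(Subobject.isPullback f S).lift (S.factorThru _ h) g (by simp), ?_⟩
    exact (Subobject.isPullback f S).lift_snd _ _ _

lemma subcomplexObj_factors (n : ℕ) : (subcomplexObj C Φ n).Factors
    ((subcomplexObj C Φ (n + 1)).arrow ≫ C.d (n + 1) n) := by
  refine (Subobject.inf_factors _).2 ⟨?_, ?_⟩
  · rw [← pullback_factors]
    exact Subobject.factors_of_le _ (inf_le_right (a := Φ (n + 1))) (Subobject.factors_self _)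
  · rw [pullback_factors]
    have h : ((subcomplexObj C Φ (n + 1)).arrow ≫ C.d (n + 1) n) ≫ C.d n (n - 1) = 0 := by simp
    rw [h]
    exact Subobject.factors_zero

/-- The largest subcomplex of a chain complex which is contained in given subobjects. -/
noncomputable def subcomplex : ChainComplex B ℕ :=
  ChainComplex.of (fun n => (subcomplexObj C Φ n : B))
    (fun n => (subcomplexObj C Φ n).factorThru _ (subcomplexObj_factors C Φ n))
    fun n => by
      rw [← cancel_mono (subcomplexObj C Φ n).arrow]
      simp

/-- The cochain complex of morphisms from a chain complex to an object. -/
noncomputable def homComplex (N : B) : CochainComplex AddCommGrpCat.{v} ℕ :=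
  CochainComplex.of (fun n => AddCommGrpCat.of (C.X n ⟶ N))
    (fun n => AddCommGrpCat.ofHom
      (AddMonoidHom.mk' (fun f => C.d (n + 1) n ≫ f) (fun f g => Preadditive.comp_add _ _ _ _ _ _)))
    fun n => by
      ext f
      change C.d (n + 1 + 1) (n + 1) ≫ C.d (n + 1) n ≫ f = 0
      rw [← Category.assoc, C.d_comp_d, zero_comp]

end Subcomplex

section Words

variable {A : Type u} [Category.{v} A] [Abelian A]

/-- The composite `S (c 0) (S (c 1) (⋯ (S (c (n - 1)) X)))`. -/
def wordObj (S : ℕ → A ⥤ A) : ∀ n, (Fin n → ℕ) → A → A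
  | 0, _, X => X
  | n + 1, c, X => (S (c 0)).obj (wordObj S n (Fin.tail c) X)

variable {T : Monad A} {S : ℕ → A ⥤ A} (σ : ∀ i, S i ⟶ (T : A ⥤ A))

/-- The map `S (c 0) (S (c 1) (⋯ (S (c (n - 1)) M))) ⟶ F₊ⁿ M`. -/
noncomputable def wordMap (M : T.Algebra) :
    ∀ (n : ℕ) (c : Fin n → ℕ), wordObj S n c M.A ⟶ (stage M n).Y
  | 0, _ => 𝟙 M.A
  | n + 1, c => (S (c 0)).map (wordMap M n (Fin.tail c)) ≫ (σ (c 0)).app _ ≫ (plusπ T).app _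

/-- The part of weight `m` of `F₊ⁿ M`: the sum of the images of the composites
`S m₁ ∘ ⋯ ∘ S mₙ` with `m₁ + ⋯ + mₙ = m`. -/
noncomputable def weightSubobject (M : T.Algebra) (n m : ℕ) : Subobject (stage M n).Y :=
  (Finset.Nat.antidiagonalTuple n m).sup fun c => imageSubobject (wordMap σ M n c)

variable [PreservesFiniteColimits (T : A ⥤ A)]

/-- The map of free modules induced by `wordMap`. -/
noncomputable def freeWordMap (M : T.Algebra) (n : ℕ) (c : Fin n → ℕ) :
    T.free.obj (wordObj S n c M.A) ⟶ (barComplex M).X n :=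
  T.free.map (wordMap σ M n c)

/-- The filtration step `C_n(F, F, M)[≤ m]` of the reduced bar resolution: the sum of the images
of the free modules on the composites `S m₁ ∘ ⋯ ∘ S mₙ` with `m₁ + ⋯ + mₙ ≤ m`. -/
noncomputable def barFiltration (M : T.Algebra) (n m : ℕ) : Subobject ((barComplex M).X n) :=
  (Finset.range (m + 1)).sup fun k => (Finset.Nat.antidiagonalTuple n k).sup fun c =>
    imageSubobject (freeWordMap σ M n c)

/-- The Koszul resolution `K(F, F, M)`: the subcomplex of the reduced bar resolution which
consists in degree `n` of the part of `C_n(F, F, M)[≤ n]` which the differential maps to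
`C_{n-1}(F, F, M)[≤ n - 1]`. -/
noncomputable def koszulComplex (M : T.Algebra) : ChainComplex T.Algebra ℕ :=
  subcomplex (barComplex M) (fun n => barFiltration σ M n n)

/-- The Koszul complex `K_F(M, N)`. -/
noncomputable def koszulCochains (M N : T.Algebra) : CochainComplex AddCommGrpCat.{v} ℕ :=
  homComplex (koszulComplex σ M) N

/-- The map from the reduced cobar complex to the Koszul complex. -/
noncomputable def cobarToKoszul (M N : T.Algebra) (n : ℕ) (c : (stage M n).Y ⟶ N.A) :
    (koszulCochains σ M N).X n :=
  ((subcomplexObj (barComplex M) (fun n => barFiltration σ M n n) n).arrow ≫ cobar M N n c :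
    (koszulComplex σ M).X n ⟶ N)

end Words

section Koszulity

variable {A : Type u} [Category.{v} A] [Abelian A]

/-- The cycles of the complex `C(I, F, X̄)`. -/
noncomputable def barCycles {T : Monad A} (ε : T ⟶ Monad.id A) (X : A) :
    ∀ n, Subobject (stage ((trivialModule ε).obj X) n).Y
  | 0 => ⊤
  | n + 1 => kernelSubobject (barDiff ε X n)

/-- The boundaries of the complex `C(I, F, X̄)`. -/
noncomputable def barBoundaries {T : Monad A} (ε : T ⟶ Monad.id A) (X : A) (n : ℕ) :
    Subobject (stage ((trivialModule ε).obj X) n).Y :=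
  imageSubobject (barDiff ε X n)

variable [HasCountableCoproducts A]

/-- A graded algebra `G` is homogeneous Koszul if it is projective and the homology of
`C(I, G, Q̄)`, in degree `n` and weight `m`, vanishes for `n ≠ m`. -/
structure GradedAlgebra.IsKoszul (G : GradedAlgebra.{w} A) (W : ObjectProperty A) : Prop where
  projective : ∀ Q, W Q → Projective (G.total.obj Q)
  homology : ∀ Q, W Q → ∀ n m, n ≠ m →
    barCycles G.aug Q n ⊓ weightSubobject G.ι ((trivialModule G.aug).obj Q) n m ≤
      barBoundaries G.aug Q n

/-- A filtered algebra is Koszul if it is projective, with a homogeneous Koszul associated graded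
algebra. -/
structure FilteredAlgebra.IsKoszul {W : ObjectProperty A} [HasCovers W]
    (F : FilteredAlgebra.{w} W) : Prop where
  projective : ∀ Q, W Q → Projective (F.T.obj Q)
  gr : F.gr.IsKoszul W

/-- A map `r` from `R` to `F≤₁ ∘ F≤₁` exhibits `R` as the kernel of the multiplication
`F≤₁ ∘ F≤₁ ⟶ F≤₂`, as a functor on the objects with property `W`. -/
def FilteredAlgebra.IsRelations {W : ObjectProperty A} (F : FilteredAlgebra.{w} W) {R : A ⥤ A}
    (r : R ⟶ F.fil.obj 1 ⋙ F.fil.obj 1) : Prop :=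
  ∀ Q, W Q → ∃ h : r.app Q ≫ (F.mul (rfl : 1 + 1 = 2)).app Q = 0,
    Nonempty (IsLimit (KernelFork.ofι (r.app Q) h))

end Koszulity

lemma GradedAlgebra.totalMap_aug {A : Type u} [Category.{v} A] [Abelian A]
    [HasCountableCoproducts A] {G G' : GradedAlgebra.{w} A} (φ : Hom G G') :
    totalMap φ ≫ G'.aug = G.aug := by
  have key : ∀ n, φ.app n ≫ G'.augApp n = G.augApp n := by
    rintro (_ | n)
    · change φ.app 0 ≫ inv G'.one = inv G.one
      rw [IsIso.comp_inv_eq, ← φ.one, IsIso.inv_hom_id_assoc]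
    · exact comp_zero
  apply MonadHom.ext
  funext X
  refine sigma_hom_ext G.pc fun i => ?_
  change (Sigma.ι G.pc i).app X ≫ (Limits.Sigma.map φ.app).app X ≫
    (Sigma.desc G'.augApp : ∐ G'.pc ⟶ _).app X =
      (Sigma.ι G.pc i).app X ≫ (Sigma.desc G.augApp : ∐ G.pc ⟶ _).app X
  rw [← NatTrans.comp_app, ← NatTrans.comp_app, ← NatTrans.comp_app]
  have h1 : Sigma.ι G.pc i ≫ Limits.Sigma.map φ.app ≫ Sigma.desc G'.augApp =
      Sigma.ι G.pc i ≫ Sigma.desc G.augApp := by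
    rw [Sigma.ι_map_assoc, Sigma.ι_desc, Sigma.ι_desc, key]
  rw [h1]

section Cohomology

variable {A : Type u} [Category.{v} A] [Abelian A]

/-- The cohomology `Hⁿ(F)` of an augmented algebra: the functor which sends `X` and `N` to
`Extⁿ_F(X̄, N̄)`. -/
noncomputable def cohomology {T : Monad A} [PreservesFiniteColimits (T : A ⥤ A)]
    (ε : T ⟶ Monad.id A) (n : ℕ) : Aᵒᵖ ⥤ A ⥤ AddCommGrpCat.{max u v} :=
  have : HasExt.{max u v} T.Algebra := HasExt.standard _
  (trivialModule ε).op ⋙ Abelian.extFunctor n ⋙ (Functor.whiskeringLeft _ _ _).obj (trivialModule ε)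

variable {T T' : Monad A} [PreservesFiniteColimits (T : A ⥤ A)]
  [PreservesFiniteColimits (T' : A ⥤ A)] (φ : T ⟶ T')

instance : PreservesFiniteLimits (Monad.algebraFunctorOfMonadHom φ) :=
  ⟨fun J _ _ =>
    have : PreservesLimitsOfShape J (Monad.algebraFunctorOfMonadHom φ ⋙ T.forget) :=
      inferInstanceAs (PreservesLimitsOfShape J T'.forget)
    have : ReflectsLimitsOfShape J T.forget := reflectsLimitsOfShape_of_reflectsIsomorphisms
    preservesLimitsOfShape_of_reflects_of_preserves _ T.forget⟩

instance : PreservesFiniteColimits (Monad.algebraFunctorOfMonadHom φ) :=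
  ⟨fun J _ _ =>
    have : PreservesColimitsOfShape J (Monad.algebraFunctorOfMonadHom φ ⋙ T.forget) :=
      inferInstanceAs (PreservesColimitsOfShape J T'.forget)
    have : ReflectsColimitsOfShape J T.forget := reflectsColimitsOfShape_of_reflectsIsomorphisms
    preservesColimitsOfShape_of_reflects_of_preserves _ T.forget⟩

instance : (Monad.algebraFunctorOfMonadHom φ).Additive where

/-- Restriction of trivial modules along a homomorphism of augmented algebras. -/
def trivialModuleIso {ε : T ⟶ Monad.id A} {ε' : T' ⟶ Monad.id A} (h : φ ≫ ε' = ε) (X : A) :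
    (trivialModule ε).obj X ≅ (Monad.algebraFunctorOfMonadHom φ).obj ((trivialModule ε').obj X) :=
  Monad.Algebra.isoMk (Iso.refl X) (by
    subst h
    change T.map (𝟙 X) ≫ φ.app X ≫ ε'.app X = (φ.app X ≫ ε'.app X) ≫ 𝟙 X
    rw [T.map_id]
    exact (Category.id_comp _).trans (Category.comp_id _).symm)

lemma trivialModuleIso_hom_naturality {ε : T ⟶ Monad.id A} {ε' : T' ⟶ Monad.id A}
    (h : φ ≫ ε' = ε) {X Y : A} (f : X ⟶ Y) :
    (trivialModuleIso φ h X).hom ≫ (Monad.algebraFunctorOfMonadHom φ).map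
      ((trivialModule ε').map f) = (trivialModule ε).map f ≫ (trivialModuleIso φ h Y).hom := by
  ext
  exact (Category.id_comp f).trans (Category.comp_id f).symm

lemma trivialModuleIso_inv_naturality {ε : T ⟶ Monad.id A} {ε' : T' ⟶ Monad.id A}
    (h : φ ≫ ε' = ε) {X Y : A} (f : X ⟶ Y) :
    (Monad.algebraFunctorOfMonadHom φ).map ((trivialModule ε').map f) ≫
      (trivialModuleIso φ h Y).inv = (trivialModuleIso φ h X).inv ≫ (trivialModule ε).map f := by
  ext
  exact (Category.comp_id f).trans (Category.id_comp f).symm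

/-- The map `Hⁿ(F') ⟶ Hⁿ(F)` induced by a homomorphism `F ⟶ F'` of augmented algebras, by
restriction of extensions of modules. -/
noncomputable def cohomologyMap {ε : T ⟶ Monad.id A} {ε' : T' ⟶ Monad.id A} (h : φ ≫ ε' = ε)
    (n : ℕ) : cohomology ε' n ⟶ cohomology ε n :=
  have : HasExt.{max u v} T.Algebra := HasExt.standard _
  have : HasExt.{max u v} T'.Algebra := HasExt.standard _
  { app X :=
    { app N := AddCommGrpCat.ofHom (AddMonoidHom.mk'
        (fun e : Abelian.Ext ((trivialModule ε').obj X.unop) ((trivialModule ε').obj N) n =>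
          (Abelian.Ext.mk₀ (trivialModuleIso φ h X.unop).hom).comp
            ((e.mapExactFunctor (Monad.algebraFunctorOfMonadHom φ)).comp
              (Abelian.Ext.mk₀ (trivialModuleIso φ h N).inv) (add_zero n)) (zero_add n))
        (fun e e' => by
          rw [Abelian.Ext.mapExactFunctor_add, Abelian.Ext.add_comp, Abelian.Ext.comp_add]))
      naturality N N' f := by
        ext e
        change Abelian.Ext ((trivialModule ε').obj X.unop) ((trivialModule ε').obj N) n at e
        change (Abelian.Ext.mk₀ (trivialModuleIso φ h X.unop).hom).comp
            (((e.comp (Abelian.Ext.mk₀ ((trivialModule ε').map f)) (add_zero n)).mapExactFunctor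
              (Monad.algebraFunctorOfMonadHom φ)).comp
              (Abelian.Ext.mk₀ (trivialModuleIso φ h N').inv) (add_zero n)) (zero_add n) =
          ((Abelian.Ext.mk₀ (trivialModuleIso φ h X.unop).hom).comp
            ((e.mapExactFunctor (Monad.algebraFunctorOfMonadHom φ)).comp
              (Abelian.Ext.mk₀ (trivialModuleIso φ h N).inv) (add_zero n)) (zero_add n)).comp
            (Abelian.Ext.mk₀ ((trivialModule ε).map f)) (add_zero n)
        rw [Abelian.Ext.mapExactFunctor_comp, Abelian.Ext.mapExactFunctor_mk₀,
          Abelian.Ext.comp_assoc_of_second_deg_zero, Abelian.Ext.mk₀_comp_mk₀,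
          Abelian.Ext.comp_assoc_of_third_deg_zero, Abelian.Ext.comp_assoc_of_second_deg_zero,
          Abelian.Ext.mk₀_comp_mk₀, trivialModuleIso_inv_naturality] }
    naturality X X' f := by
      ext N e
      change Abelian.Ext ((trivialModule ε').obj X.unop) ((trivialModule ε').obj N) n at e
      change (Abelian.Ext.mk₀ (trivialModuleIso φ h X'.unop).hom).comp
          ((((Abelian.Ext.mk₀ ((trivialModule ε').map f.unop)).comp e (zero_add n)).mapExactFunctor
            (Monad.algebraFunctorOfMonadHom φ)).comp
            (Abelian.Ext.mk₀ (trivialModuleIso φ h N).inv) (add_zero n)) (zero_add n) =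
        (Abelian.Ext.mk₀ ((trivialModule ε).map f.unop)).comp
          ((Abelian.Ext.mk₀ (trivialModuleIso φ h X.unop).hom).comp
          ((e.mapExactFunctor (Monad.algebraFunctorOfMonadHom φ)).comp
            (Abelian.Ext.mk₀ (trivialModuleIso φ h N).inv) (add_zero n)) (zero_add n)) (zero_add n)
      rw [Abelian.Ext.mapExactFunctor_comp, Abelian.Ext.mapExactFunctor_mk₀,
        Abelian.Ext.comp_assoc_of_third_deg_zero, Abelian.Ext.mk₀_comp_mk₀_assoc,
        Abelian.Ext.mk₀_comp_mk₀_assoc, trivialModuleIso_hom_naturality] }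

end Cohomology

section Statement

variable {A : Type u} [Category.{v} A] [Abelian A]

/-- The trivial action of an augmented algebra on an object. -/
def trivialAction {T : Monad A} (ε : T ⟶ Monad.id A) (X : A) : T.obj X ⟶ X := ε.app X

/-- The action of the augmentation ideal on a module, with the opposite sign, as a cobar cochain
of degree one. -/
noncomputable def actionCochain {T : Monad A} (ε : T ⟶ Monad.id A) (M : T.Algebra) :
    (stage M 1).Y ⟶ M.A :=
  -plusDesc T (M.a - trivialAction ε M.A) (by
    have h : T.η.app M.A ≫ trivialAction ε M.A = 𝟙 _ := ε.app_η M.A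
    rw [Preadditive.comp_sub, M.unit, h]
    exact sub_self _)

/-- The element `Q^M` of `K¹_F(M, M)`. -/
noncomputable def koszulElement {T : Monad A} [PreservesFiniteColimits (T : A ⥤ A)]
    {S : ℕ → A ⥤ A} (σ : ∀ i, S i ⟶ (T : A ⥤ A)) (ε : T ⟶ Monad.id A) (M : T.Algebra) :
    (koszulCochains σ M M).X 1 :=
  cobarToKoszul σ M M 1 (actionCochain ε M)

variable [HasCountableCoproducts A] {W : ObjectProperty A} [HasCovers W]

namespace FilteredAlgebra

variable (F : FilteredAlgebra.{w} W) {G : GradedAlgebra.{w} A} (Φ : GradedAlgebra.Hom G F.rees)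

/-- The homomorphism to `F` obtained from a homomorphism to `⨁ₙ F≤ₙ`. -/
noncomputable def toAlgebra : G.total ⟶ F.T := GradedAlgebra.totalMap Φ ≫ F.reesMap

/-- The homomorphism to `gr F` obtained from a homomorphism to `⨁ₙ F≤ₙ`. -/
noncomputable def toGr : G.total ⟶ F.gr.total :=
  GradedAlgebra.totalMap Φ ≫ GradedAlgebra.totalMap F.grIdeal.proj

lemma toGr_aug : F.toGr Φ ≫ F.gr.aug = G.aug := by
  rw [toGr, Category.assoc]
  exact (congr_arg (fun x => _ ≫ x) (GradedAlgebra.totalMap_aug _)).trans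
    (GradedAlgebra.totalMap_aug _)

end FilteredAlgebra

end Statement

section Theory

variable (P : Type u) [Category.{w} P] [Preadditive P] [HasCoproducts.{w} P]

/-- The models which are isomorphic to an object of the theory. -/
abbrev representables : ObjectProperty (Model P) := (embedding P).essImage

variable [IsBoundedTheory P]

instance : HasCovers (representables P) where
  exists_epi X := by
    obtain ⟨Q, f, hf⟩ := exists_epi X
    exact ⟨_, (embedding P).obj_mem_essImage Q, f, hf⟩

instance : HasCountableCoproducts (Model P) :=
  have : HasColimitsOfSize.{0, 0} (Model P) := hasColimitsOfSizeShrink.{0, 0, w, w} _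
  inferInstance

variable {P}

/-- The cohomology `Hⁿ(F)` as a functor on the theory: it sends `Q` and `N` to
`Extⁿ_F(Q̄, N̄)`. -/
noncomputable def theoryCohomology {T : Monad (Model P)}
    [PreservesFiniteColimits (T : Model P ⥤ Model P)] (ε : T ⟶ Monad.id (Model P)) (n : ℕ) :
    Pᵒᵖ ⥤ Model P ⥤ AddCommGrpCat.{max u (w + 1)} :=
  (embedding P).op ⋙ cohomology ε n

/-- The map `Hⁿ(gr F) ⟶ Hⁿ(G)` for a homomorphism of graded algebras from `G` to
`⨁ₙ F≤ₙ`. -/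
noncomputable def grCohomologyMap (F : FilteredAlgebra.{w} (representables P))
    {G : GradedAlgebra.{w} (Model P)} (Φ : GradedAlgebra.Hom G F.rees) (n : ℕ) :
    theoryCohomology F.gr.aug n ⟶ theoryCohomology G.aug n :=
  Functor.whiskerLeft (embedding P).op (cohomologyMap (F.toGr Φ) (F.toGr_aug Φ) n)

end Theory

end Koszul

open Koszul

universe v' u'

namespace Koszul

section Syzygies

variable {A : Type u} [Category.{v} A] [Abelian A] {T : Monad A}

namespace Stage

lemma plusπ_b_next (s : Stage T) [(T : A ⥤ A).Additive] :
    T.map ((plusπ T).app s.Y) ≫ s.next.b + T.map s.b ≫ (plusπ T).app s.Y =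
      T.μ.app s.Y ≫ (plusπ T).app s.Y := by
  have h2 : T.map (T.η.app s.Y) ≫ T.μ.app s.Y = 𝟙 _ := T.right_unit _
  have h3 : T.map ((plusπ T).app s.Y) ≫ T.map s.bd =
      𝟙 _ - T.map s.b ≫ T.map (T.η.app s.Y) := by
    rw [← Functor.map_comp, π_bd, Functor.map_sub, T.map_id, T.map_comp]
  change T.map ((plusπ T).app s.Y) ≫ (T.map s.bd ≫ T.μ.app s.Y) ≫ _ + _ = _
  rw [Category.assoc, reassoc_of% h3, Preadditive.sub_comp, Category.assoc, reassoc_of% h2,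
    Category.id_comp]
  exact sub_add_cancel _ _

lemma bd_b (s : Stage T) : s.bd ≫ s.b = 0 := by
  rw [← cancel_epi ((plusπ T).app s.Y), ← Category.assoc, π_bd, Preadditive.sub_comp,
    Category.assoc, s.unit, comp_zero]
  simp

lemma next_b_bd (s : Stage T) (h : s.d ≫ s.b = 0) : s.next.b ≫ s.bd = s.d := by
  change (s.d ≫ (plusπ T).app s.Y) ≫ s.bd = _
  rw [Category.assoc, π_bd, Preadditive.comp_sub, reassoc_of% h]
  simp

lemma next_assoc (s : Stage T) (h : s.d ≫ s.b = 0) :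
    T.μ.app s.next.Y ≫ s.next.b = T.map s.next.b ≫ s.next.b := by
  have h0 : s.d ≫ (plusπ T).app s.Y ≫ s.bd = s.d := by
    rw [← Category.assoc]
    exact s.next_b_bd h
  have h1 := T.μ.naturality s.bd
  have : Mono s.bd := mono_of_mono_fac s.bd_π
  have h3 : T.μ.app _ ≫ s.d = T.map s.d ≫ T.μ.app s.Y := by
    rw [Stage.d, Functor.map_comp, Category.assoc, T.assoc]
    have h4 := congr_arg (fun x => x ≫ T.μ.app s.Y) h1
    simp only [Category.assoc] at h4
    exact h4.symm
  rw [← cancel_mono s.bd]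
  dsimp only
  simp only [Category.assoc]
  rw [h0, h3]
  rw [Stage.d, ← Functor.map_comp_assoc, ← Stage.d, Category.assoc, h0]

end Stage

variable [PreservesFiniteColimits (T : A ⥤ A)]

lemma stage_assoc (M : T.Algebra) : ∀ n, T.μ.app _ ≫ (stage M n).b =
    T.map (stage M n).b ≫ (stage M n).b
  | 0 => M.assoc
  | n + 1 => (stage M n).next_assoc (stage_d_b M n)

/-- The syzygies of a module, with underlying objects the stages `F₊ⁿ M`. -/
@[simps]
noncomputable def syz (M : T.Algebra) (n : ℕ) : T.Algebra where
  A := (stage M n).Y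
  a := (stage M n).b
  unit := (stage M n).unit
  assoc := stage_assoc M n

/-- The inclusion of a syzygy in a free module. -/
@[simps]
noncomputable def syzι (M : T.Algebra) (n : ℕ) : syz M (n + 1) ⟶ T.free.obj (stage M n).Y where
  f := (stage M n).bd
  h := ((stage M n).next_b_bd (stage_d_b M n)).symm

/-- The presentation of a module by the free module on its underlying object. -/
@[simps]
def freePresentation (M : T.Algebra) : T.free.obj M.A ⟶ M where
  f := M.a
  h := M.assoc.symm

/-- The short complex `syz (n + 1) ⟶ F (F₊ⁿ M) ⟶ syz n`. -/
@[simps]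
noncomputable def syzComplex (M : T.Algebra) (n : ℕ) : ShortComplex T.Algebra where
  X₁ := syz M (n + 1)
  X₂ := T.free.obj (stage M n).Y
  X₃ := syz M n
  f := syzι M n
  g := freePresentation (syz M n)
  zero := by ext; exact (stage M n).bd_b

lemma shortExact_of_forget (S : ShortComplex T.Algebra) (h : (S.map T.forget).ShortExact) :
    S.ShortExact := by
  have h1 : S.Exact := (S.exact_map_iff_of_faithful T.forget).1 h.exact
  have h2 : Mono S.f := T.forget.mono_of_mono_map h.mono_f
  have h3 : Epi S.g := T.forget.epi_of_epi_map h.epi_g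
  exact ⟨h1⟩

lemma syzComplex_shortExact (M : T.Algebra) (n : ℕ) : (syzComplex M n).ShortExact := by
  apply shortExact_of_forget
  refine ShortComplex.Splitting.shortExact
    { r := (plusπ T).app (stage M n).Y
      s := T.η.app (stage M n).Y
      f_r := (stage M n).bd_π
      s_g := (stage M n).unit
      id := ?_ }
  change (plusπ T).app (stage M n).Y ≫ (stage M n).bd + (stage M n).b ≫ T.η.app (stage M n).Y = 𝟙 _
  rw [Stage.π_bd]
  simp

instance hasExt_algebra (T : Monad A) [PreservesFiniteColimits (T : A ⥤ A)] :
    HasExt.{max u v} T.Algebra := HasExt.standard _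

instance projective_free (X : A) [Projective X] : Projective (T.free.obj X) :=
  T.adj.map_projective X inferInstance

/-- The extension of a syzygy by the next one. -/
noncomputable def syzExt (M : T.Algebra) (n : ℕ) :
    Abelian.Ext.{max u v} (syz M n) (syz M (n + 1)) 1 :=
  (syzComplex_shortExact M n).extClass

/-- The identification of a module with its syzygy of order zero. -/
def syzZero (M : T.Algebra) : M ⟶ syz M 0 := 𝟙 M

/-- The iterated extension of a module by its syzygy. -/
noncomputable def syzClass (M : T.Algebra) : ∀ n, Abelian.Ext.{max u v} M (syz M n) n
  | 0 => Abelian.Ext.mk₀ (syzZero M)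
  | n + 1 => (syzClass M n).comp (syzExt M n) rfl

/-- The extension class which corresponds to a map out of a syzygy. -/
noncomputable def extOf {M N : T.Algebra} {n : ℕ} (c : syz M n ⟶ N) : Abelian.Ext.{max u v} M N n :=
  (syzClass M n).comp (Abelian.Ext.mk₀ c) (add_zero n)

lemma extOf_add {M N : T.Algebra} {n : ℕ} (c c' : syz M n ⟶ N) :
    extOf (c + c') = extOf c + extOf c' := by
  rw [extOf, Abelian.Ext.mk₀_add, Abelian.Ext.comp_add]
  rfl

lemma extOf_comp {M N N' : T.Algebra} {n : ℕ} (c : syz M n ⟶ N) (f : N ⟶ N') :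
    (extOf c).comp (Abelian.Ext.mk₀ f) (add_zero n) = extOf (c ≫ f) := by
  rw [extOf, extOf, Abelian.Ext.comp_assoc_of_third_deg_zero, Abelian.Ext.mk₀_comp_mk₀]

/-- A monad preserves projective objects. -/
class PreservesProj (T : Monad A) : Prop where
  proj : ∀ X : A, Projective X → Projective (T.obj X)

lemma projective_stage [PreservesProj T] (M : T.Algebra) (hM : Projective M.A) :
    ∀ n, Projective (stage M n).Y
  | 0 => hM
  | n + 1 => by
    have := projective_stage M hM n
    have h := PreservesProj.proj (T := T) _ this
    exact Retract.projective (Y := T.obj (stage M n).Y)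
      { i := (stage M n).bd, r := (plusπ T).app _, retract := (stage M n).bd_π } 

lemma syzClass_comp_surjective [PreservesProj T] (M : T.Algebra) (hM : Projective M.A)
    (N : T.Algebra) (j : ℕ) : ∀ (n k : ℕ) (h : j + k = n) (x : Abelian.Ext.{max u v} M N n),
      ∃ y : Abelian.Ext.{max u v} (syz M j) N k, (syzClass M j).comp y h = x := by
  induction j with
  | zero =>
    intro n k h x
    obtain rfl : k = n := by omega
    exact ⟨x, Abelian.Ext.mk₀_id_comp x⟩
  | succ j ih =>
    intro n k h x
    obtain ⟨y, rfl⟩ := ih n (k + 1) (by omega) x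
    have := projective_stage M hM j
    obtain ⟨z, rfl⟩ := Abelian.Ext.contravariant_sequence_exact₃ (syzComplex_shortExact M j) N y
      (Abelian.Ext.eq_zero_of_projective (P := T.free.obj (stage M j).Y) _) (add_comm 1 k)
    exact ⟨z, Abelian.Ext.comp_assoc _ _ _ _ _ (by omega)⟩

lemma syzClass_comp_injective [PreservesProj T] (M : T.Algebra) (hM : Projective M.A)
    (N : T.Algebra) (j : ℕ) : ∀ (n k : ℕ) (h : j + (k + 1) = n)
      (y : Abelian.Ext.{max u v} (syz M j) N (k + 1)), (syzClass M j).comp y h = 0 → y = 0 := by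
  induction j with
  | zero =>
    intro n k h y hy
    obtain rfl : k + 1 = n := by omega
    exact (Abelian.Ext.mk₀_id_comp y).symm.trans hy
  | succ j ih =>
    intro n k h y hy
    have h1 := ih n (k + 1) (by omega) ((syzComplex_shortExact M j).extClass.comp y (by omega)) (by
      rw [← hy]
      exact (Abelian.Ext.comp_assoc _ _ _ _ _ (by omega)).symm)
    have := projective_stage M hM j
    obtain ⟨z, rfl⟩ := Abelian.Ext.contravariant_sequence_exact₁ (syzComplex_shortExact M j) N y
      _ h1
    have hz : z = 0 := Abelian.Ext.eq_zero_of_projective (P := T.free.obj (stage M j).Y) _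
    rw [hz]
    exact Abelian.Ext.comp_zero _ _ _ _ _

lemma extOf_surjective [PreservesProj T] (M : T.Algebra) (hM : Projective M.A)
    (N : T.Algebra) (n : ℕ) (x : Abelian.Ext.{max u v} M N n) : ∃ c : syz M n ⟶ N, extOf c = x := by
  obtain ⟨y, rfl⟩ := syzClass_comp_surjective M hM N n n 0 (add_zero n) x
  obtain ⟨c, rfl⟩ := (Abelian.Ext.mk₀_bijective _ _).2 y
  exact ⟨c, rfl⟩

lemma extOf_zero_iff {M N : T.Algebra} (c : syz M 0 ⟶ N) :
    extOf c = 0 ↔ c = 0 := by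
  rw [← Abelian.Ext.mk₀_eq_zero_iff (f := c)]
  exact iff_of_eq (congr_arg (· = 0) (Abelian.Ext.mk₀_id_comp _))

lemma extOf_succ_eq_zero_iff [PreservesProj T] (M : T.Algebra) (hM : Projective M.A)
    (N : T.Algebra) (n : ℕ) (c : syz M (n + 1) ⟶ N) :
    extOf c = 0 ↔ ∃ u : T.free.obj (stage M n).Y ⟶ N, c = syzι M n ≫ u := by
  have h : extOf c = (syzClass M n).comp ((syzComplex_shortExact M n).extClass.comp
      (Abelian.Ext.mk₀ c) (add_zero 1)) rfl := Abelian.Ext.comp_assoc _ _ _ _ _ (by omega)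
  constructor
  · intro h0
    rw [h] at h0
    have h1 := syzClass_comp_injective M hM N n _ 0 _ _ h0
    obtain ⟨z, hz⟩ := Abelian.Ext.contravariant_sequence_exact₁ (syzComplex_shortExact M n) N _
      _ h1
    obtain ⟨u, rfl⟩ := (Abelian.Ext.mk₀_bijective _ _).2 z
    rw [Abelian.Ext.mk₀_comp_mk₀] at hz
    exact ⟨u, ((Abelian.Ext.mk₀_bijective _ _).1 hz).symm⟩
  · rintro ⟨u, rfl⟩
    have := (syzComplex_shortExact M n).extClass_comp_assoc (Abelian.Ext.mk₀ u) (h := add_zero 1)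
    replace this := (congr_arg (fun x => (syzComplex_shortExact M n).extClass.comp x (add_zero 1))
      (Abelian.Ext.mk₀_comp_mk₀ (syzι M n) u)).symm.trans this
    exact h.trans <| (congr_arg (fun x => (syzClass M n).comp x rfl) this).trans
      (Abelian.Ext.comp_zero _ _ _ _ _)

end Syzygies

section Lax

variable {A : Type u} [Category.{v} A] [Abelian A] {A' : Type u'} [Category.{v'} A'] [Abelian A']

/-- A functor from `A` to `A'` with a compatible transformation between monads. -/
structure LaxMap (T : Monad A) (T' : Monad A') where
  Δ : A ⥤ A'
  additive : Δ.Additive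
  θ : Δ ⋙ (T' : A' ⥤ A') ⟶ (T : A ⥤ A) ⋙ Δ
  unit : ∀ X, T'.η.app (Δ.obj X) ≫ θ.app X = Δ.map (T.η.app X)
  mul : ∀ X, T'.μ.app (Δ.obj X) ≫ θ.app X =
    T'.map (θ.app X) ≫ θ.app (T.obj X) ≫ Δ.map (T.μ.app X)

namespace LaxMap

variable {T : Monad A} {T' : Monad A'} (L : LaxMap T T')

attribute [instance] LaxMap.additive

/-- The map `F' Y' ⟶ Δ (F Y)` induced by a map `Y' ⟶ Δ Y`. -/
def lift {Y : A} {Y' : A'} (j : Y' ⟶ L.Δ.obj Y) : T'.obj Y' ⟶ L.Δ.obj (T.obj Y) :=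
  T'.map j ≫ L.θ.app Y

lemma η_lift {Y : A} {Y' : A'} (j : Y' ⟶ L.Δ.obj Y) :
    T'.η.app Y' ≫ L.lift j = j ≫ L.Δ.map (T.η.app Y) := by
  have h := T'.η.naturality j
  dsimp at h
  rw [lift, ← reassoc_of% h, L.unit]

lemma lift_comp {Y Z : A} {Y' : A'} (j : Y' ⟶ L.Δ.obj Y) (f : Y ⟶ Z) :
    L.lift (j ≫ L.Δ.map f) = L.lift j ≫ L.Δ.map (T.map f) := by
  have h := L.θ.naturality f
  dsimp at h
  rw [lift, lift, T'.map_comp, Category.assoc, h, Category.assoc]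

lemma comp_lift {Y : A} {Y' Z' : A'} (g : Z' ⟶ Y') (j : Y' ⟶ L.Δ.obj Y) :
    L.lift (g ≫ j) = T'.map g ≫ L.lift j := by
  rw [lift, lift, T'.map_comp, Category.assoc]

lemma μ_lift {Y : A} {Y' : A'} (j : Y' ⟶ L.Δ.obj Y) :
    T'.μ.app Y' ≫ L.lift j = L.lift (L.lift j) ≫ L.Δ.map (T.μ.app Y) := by
  have h := T'.μ.naturality j
  dsimp at h
  rw [lift, ← reassoc_of% h, L.mul, lift, T'.map_comp]
  simp only [Category.assoc]

/-- A map of stages relative to a lax map. -/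
structure Rel {s : Stage T} {s' : Stage T'} (j : s'.Y ⟶ L.Δ.obj s.Y) : Prop where
  b : s'.b ≫ j = L.lift j ≫ L.Δ.map s.b

variable {s : Stage T} {s' : Stage T'} {j : s'.Y ⟶ L.Δ.obj s.Y}
    {k : (plus T').obj s'.Y ⟶ L.Δ.obj ((plus T).obj s.Y)}

/-- The induced map of the next stages. -/
noncomputable def plusLift {Y : A} {Y' : A'} (j : Y' ⟶ L.Δ.obj Y) :
    (plus T').obj Y' ⟶ L.Δ.obj ((plus T).obj Y) :=
  plusDesc T' (L.lift j ≫ L.Δ.map ((plusπ T).app Y)) (by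
    rw [← Category.assoc, η_lift, Category.assoc, ← L.Δ.map_comp, plus_condition, L.Δ.map_zero,
      comp_zero])

lemma π_plusLift {Y : A} {Y' : A'} (j : Y' ⟶ L.Δ.obj Y) :
    (plusπ T').app Y' ≫ L.plusLift j = L.lift j ≫ L.Δ.map ((plusπ T).app Y) :=
  π_plusDesc _ _ _

variable {L}

lemma Rel.bd (h : L.Rel j)
    (hk : (plusπ T').app s'.Y ≫ k = L.lift j ≫ L.Δ.map ((plusπ T).app s.Y)) :
    s'.bd ≫ L.lift j = k ≫ L.Δ.map s.bd := by
  rw [← cancel_epi ((plusπ T').app s'.Y), ← Category.assoc, Stage.π_bd, reassoc_of% hk,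
    ← L.Δ.map_comp, Stage.π_bd, Preadditive.sub_comp, Category.assoc, L.η_lift, reassoc_of% h.b,
    L.Δ.map_sub, L.Δ.map_id, Preadditive.comp_sub, L.Δ.map_comp]
  simp

lemma Rel.d (h : L.Rel j)
    (hk : (plusπ T').app s'.Y ≫ k = L.lift j ≫ L.Δ.map ((plusπ T).app s.Y)) :
    s'.d ≫ L.lift j = L.lift k ≫ L.Δ.map s.d := by
  rw [Stage.d, Category.assoc, L.μ_lift, ← Category.assoc, ← L.comp_lift, h.bd hk, L.lift_comp,
    Category.assoc, ← L.Δ.map_comp, Stage.d]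

lemma Rel.next (h : L.Rel j)
    (hk : (plusπ T').app s'.Y ≫ k = L.lift j ≫ L.Δ.map ((plusπ T).app s.Y)) :
    L.Rel (s := s.next) (s' := s'.next) k := by
  constructor
  dsimp
  rw [Category.assoc, hk, ← Category.assoc, h.d hk, Category.assoc, ← L.Δ.map_comp]

end LaxMap

end Lax

section LaxInstances

variable {A : Type u} [Category.{v} A] [Abelian A]

/-- A homomorphism of monads as a lax map. -/
@[simps]
def LaxMap.ofHom {T T' : Monad A} (φ : T ⟶ T') : LaxMap T' T where
  Δ := 𝟭 A
  additive := inferInstance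
  θ := { app X := φ.app X, naturality X Y f := φ.naturality f }
  unit X := φ.app_η X
  mul X := by
    refine (φ.app_μ X).trans ?_
    exact Category.assoc _ _ _

/-- The comparison of stages for modules which are related by a lax map. -/
noncomputable def LaxMap.stageLift {A' : Type u'} [Category.{v'} A'] [Abelian A'] {T : Monad A}
    {T' : Monad A'} (L : LaxMap T T') (M : T.Algebra) (M' : T'.Algebra)
    (j : M'.A ⟶ L.Δ.obj M.A) : ∀ n, (stage M' n).Y ⟶ L.Δ.obj (stage M n).Y
  | 0 => j
  | n + 1 => L.plusLift (stageLift L M M' j n)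

lemma LaxMap.stageLift_rel {A' : Type u'} [Category.{v'} A'] [Abelian A'] {T : Monad A}
    {T' : Monad A'} (L : LaxMap T T') (M : T.Algebra) (M' : T'.Algebra)
    (j : M'.A ⟶ L.Δ.obj M.A) (hj : M'.a ≫ j = L.lift j ≫ L.Δ.map M.a) :
    ∀ n, L.Rel (s := stage M n) (s' := stage M' n) (L.stageLift M M' j n)
  | 0 => ⟨hj⟩
  | n + 1 => (stageLift_rel L M M' j hj n).next (L.π_plusLift _)

end LaxInstances

section SyzygyNaturality

variable {A : Type u} [Category.{v} A] [Abelian A] {T T' : Monad A}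
  [PreservesFiniteColimits (T : A ⥤ A)] [PreservesFiniteColimits (T' : A ⥤ A)]

/-- The comparison of stages for a map of modules over a homomorphism of monads. -/
noncomputable def stageComp (φ : T ⟶ T') {M : T.Algebra} {M' : T'.Algebra} (f : M.A ⟶ M'.A)
    (n : ℕ) : (stage M n).Y ⟶ (stage M' n).Y :=
  (LaxMap.ofHom φ).stageLift M' M f n

lemma π_stageComp (φ : T ⟶ T') {M : T.Algebra} {M' : T'.Algebra} (f : M.A ⟶ M'.A) (n : ℕ) :
    (plusπ T).app (stage M n).Y ≫ stageComp φ f (n + 1) =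
      T.map (stageComp φ f n) ≫ φ.app _ ≫ (plusπ T').app (stage M' n).Y :=
  ((LaxMap.ofHom φ).π_plusLift _).trans (Category.assoc _ _ _)

lemma stageComp_rel (φ : T ⟶ T') {M : T.Algebra} {M' : T'.Algebra}
    (f : M ⟶ (Monad.algebraFunctorOfMonadHom φ).obj M') (n : ℕ) :
    (LaxMap.ofHom φ).Rel (s := stage M' n) (s' := stage M n) (stageComp φ f.f n) :=
  (LaxMap.ofHom φ).stageLift_rel M' M f.f (f.h.symm.trans (Category.assoc _ _ _).symm) n

lemma stageComp_b (φ : T ⟶ T') {M : T.Algebra} {M' : T'.Algebra}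
    (f : M ⟶ (Monad.algebraFunctorOfMonadHom φ).obj M') (n : ℕ) :
    (stage M n).b ≫ stageComp φ f.f n =
      T.map (stageComp φ f.f n) ≫ φ.app _ ≫ (stage M' n).b :=
  (stageComp_rel φ f n).b.trans (Category.assoc _ _ _)

lemma stageComp_bd (φ : T ⟶ T') {M : T.Algebra} {M' : T'.Algebra}
    (f : M ⟶ (Monad.algebraFunctorOfMonadHom φ).obj M') (n : ℕ) :
    (stage M n).bd ≫ T.map (stageComp φ f.f n) ≫ φ.app _ =
      stageComp φ f.f (n + 1) ≫ (stage M' n).bd :=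
  (stageComp_rel φ f n).bd ((LaxMap.ofHom φ).π_plusLift _)

/-- The comparison of syzygies for a map of modules over a homomorphism of monads. -/
@[simps]
noncomputable def syzComp (φ : T ⟶ T') {M : T.Algebra} {M' : T'.Algebra}
    (f : M ⟶ (Monad.algebraFunctorOfMonadHom φ).obj M') (n : ℕ) :
    syz M n ⟶ (Monad.algebraFunctorOfMonadHom φ).obj (syz M' n) where
  f := stageComp φ f.f n
  h := (stageComp_b φ f n).symm

/-- The comparison of free modules for a homomorphism of monads. -/
@[simps]
noncomputable def freeComp (φ : T ⟶ T') {X X' : A} (f : X ⟶ X') :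
    T.free.obj X ⟶ (Monad.algebraFunctorOfMonadHom φ).obj (T'.free.obj X') where
  f := T.map f ≫ φ.app X'
  h := by
    have h := T.μ.naturality f
    change T.map (T.map f ≫ φ.app X') ≫ φ.app _ ≫ T'.μ.app X' = T.μ.app X ≫ T.map f ≫ φ.app X'
    dsimp at h
    rw [← reassoc_of% h, φ.app_μ, T.map_comp]
    simp

/-- The comparison of the short exact sequences which define the syzygies. -/
@[simps]
noncomputable def syzComplexComp (φ : T ⟶ T') {M : T.Algebra} {M' : T'.Algebra}
    (f : M ⟶ (Monad.algebraFunctorOfMonadHom φ).obj M') (n : ℕ) :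
    syzComplex M n ⟶ (syzComplex M' n).map (Monad.algebraFunctorOfMonadHom φ) where
  τ₁ := syzComp φ f (n + 1)
  τ₂ := freeComp φ (stageComp φ f.f n)
  τ₃ := syzComp φ f n
  comm₁₂ := by ext; exact (stageComp_bd φ f n).symm
  comm₂₃ := by
    ext
    exact (Category.assoc _ _ _).trans (stageComp_b φ f n).symm

lemma syzExt_comp (φ : T ⟶ T') {M : T.Algebra} {M' : T'.Algebra}
    (f : M ⟶ (Monad.algebraFunctorOfMonadHom φ).obj M') (n : ℕ) :
    (syzExt M n).comp (Abelian.Ext.mk₀ (syzComp φ f (n + 1))) (add_zero 1) =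
      (Abelian.Ext.mk₀ (syzComp φ f n)).comp
        ((syzExt M' n).mapExactFunctor (Monad.algebraFunctorOfMonadHom φ)) (zero_add 1) := by
  have h := ShortComplex.ShortExact.extClass_naturality (syzComplex_shortExact M n)
    ((syzComplex_shortExact M' n).map_of_exact (Monad.algebraFunctorOfMonadHom φ))
    (syzComplexComp φ f n)
  refine h.trans ?_
  exact congr_arg (fun x => (Abelian.Ext.mk₀ (syzComplexComp φ f n).τ₃).comp x (zero_add 1))
    (Abelian.Ext.mapExactFunctor_extClass _ (syzComplex_shortExact M' n)).symm

lemma syzClass_comp (φ : T ⟶ T') {M : T.Algebra} {M' : T'.Algebra}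
    (f : M ⟶ (Monad.algebraFunctorOfMonadHom φ).obj M') (n : ℕ) :
    (syzClass M n).comp (Abelian.Ext.mk₀ (syzComp φ f n)) (add_zero n) =
      (Abelian.Ext.mk₀ f).comp
        ((syzClass M' n).mapExactFunctor (Monad.algebraFunctorOfMonadHom φ)) (zero_add n) := by
  induction n with
  | zero =>
    rw [syzClass, syzClass, Abelian.Ext.mapExactFunctor_mk₀, Abelian.Ext.mk₀_comp_mk₀,
      Abelian.Ext.mk₀_comp_mk₀]
    congr 1
    ext
    exact (Category.id_comp f.f).trans (Category.comp_id f.f).symm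
  | succ n ih =>
    rw [syzClass, syzClass, Abelian.Ext.mapExactFunctor_comp,
      Abelian.Ext.comp_assoc_of_third_deg_zero, syzExt_comp,
      ← Abelian.Ext.comp_assoc_of_second_deg_zero, ih]
    exact Abelian.Ext.comp_assoc _ _ _ _ _ (by omega)

lemma mapExactFunctor_extOf (φ : T ⟶ T') {M : T.Algebra} {M' N' : T'.Algebra}
    (f : M ⟶ (Monad.algebraFunctorOfMonadHom φ).obj M') (n : ℕ) (c : syz M' n ⟶ N') :
    (Abelian.Ext.mk₀ f).comp
        ((extOf c).mapExactFunctor (Monad.algebraFunctorOfMonadHom φ)) (zero_add n) =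
      extOf (syzComp φ f n ≫ (Monad.algebraFunctorOfMonadHom φ).map c) := by
  rw [extOf, Abelian.Ext.mapExactFunctor_comp, Abelian.Ext.mapExactFunctor_mk₀,
    ← Abelian.Ext.comp_assoc_of_third_deg_zero, ← syzClass_comp,
    Abelian.Ext.comp_assoc_of_third_deg_zero, Abelian.Ext.mk₀_comp_mk₀, extOf]

lemma stageComp_id_b {M M' : T.Algebra} (f : M ⟶ M') (n : ℕ) :
    (stage M n).b ≫ stageComp (𝟙 T) f.f n = T.map (stageComp (𝟙 T) f.f n) ≫ (stage M' n).b := by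
  refine ((LaxMap.ofHom (𝟙 T)).stageLift_rel M' M f.f ?_ n).b.trans ?_
  · refine f.h.symm.trans ?_
    exact congr_arg (fun x => x ≫ M'.a) (Category.comp_id (T.map f.f)).symm
  · exact congr_arg (fun x => x ≫ (stage M' n).b) (Category.comp_id _)

lemma stageComp_id_bd {M M' : T.Algebra} (f : M ⟶ M') (n : ℕ) :
    (stage M n).bd ≫ T.map (stageComp (𝟙 T) f.f n) =
      stageComp (𝟙 T) f.f (n + 1) ≫ (stage M' n).bd := by
  refine Eq.trans ?_ (((LaxMap.ofHom (𝟙 T)).stageLift_rel M' M f.f ?_ n).bd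
    ((LaxMap.ofHom (𝟙 T)).π_plusLift _))
  · exact congr_arg (fun x => (stage M n).bd ≫ x) (Category.comp_id _).symm
  · refine f.h.symm.trans ?_
    exact congr_arg (fun x => x ≫ M'.a) (Category.comp_id (T.map f.f)).symm

/-- The map of syzygies induced by a map of modules. -/
@[simps]
noncomputable def syzMap {M M' : T.Algebra} (f : M ⟶ M') (n : ℕ) : syz M n ⟶ syz M' n where
  f := stageComp (𝟙 T) f.f n
  h := (stageComp_id_b f n).symm

/-- The map of the short exact sequences which define the syzygies. -/
@[simps]
noncomputable def syzComplexMap {M M' : T.Algebra} (f : M ⟶ M') (n : ℕ) :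
    syzComplex M n ⟶ syzComplex M' n where
  τ₁ := syzMap f (n + 1)
  τ₂ := T.free.map (stageComp (𝟙 T) f.f n)
  τ₃ := syzMap f n
  comm₁₂ := by ext; exact (stageComp_id_bd f n).symm
  comm₂₃ := by ext; exact (stageComp_id_b f n).symm

lemma syzExt_map {M M' : T.Algebra} (f : M ⟶ M') (n : ℕ) :
    (syzExt M n).comp (Abelian.Ext.mk₀ (syzMap f (n + 1))) (add_zero 1) =
      (Abelian.Ext.mk₀ (syzMap f n)).comp (syzExt M' n) (zero_add 1) :=
  ShortComplex.ShortExact.extClass_naturality (syzComplex_shortExact M n)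
    (syzComplex_shortExact M' n) (syzComplexMap f n)

lemma syzClass_map {M M' : T.Algebra} (f : M ⟶ M') (n : ℕ) :
    (syzClass M n).comp (Abelian.Ext.mk₀ (syzMap f n)) (add_zero n) =
      (Abelian.Ext.mk₀ f).comp (syzClass M' n) (zero_add n) := by
  induction n with
  | zero =>
    rw [syzClass, syzClass, Abelian.Ext.mk₀_comp_mk₀, Abelian.Ext.mk₀_comp_mk₀]
    congr 1
    ext
    exact (Category.id_comp f.f).trans (Category.comp_id f.f).symm
  | succ n ih =>
    rw [syzClass, syzClass, Abelian.Ext.comp_assoc_of_third_deg_zero, syzExt_map,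
      ← Abelian.Ext.comp_assoc_of_second_deg_zero, ih]
    exact Abelian.Ext.comp_assoc _ _ _ _ _ (by omega)

lemma mk₀_comp_extOf {M M' N : T.Algebra} (f : M ⟶ M') (n : ℕ) (c : syz M' n ⟶ N) :
    (Abelian.Ext.mk₀ f).comp (extOf c) (zero_add n) = extOf (syzMap f n ≫ c) := by
  rw [extOf, ← Abelian.Ext.comp_assoc_of_third_deg_zero, ← syzClass_map,
    Abelian.Ext.comp_assoc_of_third_deg_zero, Abelian.Ext.mk₀_comp_mk₀, extOf]

end SyzygyNaturality

section FreeModules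

variable {A : Type u} [Category.{v} A] {T : Monad A}

/-- The map out of a free module which extends a map of objects. -/
@[simps]
def freeDesc {X : A} {N : T.Algebra} (u : X ⟶ N.A) : T.free.obj X ⟶ N where
  f := T.map u ≫ N.a
  h := by
    have h := T.μ.naturality u
    change T.map (T.map u ≫ N.a) ≫ N.a = T.μ.app X ≫ T.map u ≫ N.a
    dsimp at h
    rw [← reassoc_of% h, N.assoc, T.map_comp, Category.assoc]

lemma η_freeDesc {X : A} {N : T.Algebra} (u : X ⟶ N.A) : T.η.app X ≫ (freeDesc u).f = u := by
  have h := T.η.naturality u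
  dsimp at h
  change T.η.app X ≫ T.map u ≫ N.a = u
  rw [← reassoc_of% h, N.unit]
  exact Category.comp_id u

lemma eq_freeDesc {X : A} {N : T.Algebra} (f : T.free.obj X ⟶ N) :
    f = freeDesc (T.η.app X ≫ f.f) := by
  ext
  have h1 : T.map f.f ≫ N.a = T.μ.app X ≫ f.f := f.h
  have h2 : T.map (T.η.app X) ≫ T.μ.app X = 𝟙 _ := T.right_unit X
  change f.f = T.map (T.η.app X ≫ f.f) ≫ N.a
  refine Eq.symm ((congr_arg (fun x => x ≫ N.a) (T.map_comp _ _)).trans ?_)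
  refine (Category.assoc _ _ _).trans ((congr_arg (fun x => T.map (T.η.app X) ≫ x) h1).trans ?_)
  refine (Category.assoc _ _ _).symm.trans ((congr_arg (fun x => x ≫ f.f) h2).trans ?_)
  exact Category.id_comp _

lemma free_hom_ext {X : A} {N : T.Algebra} {f g : T.free.obj X ⟶ N}
    (h : T.η.app X ≫ f.f = T.η.app X ≫ g.f) : f = g := by
  rw [eq_freeDesc f, eq_freeDesc g, h]

lemma adj_homEquiv_symm {X : A} {N : T.Algebra} (u : X ⟶ N.A) :
    (T.adj.homEquiv X N).symm u = freeDesc u := by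
  refine (Equiv.symm_apply_eq (T.adj.homEquiv X N)).2 (Eq.trans (η_freeDesc u).symm ?_)
  refine ((T.adj.homEquiv_unit _ _ _).trans ?_).symm
  rw [Monad.adj_unit]
  rfl

end FreeModules

section TrivialCochains

variable {A : Type u} [Category.{v} A] [Abelian A] {T : Monad A}
  [PreservesFiniteColimits (T : A ⥤ A)] (ε : T ⟶ Monad.id A)

lemma ε_naturality {X Y : A} (f : X ⟶ Y) :
    T.map f ≫ trivialAction ε Y = trivialAction ε X ≫ f := ε.naturality f

lemma η_ε (X : A) : T.η.app X ≫ trivialAction ε X = 𝟙 X := ε.app_η X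

lemma Stage.ε_eq_b (s : Stage T) {N : A} (c : s.Y ⟶ N)
    (h : s.bd ≫ trivialAction ε s.Y ≫ c = 0) :
    trivialAction ε s.Y ≫ c = s.b ≫ c := by
  have h1 : (plusπ T).app _ ≫ s.bd ≫ trivialAction ε s.Y ≫ c = 0 := by rw [h, comp_zero]
  have h2 : T.η.app s.Y ≫ trivialAction ε s.Y ≫ c = c := by
    rw [← Category.assoc, η_ε]
    exact Category.id_comp c
  rwa [← Category.assoc, Stage.π_bd, Preadditive.sub_comp, sub_eq_zero,
    Category.id_comp, Category.assoc, h2] at h1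

lemma Stage.bd_ε (s : Stage T) {N : A} (c : s.Y ⟶ N)
    (h : T.map c ≫ trivialAction ε N = s.b ≫ c) :
    s.bd ≫ trivialAction ε s.Y ≫ c = 0 := by
  rw [← ε_naturality, h, ← Category.assoc, Stage.bd_b, zero_comp]

lemma eq_ε_of_free {X N : A} (u : T.obj X ⟶ N)
    (h : T.map u ≫ trivialAction ε N = T.μ.app X ≫ u) :
    u = trivialAction ε X ≫ T.η.app X ≫ u := by
  have h3 : T.map (T.η.app X) ≫ T.μ.app X = 𝟙 _ := T.right_unit _
  have h4 := ε_naturality ε (T.η.app X ≫ u)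
  refine Eq.trans ?_ h4
  rw [T.map_comp, Category.assoc, h, ← Category.assoc]
  refine Eq.trans ?_ (congr_arg (fun x => x ≫ u) h3).symm
  exact (Category.id_comp u).symm

/-- A cocycle of the complex `C(I, F, M)`, as a map of modules out of a syzygy. -/
noncomputable def cocycleHom {M : T.Algebra} {n : ℕ} {N : A} (c : (stage M n).Y ⟶ N)
    (h : (stage M n).bd ≫ trivialAction ε _ ≫ c = 0) : syz M n ⟶ (trivialModule ε).obj N where
  f := c
  h := (ε_naturality ε c).trans ((stage M n).ε_eq_b ε c h)

lemma cocycle_condition {M : T.Algebra} {n : ℕ} {N : A} (c : syz M n ⟶ (trivialModule ε).obj N) :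
    (stage M n).bd ≫ trivialAction ε _ ≫ c.f = 0 :=
  (stage M n).bd_ε ε c.f c.h

lemma exists_cocycleHom [PreservesProj T] {M : T.Algebra} (hM : Projective M.A) {n : ℕ} {N : A}
    (x : Abelian.Ext.{max u v} M ((trivialModule ε).obj N) n) :
    ∃ (c : (stage M n).Y ⟶ N) (h : _), extOf (cocycleHom ε c h) = x := by
  obtain ⟨c, rfl⟩ := extOf_surjective M hM _ n x
  exact ⟨c.f, cocycle_condition ε c, rfl⟩

lemma extOf_cocycleHom_zero_iff {M : T.Algebra} {N : A} (c : (stage M 0).Y ⟶ N) (h : _) :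
    extOf (cocycleHom ε c h) = 0 ↔ c = 0 := by
  rw [extOf_zero_iff]
  exact ⟨fun h => congr_arg (fun x => x.f) h, fun h => by ext; exact h⟩

lemma extOf_cocycleHom_succ_iff [PreservesProj T] {M : T.Algebra} (hM : Projective M.A) {n : ℕ}
    {N : A} (c : (stage M (n + 1)).Y ⟶ N) (h : _) :
    extOf (cocycleHom ε c h) = 0 ↔
      ∃ u : (stage M n).Y ⟶ N, c = (stage M n).bd ≫ trivialAction ε _ ≫ u := by
  rw [extOf_succ_eq_zero_iff M hM]
  constructor
  · rintro ⟨u, hu⟩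
    refine ⟨T.η.app _ ≫ u.f, (congr_arg (fun x => x.f) hu).trans ?_⟩
    exact congr_arg (fun x => (stage M n).bd ≫ x) (eq_ε_of_free ε u.f u.h)
  · rintro ⟨u, hu⟩
    refine ⟨freeDesc (N := (trivialModule ε).obj N) u, ?_⟩
    ext
    rw [← ε_naturality ε] at hu
    exact hu

lemma extOf_cocycleHom_add {M : T.Algebra} {n : ℕ} {N : A} (c c' : (stage M n).Y ⟶ N) (h h' h'') :
    extOf (cocycleHom ε (c + c') h'') = extOf (cocycleHom ε c h) + extOf (cocycleHom ε c' h') := by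
  rw [← extOf_add]
  rfl

end TrivialCochains

section SplitExact

variable {A : Type u} [Category.{v} A] [Preadditive A]

/-- A composable pair of maps which is exact in the middle by means of a splitting. -/
def SplitExact {X Y Z : A} (f : X ⟶ Y) (g : Y ⟶ Z) : Prop :=
  f ≫ g = 0 ∧ ∃ (e : Y ⟶ X) (s : Z ⟶ Y), e ≫ f + g ≫ s = 𝟙 Y

lemma SplitExact.map {X Y Z : A} {f : X ⟶ Y} {g : Y ⟶ Z} (h : SplitExact f g)
    {B : Type u'} [Category.{v'} B] [Preadditive B] (F : A ⥤ B) [F.Additive] : SplitExact (F.map f) (F.map g) := by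
  obtain ⟨h0, e, s, h1⟩ := h
  refine ⟨by rw [← F.map_comp, h0, F.map_zero], F.map e, F.map s, ?_⟩
  rw [← F.map_comp, ← F.map_comp, ← F.map_add, h1, F.map_id]

lemma SplitExact.lift {X Y Z : A} {f : X ⟶ Y} {g : Y ⟶ Z} (h : SplitExact f g) {P : A} (x : P ⟶ Y)
    (hx : x ≫ g = 0) : ∃ y, y ≫ f = x := by
  obtain ⟨h0, e, s, h1⟩ := h
  refine ⟨x ≫ e, ?_⟩
  have h2 : x ≫ (e ≫ f + g ≫ s) = x := by rw [h1, Category.comp_id]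
  rw [Preadditive.comp_add, reassoc_of% hx, zero_comp, add_zero] at h2
  rw [Category.assoc, h2]

lemma SplitExact.regular {X Y Z : A} {f : X ⟶ Y} {g : Y ⟶ Z} (h : SplitExact f g) :
    ∃ e : Y ⟶ X, f ≫ e ≫ f = f := by
  obtain ⟨h0, e, s, h1⟩ := h
  refine ⟨e, ?_⟩
  have h2 : f ≫ (e ≫ f + g ≫ s) = f := by rw [h1, Category.comp_id]
  rwa [Preadditive.comp_add, reassoc_of% h0, zero_comp, add_zero] at h2

lemma SplitExact.exists_retraction {X Y Z : A} {f : X ⟶ Y} {g : Y ⟶ Z} (h : SplitExact f g)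
    [Mono f] : ∃ e : Y ⟶ X, f ≫ e = 𝟙 X := by
  obtain ⟨e, he⟩ := h.regular
  refine ⟨e, ?_⟩
  rw [← cancel_mono f, Category.assoc, he, Category.id_comp]

lemma SplitExact.of_lift {X Y Z : A} {f : X ⟶ Y} {g : Y ⟶ Z} [Projective Y] (h : f ≫ g = 0)
    (hg : ∃ s : Z ⟶ Y, g ≫ s ≫ g = g) (hl : ∀ x : Y ⟶ Y, x ≫ g = 0 → ∃ y, y ≫ f = x) :
    SplitExact f g := by
  obtain ⟨s, hs⟩ := hg
  obtain ⟨e, he⟩ := hl (𝟙 Y - g ≫ s) (by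
    rw [Preadditive.sub_comp, Category.assoc, hs, Category.id_comp, sub_self])
  exact ⟨h, e, s, by rw [he, sub_add_cancel]⟩

lemma SplitExact.of_retract {F₁ F₂ F₃ : A ⥤ A} (α : F₁ ⟶ F₂) (β : F₂ ⟶ F₃) {X Q : A}
    (r : Retract X Q) (h : SplitExact (α.app Q) (β.app Q)) : SplitExact (α.app X) (β.app X) := by
  obtain ⟨h0, e, s, h1⟩ := h
  refine ⟨?_, F₂.map r.i ≫ e ≫ F₁.map r.r, F₃.map r.i ≫ s ≫ F₂.map r.r, ?_⟩
  · have h2 : α.app X ≫ β.app X = F₁.map r.i ≫ (α.app Q ≫ β.app Q) ≫ F₃.map r.r := by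
      rw [Category.assoc, ← NatTrans.naturality, ← NatTrans.naturality_assoc,
        ← F₁.map_comp_assoc, r.retract, F₁.map_id, Category.id_comp]
    rw [h2, h0, zero_comp, comp_zero]
  · have h2 : (F₂.map r.i ≫ e ≫ F₁.map r.r) ≫ α.app X +
        β.app X ≫ F₃.map r.i ≫ s ≫ F₂.map r.r =
          F₂.map r.i ≫ (e ≫ α.app Q + β.app Q ≫ s) ≫ F₂.map r.r := by
      rw [Preadditive.add_comp, Preadditive.comp_add, Category.assoc, Category.assoc,
        Category.assoc, Category.assoc, NatTrans.naturality, NatTrans.naturality_assoc]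
    rw [h2, h1, Category.id_comp, ← F₂.map_comp, r.retract, F₂.map_id]

end SplitExact

section QuadraticData

variable {A : Type u} [Category.{v} A] [Abelian A]

/-- The generators `H` and the part of degree two `H₂` of a quadratic algebra, with the
multiplication. -/
structure QuadraticData (A : Type u) [Category.{v} A] where
  H : A ⥤ A
  H₂ : A ⥤ A
  m : H ⋙ H ⟶ H₂

/-- Two consecutive terms of the Koszul dual of a quadratic algebra. -/
structure QuadraticData.Step (D : QuadraticData A) where
  V' : A ⥤ A
  V : A ⥤ A
  i : V ⟶ V' ⋙ D.H

namespace QuadraticData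

variable (D : QuadraticData A)

/-- The map whose kernel is the next term of the Koszul dual. -/
def Step.φ {D : QuadraticData A} (s : D.Step) : s.V ⋙ D.H ⟶ s.V' ⋙ D.H₂ where
  app X := D.H.map (s.i.app X) ≫ D.m.app (s.V'.obj X)
  naturality X Y f := by
    have h1 := D.m.naturality (s.V'.map f)
    have h2 := s.i.naturality f
    dsimp at h1 h2 ⊢
    rw [← Functor.map_comp_assoc, h2, Functor.map_comp_assoc, h1, Category.assoc]

open ZeroObject in
/-- The terms of the Koszul dual. -/
noncomputable def step : ℕ → D.Step
  | 0 => ⟨(Functor.const A).obj 0, 𝟭 A, ⟨fun _ => 0, fun _ _ _ => by simp⟩⟩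
  | n + 1 => ⟨(step n).V, kernel (step n).φ, kernel.ι (step n).φ⟩

/-- The Koszul dual of a quadratic algebra, in degree `n - 1`. -/
noncomputable def U (n : ℕ) : A ⥤ A := (D.step n).V'

/-- The inclusion of a term of the Koszul dual. -/
noncomputable def i (n : ℕ) : D.U (n + 1) ⟶ D.U n ⋙ D.H := (D.step n).i

/-- The map whose kernel is the next term of the Koszul dual. -/
noncomputable def φ (n : ℕ) : D.U (n + 1) ⋙ D.H ⟶ D.U n ⋙ D.H₂ := (D.step n).φ

lemma φ_app (n : ℕ) (X : A) :
    (D.φ n).app X = D.H.map ((D.i n).app X) ≫ D.m.app ((D.U n).obj X) := rfl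

lemma i_φ (n : ℕ) (X : A) : (D.i (n + 1)).app X ≫ (D.φ n).app X = 0 := by
  have h : D.i (n + 1) ≫ D.φ n = 0 := kernel.condition _
  rw [← NatTrans.comp_app, h, zero_app]

instance (n : ℕ) (X : A) : Mono ((D.i (n + 1)).app X) :=
  inferInstanceAs (Mono ((kernel.ι (D.step n).φ).app X))

lemma exists_lift (n : ℕ) {X Z : A} (x : Z ⟶ D.H.obj ((D.U (n + 1)).obj X))
    (h : x ≫ (D.φ n).app X = 0) : ∃ y, y ≫ (D.i (n + 1)).app X = x := by
  have hl := (KernelFork.ofι (kernel.ι (D.step n).φ) (kernel.condition _)).mapIsLimit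
    (kernelIsKernel _) ((evaluation A A).obj X)
  exact ⟨_, (KernelFork.IsLimit.lift' hl x h).2⟩

lemma U_zero_isZero (X : A) : IsZero ((D.U 0).obj X) :=
  isZero_zero (C := A)

end QuadraticData

end QuadraticData

namespace GradedAlgebra

variable {A : Type u} [Category.{v} A] [Abelian A] (G : GradedAlgebra.{w} A)

instance (n : ℕ) : PreservesFiniteColimits (G.pc n) := preservesFiniteColimits_of_cocontinuous.{w} _

instance (n : ℕ) : (G.pc n).Additive := additive_of_preservesFiniteColimits _

/-- The quadratic data of a graded algebra. -/
@[simps]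
def quad : QuadraticData A where
  H := G.pc 1
  H₂ := G.pc 2
  m := G.mul (rfl : 1 + 1 = 2)

/-- The terms of the Koszul dual of a graded algebra. -/
noncomputable abbrev U (n : ℕ) : A ⥤ A := G.quad.U n

/-- The inclusions of the terms of the Koszul dual of a graded algebra. -/
noncomputable def i (n : ℕ) (X : A) : (G.U (n + 1)).obj X ⟶ (G.pc 1).obj ((G.U n).obj X) :=
  (G.quad.i n).app X

lemma i_naturality (n : ℕ) {X Y : A} (f : X ⟶ Y) :
    (G.U (n + 1)).map f ≫ G.i n Y = G.i n X ≫ (G.pc 1).map ((G.U n).map f) :=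
  (G.quad.i n).naturality f

lemma mul_naturality {i j k : ℕ} (h : i + j = k) {X Y : A} (f : X ⟶ Y) :
    (G.pc i).map ((G.pc j).map f) ≫ (G.mul h).app Y = (G.mul h).app X ≫ (G.pc k).map f :=
  (G.mul h).naturality f

/-- The differential of the Koszul resolution of a graded algebra. -/
noncomputable def κ {a b : ℕ} (h : a + 1 = b) (n : ℕ) (X : A) :
    (G.pc a).obj ((G.U (n + 1)).obj X) ⟶ (G.pc b).obj ((G.U n).obj X) :=
  (G.pc a).map (G.i n X) ≫ (G.mul h).app ((G.U n).obj X)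

lemma κ_naturality {a b : ℕ} (h : a + 1 = b) (n : ℕ) {X Y : A} (f : X ⟶ Y) :
    (G.pc a).map ((G.U (n + 1)).map f) ≫ G.κ h n Y =
      G.κ h n X ≫ (G.pc b).map ((G.U n).map f) := by
  rw [κ, κ, Category.assoc, ← mul_naturality, ← Functor.map_comp_assoc, i_naturality,
    Functor.map_comp_assoc]

/-- The differential of the Koszul resolution, as a transformation. -/
noncomputable def κNat {a b : ℕ} (h : a + 1 = b) (n : ℕ) :
    G.U (n + 1) ⋙ G.pc a ⟶ G.U n ⋙ G.pc b where
  app := G.κ h n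
  naturality _ _ f := G.κ_naturality h n f

lemma i_κ (n : ℕ) (X : A) :
    G.i (n + 1) X ≫ G.κ (rfl : 1 + 1 = 2) n X = 0 := G.quad.i_φ n X

instance (n : ℕ) (X : A) : Mono (G.i (n + 1) X) :=
  inferInstanceAs (Mono ((G.quad.i (n + 1)).app X))

lemma exists_i_lift (n : ℕ) {X Z : A} (x : Z ⟶ (G.pc 1).obj ((G.U (n + 1)).obj X))
    (h : x ≫ G.κ (rfl : 1 + 1 = 2) n X = 0) : ∃ y, y ≫ G.i (n + 1) X = x :=
  G.quad.exists_lift n x h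

lemma mul_κ {a b c d : ℕ} (h₁ : a + b = c) (h₂ : b + 1 = d) {e : ℕ} (h₃ : c + 1 = e)
    (h₄ : a + d = e) (n : ℕ) (X : A) :
    (G.mul h₁).app ((G.U (n + 1)).obj X) ≫ G.κ h₃ n X =
      (G.pc a).map (G.κ h₂ n X) ≫ (G.mul h₄).app ((G.U n).obj X) := by
  have h5 := (G.mul h₁).naturality (G.i n X)
  dsimp at h5
  rw [κ, ← reassoc_of% h5, G.assoc h₁ h₃ h₂ h₄, κ, Functor.map_comp, Category.assoc]

lemma κ_κ {a b c : ℕ} (h : a + 1 = b) (h' : b + 1 = c) (n : ℕ) (X : A) :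
    G.κ h (n + 1) X ≫ G.κ h' n X = 0 := by
  rw [κ, Category.assoc, G.mul_κ h (rfl : 1 + 1 = 2) h' (by omega), ← Functor.map_comp_assoc,
    i_κ, Functor.map_zero, zero_comp]

lemma one_κ (n : ℕ) (X : A) :
    G.one.app ((G.U (n + 1)).obj X) ≫ G.κ (zero_add 1) n X = G.i n X := by
  have h1 := G.one.naturality (G.i n X)
  dsimp at h1
  rw [κ, ← reassoc_of% h1, G.one_mul]
  exact Category.comp_id _

/-- A graded algebra preserves projective objects if its components do. -/
class ProjComponents : Prop where
  proj : ∀ (n : ℕ) (X : A), Projective X → Projective ((G.pc n).obj X)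

/-- Exactness of the Koszul resolution at one place. -/
structure KoszulExactAt (X : A) (n : ℕ) : Prop where
  splitExact : ∀ {a b c : ℕ} (h : a + 1 = b) (h' : b + 1 = c),
    SplitExact (G.κ h (n + 1) X) (G.κ h' n X)

variable {G}

lemma KoszulExactAt.split_i {X : A} {n : ℕ} (H : G.KoszulExactAt X n) :
    SplitExact (G.i (n + 1) X) (G.κ (rfl : 1 + 1 = 2) n X) := by
  obtain ⟨h0, e, s, h1⟩ := H.splitExact (zero_add 1) rfl
  refine ⟨G.i_κ n X, e ≫ (inv G.one).app _, s, ?_⟩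
  rw [← h1, ← G.one_κ]
  have h2 : (inv G.one).app ((G.U (n + 2)).obj X) ≫ G.one.app ((G.U (n + 2)).obj X) = 𝟙 _ := by
    rw [← NatTrans.comp_app, IsIso.inv_hom_id, NatTrans.id_app]
  rw [Category.assoc, reassoc_of% h2]

lemma regular_κ_zero {X : A} {b c : ℕ} (h : b + 1 = c) :
    ∃ s, G.κ h 0 X ≫ s ≫ G.κ h 0 X = G.κ h 0 X := by
  refine ⟨0, ?_⟩
  have : IsZero ((G.pc c).obj ((G.U 0).obj X)) := (G.pc c).map_isZero (G.quad.U_zero_isZero X)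
  exact this.eq_of_tgt _ _

lemma KoszulExactAt.projective [G.ProjComponents] {X : A} {n : ℕ} (H : G.KoszulExactAt X n)
    (h : Projective ((G.U (n + 1)).obj X)) : Projective ((G.U (n + 2)).obj X) := by
  obtain ⟨e, he⟩ := H.split_i.exists_retraction
  have h' : Projective ((G.pc 1).obj ((G.U (n + 1)).obj X)) := ProjComponents.proj (G := G) 1 _ h
  exact Retract.projective { i := _, r := e, retract := he }

lemma projective_U [G.ProjComponents] {X : A} (hX : Projective X) :
    ∀ n, (∀ m < n, G.KoszulExactAt X m) → Projective ((G.U (n + 1)).obj X)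
  | 0, _ => hX
  | n + 1, H => (H n (Nat.lt_succ_self n)).projective
      (projective_U hX n fun m hm => H m (hm.trans (Nat.lt_succ_self n)))

lemma koszulExactAt_of_lift [G.ProjComponents] {X : A} (n : ℕ)
    (hX : Projective ((G.U (n + 1)).obj X)) (H : ∀ m, m + 1 = n → G.KoszulExactAt X m)
    (hl : ∀ {a b c : ℕ} (h : a + 1 = b) (h' : b + 1 = c) (Z : A) [Projective Z]
      (x : Z ⟶ (G.pc b).obj ((G.U (n + 1)).obj X)), x ≫ G.κ h' n X = 0 →
        ∃ y, y ≫ G.κ h (n + 1) X = x) : G.KoszulExactAt X n := by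
  refine ⟨fun {a b c} h h' => ?_⟩
  have hp := ProjComponents.proj (G := G) b _ hX
  refine SplitExact.of_lift (G.κ_κ h h' n X) ?_ (hl h h' _)
  cases n with
  | zero => exact regular_κ_zero h'
  | succ n => exact ((H n rfl).splitExact h' rfl).regular

lemma KoszulExactAt.of_retract {X Q : A} (r : Retract X Q) {n : ℕ} (H : G.KoszulExactAt Q n) :
    G.KoszulExactAt X n :=
  ⟨fun h h' => SplitExact.of_retract (G.κNat _ _) (G.κNat _ _) r (H.splitExact h h')⟩

section Total

variable [HasCountableCoproducts A] (G)

lemma total_hom_ext {X Z : A} {f g : G.total.obj X ⟶ Z}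
    (h : ∀ n, (G.ι n).app X ≫ f = (G.ι n).app X ≫ g) : f = g :=
  sigma_hom_ext G.pc h

/-- A map out of `G X` given by maps out of the components. -/
noncomputable def totalDesc {X Z : A} (f : ∀ n, (G.pc n).obj X ⟶ Z) : G.total.obj X ⟶ Z :=
  Cofan.IsColimit.desc (isColimitSigma G.pc X) f

lemma ι_totalDesc {X Z : A} (f : ∀ n, (G.pc n).obj X ⟶ Z) (n : ℕ) :
    (G.ι n).app X ≫ G.totalDesc f = f n :=
  Cofan.IsColimit.fac (isColimitSigma G.pc X) f n

lemma ι_μ (X : A) {i j k : ℕ} (h : i + j = k) :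
    (G.pc i).map ((G.ι j).app X) ≫ (G.ι i).app (G.total.obj X) ≫ G.total.μ.app X =
      (G.mul h).app X ≫ (G.ι k).app X := G.ι_totalMul X h

lemma one_ι (X : A) : G.one.app X ≫ (G.ι 0).app X = G.total.η.app X := rfl

lemma ι_naturality (n : ℕ) {X Y : A} (f : X ⟶ Y) :
    (G.ι n).app X ≫ G.total.map f = (G.pc n).map f ≫ (G.ι n).app Y :=
  ((G.ι n).naturality f).symm

/-- The projection to a homogeneous component. -/
noncomputable def pr (n : ℕ) (X : A) : G.total.obj X ⟶ (G.pc n).obj X :=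
  G.totalDesc fun m => if h : m = n then eqToHom (by rw [h]) else 0

lemma ι_pr (n : ℕ) (X : A) : (G.ι n).app X ≫ G.pr n X = 𝟙 _ := by
  rw [pr, ι_totalDesc, dif_pos rfl, eqToHom_refl]

lemma ι_pr_of_ne {m n : ℕ} (h : m ≠ n) (X : A) : (G.ι m).app X ≫ G.pr n X = 0 := by
  rw [pr, ι_totalDesc, dif_neg h]

lemma pr_naturality (n : ℕ) {X Y : A} (f : X ⟶ Y) :
    G.total.map f ≫ G.pr n Y = G.pr n X ≫ (G.pc n).map f := by
  refine G.total_hom_ext fun m => ?_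
  rw [← Category.assoc, ι_naturality, Category.assoc]
  by_cases h : m = n
  · subst h
    rw [ι_pr, Category.comp_id, ← Category.assoc, ι_pr, Category.id_comp]
  · rw [G.ι_pr_of_ne h, comp_zero, ← Category.assoc, G.ι_pr_of_ne h, zero_comp]

lemma ι_aug_zero (X : A) : (G.ι 0).app X ≫ trivialAction G.aug X = (inv G.one).app X := by
  have h : Sigma.ι G.pc 0 ≫ Sigma.desc G.augApp = inv G.one := Sigma.ι_desc _ _
  exact congr_arg (fun a => NatTrans.app a X) h

lemma ι_aug_succ (n : ℕ) (X : A) : (G.ι (n + 1)).app X ≫ trivialAction G.aug X = 0 := by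
  have h : Sigma.ι G.pc (n + 1) ≫ Sigma.desc G.augApp = 0 := Sigma.ι_desc _ _
  exact congr_arg (fun a => NatTrans.app a X) h

lemma aug_eq (X : A) : trivialAction G.aug X = G.pr 0 X ≫ (inv G.one).app X := by
  refine G.total_hom_ext fun m => ?_
  rw [← Category.assoc]
  cases m with
  | zero => rw [ι_aug_zero, ι_pr, Category.id_comp]
  | succ m => rw [ι_aug_succ, G.ι_pr_of_ne (by omega), zero_comp]

instance [G.ProjComponents] : PreservesProj G.total where
  proj X hX := by
    have : ∀ i, Projective ((G.pc i).obj X) := fun i => ProjComponents.proj i X hX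
    refine ⟨fun f e he => ?_⟩
    choose g hg using fun n => Projective.factors ((G.ι n).app X ≫ f) e
    refine ⟨G.totalDesc g, G.total_hom_ext fun n => ?_⟩
    rw [← Category.assoc, ι_totalDesc, hg]

lemma projComponents_of_total (h : ∀ X : A, Projective X → Projective (G.total.obj X)) :
    G.ProjComponents where
  proj n X hX := by
    have := h X hX
    exact Retract.projective { i := _, r := _, retract := G.ι_pr n X }

/-- The inclusion of the generators of the kernel into a free module in the Koszul resolution. -/
noncomputable def genMap (n : ℕ) (X : A) : (G.U (n + 1)).obj X ⟶ G.total.obj ((G.U n).obj X) :=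
  G.i n X ≫ (G.ι 1).app _

/-- The differential of the Koszul resolution. -/
noncomputable def koszulD (n : ℕ) (X : A) :
    G.total.obj ((G.U (n + 1)).obj X) ⟶ G.total.obj ((G.U n).obj X) :=
  G.total.map (G.genMap n X) ≫ G.total.μ.app _

lemma ι_koszulD {a b : ℕ} (h : a + 1 = b) (n : ℕ) (X : A) :
    (G.ι a).app _ ≫ G.koszulD n X = G.κ h n X ≫ (G.ι b).app ((G.U n).obj X) := by
  rw [koszulD, genMap, ← Category.assoc, ι_naturality, Functor.map_comp, Category.assoc,
    Category.assoc, ι_μ _ _ h, κ, Category.assoc]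

lemma koszulD_koszulD (n : ℕ) (X : A) : G.koszulD (n + 1) X ≫ G.koszulD n X = 0 := by
  refine G.total_hom_ext fun a => ?_
  rw [← Category.assoc, G.ι_koszulD rfl, Category.assoc, G.ι_koszulD rfl, ← Category.assoc, κ_κ,
    zero_comp, comp_zero]

lemma koszulD_pr_zero (n : ℕ) (X : A) : G.koszulD n X ≫ G.pr 0 _ = 0 := by
  refine G.total_hom_ext fun a => ?_
  rw [← Category.assoc, G.ι_koszulD rfl, Category.assoc, G.ι_pr_of_ne (by omega), comp_zero,
    comp_zero]

lemma koszulD_pr {a b : ℕ} (h : a + 1 = b) (n : ℕ) (X : A) :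
    G.koszulD n X ≫ G.pr b _ = G.pr a _ ≫ G.κ h n X := by
  refine G.total_hom_ext fun a' => ?_
  rw [← Category.assoc, G.ι_koszulD rfl, Category.assoc]
  by_cases h' : a' = a
  · subst h' h
    rw [ι_pr, ← Category.assoc, ι_pr, Category.comp_id, Category.id_comp]
  · rw [G.ι_pr_of_ne (by omega), ← Category.assoc, G.ι_pr_of_ne h', comp_zero, zero_comp]

variable {G}

lemma KoszulExactAt.total {X : A} {n : ℕ} (H : G.KoszulExactAt X n) :
    ∃ (E : G.total.obj ((G.U (n + 1)).obj X) ⟶ G.total.obj ((G.U (n + 2)).obj X))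
      (S : G.total.obj ((G.U n).obj X) ⟶ G.total.obj ((G.U (n + 1)).obj X)),
      E ≫ G.koszulD (n + 1) X + G.koszulD n X ≫ S + G.pr 0 _ ≫ (G.ι 0).app _ = 𝟙 _ := by
  choose h0 e s hes using fun a : ℕ => H.splitExact (rfl : a + 1 = a + 1) (rfl : a + 1 + 1 = a + 2)
  let E : G.total.obj ((G.U (n + 1)).obj X) ⟶ G.total.obj ((G.U (n + 2)).obj X) :=
    G.totalDesc fun a => match a with
      | 0 => 0
      | a + 1 => e a ≫ (G.ι a).app _
  let S : G.total.obj ((G.U n).obj X) ⟶ G.total.obj ((G.U (n + 1)).obj X) :=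
    G.totalDesc fun a => match a with
      | 0 => 0
      | 1 => 0
      | a + 2 => s a ≫ (G.ι (a + 1)).app _
  refine ⟨E, S, G.total_hom_ext fun a => ?_⟩
  have hE := G.ι_totalDesc (X := (G.U (n + 1)).obj X)
    (Z := G.total.obj ((G.U (n + 2)).obj X)) (fun a => match a with
      | 0 => 0
      | a + 1 => e a ≫ (G.ι a).app _) a
  have hS := G.ι_totalDesc (X := (G.U n).obj X)
    (Z := G.total.obj ((G.U (n + 1)).obj X)) (fun a => match a with
      | 0 => 0
      | 1 => 0
      | a + 2 => s a ≫ (G.ι (a + 1)).app _) (a + 1)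
  change (G.ι a).app _ ≫ E = _ at hE
  change (G.ι (a + 1)).app _ ≫ S = _ at hS
  rw [Preadditive.comp_add, Preadditive.comp_add, ← Category.assoc, ← Category.assoc,
    ← Category.assoc, hE, G.ι_koszulD rfl, Category.assoc (G.κ rfl n X), hS, Category.comp_id]
  cases a with
  | zero => rw [ι_pr]; simp
  | succ a =>
    rw [G.ι_pr_of_ne (by omega)]
    dsimp only
    rw [Category.assoc, G.ι_koszulD rfl, zero_comp, add_zero, ← Category.assoc, ← Category.assoc,
      ← Preadditive.add_comp]
    exact (congr_arg (fun x => x ≫ _) (hes a)).trans (Category.id_comp _)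

lemma KoszulExactAt.total_lift {X : A} {n : ℕ} (H : G.KoszulExactAt X n) {Z : A}
    (x : Z ⟶ G.total.obj ((G.U (n + 1)).obj X)) (h : x ≫ G.koszulD n X = 0)
    (h0 : x ≫ G.pr 0 _ = 0) : ∃ y, y ≫ G.koszulD (n + 1) X = x := by
  obtain ⟨E, S, hES⟩ := H.total
  refine ⟨x ≫ E, ?_⟩
  have h2 := congr_arg (fun a => x ≫ a) hES
  rw [Preadditive.comp_add, Preadditive.comp_add, reassoc_of% h, reassoc_of% h0, zero_comp,
    zero_comp, add_zero, add_zero, Category.comp_id] at h2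
  rw [Category.assoc, h2]

end Total

end GradedAlgebra

section Resolves

variable {A : Type u} [Category.{v} A] [Abelian A] {T : Monad A}
  [PreservesFiniteColimits (T : A ⥤ A)]

/-- An iterated extension of a module `M` which is compatible with the bar resolution, such that
dimension shifting is injective. -/
structure Resolves {M Z : T.Algebra} {n : ℕ} (k : Z ⟶ syz M n) (ξ : Abelian.Ext.{max u v} M Z n) :
    Prop where
  comp_eq : ξ.comp (Abelian.Ext.mk₀ k) (add_zero n) = syzClass M n
  injective : ∀ (N : T.Algebra) (j m : ℕ) (h : n + (j + 1) = m)
    (y : Abelian.Ext.{max u v} Z N (j + 1)), ξ.comp y h = 0 → y = 0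

lemma resolves_zero (M : T.Algebra) : Resolves (syzZero M) (Abelian.Ext.mk₀ (𝟙 M)) where
  comp_eq := by rw [Abelian.Ext.mk₀_comp_mk₀, Category.id_comp]; rfl
  injective N j m h y hy := by
    obtain rfl : j + 1 = m := by omega
    rwa [Abelian.Ext.mk₀_id_comp] at hy

lemma Resolves.next {M : T.Algebra} {n : ℕ} {S : ShortComplex T.Algebra} (hS : S.ShortExact)
    (f : S ⟶ syzComplex M n) {ξ : Abelian.Ext.{max u v} M S.X₃ n} (H : Resolves f.τ₃ ξ)
    (hp : Projective S.X₂) : Resolves f.τ₁ (ξ.comp hS.extClass (rfl : n + 1 = n + 1)) where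
  comp_eq := by
    have h1 := ShortComplex.ShortExact.extClass_naturality hS (syzComplex_shortExact M n) f
    refine (Abelian.Ext.comp_assoc_of_third_deg_zero ξ hS.extClass _ rfl).trans ?_
    refine (congr_arg (fun z => ξ.comp z rfl) h1).trans ?_
    refine (Abelian.Ext.comp_assoc_of_second_deg_zero ξ _ _ rfl).symm.trans ?_
    exact congr_arg (fun z => z.comp (syzExt M n) rfl) H.comp_eq
  injective N j m h y hy := by
    have h1 := H.injective N (j + 1) m (by omega) (hS.extClass.comp y (by omega)) (by
      rw [← hy]
      exact (Abelian.Ext.comp_assoc _ _ _ _ _ (by omega)).symm)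
    obtain ⟨z, rfl⟩ := Abelian.Ext.contravariant_sequence_exact₁ hS N y _ h1
    rw [Abelian.Ext.eq_zero_of_projective z, Abelian.Ext.comp_zero]

lemma Resolves.factors {M : T.Algebra} {n : ℕ} {S : ShortComplex T.Algebra} (hS : S.ShortExact)
    {k : S.X₃ ⟶ syz M n} {ξ : Abelian.Ext.{max u v} M S.X₃ n} (H : Resolves k ξ)
    {N : T.Algebra} (c : S.X₁ ⟶ N)
    (hc : (ξ.comp hS.extClass (rfl : n + 1 = n + 1)).comp (Abelian.Ext.mk₀ c) (add_zero _) = 0) :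
    ∃ u : S.X₂ ⟶ N, c = S.f ≫ u := by
  have h1 := H.injective N 0 (n + 1) rfl (hS.extClass.comp (Abelian.Ext.mk₀ c) (add_zero 1)) (by
    rw [← hc]
    exact (Abelian.Ext.comp_assoc_of_third_deg_zero _ _ _ _).symm)
  obtain ⟨z, hz⟩ := Abelian.Ext.contravariant_sequence_exact₁ hS N _ _ h1
  obtain ⟨u, rfl⟩ := (Abelian.Ext.mk₀_bijective _ _).2 z
  rw [Abelian.Ext.mk₀_comp_mk₀] at hz
  exact ⟨u, ((Abelian.Ext.mk₀_bijective _ _).1 hz).symm⟩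

/-- The lift of a map of modules to a syzygy. -/
noncomputable def syzLift {M Z : T.Algebra} {n : ℕ} (x : Z ⟶ T.free.obj (stage M n).Y)
    (h : x ≫ freePresentation (syz M n) = 0) : Z ⟶ syz M (n + 1) :=
  have : Mono (syzComplex M n).f := (syzComplex_shortExact M n).mono_f
  (syzComplex_shortExact M n).exact.lift x h

lemma syzLift_ι {M Z : T.Algebra} {n : ℕ} (x : Z ⟶ T.free.obj (stage M n).Y)
    (h : x ≫ freePresentation (syz M n) = 0) : syzLift x h ≫ syzι M n = x :=
  have : Mono (syzComplex M n).f := (syzComplex_shortExact M n).mono_f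
  (syzComplex_shortExact M n).exact.lift_f x h

lemma syzLift_f {M Z : T.Algebra} {n : ℕ} (x : Z ⟶ T.free.obj (stage M n).Y)
    (h : x ≫ freePresentation (syz M n) = 0) :
    (syzLift x h).f = x.f ≫ (plusπ T).app (stage M n).Y := by
  have h1 : (syzLift x h).f ≫ (stage M n).bd = x.f := congr_arg (fun a => a.f) (syzLift_ι x h)
  rw [← h1]
  refine Eq.trans ?_ (Category.assoc _ _ _).symm
  exact ((congr_arg (fun a => (syzLift x h).f ≫ a) (stage M n).bd_π).trans
    (Category.comp_id _)).symm

end Resolves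

namespace GradedAlgebra

variable {A : Type u} [Category.{v} A] [Abelian A] [HasCountableCoproducts A]
  (G : GradedAlgebra.{w} A)

/-- The differential of the Koszul resolution as a map of modules. -/
noncomputable def koszulDHom (n : ℕ) (X : A) :
    G.total.free.obj ((G.U (n + 1)).obj X) ⟶ G.total.free.obj ((G.U n).obj X) :=
  freeDesc (N := G.total.free.obj ((G.U n).obj X)) (G.genMap n X)

lemma koszulDHom_f (n : ℕ) (X : A) : (G.koszulDHom n X).f = G.koszulD n X := rfl

/-- The augmentation of a free module. -/
noncomputable def freeAug (X : A) : G.total.free.obj X ⟶ (trivialModule G.aug).obj X :=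
  freeDesc (N := (trivialModule G.aug).obj X) (𝟙 X)

lemma freeAug_f (X : A) : (G.freeAug X).f = trivialAction G.aug X := by
  refine (congr_arg (fun x => x ≫ trivialAction G.aug X) (G.total.map_id X)).trans ?_
  exact Category.id_comp _

/-- The syzygies of the Koszul resolution of a trivial module. -/
noncomputable def koszulSyz (X : A) : ℕ → G.total.Algebra
  | 0 => (trivialModule G.aug).obj X
  | n + 1 => kernel (biprod.lift (G.koszulDHom n X) (G.freeAug ((G.U (n + 1)).obj X)))

/-- The inclusion of a syzygy of the Koszul resolution. -/
noncomputable def koszulSyzι (n : ℕ) (X : A) :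
    G.koszulSyz X (n + 1) ⟶ G.total.free.obj ((G.U (n + 1)).obj X) :=
  kernel.ι _

instance (n : ℕ) (X : A) : Mono (G.koszulSyzι n X) := inferInstanceAs (Mono (kernel.ι _))

instance (n : ℕ) (X : A) : Mono (G.koszulSyzι n X).f :=
  inferInstanceAs (Mono (G.total.forget.map (G.koszulSyzι n X)))

lemma koszulSyzι_comp (n : ℕ) (X : A) :
    G.koszulSyzι n X ≫ G.koszulDHom n X = 0 ∧ G.koszulSyzι n X ≫ G.freeAug _ = 0 := by
  have h := kernel.condition (biprod.lift (G.koszulDHom n X) (G.freeAug ((G.U (n + 1)).obj X)))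
  have h1 := congr_arg (fun x => x ≫ biprod.fst) h
  have h2 := congr_arg (fun x => x ≫ biprod.snd) h
  simp only [Category.assoc, biprod.lift_fst, biprod.lift_snd, zero_comp] at h1 h2
  exact ⟨h1, h2⟩

lemma koszulSyzι_f_koszulD (n : ℕ) (X : A) : (G.koszulSyzι n X).f ≫ G.koszulD n X = 0 :=
  congr_arg (fun x => x.f) (G.koszulSyzι_comp n X).1

lemma koszulSyzι_f_aug (n : ℕ) (X : A) : (G.koszulSyzι n X).f ≫ trivialAction G.aug _ = 0 := by
  rw [← freeAug_f]
  exact congr_arg (fun x => x.f) (G.koszulSyzι_comp n X).2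

lemma comp_aug_eq_zero_iff {Z X : A} (x : Z ⟶ G.total.obj X) :
    x ≫ trivialAction G.aug X = 0 ↔ x ≫ G.pr 0 X = 0 := by
  rw [aug_eq, ← Category.assoc]
  exact ⟨fun h => (cancel_mono _).1 (h.trans zero_comp.symm), fun h => by rw [h, zero_comp]⟩

lemma koszulSyzι_f_pr (n : ℕ) (X : A) : (G.koszulSyzι n X).f ≫ G.pr 0 _ = 0 :=
  (G.comp_aug_eq_zero_iff _).1 (G.koszulSyzι_f_aug n X)

lemma exists_hom_koszulSyz {n : ℕ} {X : A} {Z : G.total.Algebra}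
    (x : Z ⟶ G.total.free.obj ((G.U (n + 1)).obj X)) (h : x.f ≫ G.koszulD n X = 0)
    (h0 : x.f ≫ G.pr 0 _ = 0) : ∃ y, y ≫ G.koszulSyzι n X = x := by
  refine ⟨kernel.lift _ x ?_, kernel.lift_ι _ _ _⟩
  refine biprod.hom_ext _ _ ?_ ?_
  · rw [Category.assoc, biprod.lift_fst, zero_comp]
    ext
    exact h
  · rw [Category.assoc, biprod.lift_snd, zero_comp]
    ext
    change x.f ≫ (G.freeAug _).f = 0
    rw [freeAug_f]
    exact (G.comp_aug_eq_zero_iff _).2 h0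

lemma exists_map_koszulSyz {n : ℕ} {X Z : A} (x : Z ⟶ G.total.obj ((G.U (n + 1)).obj X))
    (h : x ≫ G.koszulD n X = 0) (h0 : x ≫ G.pr 0 _ = 0) :
    ∃ y : Z ⟶ (G.koszulSyz X (n + 1)).A, y ≫ (G.koszulSyzι n X).f = x := by
  have hx : ∀ (N : G.total.Algebra) (f : G.total.free.obj ((G.U (n + 1)).obj X) ⟶ N),
      x ≫ f.f = 0 → freeDesc (N := G.total.free.obj _) x ≫ f = 0 := fun N f hf => by
    apply free_hom_ext
    have h2 : G.total.η.app Z ≫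
      (freeDesc (N := G.total.free.obj ((G.U (n + 1)).obj X)) x).f = x := η_freeDesc _
    refine (Category.assoc _ _ _).symm.trans ?_
    refine (congr_arg (fun a => a ≫ f.f) h2).trans (hf.trans ?_)
    exact (comp_zero (f := G.total.η.app Z)).symm
  obtain ⟨y, hy⟩ := G.exists_hom_koszulSyz (freeDesc (N := G.total.free.obj _) x)
    (congr_arg (fun x => x.f) (hx _ (G.koszulDHom n X) h))
    ((G.comp_aug_eq_zero_iff _).1 (by
      rw [← freeAug_f]
      refine congr_arg (fun x => x.f) (hx _ (G.freeAug _) ?_)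
      rw [freeAug_f]
      exact (G.comp_aug_eq_zero_iff _).2 h0))
  refine ⟨G.total.η.app Z ≫ y.f, ?_⟩
  refine (Category.assoc _ _ _).trans ?_
  refine (congr_arg (fun a => G.total.η.app Z ≫ a.f) hy).trans ?_
  exact η_freeDesc (N := G.total.free.obj ((G.U (n + 1)).obj X)) x

/-- The projection from a free module to a syzygy of the Koszul resolution. -/
noncomputable def koszulSyzπ (X : A) :
    ∀ n, G.total.free.obj ((G.U (n + 1)).obj X) ⟶ G.koszulSyz X n
  | 0 => G.freeAug X
  | n + 1 => (G.exists_hom_koszulSyz (G.koszulDHom (n + 1) X) (G.koszulD_koszulD n X)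
      (G.koszulD_pr_zero (n + 1) X)).choose

lemma koszulSyzπ_ι (n : ℕ) (X : A) :
    G.koszulSyzπ X (n + 1) ≫ G.koszulSyzι n X = G.koszulDHom (n + 1) X :=
  (G.exists_hom_koszulSyz (G.koszulDHom (n + 1) X) (G.koszulD_koszulD n X)
    (G.koszulD_pr_zero (n + 1) X)).choose_spec

lemma koszulSyzι_π (n : ℕ) (X : A) : G.koszulSyzι n X ≫ G.koszulSyzπ X n = 0 := by
  cases n with
  | zero => exact (G.koszulSyzι_comp 0 X).2
  | succ n =>
    rw [← cancel_mono (G.koszulSyzι n X), Category.assoc, koszulSyzπ_ι, zero_comp]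
    exact (G.koszulSyzι_comp (n + 1) X).1

lemma pr_zero_of_koszulD {n : ℕ} {X Z : A} (x : Z ⟶ G.total.obj ((G.U (n + 2)).obj X))
    (h : x ≫ G.koszulD (n + 1) X = 0) : x ≫ G.pr 0 _ = 0 := by
  have h1 := congr_arg (fun a => a ≫ G.pr 1 _) h
  simp only [Category.assoc, zero_comp] at h1
  rw [G.koszulD_pr (zero_add 1)] at h1
  have h2 : (inv G.one).app ((G.U (n + 2)).obj X) ≫ G.one.app ((G.U (n + 2)).obj X) = 𝟙 _ := by
    rw [← NatTrans.comp_app, IsIso.inv_hom_id, NatTrans.id_app]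
  have h3 : G.κ (zero_add 1) (n + 1) X = (inv G.one).app _ ≫ G.i (n + 1) X := by
    rw [← one_κ, reassoc_of% h2]
  rw [h3, ← Category.assoc, ← Category.assoc] at h1
  have h4 := (cancel_mono (G.i (n + 1) X)).1 (h1.trans zero_comp.symm)
  exact (cancel_mono _).1 (h4.trans zero_comp.symm)

/-- The short complexes of the Koszul resolution. -/
@[simps]
noncomputable def koszulSyzComplex (X : A) (n : ℕ) : ShortComplex G.total.Algebra where
  X₁ := G.koszulSyz X (n + 1)
  X₂ := G.total.free.obj ((G.U (n + 1)).obj X)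
  X₃ := G.koszulSyz X n
  f := G.koszulSyzι n X
  g := G.koszulSyzπ X n
  zero := G.koszulSyzι_π n X

lemma koszulD_of_koszulSyzπ {Z : G.total.Algebra} {X : A} {n : ℕ}
    (x : Z ⟶ G.total.free.obj ((G.U (n + 1)).obj X)) (h : x ≫ G.koszulSyzπ X n = 0) :
    x.f ≫ G.koszulD n X = 0 ∧ x.f ≫ G.pr 0 _ = 0 := by
  cases n with
  | zero =>
    refine ⟨?_, ?_⟩
    · have : IsZero (G.total.obj ((G.U 0).obj X)) :=
        (G.total : A ⥤ A).map_isZero (G.quad.U_zero_isZero X)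
      exact this.eq_of_tgt _ _
    · refine (G.comp_aug_eq_zero_iff _).1 ?_
      rw [← freeAug_f]
      exact congr_arg (fun a => a.f) h
  | succ n =>
    have h' : x ≫ G.koszulDHom (n + 1) X = 0 := by
      rw [← koszulSyzπ_ι, ← Category.assoc, h, zero_comp]
    have h1 : x.f ≫ G.koszulD (n + 1) X = 0 := congr_arg (fun a => a.f) h'
    exact ⟨h1, G.pr_zero_of_koszulD x.f h1⟩

lemma koszulSyzComplex_exact (X : A) (n : ℕ) : (G.koszulSyzComplex X n).Exact := by
  have : Mono (G.koszulSyzComplex X n).f := inferInstanceAs (Mono (G.koszulSyzι n X))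
  refine ShortComplex.exact_of_f_is_kernel _ (KernelFork.IsLimit.ofι' _ _ fun {Z} x hx => ?_)
  have h := G.koszulD_of_koszulSyzπ (n := n) (X := X) x hx
  exact ⟨_, (G.exists_hom_koszulSyz (n := n) (X := X) x h.1 h.2).choose_spec⟩

variable {G}

lemma epi_koszulSyzπ {X : A} (n : ℕ) (H : ∀ m, m + 1 = n → G.KoszulExactAt X m) :
    Epi (G.koszulSyzπ X n) := by
  cases n with
  | zero =>
    refine G.total.forget.epi_of_epi_map ?_
    change Epi (G.freeAug X).f
    rw [freeAug_f]
    refine ⟨fun g h e => ?_⟩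
    have h1 := congr_arg (fun a => G.total.η.app X ≫ a) e
    exact ((reassoc_of% (η_ε G.aug X)) g).symm.trans (h1.trans ((reassoc_of% (η_ε G.aug X)) h))
  | succ n =>
    refine G.total.forget.epi_of_epi_map ?_
    change Epi (G.koszulSyzπ X (n + 1)).f
    obtain ⟨y, hy⟩ := (H n rfl).total_lift (G.koszulSyzι n X).f (G.koszulSyzι_f_koszulD n X)
      (G.koszulSyzι_f_pr n X)
    have : y ≫ (G.koszulSyzπ X (n + 1)).f = 𝟙 _ := by
      rw [← cancel_mono (G.koszulSyzι n X).f]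
      refine (Category.assoc _ _ _).trans (Eq.trans ?_ (hy.trans (Category.id_comp _).symm))
      exact congr_arg (fun a => y ≫ a.f) (G.koszulSyzπ_ι n X)
    exact epi_of_epi_fac this

lemma koszulSyzComplex_shortExact {X : A} (n : ℕ) (H : ∀ m, m + 1 = n → G.KoszulExactAt X m) :
    (G.koszulSyzComplex X n).ShortExact := by
  have h1 : Mono (G.koszulSyzComplex X n).f := inferInstanceAs (Mono (G.koszulSyzι n X))
  have h2 : Epi (G.koszulSyzComplex X n).g := epi_koszulSyzπ n H
  exact ⟨G.koszulSyzComplex_exact X n⟩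

variable (G)

/-- The map from the Koszul dual to the bar construction. -/
noncomputable def koszulIncl (M : G.total.Algebra) : ∀ n, (G.U (n + 1)).obj M.A ⟶ (stage M n).Y
  | 0 => 𝟙 M.A
  | n + 1 => G.i (n + 1) M.A ≫ (G.pc 1).map (koszulIncl M n) ≫ (G.ι 1).app _ ≫
      (plusπ G.total).app _

/-- The generators of a syzygy of the Koszul resolution. -/
noncomputable def koszulSyzGen (X : A) (n : ℕ) : (G.U (n + 1)).obj X ⟶ (G.koszulSyz X n).A :=
  G.total.η.app _ ≫ (G.koszulSyzπ X n).f

lemma koszulSyzπ_comp {X : A} {n : ℕ} {N : G.total.Algebra} (k : G.koszulSyz X n ⟶ N)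
    {v : (G.U (n + 1)).obj X ⟶ N.A} (h : G.koszulSyzGen X n ≫ k.f = v) :
    G.koszulSyzπ X n ≫ k = freeDesc v := by
  apply free_hom_ext
  refine Eq.trans ?_ (η_freeDesc v).symm
  rw [← h]
  exact (Category.assoc _ _ _).symm

lemma free_map_freePresentation {X : A} {N : G.total.Algebra} (v : X ⟶ N.A) :
    G.total.free.map v ≫ freePresentation N = freeDesc v := by
  ext
  rfl

lemma genMap_map {n : ℕ} {X Y : A} (v : (G.U n).obj X ⟶ Y) :
    G.genMap n X ≫ G.total.map v ≫ (plusπ G.total).app Y =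
      G.i n X ≫ (G.pc 1).map v ≫ (G.ι 1).app Y ≫ (plusπ G.total).app Y := by
  rw [genMap, Category.assoc, ← Category.assoc ((G.ι 1).app _), ι_naturality, Category.assoc]

lemma koszulSyzGen_ι (n : ℕ) (X : A) :
    G.koszulSyzGen X (n + 1) ≫ (G.koszulSyzι n X).f = G.genMap (n + 1) X := by
  refine (Category.assoc _ _ _).trans ?_
  refine (congr_arg (fun a => G.total.η.app _ ≫ a.f) (G.koszulSyzπ_ι n X)).trans ?_
  exact η_freeDesc (N := G.total.free.obj _) _

lemma koszulSyzι_free {n : ℕ} {X : A} {N : G.total.Algebra} (k : G.koszulSyz X n ⟶ N)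
    {v : (G.U (n + 1)).obj X ⟶ N.A} (h : G.koszulSyzGen X n ≫ k.f = v) :
    (G.koszulSyzι n X ≫ G.total.free.map v) ≫ freePresentation N = 0 := by
  rw [Category.assoc, free_map_freePresentation, ← G.koszulSyzπ_comp k h, ← Category.assoc,
    koszulSyzι_π, zero_comp]

/-- The comparison of the Koszul resolution with the bar resolution. -/
noncomputable def koszulSyzToSyz (X : A) : ∀ n,
    {k : G.koszulSyz X n ⟶ syz ((trivialModule G.aug).obj X) n //
      G.koszulSyzGen X n ≫ k.f = G.koszulIncl ((trivialModule G.aug).obj X) n}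
  | 0 => ⟨syzZero _, by
      refine (Category.assoc _ _ _).trans ?_
      refine (congr_arg (fun x => _ ≫ x) (Category.comp_id _)).trans ?_
      exact η_freeDesc (N := (trivialModule G.aug).obj X) (𝟙 X)⟩
  | n + 1 => ⟨syzLift (M := (trivialModule G.aug).obj X) _
        (G.koszulSyzι_free (koszulSyzToSyz X n).1 (koszulSyzToSyz X n).2), by
      refine (congr_arg (fun a => G.koszulSyzGen X (n + 1) ≫ a)
        (syzLift_f (M := (trivialModule G.aug).obj X) _ _)).trans ?_
      refine Eq.trans ?_ (((reassoc_of% (G.koszulSyzGen_ι n X)) _).trans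
        (G.genMap_map (G.koszulIncl ((trivialModule G.aug).obj X) n)))
      exact congr_arg (fun a => G.koszulSyzGen X (n + 1) ≫ a) (Category.assoc _ _ _)⟩

lemma koszulSyzToSyz_ι (n : ℕ) (X : A) : (G.koszulSyzToSyz X (n + 1)).1 ≫
    syzι ((trivialModule G.aug).obj X) n =
      G.koszulSyzι n X ≫ G.total.free.map (G.koszulIncl ((trivialModule G.aug).obj X) n) :=
  syzLift_ι _ _

/-- The comparison of the short complexes of the Koszul and bar resolutions. -/
noncomputable def koszulSyzComplexHom (X : A) (n : ℕ) :
    G.koszulSyzComplex X n ⟶ syzComplex ((trivialModule G.aug).obj X) n where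
  τ₁ := (G.koszulSyzToSyz X (n + 1)).1
  τ₂ := G.total.free.map (G.koszulIncl ((trivialModule G.aug).obj X) n)
  τ₃ := (G.koszulSyzToSyz X n).1
  comm₁₂ := G.koszulSyzToSyz_ι n X
  comm₂₃ := by
    refine Eq.trans ?_ (G.koszulSyzπ_comp _ (G.koszulSyzToSyz X n).2).symm
    exact G.free_map_freePresentation (N := syz ((trivialModule G.aug).obj X) n) _

variable {G}

lemma exists_resolves [G.ProjComponents] {X : A} (hX : Projective X) :
    ∀ n, (∀ m, m + 2 ≤ n → G.KoszulExactAt X m) →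
      ∃ ξ, Resolves (G.koszulSyzToSyz X n).1 ξ
  | 0, _ => ⟨_, resolves_zero _⟩
  | n + 1, H => by
    obtain ⟨ξ, hξ⟩ := exists_resolves hX n fun m hm => H m (by omega)
    have := projective_U hX n fun m hm => H m (by omega)
    exact ⟨_, hξ.next (koszulSyzComplex_shortExact n fun m hm => H m (by omega))
      (G.koszulSyzComplexHom X n) (projective_free _)⟩

lemma extOf_eq_zero [G.ProjComponents] {X : A} (hX : Projective X)
    (H : ∀ n, G.KoszulExactAt X n) {n : ℕ} {N : G.total.Algebra}
    (c : syz ((trivialModule G.aug).obj X) n ⟶ N)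
    (hc : G.koszulIncl ((trivialModule G.aug).obj X) n ≫ c.f = 0) : extOf c = 0 := by
  obtain ⟨ξ, hξ⟩ := exists_resolves hX n fun m _ => H m
  have h1 : (G.koszulSyzToSyz X n).1 ≫ c = 0 := by
    have := epi_koszulSyzπ (G := G) (X := X) n fun m _ => H m
    rw [← cancel_epi (G.koszulSyzπ X n), comp_zero]
    refine (G.koszulSyzπ_comp ((G.koszulSyzToSyz X n).1 ≫ c) (v := 0) ?_).trans ?_
    · refine Eq.trans ?_ ((congr_arg (fun a => a ≫ c.f) (G.koszulSyzToSyz X n).2).trans hc)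
      exact (Category.assoc _ _ _).symm
    · apply free_hom_ext
      exact (η_freeDesc _).trans comp_zero.symm
  rw [extOf, ← hξ.comp_eq, Abelian.Ext.comp_assoc_of_third_deg_zero, Abelian.Ext.mk₀_comp_mk₀, h1,
    Abelian.Ext.mk₀_zero, Abelian.Ext.comp_zero]

end GradedAlgebra

section Images

variable {A : Type u} [Category.{v} A] [Abelian A]

lemma imageSubobject_factors {X Y Z : A} (f : X ⟶ Y) (x : Z ⟶ Y) (h : x ≫ cokernel.π f = 0) :
    (imageSubobject f).Factors x := by
  refine (Subobject.mk_factors_iff _ _).2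
    ⟨kernel.lift (cokernel.π f) x h ≫ (Abelian.imageIsoImage f).hom, ?_⟩
  refine (Category.assoc _ _ _).trans ?_
  refine (congr_arg (fun a => kernel.lift (cokernel.π f) x h ≫ a)
    (IsImage.isoExt_hom_m (Abelian.imageStrongEpiMonoFactorisation f).toMonoIsImage
      (Image.isImage f))).trans ?_
  exact kernel.lift_ι _ _ _

lemma eq_zero_of_imageSubobject_factors {X Y Z W : A} (f : X ⟶ Y) (x : Z ⟶ Y)
    (h : (imageSubobject f).Factors x) (c : Y ⟶ W) (hc : f ≫ c = 0) : x ≫ c = 0 := by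
  rw [← (imageSubobject f).factorThru_arrow x h, Category.assoc]
  have : (imageSubobject f).arrow ≫ c = 0 := by
    rw [← cancel_epi (factorThruImageSubobject f), imageSubobject_arrow_comp_assoc, hc, comp_zero]
  rw [this, comp_zero]

lemma imageSubobject_le_kernelSubobject {X Y W : A} (f : X ⟶ Y) (c : Y ⟶ W) (hc : f ≫ c = 0) :
    imageSubobject f ≤ kernelSubobject c :=
  Subobject.le_of_comm ((kernelSubobject c).factorThru _ ((kernelSubobject_factors_iff _ _).2
    (eq_zero_of_imageSubobject_factors f _ (Subobject.factors_self _) c hc)))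
    (Subobject.factorThru_arrow _ _ _)

end Images

section Words

variable {A : Type u} [Category.{v} A] [Abelian A] {T : Monad A} {S : ℕ → A ⥤ A}
  (σ : ∀ i, S i ⟶ (T : A ⥤ A))

/-- A map which factors through a word of a given weight. -/
def FactorsWord (M : T.Algebra) (n m : ℕ) {Z : A} (z : Z ⟶ (stage M n).Y) : Prop :=
  ∃ (c : Fin n → ℕ) (p : Z ⟶ wordObj S n c M.A), ∑ i, c i = m ∧ p ≫ wordMap σ M n c = z

lemma FactorsWord.factors {M : T.Algebra} {n m : ℕ} {Z : A} {z : Z ⟶ (stage M n).Y}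
    (h : FactorsWord σ M n m z) : (weightSubobject σ M n m).Factors z := by
  obtain ⟨c, p, hc, rfl⟩ := h
  refine Subobject.factors_of_le _ (Finset.le_sup (f := fun c => imageSubobject (wordMap σ M n c))
    (Finset.Nat.mem_antidiagonalTuple.2 hc)) ?_
  refine (Subobject.mk_factors_iff _ _).2 ⟨p ≫ factorThruImage _, ?_⟩
  refine (Category.assoc _ _ _).trans ?_
  exact congr_arg (fun a => p ≫ a) (image.fac _)

lemma FactorsWord.cons {M : T.Algebra} {n m : ℕ} {Y Z : A} {y : Y ⟶ (stage M n).Y}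
    (h : FactorsWord σ M n m y) {j k : ℕ} (hk : j + m = k) (x : Z ⟶ (S j).obj Y) :
    FactorsWord σ M (n + 1) k (x ≫ (S j).map y ≫ (σ j).app _ ≫ (plusπ T).app _) := by
  obtain ⟨c, p, hc, rfl⟩ := h
  refine ⟨Fin.cons j c, x ≫ (S j).map p, ?_, ?_⟩
  · rw [Fin.sum_univ_succ, Fin.cons_zero]
    simp only [Fin.cons_succ]
    rw [hc, hk]
  · rw [Functor.map_comp]
    refine (Category.assoc _ _ _).trans ?_
    refine congr_arg (fun a => x ≫ a) ?_
    exact (Category.assoc _ _ _).symm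

lemma FactorsWord.zero (M : T.Algebra) : FactorsWord σ M 0 0 (𝟙 M.A) :=
  ⟨fun i => i.elim0, 𝟙 _, rfl, Category.comp_id _⟩

end Words

namespace GradedAlgebra

variable {A : Type u} [Category.{v} A] [Abelian A] [HasCountableCoproducts A]
  (G : GradedAlgebra.{w} A)

lemma one_mul' (n : ℕ) (X : A) :
    (G.mul (zero_add n)).app X = (inv G.one).app ((G.pc n).obj X) := by
  have h := G.one_mul n X
  have h2 : (inv G.one).app ((G.pc n).obj X) ≫ G.one.app ((G.pc n).obj X) = 𝟙 _ := by
    rw [← NatTrans.comp_app, IsIso.inv_hom_id, NatTrans.id_app]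
  rw [← Category.comp_id ((inv G.one).app _), ← h, reassoc_of% h2]

lemma mul_one' (n : ℕ) (X : A) :
    (G.mul (add_zero n)).app X = (G.pc n).map ((inv G.one).app X) := by
  have h := G.mul_one n X
  have h2 : (G.pc n).map ((inv G.one).app X) ≫ (G.pc n).map (G.one.app X) = 𝟙 _ := by
    rw [← Functor.map_comp, ← NatTrans.comp_app, IsIso.inv_hom_id, NatTrans.id_app]
    exact (G.pc n).map_id _
  rw [← Category.comp_id ((G.pc n).map _), ← h, reassoc_of% h2]

lemma map_total_hom_ext {X Z : A} (j : ℕ) {f g : (G.pc j).obj (G.total.obj X) ⟶ Z}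
    (h : ∀ n, (G.pc j).map ((G.ι n).app X) ≫ f = (G.pc j).map ((G.ι n).app X) ≫ g) : f = g :=
  sigma_map_hom_ext.{w} G.pc (G.pc j) h

lemma ι_μ_pr {j a b : ℕ} (h : j + a = b) (X : A) :
    (G.ι j).app (G.total.obj X) ≫ G.total.μ.app X ≫ G.pr b X =
      (G.pc j).map (G.pr a X) ≫ (G.mul h).app X := by
  refine G.map_total_hom_ext j fun n => ?_
  have h1 := congr_arg (fun x => x ≫ G.pr b X) (G.ι_μ X (rfl : j + n = _))
  simp only [Category.assoc] at h1
  rw [h1]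
  by_cases hn : n = a
  · subst hn h
    rw [ι_pr, ← Functor.map_comp_assoc, ι_pr, (G.pc _).map_id]
    exact (Category.comp_id _).trans (Category.id_comp _).symm
  · rw [G.ι_pr_of_ne (by omega), ← Functor.map_comp_assoc, G.ι_pr_of_ne hn, Functor.map_zero,
      zero_comp, comp_zero]

lemma ι_μ_pr_of_lt {j b : ℕ} (h : b < j) (X : A) :
    (G.ι j).app (G.total.obj X) ≫ G.total.μ.app X ≫ G.pr b X = 0 := by
  refine G.map_total_hom_ext j fun n => ?_
  have h1 := congr_arg (fun x => x ≫ G.pr b X) (G.ι_μ X (rfl : j + n = _))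
  simp only [Category.assoc] at h1
  rw [h1, G.ι_pr_of_ne (by omega), comp_zero, comp_zero]

lemma μ_pr_one (X : A) : G.total.μ.app X ≫ G.pr 1 X =
    G.pr 1 (G.total.obj X) ≫ (G.pc 1).map (trivialAction G.aug X) +
      trivialAction G.aug (G.total.obj X) ≫ G.pr 1 X := by
  refine G.total_hom_ext fun j => ?_
  rw [Preadditive.comp_add]
  rcases j with _ | _ | j
  · have h := (inv G.one).naturality (G.pr 1 X)
    dsimp at h
    refine (G.ι_μ_pr (zero_add 1) X).trans ?_
    rw [one_mul', ← Category.assoc, G.ι_pr_of_ne (by omega), zero_comp, zero_add,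
      ← Category.assoc, ι_aug_zero]
    exact h
  · refine (G.ι_μ_pr (add_zero 1) X).trans ?_
    rw [mul_one', ← Category.assoc, ι_pr, Category.id_comp, ← Category.assoc, ι_aug_succ,
      zero_comp, add_zero, aug_eq, Functor.map_comp]
  · rw [G.ι_μ_pr_of_lt (by omega), ← Category.assoc, G.ι_pr_of_ne (by omega), zero_comp,
      ← Category.assoc, ι_aug_succ, zero_comp, add_zero]

/-- The projection of the augmentation ideal to the component of degree one. -/
noncomputable def plusPr (X : A) : (plus G.total).obj X ⟶ (G.pc 1).obj X :=
  plusDesc G.total (G.pr 1 X) (by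
    rw [← one_ι, Category.assoc, G.ι_pr_of_ne (by omega), comp_zero])

lemma π_plusPr (X : A) : (plusπ G.total).app X ≫ G.plusPr X = G.pr 1 X := π_plusDesc _ _ _

lemma ι_π_plusPr (Y : A) :
    (G.ι 1).app Y ≫ (plusπ G.total).app Y ≫ G.plusPr Y = 𝟙 _ := by
  rw [π_plusPr, ι_pr]

lemma koszulIncl_comp_plusPr (M : G.total.Algebra) (n : ℕ) {Z : A}
    (f : (G.pc 1).obj (stage M n).Y ⟶ Z) :
    G.koszulIncl M (n + 1) ≫ G.plusPr (stage M n).Y ≫ f =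
      G.i (n + 1) M.A ≫ (G.pc 1).map (G.koszulIncl M n) ≫ f := by
  have h : (G.i (n + 1) M.A ≫ (G.pc 1).map (G.koszulIncl M n) ≫ (G.ι 1).app (stage M n).Y ≫
      (plusπ G.total).app (stage M n).Y) ≫ G.plusPr (stage M n).Y ≫ f =
      G.i (n + 1) M.A ≫ (G.pc 1).map (G.koszulIncl M n) ≫ f := by
    simp only [Category.assoc]
    rw [reassoc_of% (G.ι_π_plusPr (stage M n).Y)]
  exact h

lemma next_b_plusPr (s : Stage G.total) {U V : A} (r : s.Y ⟶ U) (e : (G.pc 1).obj U ⟶ V)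
    (hb : s.b ≫ r = trivialAction G.aug s.Y ≫ r) :
    s.next.b ≫ G.plusPr s.Y ≫ (G.pc 1).map r ≫ e =
      trivialAction G.aug ((plus G.total).obj s.Y) ≫ G.plusPr s.Y ≫ (G.pc 1).map r ≫ e := by
  have h1 := s.plusπ_b_next
  rw [← cancel_epi (G.total.map ((plusπ G.total).app s.Y))]
  have h2 := congr_arg (fun x => x ≫ G.plusPr s.Y ≫ (G.pc 1).map r ≫ e) h1
  simp only [Preadditive.add_comp, Category.assoc] at h2
  rw [reassoc_of% (G.π_plusPr s.Y)] at h2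
  have h3 : G.total.map s.b ≫ G.pr 1 s.Y ≫ (G.pc 1).map r ≫ e =
      G.pr 1 _ ≫ (G.pc 1).map (trivialAction G.aug s.Y) ≫ (G.pc 1).map r ≫ e := by
    rw [reassoc_of% (G.pr_naturality 1 s.b), ← Functor.map_comp_assoc, hb,
      Functor.map_comp_assoc]
  have h4 := congr_arg (fun x => x ≫ (G.pc 1).map r ≫ e) (G.μ_pr_one s.Y)
  simp only [Preadditive.add_comp, Category.assoc] at h4
  have h5 : G.total.map ((plusπ G.total).app s.Y) ≫
      trivialAction G.aug ((plus G.total).obj s.Y) ≫ G.plusPr s.Y ≫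
        (G.pc 1).map r ≫ e = trivialAction G.aug (G.total.obj s.Y) ≫
          G.pr 1 s.Y ≫ (G.pc 1).map r ≫ e := by
    rw [← Category.assoc, ε_naturality, Category.assoc, reassoc_of% (G.π_plusPr s.Y)]
  refine Eq.trans ?_ h5.symm
  rw [h3] at h2
  refine Eq.trans ?_ (add_right_cancel (h2.trans (h4.trans (add_comm _ _))))
  simp only [Category.assoc]
  rw [reassoc_of% (G.π_plusPr s.Y)]

lemma word_plusPr {Y Z U V : A} (j : ℕ) (p : Z ⟶ Y) (r : Y ⟶ U) (e : (G.pc 1).obj U ⟶ V)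
    (h : j = 1 → p ≫ r = 0) :
    ((G.pc j).map p ≫ (G.ι j).app Y ≫ (plusπ G.total).app Y) ≫
      G.plusPr Y ≫ (G.pc 1).map r ≫ e = 0 := by
  simp only [Category.assoc]
  rw [reassoc_of% (G.π_plusPr Y)]
  by_cases h0 : j = 1
  · subst h0
    rw [reassoc_of% (G.ι_pr 1 Y), ← Functor.map_comp_assoc, h rfl, Functor.map_zero, zero_comp]
  · rw [reassoc_of% (G.ι_pr_of_ne h0 Y), zero_comp, comp_zero]

variable {G}

/-- A retraction of the bar construction on the Koszul dual. -/
structure KoszulRetr (M : G.total.Algebra) (n : ℕ) (r : (stage M n).Y ⟶ (G.U (n + 1)).obj M.A) :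
    Prop where
  incl : G.koszulIncl M n ≫ r = 𝟙 _
  word : ∀ c : Fin n → ℕ, ∑ i, c i ≠ n → wordMap G.ι M n c ≫ r = 0
  cocycle : M.a = trivialAction G.aug M.A →
    (stage M n).b ≫ r = trivialAction G.aug (stage M n).Y ≫ r

lemma koszulRetr_succ {M : G.total.Algebra} {n : ℕ} {r : (stage M n).Y ⟶ (G.U (n + 1)).obj M.A}
    (h : KoszulRetr M n r)
    (e : (G.pc 1).obj ((G.U (n + 1)).obj M.A) ⟶ (G.U (n + 2)).obj M.A)
    (he : G.i (n + 1) M.A ≫ e = 𝟙 _) :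
    KoszulRetr M (n + 1) (G.plusPr (stage M n).Y ≫ (G.pc 1).map r ≫ e) where
  incl := by
    have h1 : (G.pc 1).map (G.koszulIncl M n) ≫ (G.pc 1).map r = 𝟙 _ := by
      rw [← Functor.map_comp, h.incl, (G.pc 1).map_id]
    refine (G.koszulIncl_comp_plusPr M n _).trans ?_
    rw [reassoc_of% h1, he]
  word c hc := by
    refine G.word_plusPr (c 0) (wordMap G.ι M n (Fin.tail c)) r e fun h0 => h.word _ fun h3 => hc ?_
    have h4 : ∑ i : Fin n, c i.succ = n := h3
    rw [Fin.sum_univ_succ, h0, h4, add_comm]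
  cocycle hM := next_b_plusPr _ _ r e (h.cocycle hM)

lemma exists_koszulRetr (M : G.total.Algebra) :
    ∀ n, (∀ m, m + 1 ≤ n → G.KoszulExactAt M.A m) → ∃ r, KoszulRetr M n r
  | 0, _ => ⟨𝟙 _, by
      refine ⟨Category.comp_id _, fun c hc => absurd rfl hc, fun hM => ?_⟩
      exact congr_arg (fun a => a ≫ 𝟙 M.A) hM⟩
  | n + 1, H => by
    obtain ⟨r, hr⟩ := exists_koszulRetr M n fun m hm => H m (by omega)
    obtain ⟨e, he⟩ := (H n le_rfl).split_i.exists_retraction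
    exact ⟨_, koszulRetr_succ hr e he⟩

lemma exists_coboundary [G.ProjComponents] {X : A} (hX : Projective X)
    (H : ∀ n, G.KoszulExactAt X n) {n : ℕ} {N : A}
    (c : (stage ((trivialModule G.aug).obj X) (n + 1)).Y ⟶ N)
    (h : (stage ((trivialModule G.aug).obj X) (n + 1)).bd ≫ trivialAction G.aug _ ≫ c = 0)
    (hc : G.koszulIncl ((trivialModule G.aug).obj X) (n + 1) ≫ c = 0) :
    ∃ u : (stage ((trivialModule G.aug).obj X) n).Y ⟶ N,
      c = (stage ((trivialModule G.aug).obj X) n).bd ≫ trivialAction G.aug _ ≫ u :=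
  (extOf_cocycleHom_succ_iff G.aug (M := (trivialModule G.aug).obj X) hX c h).1
    (extOf_eq_zero hX H _ hc)

lemma isKoszul_of_koszulExactAt [G.ProjComponents] {W : ObjectProperty A}
    (hW : ∀ Q, W Q → Projective Q) (H : ∀ Q, W Q → ∀ n, G.KoszulExactAt Q n) : G.IsKoszul W where
  projective Q hQ := PreservesProj.proj Q (hW Q hQ)
  homology Q hQ n m hnm := by
    cases n with
    | zero =>
      refine inf_le_right.trans (le_trans (Finset.sup_le fun c hc => absurd ?_ hnm) bot_le)
      rw [Finset.Nat.mem_antidiagonalTuple] at hc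
      exact hc
    | succ n =>
      set M := (trivialModule G.aug).obj Q with hM
      obtain ⟨r, hr⟩ := exists_koszulRetr M (n + 1) fun m _ => H Q hQ m
      set c : (stage M (n + 1)).Y ⟶ _ := cokernel.π (barDiff G.aug Q (n + 1)) with hc
      have hc0 : (stage M (n + 1)).bd ≫ trivialAction G.aug _ ≫ c = 0 :=
        (Category.assoc _ _ _).symm.trans (cokernel.condition (barDiff G.aug Q (n + 1)))
      have hr0 : (stage M (n + 1)).bd ≫ trivialAction G.aug _ ≫ r = 0 := by
        have h1 := hr.cocycle rfl
        rw [← h1, ← Category.assoc, Stage.bd_b, zero_comp]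
      obtain ⟨u, hu⟩ := exists_coboundary (hW Q hQ) (H Q hQ) (n := n)
        (c - r ≫ G.koszulIncl M (n + 1) ≫ c) (by
          rw [Preadditive.comp_sub, Preadditive.comp_sub, hc0]
          have h2 := congr_arg (fun a => a ≫ G.koszulIncl M (n + 1) ≫ c) hr0
          simp only [Category.assoc, zero_comp] at h2
          exact (congr_arg (fun a => 0 - a) h2).trans (sub_zero _)) (by
          rw [Preadditive.comp_sub, ← Category.assoc _ r]
          refine (congr_arg (fun a => _ - a ≫ _) hr.incl).trans ?_
          rw [Category.id_comp]
          exact sub_self _)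
      set S := barCycles G.aug Q (n + 1) ⊓ weightSubobject G.ι M (n + 1) m with hS
      have h1 : S.arrow ≫ barDiff G.aug Q n = 0 :=
        (kernelSubobject_factors_iff _ _).1
          (Subobject.factors_of_le _ (inf_le_left : S ≤ barCycles G.aug Q (n + 1))
            (Subobject.factors_self S))
      have h2 : S.arrow ≫ r = 0 := by
        refine (kernelSubobject_factors_iff _ _).1 (Subobject.factors_of_le _
          ((inf_le_right : S ≤ _).trans (Finset.sup_le fun c' hc' => ?_))
            (Subobject.factors_self S))
        refine imageSubobject_le_kernelSubobject _ _ (hr.word c' ?_)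
        rw [Finset.Nat.mem_antidiagonalTuple.1 hc']
        exact fun h => hnm h.symm
      have h3 : S.arrow ≫ c = 0 := by
        have h5 : S.arrow ≫ (c - r ≫ G.koszulIncl M (n + 1) ≫ c) = 0 := by
          rw [hu]
          have h5 := congr_arg (fun a => a ≫ u) h1
          simp only [zero_comp] at h5
          refine Eq.trans ?_ h5
          refine Eq.trans ?_ (Category.assoc _ _ _).symm
          exact congr_arg (fun a => S.arrow ≫ a) (Category.assoc _ _ _).symm
        rw [Preadditive.comp_sub, ← Category.assoc S.arrow r, h2, zero_comp, sub_zero] at h5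
        exact h5
      exact Subobject.le_of_comm (Subobject.factorThru _ _
        (imageSubobject_factors (barDiff G.aug Q (n + 1)) S.arrow h3))
        (Subobject.factorThru_arrow _ _ _)

end GradedAlgebra

namespace GradedAlgebra

variable {A : Type u} [Category.{v} A] [Abelian A] (G : GradedAlgebra.{w} A)

/-- The cycles of the Koszul resolution of a given weight. -/
noncomputable def koszulCycles (n b : ℕ) (X : A) : A := kernel (G.κ (rfl : b + 1 = b + 1) n X)

/-- The inclusion of the cycles. -/
noncomputable def koszulCyclesι (n b : ℕ) (X : A) :
    G.koszulCycles n b X ⟶ (G.pc b).obj ((G.U (n + 1)).obj X) := kernel.ι _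

instance (n b : ℕ) (X : A) : Mono (G.koszulCyclesι n b X) := inferInstanceAs (Mono (kernel.ι _))

lemma koszulCyclesι_κ (n b : ℕ) (X : A) :
    G.koszulCyclesι n b X ≫ G.κ (rfl : b + 1 = b + 1) n X = 0 := kernel.condition _

/-- The map from a free part to the cycles. -/
noncomputable def toKoszulCycles (n a : ℕ) (X : A) :
    (G.pc a).obj ((G.U (n + 2)).obj X) ⟶ G.koszulCycles n (a + 1) X :=
  kernel.lift _ (G.κ rfl (n + 1) X) (G.κ_κ rfl rfl n X)

lemma toKoszulCycles_ι (n a : ℕ) (X : A) :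
    G.toKoszulCycles n a X ≫ G.koszulCyclesι n (a + 1) X = G.κ rfl (n + 1) X :=
  kernel.lift_ι _ _ _

lemma epi_toKoszulCycles_zero (n : ℕ) (X : A) : Epi (G.toKoszulCycles n 0 X) := by
  obtain ⟨y, hy⟩ := G.exists_i_lift n (G.koszulCyclesι n 1 X) (G.koszulCyclesι_κ n 1 X)
  have h : (y ≫ G.one.app _) ≫ G.toKoszulCycles n 0 X = 𝟙 _ := by
    rw [← cancel_mono (G.koszulCyclesι n 1 X), Category.assoc, toKoszulCycles_ι, Category.id_comp]
    refine (Category.assoc _ _ _).trans ?_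
    exact (congr_arg (fun a => y ≫ a) (G.one_κ (n + 1) X)).trans hy
  exact ⟨fun f g hfg => by
    rw [← Category.id_comp f, ← h, Category.assoc, hfg, ← Category.assoc, h, Category.id_comp]⟩

lemma mul_koszulCycles (n : ℕ) (X : A) {j b c : ℕ} (h : j + b = c) :
    ((G.pc j).map (G.koszulCyclesι n b X) ≫ (G.mul h).app ((G.U (n + 1)).obj X)) ≫
      G.κ (rfl : c + 1 = c + 1) n X = 0 := by
  refine (Category.assoc _ _ _).trans ?_
  rw [G.mul_κ h (rfl : b + 1 = b + 1) rfl (by omega), ← Functor.map_comp_assoc, koszulCyclesι_κ,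
    Functor.map_zero, zero_comp]

/-- The action on cycles. -/
noncomputable def actKoszulCycles (n : ℕ) (X : A) {j b c : ℕ} (h : j + b = c) :
    (G.pc j).obj (G.koszulCycles n b X) ⟶ G.koszulCycles n c X :=
  kernel.lift _ _ (G.mul_koszulCycles n X h)

lemma actKoszulCycles_ι (n : ℕ) (X : A) {j b c : ℕ} (h : j + b = c) :
    G.actKoszulCycles n X h ≫ G.koszulCyclesι n c X =
      (G.pc j).map (G.koszulCyclesι n b X) ≫ (G.mul h).app ((G.U (n + 1)).obj X) :=
  kernel.lift_ι _ _ _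

lemma map_toKoszulCycles_act (n : ℕ) (X : A) {j a c : ℕ} (h : j + (a + 1) = c + 1) :
    (G.pc j).map (G.toKoszulCycles n a X) ≫ G.actKoszulCycles n X h =
      (G.mul (show j + a = c by omega)).app ((G.U (n + 2)).obj X) ≫ G.toKoszulCycles n c X := by
  rw [← cancel_mono (G.koszulCyclesι n (c + 1) X), Category.assoc, actKoszulCycles_ι,
    ← Functor.map_comp_assoc, toKoszulCycles_ι]
  refine Eq.symm ((Category.assoc _ _ _).trans ?_)
  rw [toKoszulCycles_ι]
  exact G.mul_κ _ rfl rfl h (n + 1) X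

variable [HasCountableCoproducts A]

/-- The projection from a syzygy to the cycles of a given weight. -/
noncomputable def koszulSyzPr (n b : ℕ) (X : A) :
    (G.koszulSyz X (n + 1)).A ⟶ G.koszulCycles n b X :=
  kernel.lift _ ((G.koszulSyzι n X).f ≫ G.pr b _) (by
    have h := G.koszulSyzι_f_koszulD n X
    have h1 := congr_arg (fun a => a ≫ G.pr (b + 1) _) h
    refine (Category.assoc _ _ _).trans ?_
    refine (congr_arg (fun a => (G.koszulSyzι n X).f ≫ a) (G.koszulD_pr rfl n X)).symm.trans ?_
    exact (Category.assoc _ _ _).symm.trans (h1.trans zero_comp))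

lemma koszulSyzPr_ι (n b : ℕ) (X : A) : G.koszulSyzPr n b X ≫ G.koszulCyclesι n b X =
    (G.koszulSyzι n X).f ≫ G.pr b ((G.U (n + 1)).obj X) := kernel.lift_ι _ _ _

lemma koszulSyzPr_zero (n : ℕ) (X : A) : G.koszulSyzPr n 0 X = 0 := by
  rw [← cancel_mono (G.koszulCyclesι n 0 X), koszulSyzPr_ι, zero_comp]
  exact G.koszulSyzι_f_pr n X

lemma ι_act_koszulSyz (n j : ℕ) (X : A) : ((G.ι j).app (G.koszulSyz X (n + 1)).A ≫
    (G.koszulSyz X (n + 1)).a) ≫ (G.koszulSyzι n X).f = (G.pc j).map (G.koszulSyzι n X).f ≫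
      (G.ι j).app (G.total.obj ((G.U (n + 1)).obj X)) ≫ G.total.μ.app _ := by
  have h : G.total.map (G.koszulSyzι n X).f ≫ G.total.μ.app _ =
    (G.koszulSyz X (n + 1)).a ≫ (G.koszulSyzι n X).f := (G.koszulSyzι n X).h
  refine (Category.assoc _ _ _).trans ?_
  refine (congr_arg (fun a => (G.ι j).app (G.koszulSyz X (n + 1)).A ≫ a) h).symm.trans ?_
  refine (Category.assoc _ _ _).symm.trans ?_
  refine (congr_arg (fun a => a ≫ G.total.μ.app _) (G.ι_naturality j (G.koszulSyzι n X).f)).trans ?_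
  exact Category.assoc _ _ _

lemma ι_act_koszulSyzPr (n : ℕ) (X : A) {j b c : ℕ} (h : j + b = c) :
    ((G.ι j).app (G.koszulSyz X (n + 1)).A ≫ (G.koszulSyz X (n + 1)).a) ≫ G.koszulSyzPr n c X =
      (G.pc j).map (G.koszulSyzPr n b X) ≫ G.actKoszulCycles n X h := by
  have h0 : ((G.pc j).map (G.koszulSyzPr n b X) ≫ G.actKoszulCycles n X h) ≫
      G.koszulCyclesι n c X = (G.pc j).map (G.koszulSyzι n X).f ≫
        (G.pc j).map (G.pr b ((G.U (n + 1)).obj X)) ≫ (G.mul h).app ((G.U (n + 1)).obj X) := by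
    rw [Category.assoc, actKoszulCycles_ι, ← Functor.map_comp_assoc, koszulSyzPr_ι]
    exact (congr_arg (fun a => a ≫ _) (Functor.map_comp _ _ _)).trans (Category.assoc _ _ _)
  refine (cancel_mono (G.koszulCyclesι n c X)).1 (Eq.trans ?_ h0.symm)
  have h1 := congr_arg (fun a => a ≫ G.pr c _) (G.ι_act_koszulSyz n j X)
  refine (Category.assoc _ _ _).trans ?_
  refine (congr_arg (fun a => _ ≫ a) (G.koszulSyzPr_ι n c X)).trans ?_
  refine (Category.assoc _ _ _).symm.trans (h1.trans ?_)
  refine (Category.assoc _ _ _).trans ?_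
  refine congr_arg (fun a => (G.pc j).map (G.koszulSyzι n X).f ≫ a) ?_
  exact (Category.assoc _ _ _).trans (G.ι_μ_pr h _)

lemma ι_act_koszulSyzPr_of_lt (n : ℕ) (X : A) {j c : ℕ} (h : c < j) :
    ((G.ι j).app (G.koszulSyz X (n + 1)).A ≫ (G.koszulSyz X (n + 1)).a) ≫
      G.koszulSyzPr n c X = 0 := by
  rw [← cancel_mono (G.koszulCyclesι n c X), Category.assoc, koszulSyzPr_ι, zero_comp]
  have h1 := congr_arg (fun a => a ≫ G.pr c _) (G.ι_act_koszulSyz n j X)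
  refine (Category.assoc _ _ _).symm.trans (h1.trans ?_)
  refine (Category.assoc _ _ _).trans ?_
  refine (congr_arg (fun a => (G.pc j).map (G.koszulSyzι n X).f ≫ a)
    ((Category.assoc _ _ _).trans (G.ι_μ_pr_of_lt h _))).trans comp_zero

lemma ι_zero_act (M : G.total.Algebra) : (G.ι 0).app M.A ≫ M.a = (inv G.one).app M.A := by
  have h2 : (inv G.one).app M.A ≫ G.one.app M.A = 𝟙 _ := by
    rw [← NatTrans.comp_app, IsIso.inv_hom_id, NatTrans.id_app]
  have h : G.one.app M.A ≫ (G.ι 0).app M.A ≫ M.a = 𝟙 _ := by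
    rw [← Category.assoc, one_ι]
    exact M.unit
  rw [← Category.comp_id ((inv G.one).app _), ← h, reassoc_of% h2]

lemma koszulSyzPr_trivial (n a : ℕ) (X : A) (H : ∀ a' < a, Epi (G.toKoszulCycles n a' X))
    {N : A} (f : G.koszulCycles n (a + 1) X ⟶ N) (hf : G.toKoszulCycles n a X ≫ f = 0) :
    (G.koszulSyz X (n + 1)).a ≫ G.koszulSyzPr n (a + 1) X ≫ f =
      trivialAction G.aug _ ≫ G.koszulSyzPr n (a + 1) X ≫ f := by
  refine G.total_hom_ext fun j => ?_
  rcases j with _ | j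
  · refine (Category.assoc _ _ _).symm.trans ?_
    refine Eq.trans ?_ (Category.assoc _ _ _)
    exact congr_arg (fun x => x ≫ G.koszulSyzPr n (a + 1) X ≫ f)
      ((G.ι_zero_act (G.koszulSyz X (n + 1))).trans (G.ι_aug_zero _).symm)
  · rw [← Category.assoc ((G.ι (j + 1)).app _) (trivialAction G.aug _), ι_aug_succ, zero_comp,
      ← Category.assoc, ← Category.assoc]
    rcases lt_trichotomy j a with h | h | h
    · obtain ⟨d, rfl⟩ := Nat.exists_eq_add_of_lt h
      have := H d (by omega)
      have h2 : G.actKoszulCycles n X (show j + 1 + (d + 1) = j + d + 1 + 1 by omega) ≫ f = 0 := by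
        have : Epi ((G.pc (j + 1)).map (G.toKoszulCycles n d X)) := inferInstance
        rw [← cancel_epi ((G.pc (j + 1)).map (G.toKoszulCycles n d X)), ← Category.assoc,
          map_toKoszulCycles_act, comp_zero]
        exact (Category.assoc _ _ _).trans ((congr_arg (fun x => _ ≫ x) hf).trans comp_zero)
      rw [G.ι_act_koszulSyzPr n X (show j + 1 + (d + 1) = j + d + 1 + 1 by omega),
        Category.assoc, h2, comp_zero]
    · subst h
      rw [G.ι_act_koszulSyzPr n X (add_zero (j + 1)), koszulSyzPr_zero, Functor.map_zero, zero_comp,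
        zero_comp]
    · rw [G.ι_act_koszulSyzPr_of_lt n X (by omega), zero_comp]

lemma _root_.Koszul.Resolves.comp_sub_eq_zero {T : Monad A} [PreservesFiniteColimits (T : A ⥤ A)]
    {M Z N : T.Algebra} {n : ℕ} {k : Z ⟶ syz M n} {ξ} (hξ : Resolves k ξ) (c : Z ⟶ N)
    (c' : syz M n ⟶ N) (h : extOf c' = ξ.comp (Abelian.Ext.mk₀ c) (add_zero n)) :
    ξ.comp (Abelian.Ext.mk₀ (c - k ≫ c')) (add_zero n) = 0 := by
  have h2 : ξ.comp (Abelian.Ext.mk₀ (k ≫ c')) (add_zero n) = extOf c' := by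
    refine (congr_arg (fun z => ξ.comp z (add_zero n)) (Abelian.Ext.mk₀_comp_mk₀ k c').symm).trans ?_
    refine (Abelian.Ext.comp_assoc_of_third_deg_zero _ _ _ _).symm.trans ?_
    exact congr_arg (fun z => z.comp (Abelian.Ext.mk₀ c') (add_zero n)) hξ.comp_eq
  have h3 : c = (c - k ≫ c') + k ≫ c' := by rw [sub_add_cancel]
  have h4 := congr_arg (fun x => ξ.comp (Abelian.Ext.mk₀ x) (add_zero n)) h3
  rw [Abelian.Ext.mk₀_add, Abelian.Ext.comp_add, h2, h] at h4
  exact add_eq_right.1 h4.symm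

lemma factorsWord_koszulIncl (M : G.total.Algebra) :
    ∀ n, FactorsWord G.ι M n n (G.koszulIncl M n)
  | 0 => FactorsWord.zero _ _
  | n + 1 => (factorsWord_koszulIncl M n).cons G.ι (by omega) (G.i (n + 1) M.A)

lemma cycle_barDiff (n : ℕ) (X : A) {Z : A} (z : Z ⟶ (G.koszulSyz X (n + 1)).A) :
    (z ≫ (G.koszulSyzToSyz X (n + 1)).1.f) ≫ barDiff G.aug X n = 0 := by
  have h : (G.koszulSyzToSyz X (n + 1)).1.f ≫ (stage ((trivialModule G.aug).obj X) n).bd =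
      (G.koszulSyzι n X).f ≫ G.total.map (G.koszulIncl ((trivialModule G.aug).obj X) n) :=
    congr_arg (fun a => a.f) (G.koszulSyzToSyz_ι n X)
  have h2 : (G.koszulSyzι n X).f ≫ G.total.map (G.koszulIncl ((trivialModule G.aug).obj X) n) ≫
      trivialAction G.aug _ = 0 := by
    have h3 := ε_naturality G.aug (G.koszulIncl ((trivialModule G.aug).obj X) n)
    refine (congr_arg (fun a => (G.koszulSyzι n X).f ≫ a) h3).trans ?_
    have h4 := congr_arg (fun a => a ≫ G.koszulIncl ((trivialModule G.aug).obj X) n)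
      (G.koszulSyzι_f_aug n X)
    exact (Category.assoc _ _ _).symm.trans (h4.trans zero_comp)
  have h5 := congr_arg (fun a => z ≫ a ≫ trivialAction G.aug _) h
  refine (Category.assoc _ _ _).trans ?_
  refine (congr_arg (fun a => z ≫ a) (Category.assoc _ _ _).symm).trans ?_
  refine h5.trans ?_
  refine (congr_arg (fun a => z ≫ a) ((Category.assoc _ _ _).trans h2)).trans comp_zero

lemma koszulSyzToSyz_f (n : ℕ) (X : A) {Z : A} (z : Z ⟶ (G.koszulSyz X (n + 1)).A) {b : ℕ}
    (y : Z ⟶ (G.pc b).obj ((G.U (n + 1)).obj X))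
    (h : z ≫ (G.koszulSyzι n X).f = y ≫ (G.ι b).app _) :
    z ≫ (G.koszulSyzToSyz X (n + 1)).1.f =
      y ≫ (G.pc b).map (G.koszulIncl ((trivialModule G.aug).obj X) n) ≫ (G.ι b).app _ ≫
        (plusπ G.total).app _ := by
  have h1 : (G.koszulSyzToSyz X (n + 1)).1.f =
      ((G.koszulSyzι n X).f ≫ G.total.map (G.koszulIncl ((trivialModule G.aug).obj X) n)) ≫
        (plusπ G.total).app _ := syzLift_f (M := (trivialModule G.aug).obj X) _ _
  have h2 := G.ι_naturality b (G.koszulIncl ((trivialModule G.aug).obj X) n)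
  have h3 := congr_arg (fun a => a ≫ G.total.map (G.koszulIncl ((trivialModule G.aug).obj X) n) ≫
    (plusπ G.total).app _) h
  have h4 := congr_arg (fun a => y ≫ a ≫ (plusπ G.total).app _) h2
  refine (congr_arg (fun a => z ≫ a) (h1.trans (Category.assoc _ _ _))).trans ?_
  refine (Category.assoc _ _ _).symm.trans (h3.trans ?_)
  refine (Category.assoc _ _ _).trans ?_
  refine (congr_arg (fun a => y ≫ a) (Category.assoc _ _ _).symm).trans (h4.trans ?_)
  exact congr_arg (fun a => y ≫ a) (Category.assoc _ _ _)

variable {G}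

lemma epi_toKoszulCycles [G.ProjComponents] {W : ObjectProperty A}
    (hG : G.IsKoszul W) {Q : A} (hQ : W Q) (hp : Projective Q) (n : ℕ)
    (H : ∀ m < n, G.KoszulExactAt Q m) (a : ℕ) : Epi (G.toKoszulCycles n a Q) := by
  induction a using Nat.strong_induction_on with
  | _ a ih =>
  rcases a with _ | a
  · exact G.epi_toKoszulCycles_zero n Q
  set f := cokernel.π (G.toKoszulCycles n (a + 1) Q) with hf
  suffices f = 0 by exact Preadditive.epi_of_cokernel_zero this
  let M := (trivialModule G.aug).obj Q
  let c : G.koszulSyz Q (n + 1) ⟶ (trivialModule G.aug).obj (cokernel (G.toKoszulCycles n (a + 1) Q)) :=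
    { f := G.koszulSyzPr n (a + 2) Q ≫ f
      h := (ε_naturality G.aug _).trans
        (G.koszulSyzPr_trivial n (a + 1) Q ih f (cokernel.condition _)).symm }
  obtain ⟨ξ, hξ⟩ := exists_resolves hp n fun m hm => H m (by omega)
  have hS := koszulSyzComplex_shortExact (G := G) (X := Q) n fun m hm => H m (by omega)
  have hU := projective_U hp n H
  have hξ' := hξ.next hS (G.koszulSyzComplexHom Q n) (projective_free _)
  obtain ⟨c', hc', he⟩ := exists_cocycleHom G.aug (M := M) hp
    ((ξ.comp hS.extClass rfl).comp (Abelian.Ext.mk₀ c) (add_zero (n + 1)))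
  set k := (G.koszulSyzToSyz Q (n + 1)).1 with hk
  have h1 := hξ'.comp_sub_eq_zero c (cocycleHom G.aug c' hc') he
  obtain ⟨u, hu⟩ := hξ.factors hS _ h1
  have h5 : c.f = k.f ≫ c' := by
    have h6 : u.f = trivialAction G.aug _ ≫ G.total.η.app _ ≫ u.f := eq_ε_of_free G.aug u.f u.h
    have h7 : (G.koszulSyzι n Q).f ≫ u.f = 0 := by
      rw [h6]
      exact (Category.assoc _ _ _).symm.trans
        ((congr_arg (fun x => x ≫ _) (G.koszulSyzι_f_aug n Q)).trans zero_comp)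
    have h8 : c - k ≫ cocycleHom G.aug c' hc' = 0 := by
      refine hu.trans ?_
      ext
      exact h7
    exact congr_arg (fun x => x.f) (sub_eq_zero.1 h8)
  obtain ⟨j, hj⟩ := G.exists_map_koszulSyz
    (G.koszulCyclesι n (a + 2) Q ≫ (G.ι (a + 2)).app ((G.U (n + 1)).obj Q))
    (by rw [Category.assoc, G.ι_koszulD rfl, ← Category.assoc, koszulCyclesι_κ, zero_comp])
    (by rw [Category.assoc, G.ι_pr_of_ne (by omega), comp_zero])
  have h9 : j ≫ c.f = f := by
    have h10 : j ≫ G.koszulSyzPr n (a + 2) Q = 𝟙 _ := by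
      refine (cancel_mono (G.koszulCyclesι n (a + 2) Q)).1 ((Category.assoc _ _ _).trans ?_)
      refine (congr_arg (fun x => j ≫ x) (G.koszulSyzPr_ι n (a + 2) Q)).trans ?_
      refine (Category.assoc _ _ _).symm.trans ?_
      refine (congr_arg (fun x => x ≫ _) hj).trans ?_
      refine (Category.assoc _ _ _).trans ?_
      refine (congr_arg (fun x => _ ≫ x) (G.ι_pr _ _)).trans ?_
      exact (Category.comp_id _).trans (Category.id_comp _).symm
    exact (Category.assoc _ _ _).symm.trans ((congr_arg (fun x => x ≫ f) h10).trans
      (Category.id_comp f))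
  have h11 : (weightSubobject G.ι M (n + 1) (n + (a + 2))).Factors (j ≫ k.f) := by
    refine FactorsWord.factors G.ι ?_
    exact (G.koszulSyzToSyz_f n Q j _ hj).symm ▸
      (G.factorsWord_koszulIncl M n).cons G.ι (by omega) _
  have h12 : (barCycles G.aug Q (n + 1)).Factors (j ≫ k.f) :=
    (kernelSubobject_factors_iff _ _).2 (G.cycle_barDiff n Q j)
  have h13 := Subobject.factors_of_le _ (hG.homology Q hQ (n + 1) (n + (a + 2)) (by omega))
    ((Subobject.inf_factors _).2 ⟨h12, h11⟩)
  have h14 := eq_zero_of_imageSubobject_factors _ _ h13 c' ((Category.assoc _ _ _).trans hc')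
  rw [← h9, h5]
  exact (Category.assoc _ _ _).symm.trans h14

lemma koszulExactAt_of_isKoszul [G.ProjComponents] {W : ObjectProperty A}
    (hG : G.IsKoszul W) {Q : A} (hQ : W Q) (hp : Projective Q) (n : ℕ) : G.KoszulExactAt Q n := by
  induction n using Nat.strong_induction_on with
  | _ n ih =>
  refine koszulExactAt_of_lift n (projective_U hp n ih) (fun m hm => ih m (by omega)) ?_
  intro a b c h h' Z _ x hx
  subst h h'
  have : Epi (G.toKoszulCycles n a Q) := epi_toKoszulCycles hG hQ hp n ih a
  let y : Z ⟶ G.koszulCycles n (a + 1) Q := kernel.lift (G.κ rfl n Q) x hx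
  have h1 : y ≫ G.koszulCyclesι n (a + 1) Q = x := kernel.lift_ι _ _ _
  refine ⟨Projective.factorThru y (G.toKoszulCycles n a Q), ?_⟩
  rw [← toKoszulCycles_ι, ← Category.assoc, Projective.factorThru_comp]
  exact h1

end GradedAlgebra

namespace GradedAlgebra

variable {A : Type u} [Category.{v} A] [Abelian A] [HasCountableCoproducts A] {B G : GradedAlgebra.{w} A}

lemma U_zero_hom_ext (X : A) {Z : A} (f g : (G.U 0).obj X ⟶ Z) : f = g :=
  (G.quad.U_zero_isZero X).eq_of_src _ _

lemma map_U_zero_hom_ext (F : A ⥤ A) [F.Additive] (X : A) {Z : A} (f g : Z ⟶ F.obj ((G.U 0).obj X)) :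
    f = g :=
  (F.map_isZero (G.quad.U_zero_isZero X)).eq_of_tgt _ _

section Hom

variable (φ : Hom B G)

lemma Hom.naturality (n : ℕ) {X Y : A} (f : X ⟶ Y) :
    (B.pc n).map f ≫ (φ.app n).app Y = (φ.app n).app X ≫ (G.pc n).map f :=
  (φ.app n).naturality f

/-- The map of Koszul duals induced by a homomorphism, in two consecutive degrees. -/
noncomputable def homUAux (X : A) : ∀ n,
    {p : ((B.U n).obj X ⟶ (G.U n).obj X) × ((B.U (n + 1)).obj X ⟶ (G.U (n + 1)).obj X) //
      p.2 ≫ G.i n X = B.i n X ≫ (φ.app 1).app _ ≫ (G.pc 1).map p.1}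
  | 0 => ⟨⟨0, 𝟙 X⟩, map_U_zero_hom_ext _ _ _ _⟩
  | n + 1 =>
    let p := homUAux X n
    have h := G.exists_i_lift n (B.i (n + 1) X ≫ (φ.app 1).app _ ≫ (G.pc 1).map p.1.2) (by
      have h1 := φ.mul (rfl : 1 + 1 = 2) ((B.U n).obj X)
      rw [κ, Category.assoc, Category.assoc, ← Functor.map_comp_assoc, p.2, Functor.map_comp,
        Functor.map_comp]
      simp only [Category.assoc]
      rw [mul_naturality, ← reassoc_of% (φ.naturality 1 (B.i n X)),
        ← reassoc_of% (φ.naturality 1 ((φ.app 1).app ((B.U n).obj X))), ← reassoc_of% h1]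
      have h2 := B.i_κ n X
      rw [κ] at h2
      rw [reassoc_of% h2, zero_comp])
    ⟨⟨p.1.2, h.choose⟩, h.choose_spec⟩

/-- The map of Koszul duals induced by a homomorphism of graded algebras. -/
noncomputable def homU (n : ℕ) (X : A) : (B.U n).obj X ⟶ (G.U n).obj X := (homUAux φ X n).1.1

lemma homU_i (n : ℕ) (X : A) : homU φ (n + 1) X ≫ G.i n X =
    B.i n X ≫ (φ.app 1).app _ ≫ (G.pc 1).map (homU φ n X) := (homUAux φ X n).2

lemma homU_naturality {X Y : A} (f : X ⟶ Y) : ∀ n,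
    (B.U n).map f ≫ homU φ n Y = homU φ n X ≫ (G.U n).map f
  | 0 => U_zero_hom_ext _ _ _
  | 1 => (Category.comp_id _).trans (Category.id_comp _).symm
  | n + 2 => by
    rw [← cancel_mono (G.i (n + 1) Y), Category.assoc, Category.assoc, homU_i, i_naturality,
      reassoc_of% (B.i_naturality (n + 1) f), reassoc_of% (homU_i φ (n + 1) X),
      reassoc_of% (φ.naturality 1 ((B.U (n + 1)).map f)), ← Functor.map_comp, ← Functor.map_comp,
      homU_naturality f (n + 1)]

lemma homU_κ {a b : ℕ} (h : a + 1 = b) (n : ℕ) (X : A) :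
    B.κ h n X ≫ (φ.app b).app _ ≫ (G.pc b).map (homU φ n X) =
      ((φ.app a).app _ ≫ (G.pc a).map (homU φ (n + 1) X)) ≫ G.κ h n X := by
  rw [κ, κ, Category.assoc, Category.assoc, ← Functor.map_comp_assoc, homU_i,
    reassoc_of% (φ.mul h), Functor.map_comp, Functor.map_comp, ← mul_naturality]
  simp only [Category.assoc]
  rw [← reassoc_of% (φ.naturality a (B.i n X)),
    ← reassoc_of% (φ.naturality a ((φ.app 1).app ((B.U n).obj X)))]

end Hom

/-- A central element of degree one of a graded algebra `B`, together with a homomorphism to a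
graded algebra `G` which exhibits `G` as the quotient by this element. -/
structure CentralQuotient (B G : GradedAlgebra.{w} A) where
  π : Hom B G
  t : ∀ X, X ⟶ (B.pc 1).obj X
  t_naturality : ∀ {X Y : A} (f : X ⟶ Y), f ≫ t Y = t X ≫ (B.pc 1).map f
  central : ∀ X, t ((B.pc 1).obj X) ≫ (B.mul (rfl : 1 + 1 = 2)).app X =
    (B.pc 1).map (t X) ≫ (B.mul (rfl : 1 + 1 = 2)).app X
  t_π : ∀ X, t X ≫ (π.app 1).app X = 0
  mono : ∀ {a b : ℕ} (h : a + 1 = b) (X : A), Projective X →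
    Mono ((B.pc a).map (t X) ≫ (B.mul h).app X)
  lift : ∀ {a b : ℕ} (h : a + 1 = b) (X : A), Projective X → ∀ {Z : A} (x : Z ⟶ (B.pc b).obj X),
    x ≫ (π.app b).app X = 0 → ∃ y, y ≫ (B.pc a).map (t X) ≫ (B.mul h).app X = x
  exists_section : ∀ (b : ℕ) (X : A), Projective X → ∃ s, s ≫ (π.app b).app X = 𝟙 _

namespace CentralQuotient

variable (D : CentralQuotient B G)

/-- The multiplication by the central element. -/
noncomputable def τ {a b : ℕ} (h : a + 1 = b) (X : A) : (B.pc a).obj X ⟶ (B.pc b).obj X :=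
  (B.pc a).map (D.t X) ≫ (B.mul h).app X

lemma τ_naturality {a b : ℕ} (h : a + 1 = b) {X Y : A} (f : X ⟶ Y) :
    (B.pc a).map f ≫ D.τ h Y = D.τ h X ≫ (B.pc b).map f := by
  rw [τ, τ, ← Functor.map_comp_assoc, t_naturality, Functor.map_comp_assoc, mul_naturality,
    Category.assoc]

lemma τ_π {a b : ℕ} (h : a + 1 = b) (X : A) : D.τ h X ≫ (D.π.app b).app X = 0 := by
  rw [τ, Category.assoc, D.π.mul h, ← Functor.map_comp_assoc, t_π, Functor.map_zero, zero_comp]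

/-- The map of degree one of the Koszul dual given by the central element, in two consecutive
degrees. -/
noncomputable def σAux (X : A) : ∀ n,
    {p : ((B.U n).obj X ⟶ (B.U (n + 1)).obj X) × ((B.U (n + 1)).obj X ⟶ (B.U (n + 2)).obj X) //
      p.2 ≫ B.i (n + 1) X = D.t ((B.U (n + 1)).obj X) - B.i n X ≫ (B.pc 1).map p.1}
  | 0 =>
    have h := B.exists_i_lift 0 (D.t ((B.U 1).obj X)) (map_U_zero_hom_ext _ _ _ _)
    ⟨⟨0, h.choose⟩, by
      refine h.choose_spec.trans ?_
      rw [Functor.map_zero, comp_zero]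
      exact (sub_zero _).symm⟩
  | n + 1 =>
    let p := σAux X n
    have h := B.exists_i_lift (n + 1)
      (D.t ((B.U (n + 2)).obj X) - B.i (n + 1) X ≫ (B.pc 1).map p.1.2) (by
      have h2 := B.i_κ n X
      have h1 : (B.pc 1).map p.1.2 ≫ B.κ (rfl : 1 + 1 = 2) (n + 1) X =
          D.τ (rfl : 1 + 1 = 2) _ - B.κ (rfl : 1 + 1 = 2) n X ≫ (B.pc 2).map p.1.1 := by
        rw [κ, ← Functor.map_comp_assoc, p.2, Functor.map_sub, Preadditive.sub_comp,
          Functor.map_comp, Category.assoc, mul_naturality, κ, Category.assoc]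
        rfl
      rw [Preadditive.sub_comp, Category.assoc, h1, Preadditive.comp_sub, reassoc_of% h2,
        zero_comp, sub_zero, κ, ← Category.assoc, ← t_naturality, Category.assoc, D.central,
        sub_eq_zero]
      rfl)
    ⟨⟨p.1.2, h.choose⟩, h.choose_spec⟩

/-- The map of degree one of the Koszul dual given by the central element. -/
noncomputable def σ (n : ℕ) (X : A) : (B.U n).obj X ⟶ (B.U (n + 1)).obj X := (D.σAux X n).1.1

lemma σ_i (n : ℕ) (X : A) : D.σ (n + 1) X ≫ B.i (n + 1) X =
    D.t ((B.U (n + 1)).obj X) - B.i n X ≫ (B.pc 1).map (D.σ n X) := (D.σAux X n).2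

lemma map_σ_κ {a b : ℕ} (h : a + 1 = b) (n : ℕ) (X : A) :
    (B.pc a).map (D.σ (n + 1) X) ≫ B.κ h (n + 1) X =
      D.τ h _ - B.κ h n X ≫ (B.pc b).map (D.σ n X) := by
  rw [κ, ← Functor.map_comp_assoc, σ_i, Functor.map_sub, Preadditive.sub_comp,
    Functor.map_comp, Category.assoc, mul_naturality, κ, Category.assoc]
  rfl

lemma σ_naturality {X Y : A} (f : X ⟶ Y) : ∀ n,
    (B.U n).map f ≫ D.σ n Y = D.σ n X ≫ (B.U (n + 1)).map f
  | 0 => U_zero_hom_ext _ _ _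
  | n + 1 => by
    rw [← cancel_mono (B.i (n + 1) Y), Category.assoc, Category.assoc, σ_i, i_naturality,
      ← Category.assoc, σ_i, Preadditive.comp_sub, Preadditive.sub_comp, t_naturality,
      ← Category.assoc, i_naturality, Category.assoc, Category.assoc, ← Functor.map_comp,
      ← Functor.map_comp, σ_naturality f n]

lemma σ_σ (X : A) : ∀ n, D.σ n X ≫ D.σ (n + 1) X = 0
  | 0 => U_zero_hom_ext _ _ _
  | n + 1 => by
    rw [← cancel_mono (B.i (n + 2) X), Category.assoc, σ_i, Preadditive.comp_sub, ← Category.assoc,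
      σ_i, Preadditive.sub_comp, t_naturality, Category.assoc, ← Functor.map_comp, σ_σ X n,
      Functor.map_zero, comp_zero, sub_zero, sub_self, zero_comp]

lemma σ_π (X : A) : ∀ n, D.σ n X ≫ homU D.π (n + 1) X = 0
  | 0 => U_zero_hom_ext _ _ _
  | n + 1 => by
    rw [← cancel_mono (G.i (n + 1) X), Category.assoc, homU_i, ← Category.assoc, σ_i,
      Preadditive.sub_comp, reassoc_of% (D.t_π), zero_comp, Category.assoc,
      reassoc_of% (D.π.naturality 1 (D.σ n X)), ← Functor.map_comp, σ_π X n, Functor.map_zero,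
      comp_zero, comp_zero, sub_zero, zero_comp]

variable {X : A}

instance mono_τ {a b : ℕ} (h : a + 1 = b) (X : A) [Projective X] : Mono (D.τ h X) :=
  D.mono h X inferInstance

lemma eq_zero_of_τ {n a b : ℕ} (h : a + 1 = b) (hG : Projective ((G.U n).obj X)) {Z : A}
    (v : Z ⟶ (B.pc a).obj ((B.U n).obj X))
    (hv : v ≫ D.τ h _ ≫ (B.pc b).map (homU D.π n X) = 0) : v ≫ (B.pc a).map (homU D.π n X) = 0 := by
  rw [← cancel_mono (D.τ h ((G.U n).obj X)), Category.assoc, τ_naturality, hv, zero_comp]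

/-- The splitting of the Koszul dual of `B` in one degree. -/
structure SplitAt (D : CentralQuotient B G) (X : A) (n : ℕ) : Prop where
  splitExact : SplitExact (D.σ n X) (homU D.π (n + 1) X)
  exists_section : ∃ s, s ≫ homU D.π (n + 1) X = 𝟙 _
  projective : Projective ((G.U n).obj X)

lemma SplitAt.eq_zero {n : ℕ} (H : D.SplitAt X n) (H' : ∀ m, m + 1 = n → D.SplitAt X m) {b c : ℕ}
    (h : b + 1 = c) {Z : A} (x : Z ⟶ (B.pc b).obj ((B.U (n + 1)).obj X)) (hx : x ≫ B.κ h n X = 0)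
    (hx' : x ≫ (B.pc b).map (homU D.π (n + 1) X) = 0) : x = 0 := by
  obtain ⟨v, rfl⟩ := (H.splitExact.map (B.pc b)).lift x hx'
  cases n with
  | zero =>
    rw [map_U_zero_hom_ext (B.pc b) X v 0, zero_comp]
  | succ n =>
    have h1 : v ≫ (B.pc b).map (homU D.π (n + 1) X) = 0 := by
      refine D.eq_zero_of_τ h H.projective v ?_
      rw [Category.assoc, map_σ_κ, Preadditive.comp_sub, sub_eq_zero] at hx
      rw [← Category.assoc, hx, Category.assoc, Category.assoc, ← Functor.map_comp, σ_π,
        Functor.map_zero, comp_zero, comp_zero]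
    obtain ⟨z, rfl⟩ := ((H' n rfl).splitExact.map (B.pc b)).lift v h1
    rw [Category.assoc, ← Functor.map_comp, σ_σ, Functor.map_zero, comp_zero]

lemma SplitAt.exists_comp_π {n : ℕ} (H : D.SplitAt X n) (b : ℕ)
    (hG : Projective ((G.U (n + 1)).obj X)) {Z : A} (x : Z ⟶ (G.pc b).obj ((G.U (n + 1)).obj X)) :
    ∃ y, y ≫ (D.π.app b).app _ ≫ (G.pc b).map (homU D.π (n + 1) X) = x := by
  obtain ⟨s, hs⟩ := H.exists_section
  obtain ⟨s', hs'⟩ := D.exists_section b _ hG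
  refine ⟨x ≫ s' ≫ (B.pc b).map s, ?_⟩
  rw [Category.assoc, Category.assoc, reassoc_of% (D.π.naturality b s), ← Functor.map_comp, hs,
    (G.pc b).map_id, Category.comp_id, hs', Category.comp_id]

lemma SplitAt.exists_κ {n : ℕ} (H : D.SplitAt X n) (H' : ∀ m, m + 1 = n → D.SplitAt X m)
    (hG : Projective ((G.U (n + 1)).obj X)) {a b c : ℕ} (h : a + 1 = b)
    (h' : b + 1 = c) {Z : A} (x : Z ⟶ (B.pc b).obj ((B.U (n + 1)).obj X))
    (hx : x ≫ (D.π.app b).app _ ≫ (G.pc b).map (homU D.π (n + 1) X) = 0)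
    (hx' : x ≫ B.κ h' n X = 0) :
    ∃ w, w ≫ (B.pc a).map (D.σ (n + 1) X) ≫ B.κ h (n + 1) X = x := by
  obtain ⟨s, hs⟩ := H.exists_section
  rw [← D.π.naturality, ← Category.assoc] at hx
  obtain ⟨w, hw⟩ := D.lift h _ hG _ hx
  refine ⟨w ≫ (B.pc a).map s, ?_⟩
  rw [← sub_eq_zero]
  refine H.eq_zero D H' h' _ ?_ ?_
  · rw [Preadditive.sub_comp, hx', sub_zero]
    simp only [Category.assoc]
    rw [κ_κ, comp_zero, comp_zero, comp_zero]
  · have h1 : (B.pc a).map s ≫ D.τ h _ ≫ (B.pc b).map (homU D.π (n + 1) X) = D.τ h _ := by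
      rw [← τ_naturality, ← Functor.map_comp_assoc, hs, (B.pc a).map_id, Category.id_comp]
    rw [Preadditive.sub_comp, ← hw, map_σ_κ]
    simp only [Category.assoc, Preadditive.comp_sub, Preadditive.sub_comp]
    rw [h1, ← Functor.map_comp, σ_π, Functor.map_zero, comp_zero, comp_zero, comp_zero, sub_zero]
    exact sub_self _

lemma splitAt_zero (X : A) : D.SplitAt X 0 where
  splitExact := ⟨D.σ_π X 0, 0, 𝟙 _, (congr_arg (fun a => a + _) zero_comp).trans
    ((zero_add _).trans (Category.comp_id (𝟙 X)))⟩
  exists_section := ⟨𝟙 _, Category.comp_id _⟩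
  projective := ⟨fun _ _ _ => ⟨0, U_zero_hom_ext _ _ _⟩⟩

lemma splitAt_succ {n : ℕ} (K : ∀ m ≤ n, D.SplitAt X m) (hG : Projective ((G.U (n + 1)).obj X)) :
    D.SplitAt X (n + 1) := by
  have H := K n le_rfl
  have H' : ∀ m, m + 1 = n → D.SplitAt X m := fun m hm => K m (by omega)
  have hs : ∃ s, s ≫ homU D.π (n + 2) X = 𝟙 _ := by
    obtain ⟨u, hu⟩ := H.exists_comp_π D 1 hG (G.i (n + 1) X)
    have h1 : u ≫ B.κ (rfl : 1 + 1 = 2) n X ≫ (D.π.app 2).app _ ≫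
        (G.pc 2).map (homU D.π n X) = 0 := by
      rw [homU_κ, ← Category.assoc, hu, i_κ]
    have h2 : ∃ z, u ≫ B.κ (rfl : 1 + 1 = 2) n X =
        z ≫ (B.pc 1).map (D.σ n X) ≫ B.κ (rfl : 1 + 1 = 2) n X := by
      cases n with
      | zero => exact ⟨0, map_U_zero_hom_ext _ _ _ _⟩
      | succ n =>
        obtain ⟨w, hw⟩ := (H' n rfl).exists_κ D (fun m hm => K m (by omega)) H.projective (rfl : 1 + 1 = 2) rfl _ ((Category.assoc _ _ _).trans h1)
          (by rw [Category.assoc, κ_κ, comp_zero])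
        exact ⟨w, hw.symm⟩
    obtain ⟨z, hz⟩ := h2
    obtain ⟨y, hy⟩ := B.exists_i_lift n (u - z ≫ (B.pc 1).map (D.σ n X)) (by
      rw [Preadditive.sub_comp, hz, Category.assoc, sub_self])
    refine ⟨y, ?_⟩
    rw [← cancel_mono (G.i (n + 1) X), Category.assoc, homU_i, ← Category.assoc, hy,
      Preadditive.sub_comp, hu, Category.assoc, reassoc_of% (D.π.naturality 1 (D.σ n X)),
      ← Functor.map_comp, σ_π, Functor.map_zero, comp_zero, comp_zero, sub_zero, Category.id_comp]
  obtain ⟨s, hs⟩ := hs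
  refine ⟨⟨D.σ_π X _, ?_⟩, ⟨s, hs⟩, hG⟩
  obtain ⟨w, hw⟩ := D.lift (zero_add 1) _ hG
    ((𝟙 _ - homU D.π (n + 2) X ≫ s) ≫ B.i (n + 1) X ≫ (B.pc 1).map (homU D.π (n + 1) X)) (by
      simp only [Category.assoc]
      rw [D.π.naturality, ← homU_i, Preadditive.sub_comp, Category.id_comp, Category.assoc,
        reassoc_of% hs, sub_self])
  obtain ⟨s', hs'⟩ := H.exists_section
  have ht : ∀ Y : A, D.τ (zero_add 1) Y = (inv B.one).app Y ≫ D.t Y := fun Y => by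
    have h := (inv B.one).naturality (D.t Y)
    dsimp at h
    rw [τ, one_mul', h]
  refine ⟨w ≫ (inv B.one).app _ ≫ s', s, ?_⟩
  have key : (𝟙 _ - homU D.π (n + 2) X ≫ s) ≫ B.i (n + 1) X =
      (w ≫ (inv B.one).app _ ≫ s') ≫ D.σ (n + 1) X ≫ B.i (n + 1) X := by
    rw [← sub_eq_zero]
    refine H.eq_zero D H' (rfl : 1 + 1 = 2) _ ?_ ?_
    · rw [Preadditive.sub_comp]
      simp only [Category.assoc]
      rw [i_κ]
      simp only [comp_zero, sub_zero]
    · rw [Preadditive.sub_comp, Category.assoc, ← hw, σ_i]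
      simp only [Category.assoc, Preadditive.comp_sub, Preadditive.sub_comp]
      rw [← D.t_naturality, reassoc_of% hs', ← Functor.map_comp, σ_π, Functor.map_zero]
      simp only [comp_zero, sub_zero]
      rw [sub_eq_zero]
      exact congr_arg (fun a => w ≫ a) (ht _)
  have key2 : (𝟙 _ - homU D.π (n + 2) X ≫ s) = (w ≫ (inv B.one).app _ ≫ s') ≫ D.σ (n + 1) X := by
    rw [← cancel_mono (B.i (n + 1) X), key]
    exact (Category.assoc _ _ _).symm
  rw [← key2, sub_add_cancel]

lemma splitAt (hG : ∀ m, Projective ((G.U (m + 1)).obj X)) (n : ℕ) : D.SplitAt X n := by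
  induction n using Nat.strong_induction_on with
  | _ n ih =>
    cases n with
    | zero => exact D.splitAt_zero X
    | succ n => exact D.splitAt_succ (fun m hm => ih m (by omega)) (hG n)

lemma projective_of_splitExact {X Y Z : A} {f : X ⟶ Y} {g : Y ⟶ Z} (h : SplitExact f g)
    [Projective X] [Projective Z] : Projective Y := by
  obtain ⟨h0, e, s, h1⟩ := h
  refine ⟨fun k p hp => ?_⟩
  refine ⟨e ≫ Projective.factorThru (f ≫ k) p + g ≫ Projective.factorThru (s ≫ k) p, ?_⟩
  rw [Preadditive.add_comp, Category.assoc, Category.assoc, Projective.factorThru_comp,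
    Projective.factorThru_comp, ← Category.assoc, ← Category.assoc, ← Preadditive.add_comp, h1,
    Category.id_comp]

lemma splitExact_τ {a b : ℕ} (h : a + 1 = b) (X : A) (hX : Projective X) :
    SplitExact (D.τ h X) ((D.π.app b).app X) := by
  obtain ⟨s, hs⟩ := D.exists_section b X hX
  obtain ⟨e, he⟩ := D.lift h X hX (𝟙 _ - (D.π.app b).app X ≫ s) (by
    rw [Preadditive.sub_comp, Category.assoc, hs, Category.comp_id, Category.id_comp, sub_self])
  refine ⟨D.τ_π h X, e, s, ?_⟩
  rw [τ, he, sub_add_cancel]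

include D in
lemma projComponents [G.ProjComponents] : B.ProjComponents where
  proj n X hX := by
    induction n with
    | zero =>
      have : (inv B.one).app X ≫ B.one.app X = 𝟙 _ := by
        rw [← NatTrans.comp_app, IsIso.inv_hom_id, NatTrans.id_app]
      have : Projective ((𝟭 A).obj X) := hX
      exact Retract.projective { i := (inv B.one).app X, r := B.one.app X, retract := by assumption }
    | succ n ih =>
      have := ProjComponents.proj (G := G) (n + 1) X hX
      exact projective_of_splitExact (D.splitExact_τ rfl X hX)

include D in
lemma koszulExactAt [G.ProjComponents] (hX : Projective X) (H : ∀ n, G.KoszulExactAt X n) (n : ℕ) :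
    B.KoszulExactAt X n := by
  have hG : ∀ m, Projective ((G.U (m + 1)).obj X) := fun m => projective_U hX m fun m _ => H m
  have hS := D.splitAt hG
  have := D.projComponents
  induction n using Nat.strong_induction_on with
  | _ n ih =>
    refine koszulExactAt_of_lift n (projective_U hX n ih) (fun m hm => ih m (by omega)) ?_
    intro a b c h h' Z _ x hx
    obtain ⟨y, hy⟩ := ((H n).splitExact h h').lift
      (x ≫ (D.π.app b).app _ ≫ (G.pc b).map (homU D.π (n + 1) X)) (by
        have h2 := homU_κ D.π h' n X
        simp only [Category.assoc] at h2 ⊢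
        rw [← h2, reassoc_of% hx, zero_comp])
    obtain ⟨u, hu⟩ := (hS (n + 1)).exists_comp_π D a (hG (n + 1)) y
    obtain ⟨w, hw⟩ := (hS n).exists_κ D (fun m _ => hS m) (hG n) h h' (x - u ≫ B.κ h (n + 1) X) (by
        rw [Preadditive.sub_comp, Category.assoc, homU_κ, ← Category.assoc u, hu, hy, sub_self]) (by
        rw [Preadditive.sub_comp, hx, Category.assoc, κ_κ, comp_zero, sub_zero])
    refine ⟨w ≫ (B.pc a).map (D.σ (n + 1) X) + u, ?_⟩
    rw [Preadditive.add_comp, Category.assoc, hw, sub_add_cancel]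

lemma exact_σ (hX : Projective X) (hG : ∀ m, Projective ((G.U (m + 1)).obj X)) (n : ℕ) {Z : A}
    (x : Z ⟶ (B.U (n + 1)).obj X) (hx : x ≫ D.σ (n + 1) X = 0) :
    x ≫ homU D.π (n + 1) X = 0 := by
  have h1 : x ≫ D.t _ ≫ (B.pc 1).map (homU D.π (n + 1) X) = 0 := by
    have h2 := congr_arg (fun a => a ≫ B.i (n + 1) X ≫ (B.pc 1).map (homU D.π (n + 1) X)) hx
    simp only [Category.assoc, zero_comp] at h2
    rw [← Category.assoc (D.σ _ _), σ_i, Preadditive.sub_comp, Category.assoc, ← Functor.map_comp,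
      σ_π, Functor.map_zero, comp_zero, sub_zero] at h2
    exact h2
  have h3 : Mono (D.t ((G.U (n + 1)).obj X)) := by
    have h4 := D.mono (zero_add 1) _ (hG n)
    have h5 : (B.pc 0).map (D.t ((G.U (n + 1)).obj X)) ≫ (B.mul (zero_add 1)).app _ =
        (inv B.one).app _ ≫ D.t _ := by
      have h := (inv B.one).naturality (D.t ((G.U (n + 1)).obj X))
      dsimp at h
      rw [one_mul', h]
      rfl
    rw [h5] at h4
    have h6 : D.t ((G.U (n + 1)).obj X) = B.one.app _ ≫ (inv B.one).app _ ≫ D.t _ := by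
      rw [← Category.assoc, ← NatTrans.comp_app, IsIso.hom_inv_id, NatTrans.id_app]
      exact (Category.id_comp _).symm
    rw [h6]
    exact mono_comp _ _
  rw [← cancel_mono (D.t ((G.U (n + 1)).obj X)), Category.assoc, D.t_naturality, h1, zero_comp]

end CentralQuotient

end GradedAlgebra

section Covers

variable {A : Type u} [Category.{v} A] [Abelian A] {W : ObjectProperty A} [HasCovers W]

lemma exists_projective_cover (hW : ∀ Q, W Q → Projective Q) (X : A) :
    ∃ (Z : A) (_ : Projective Z) (f : Z ⟶ X), Epi f := by
  obtain ⟨Q, hQ, f, hf⟩ := HasCovers.exists_epi (W := W) X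
  exact ⟨Q, hW Q hQ, f, hf⟩

lemma exists_retract_of_projective {X : A} (hX : Projective X) :
    ∃ Q, W Q ∧ Nonempty (Retract X Q) := by
  obtain ⟨Q, hQ, f, hf⟩ := HasCovers.exists_epi (W := W) X
  exact ⟨Q, hQ, ⟨{ i := Projective.factorThru (𝟙 X) f, r := f, retract := Projective.factorThru_comp _ _ }⟩⟩

lemma isIso_app_of_projective (hW : ∀ Q, W Q → Projective Q) {F F' : A ⥤ A}
    [PreservesFiniteColimits F] [PreservesFiniteColimits F'] (α : F ⟶ F')
    (h : ∀ X, Projective X → IsIso (α.app X)) (X : A) : IsIso (α.app X) := by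
  obtain ⟨Q, hQ, f, hf⟩ := exists_projective_cover hW X
  obtain ⟨Q', hQ', f', hf'⟩ := exists_projective_cover hW (kernel f)
  have : F.Additive := additive_of_preservesFiniteColimits _
  have : F'.Additive := additive_of_preservesFiniteColimits _
  let S : ShortComplex A := ShortComplex.mk (f' ≫ kernel.ι f) f (by simp)
  have hS : S.Exact := by
    let φ : S ⟶ ShortComplex.mk (kernel.ι f) f (kernel.condition f) :=
      { τ₁ := f', τ₂ := 𝟙 _, τ₃ := 𝟙 _ }
    have h1 : Epi φ.τ₁ := hf'
    have h2 : IsIso φ.τ₂ := inferInstanceAs (IsIso (𝟙 _))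
    have h3 : Mono φ.τ₃ := inferInstanceAs (Mono (𝟙 _))
    exact (ShortComplex.exact_iff_of_epi_of_isIso_of_mono φ).2 (ShortComplex.exact_kernel f)
  have h1 : IsIso (α.app Q) := h Q hQ
  have h2 : IsIso (α.app Q') := h Q' hQ'
  have hS1 : (S.map F).Exact := hS.map_of_epi_of_preservesCokernel F hf inferInstance
  have hS2 : (S.map F').Exact := hS.map_of_epi_of_preservesCokernel F' hf inferInstance
  have e1 : Epi (F.map f) := inferInstance
  have e2 : Epi (F'.map f) := inferInstance
  have e1' : Epi (S.map F).g := e1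
  have e2' : Epi (S.map F').g := e2
  have key : F'.map (f' ≫ kernel.ι f) ≫ inv (α.app Q) ≫ F.map f = 0 := by
    rw [← cancel_epi (α.app Q'), ← α.naturality_assoc, IsIso.hom_inv_id_assoc, ← F.map_comp,
      comp_zero]
    simp
  obtain ⟨g, hg⟩ : ∃ g : F'.obj X ⟶ F.obj X, F'.map f ≫ g = inv (α.app Q) ≫ F.map f := by
    generalize inv (α.app Q) ≫ F.map f = k at key
    exact ⟨hS2.desc k key, hS2.g_desc k key⟩
  refine ⟨g, ?_, ?_⟩
  · rw [← cancel_epi (F.map f), α.naturality_assoc, hg, IsIso.hom_inv_id_assoc, Category.comp_id]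
  · rw [← cancel_epi (F'.map f), reassoc_of% hg, α.naturality, IsIso.inv_hom_id_assoc,
      Category.comp_id]

end Covers

namespace GradedAlgebra

variable {A : Type u} [Category.{v} A] [Abelian A] [HasCountableCoproducts A]
  {B G : GradedAlgebra.{w} A}

/-- The composite of two homomorphisms of graded algebras. -/
@[simps]
def Hom.comp {B' : GradedAlgebra.{w} A} (φ : Hom B B') (ψ : Hom B' G) : Hom B G where
  app n := φ.app n ≫ ψ.app n
  one := by rw [← Category.assoc, φ.one, ψ.one]
  mul {i j k} h X := by
    rw [NatTrans.comp_app, ← Category.assoc, φ.mul h, Category.assoc, Category.assoc, ψ.mul h,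
      NatTrans.comp_app, NatTrans.comp_app, Functor.map_comp, Category.assoc, Category.assoc,
      ← reassoc_of% (φ.naturality i ((ψ.app j).app X))]

lemma ι_totalMap (φ : Hom B G) (n : ℕ) (X : A) :
    (B.ι n).app X ≫ (totalMap φ).app X = (φ.app n).app X ≫ (G.ι n).app X :=
  congr_arg (fun a => a.app X) (Sigma.ι_map φ.app n)

lemma totalMap_comp {B' : GradedAlgebra.{w} A} (φ : Hom B B') (ψ : Hom B' G) :
    totalMap (φ.comp ψ) = totalMap φ ≫ totalMap ψ := by
  apply MonadHom.ext
  funext X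
  refine B.total_hom_ext fun n => ?_
  rw [ι_totalMap]
  refine Eq.trans ?_ (Category.assoc _ _ _)
  rw [ι_totalMap, Category.assoc, ι_totalMap]
  simp

/-- Transport of the structure of a central quotient along an isomorphism. -/
noncomputable def CentralQuotient.transport {T : GradedAlgebra.{w} A} (D : CentralQuotient B G)
    (φ : Hom T B) (hφ : ∀ n, IsIso (φ.app n)) : CentralQuotient T G :=
  have h : ∀ n X, IsIso ((φ.app n).app X) := inferInstance
  have hτ : ∀ {a b : ℕ} (h : a + 1 = b) (X : A),
      ((T.pc a).map (D.t X ≫ inv ((φ.app 1).app X)) ≫ (T.mul h).app X) ≫ (φ.app b).app X =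
        (φ.app a).app X ≫ (B.pc a).map (D.t X) ≫ (B.mul h).app X := fun {a b} h X => by
    rw [Category.assoc, φ.mul h, ← Functor.map_comp_assoc, Category.assoc, IsIso.inv_hom_id,
      Category.comp_id, ← Category.assoc, φ.naturality, Category.assoc]
  have hτ' : ∀ {a b : ℕ} (h : a + 1 = b) (X : A),
      (T.pc a).map (D.t X ≫ inv ((φ.app 1).app X)) ≫ (T.mul h).app X =
        (φ.app a).app X ≫ ((B.pc a).map (D.t X) ≫ (B.mul h).app X) ≫ inv ((φ.app b).app X) :=
    fun {a b} h X => by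
      rw [← cancel_mono ((φ.app b).app X), hτ]
      simp
  { π := φ.comp D.π
    t X := D.t X ≫ inv ((φ.app 1).app X)
    t_naturality {X Y} f := by
      rw [← cancel_mono ((φ.app 1).app Y)]
      simp [D.t_naturality]
    central X := by
      rw [← cancel_mono ((φ.app 2).app X), hτ, ← D.central, Category.assoc, φ.mul rfl,
        Category.assoc, reassoc_of% (φ.naturality 1 ((φ.app 1).app X)), IsIso.inv_hom_id_assoc,
        ← reassoc_of% (D.t_naturality ((φ.app 1).app X))]
    t_π X := by simp [D.t_π]
    mono {a b} h X hX := by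
      have := D.mono h X hX
      rw [hτ' h]
      infer_instance
    lift {a b} h X hX Z x hx := by
      obtain ⟨y, hy⟩ := D.lift h X hX (x ≫ (φ.app b).app X) ((Category.assoc _ _ _).trans hx)
      refine ⟨y ≫ inv ((φ.app a).app X), ?_⟩
      rw [hτ' h, Category.assoc, IsIso.inv_hom_id_assoc, ← Category.assoc, hy, Category.assoc,
        IsIso.hom_inv_id, Category.comp_id]
    exists_section b X hX := by
      obtain ⟨s, hs⟩ := D.exists_section b X hX
      exact ⟨s ≫ inv ((φ.app b).app X), by simp [hs]⟩ }

section Quadratic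

variable {R : A ⥤ A} [PreservesColimitsOfSize.{w, w} R] (B)

/-- The multiplication from the tensor powers of the part of degree one. -/
noncomputable def powHom : ∀ n, pow (B.pc 1) n ⟶ B.pc n
  | 0 => B.one
  | n + 1 => Functor.whiskerRight (powHom n) (B.pc 1) ≫ B.mul (add_comm 1 n)

lemma powHom_one (X : A) : (B.powHom 1).app X = 𝟙 _ := B.mul_one 1 X

lemma mul_step {i j k n l : ℕ} (h : i + j = k) (hl : 1 + i = l) (hn : 1 + k = n)
    (h' : l + j = n) {P P' Q X : A} (m : P ⟶ Q) (q : Q ⟶ (B.pc k).obj X) (u : P ⟶ P')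
    (p : P' ⟶ (B.pc i).obj ((B.pc j).obj X)) (e : m ≫ q = u ≫ p ≫ (B.mul h).app X) :
    (B.pc 1).map m ≫ (B.pc 1).map q ≫ (B.mul hn).app X =
      (B.pc 1).map u ≫ ((B.pc 1).map p ≫ (B.mul hl).app _) ≫ (B.mul h').app X := by
  rw [← Functor.map_comp_assoc, e, Category.assoc, B.assoc hl h' h hn]
  simp

lemma powMul_powHom : ∀ (i j k : ℕ) (h : i + j = k) (X : A),
    (powMul (B.pc 1) i j k h).app X ≫ (B.powHom k).app X =
      (pow (B.pc 1) i).map ((B.powHom j).app X) ≫ (B.powHom i).app _ ≫ (B.mul h).app X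
  | 0, j, k, h, X => by
    obtain rfl : j = k := by omega
    exact (Category.id_comp _).trans ((Category.comp_id _).symm.trans
      (congr_arg (fun a => (B.powHom j).app X ≫ a) (B.one_mul j X).symm))
  | i + 1, j, 0, h, X => absurd h (by omega)
  | i + 1, j, k + 1, h, X => B.mul_step _ _ _ _ _ _ _ _ (powMul_powHom i j k (by omega) X)

lemma powMul_one (n : ℕ) (h : 1 + n = n + 1) (X : A) {Z : A}
    (f : (pow (B.pc 1) (n + 1)).obj X ⟶ Z) : (powMul (B.pc 1) 1 n (n + 1) h).app X ≫ f = f :=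
  (congr_arg (fun a => a ≫ f) ((B.pc 1).map_id _)).trans (Category.id_comp _)

variable {B} (r : R ⟶ B.pc 1 ⋙ B.pc 1)

lemma relations_mul (hr : ∀ X, r.app X ≫ (B.mul (rfl : 1 + 1 = 2)).app X = 0) {b c d : ℕ}
    (hc : 1 + b = c) (hd : 1 + c = d) {P X : A} (f : P ⟶ (B.pc b).obj X) :
    r.app P ≫ (B.pc 1).map ((B.pc 1).map f ≫ (B.mul hc).app X) ≫ (B.mul hd).app X = 0 := by
  have h2 := r.naturality f
  dsimp at h2
  rw [Functor.map_comp_assoc, ← B.assoc (rfl : 1 + 1 = 2) (show 2 + b = d by omega) hc hd,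
    ← reassoc_of% h2, reassoc_of% (hr ((B.pc b).obj X)), zero_comp, comp_zero]

lemma rel_powHom (hr : ∀ X, r.app X ≫ (B.mul (rfl : 1 + 1 = 2)).app X = 0) (a b n : ℕ)
    (h : a + b + 2 = n) (X : A) : (rel r a b n h).app X ≫ (B.powHom n).app X = 0 := by
  have h1 : r.app ((pow (B.pc 1) b).obj X) ≫ (B.powHom (b + 2)).app X = 0 :=
    relations_mul r hr _ _ _
  have := cocontinuous_pow.{w} (B.pc 1) a
  have := preservesFiniteColimits_of_cocontinuous.{w} (pow (B.pc 1) a)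
  have : (pow (B.pc 1) a).Additive := additive_of_preservesFiniteColimits _
  refine (Category.assoc _ _ _).trans ?_
  refine (congr_arg (fun x => _ ≫ x) (B.powMul_powHom a (b + 2) n (by omega) X)).trans ?_
  refine (Category.assoc _ _ _).symm.trans ?_
  refine (congr_arg (fun x => x ≫ _) (((pow (B.pc 1) a).map_comp _ _).symm.trans
    ((congr_arg _ h1).trans ((pow (B.pc 1) a).map_zero _ _)))).trans zero_comp

/-- The homomorphism from a quadratic algebra which extends the identity of the part of degree
one. -/
noncomputable def quadraticDesc (hr : ∀ X, r.app X ≫ (B.mul (rfl : 1 + 1 = 2)).app X = 0) (n : ℕ) :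
    (quadraticAlgebra.{w} r).pc n ⟶ B.pc n :=
  cokernel.desc (relSum r n) (B.powHom n) (by
    refine Limits.Sigma.hom_ext _ _ fun p => ?_
    rw [comp_zero, relSum, Sigma.ι_desc_assoc]
    ext X
    exact rel_powHom r hr _ _ _ _ X)

/-- The projection from the tensor powers. -/
noncomputable def quadraticπ (n : ℕ) : pow (B.pc 1) n ⟶ (quadraticAlgebra.{w} r).pc n :=
  (quadraticIdeal.{w} r).π n

instance (n : ℕ) (X : A) : Epi ((quadraticπ.{w} r n).app X) :=
  inferInstanceAs (Epi (((quadraticIdeal.{w} r).π n).app X))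

lemma quadraticπ_desc (hr : ∀ X, r.app X ≫ (B.mul (rfl : 1 + 1 = 2)).app X = 0) (n : ℕ) (X : A) :
    (quadraticπ.{w} r n).app X ≫ (quadraticDesc r hr n).app X = (B.powHom n).app X := by
  have : quadraticπ.{w} r n ≫ quadraticDesc r hr n = B.powHom n := cokernel.π_desc _ _ _
  rw [← NatTrans.comp_app, this]

lemma quadraticπ_mul {i j k : ℕ} (h : i + j = k) (X : A) :
    (pow (B.pc 1) i).map ((quadraticπ.{w} r j).app X) ≫ (quadraticπ.{w} r i).app _ ≫
      ((quadraticAlgebra.{w} r).mul h).app X =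
        (powMul (B.pc 1) i j k h).app X ≫ (quadraticπ.{w} r k).app X :=
  (quadraticIdeal.{w} r).π_π_mulApp h X

/-- The homomorphism from a quadratic algebra to an algebra in which the relations hold. -/
noncomputable def quadraticHom (hr : ∀ X, r.app X ≫ (B.mul (rfl : 1 + 1 = 2)).app X = 0) :
    Hom (quadraticAlgebra.{w} r) B where
  app n := quadraticDesc r hr n
  one := by
    ext X
    exact (congr_arg (fun a => a ≫ _) (Category.id_comp _)).trans (quadraticπ_desc r hr 0 X)
  mul {i j k} h X := by
    have := cocontinuous_pow.{w} (B.pc 1) i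
    have := preservesFiniteColimits_of_cocontinuous.{w} (pow (B.pc 1) i)
    have e : Epi ((pow (B.pc 1) i).map ((quadraticπ.{w} r j).app X)) := inferInstance
    rw [← cancel_epi ((quadraticπ.{w} r i).app _), ← cancel_epi ((pow (B.pc 1) i).map ((quadraticπ.{w} r j).app X))]
    have h1 := quadraticπ_mul r h X
    have h2 := (quadraticπ.{w} r i).naturality ((quadraticDesc r hr j).app X)
    rw [reassoc_of% h1, quadraticπ_desc, powMul_powHom, ← reassoc_of% h2,
      ← Functor.map_comp_assoc, quadraticπ_desc, reassoc_of% (quadraticπ_desc r hr i)]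

lemma gen_quadraticHom (hr : ∀ X, r.app X ≫ (B.mul (rfl : 1 + 1 = 2)).app X = 0) :
    quadraticAlgebra.gen.{w} r ≫ (quadraticHom r hr).app 1 = 𝟙 (B.pc 1) := by
  ext X
  refine (congr_arg (fun a => a ≫ _) (Category.id_comp _)).trans ?_
  exact (quadraticπ_desc r hr 1 X).trans (B.powHom_one X)

lemma quadraticπ_succ (n : ℕ) (X : A) : (quadraticπ.{w} r (n + 1)).app X =
    (B.pc 1).map ((quadraticπ.{w} r n).app X) ≫ (quadraticAlgebra.gen.{w} r).app _ ≫
      ((quadraticAlgebra.{w} r).mul (add_comm 1 n)).app X := by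
  have h1 := quadraticπ_mul r (add_comm 1 n) X
  refine (B.powMul_one n (add_comm 1 n) X _).symm.trans (h1.symm.trans ?_)
  exact congr_arg (fun a => (B.pc 1).map ((quadraticπ.{w} r n).app X) ≫ a ≫
    ((quadraticAlgebra.{w} r).mul (add_comm 1 n)).app X) (Category.id_comp _).symm

lemma gen_mul_hom (φ : Hom (quadraticAlgebra.{w} r) B)
    (hφ : quadraticAlgebra.gen.{w} r ≫ φ.app 1 = 𝟙 (B.pc 1)) {n k : ℕ} (h : 1 + n = k) {X Y : A}
    (p : Y ⟶ ((quadraticAlgebra.{w} r).pc n).obj X) (q : Y ⟶ (B.pc n).obj X)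
    (hp : p ≫ (φ.app n).app X = q) :
    ((B.pc 1).map p ≫ (quadraticAlgebra.gen.{w} r).app _ ≫
      ((quadraticAlgebra.{w} r).mul h).app X) ≫ (φ.app k).app X =
        (B.pc 1).map q ≫ (B.mul h).app X := by
  have h4 := (quadraticAlgebra.gen.{w} r).naturality ((φ.app n).app X)
  have h3 : (quadraticAlgebra.gen.{w} r).app ((B.pc n).obj X) ≫ (φ.app 1).app _ = 𝟙 _ :=
    congr_arg (fun a => a.app ((B.pc n).obj X)) hφ
  rw [Category.assoc, Category.assoc, φ.mul h, ← reassoc_of% h4, reassoc_of% h3,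
    ← Functor.map_comp_assoc, hp]

lemma quadraticπ_hom (φ : Hom (quadraticAlgebra.{w} r) B)
    (hφ : quadraticAlgebra.gen.{w} r ≫ φ.app 1 = 𝟙 (B.pc 1)) : ∀ (n : ℕ) (X : A),
    (quadraticπ.{w} r n).app X ≫ (φ.app n).app X = (B.powHom n).app X
  | 0, X => by
    refine Eq.trans ?_ (congr_arg (fun a => a.app X) φ.one)
    exact (congr_arg (fun a => a ≫ _) (Category.id_comp _)).symm
  | n + 1, X => by
    refine (congr_arg (fun a => a ≫ _) (quadraticπ_succ r n X)).trans ?_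
    exact gen_mul_hom r φ hφ _ _ _ (quadraticπ_hom φ hφ n X)

lemma quadraticHom_unique {φ φ' : Hom (quadraticAlgebra.{w} r) B}
    (hφ : quadraticAlgebra.gen.{w} r ≫ φ.app 1 = 𝟙 (B.pc 1))
    (hφ' : quadraticAlgebra.gen.{w} r ≫ φ'.app 1 = 𝟙 (B.pc 1)) : φ = φ' := by
  ext n X
  rw [← cancel_epi ((quadraticπ.{w} r n).app X), quadraticπ_hom r φ hφ, quadraticπ_hom r φ' hφ']

end Quadratic

end GradedAlgebra

lemma isIso_powMul {A : Type u} [Category.{v} A] (H : A ⥤ A) : ∀ (i j k : ℕ) (h : i + j = k) (X : A),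
    IsIso ((powMul H i j k h).app X)
  | 0, j, k, h, X => by
    obtain rfl : j = k := by omega
    rw [powMul_zero]
    exact inferInstanceAs (IsIso (𝟙 ((pow H j).obj X)))
  | i + 1, j, 0, h, X => absurd h (by omega)
  | i + 1, j, k + 1, h, X => by
    have := isIso_powMul H i j k (by omega) X
    exact inferInstanceAs (IsIso (H.map ((powMul H i j k (by omega)).app X)))

/-- The identification of `Hⁿ (H X)` with `Hⁿ⁺¹ X`. -/
def powSnoc {A : Type u} [Category.{v} A] (H : A ⥤ A) (n : ℕ) (X : A) :
    (pow H n).obj (H.obj X) ⟶ (pow H (n + 1)).obj X :=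
  (powMul H n 1 (n + 1) rfl).app X

instance {A : Type u} [Category.{v} A] (H : A ⥤ A) (n : ℕ) (X : A) : IsIso (powSnoc H n X) :=
  isIso_powMul H n 1 (n + 1) rfl X

namespace GradedAlgebra

variable {A : Type u} [Category.{v} A] [Abelian A] [HasCountableCoproducts A]
  (B : GradedAlgebra.{w} A) {R : A ⥤ A} [PreservesColimitsOfSize.{w, w} R]

lemma powSnoc_powHom (n : ℕ) (X : A) : powSnoc (B.pc 1) n X ≫ (B.powHom (n + 1)).app X =
    (B.powHom n).app ((B.pc 1).obj X) ≫ (B.mul rfl).app X := by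
  refine (B.powMul_powHom n 1 (n + 1) rfl X).trans ?_
  refine (congr_arg (fun a => (pow (B.pc 1) n).map a ≫ (B.powHom n).app ((B.pc 1).obj X) ≫
    (B.mul rfl).app X) (B.powHom_one X)).trans ?_
  exact (congr_arg (fun a => a ≫ _) ((pow (B.pc 1) n).map_id _)).trans (Category.id_comp _)

lemma powHom_naturality (n : ℕ) {X Y : A} (f : X ⟶ Y) :
    (pow (B.pc 1) n).map f ≫ (B.powHom n).app Y = (B.powHom n).app X ≫ (B.pc n).map f :=
  (B.powHom n).naturality f

variable {B} (r : R ⟶ B.pc 1 ⋙ B.pc 1)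

lemma powSnoc_quadraticπ (n : ℕ) (X : A) : powSnoc (B.pc 1) n X ≫ (quadraticπ.{w} r (n + 1)).app X =
    (quadraticπ.{w} r n).app ((B.pc 1).obj X) ≫ ((quadraticAlgebra.{w} r).pc n).map
      ((quadraticπ.{w} r 1).app X) ≫ ((quadraticAlgebra.{w} r).mul rfl).app X := by
  refine (quadraticπ_mul r rfl X).symm.trans ?_
  refine (Category.assoc _ _ _).symm.trans (Eq.trans ?_ (Category.assoc _ _ _))
  exact congr_arg (fun a => a ≫ _) ((quadraticπ.{w} r n).naturality ((quadraticπ.{w} r 1).app X))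

lemma map_relations_powSnoc (n : ℕ) (X : A) : (pow (B.pc 1) n).map (r.app X) ≫
    powSnoc (B.pc 1) n ((B.pc 1).obj X) ≫ powSnoc (B.pc 1) (n + 1) X ≫
      (quadraticπ.{w} r (n + 2)).app X = 0 := by
  have h1 := powMul_assoc (B.pc 1) n 1 1 (n + 1) 2 (n + 2) rfl rfl rfl rfl X
  have h2 : (pow (B.pc 1) n).map ((powMul (B.pc 1) 1 1 2 rfl).app X) ≫
      (powMul (B.pc 1) n 2 (n + 2) rfl).app X = (powMul (B.pc 1) n 2 (n + 2) rfl).app X := by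
    refine (congr_arg (fun a => (pow (B.pc 1) n).map a ≫ (powMul (B.pc 1) n 2 (n + 2) rfl).app X)
      ((B.pc 1).map_id _)).trans ?_
    exact (congr_arg (fun a => a ≫ _) ((pow (B.pc 1) n).map_id _)).trans (Category.id_comp _)
  have h3 : (rel r n 0 (n + 2) rfl).app X ≫ (quadraticπ.{w} r (n + 2)).app X = 0 :=
    rel_π r n 0 (n + 2) rfl X
  refine Eq.trans ?_ h3
  refine Eq.trans ?_ (Category.assoc _ _ _).symm
  refine congr_arg (fun a => (pow (B.pc 1) n).map (r.app X) ≫ a) ?_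
  refine (Category.assoc _ _ _).symm.trans ?_
  exact congr_arg (fun a => a ≫ _) (h1.trans h2)

/-- Surjectivity of the multiplication from tensor powers, and generation of its kernel by
relations, tested on projective objects. -/
structure QuadraticAt (r : R ⟶ B.pc 1 ⋙ B.pc 1) (n : ℕ) (X : A) : Prop where
  exists_lift : ∀ {Z : A} [Projective Z] (x : Z ⟶ (B.pc n).obj X), ∃ y, y ≫ (B.powHom n).app X = x
  eq_zero : ∀ {Z : A} [Projective Z] (x : Z ⟶ (pow (B.pc 1) n).obj X), x ≫ (B.powHom n).app X = 0 →
    x ≫ (quadraticπ.{w} r n).app X = 0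

lemma quadraticAt_zero (X : A) : QuadraticAt r 0 X where
  exists_lift x := ⟨x ≫ (inv B.one).app X, by
    have : (inv B.one).app X ≫ B.one.app X = 𝟙 _ := by
      rw [← NatTrans.comp_app, IsIso.inv_hom_id, NatTrans.id_app]
    exact (Category.assoc _ _ _).trans ((congr_arg (fun a => x ≫ a) this).trans
      (Category.comp_id _))⟩
  eq_zero x hx := by
    have h1 : x = 0 := (cancel_mono (B.one.app X)).1 (hx.trans zero_comp.symm)
    rw [h1, zero_comp]

lemma quadraticAt_one (X : A) : QuadraticAt r 1 X where
  exists_lift x := ⟨x, (congr_arg (fun a => x ≫ a) (B.powHom_one X)).trans (Category.comp_id _)⟩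
  eq_zero x hx := by
    have h1 : x = 0 := (Category.comp_id _).symm.trans
      ((congr_arg (fun a => x ≫ a) (B.powHom_one X)).symm.trans hx)
    rw [h1, zero_comp]

/-- The isomorphism from the second term of the Koszul dual to the part of degree one. -/
noncomputable def iOne (B : GradedAlgebra.{w} A) (X : A) : (B.U 2).obj X ⟶ (B.pc 1).obj X := B.i 1 X

lemma κ_one {a b : ℕ} (h : a + 1 = b) (X : A) :
    B.κ h 1 X = (B.pc a).map (B.iOne X) ≫ (B.mul h).app X := rfl

lemma exists_iOne_section (X : A) : ∃ s, s ≫ B.iOne X = 𝟙 ((B.pc 1).obj X) :=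
  B.exists_i_lift 0 (X := X) (𝟙 _) (map_U_zero_hom_ext _ _ _ _)

lemma exists_mul_lift {X : A} (H : B.KoszulExactAt X 0) (n : ℕ) {Z : A}
    (x : Z ⟶ (B.pc (n + 1)).obj X) :
    ∃ w : Z ⟶ (B.pc n).obj ((B.pc 1).obj X), w ≫ (B.mul rfl).app X = x := by
  obtain ⟨w, hw⟩ := (H.splitExact (rfl : n + 1 = n + 1) rfl).lift x (map_U_zero_hom_ext _ _ _ _)
  exact ⟨w ≫ (B.pc n).map (B.iOne X), (Category.assoc _ _ _).trans hw⟩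

/-- The inclusion of the third term of the Koszul dual. -/
noncomputable def relationsIncl (B : GradedAlgebra.{w} A) (X : A) :
    (B.U 3).obj X ⟶ (B.pc 1).obj ((B.pc 1).obj X) :=
  B.i 2 X ≫ (B.pc 1).map (B.iOne X)

lemma relationsIncl_mul (X : A) : B.relationsIncl X ≫ (B.mul rfl).app X = 0 :=
  (Category.assoc _ _ _).trans (B.i_κ 1 X)

lemma exists_relations_lift {X : A} (H : B.KoszulExactAt X 1) (n : ℕ) {Z : A}
    (x : Z ⟶ (B.pc (n + 1)).obj ((B.pc 1).obj X))
    (hx : x ≫ (B.mul (rfl : n + 1 + 1 = n + 2)).app X = 0) :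
    ∃ w : Z ⟶ (B.pc n).obj ((B.U 3).obj X),
      w ≫ (B.pc n).map (B.relationsIncl X) ≫ (B.mul (rfl : n + 1 = n + 1)).app ((B.pc 1).obj X) = x := by
  obtain ⟨s, hs⟩ := exists_iOne_section (B := B) X
  have hs' : (B.pc (n + 1)).map s ≫ (B.pc (n + 1)).map (B.iOne X) = 𝟙 _ := by
    rw [← Functor.map_comp, hs, (B.pc (n + 1)).map_id]
  obtain ⟨w, hw⟩ := (H.splitExact (rfl : n + 1 = n + 1) (rfl : n + 1 + 1 = n + 2)).lift
    (x ≫ (B.pc (n + 1)).map s) (by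
    rw [κ_one]
    refine (Category.assoc _ _ _).trans ((congr_arg (fun a => x ≫ a) ?_).trans hx)
    refine (Category.assoc _ _ _).symm.trans ((congr_arg (fun a => a ≫ _) hs').trans ?_)
    exact Category.id_comp _)
  refine ⟨w, ?_⟩
  have h1 := congr_arg (fun a => a ≫ (B.pc (n + 1)).map (B.iOne X)) hw
  have h2 : (B.pc n).map (B.relationsIncl X) ≫ (B.mul (rfl : n + 1 = n + 1)).app ((B.pc 1).obj X) =
      B.κ rfl 2 X ≫ (B.pc (n + 1)).map (B.iOne X) := by
    rw [κ, relationsIncl, Functor.map_comp, Category.assoc, mul_naturality, Category.assoc]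
  rw [h2]
  refine (Category.assoc _ _ _).symm.trans (h1.trans ?_)
  exact (Category.assoc _ _ _).trans ((congr_arg (fun a => x ≫ a) hs').trans (Category.comp_id _))

variable [B.ProjComponents]

lemma quadraticAt (hr : ∀ X, r.app X ≫ (B.mul (rfl : 1 + 1 = 2)).app X = 0)
    (hR : ∀ X, Projective X → ∀ {Z : A} (x : Z ⟶ (B.pc 1).obj ((B.pc 1).obj X)),
      x ≫ (B.mul (rfl : 1 + 1 = 2)).app X = 0 → ∃ y, y ≫ r.app X = x)
    (H : ∀ X, Projective X → ∀ n, B.KoszulExactAt X n) (n : ℕ) :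
    ∀ X, Projective X → QuadraticAt r n X := by
  induction n using Nat.strong_induction_on with
  | _ n ih =>
    intro X hX
    rcases n with _ | _ | n
    · exact quadraticAt_zero r X
    · exact quadraticAt_one r X
    have hX1 : Projective ((B.pc 1).obj X) := ProjComponents.proj 1 X hX
    have IH := ih (n + 1) (by omega) _ hX1
    refine ⟨fun x => ?_, fun {Z} _ x hx => ?_⟩
    · obtain ⟨w, hw⟩ := exists_mul_lift (H X hX 0) (n + 1) x
      obtain ⟨y, hy⟩ := IH.exists_lift w
      refine ⟨y ≫ powSnoc (B.pc 1) (n + 1) X, ?_⟩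
      rw [Category.assoc, powSnoc_powHom, reassoc_of% hy, hw]
    · obtain ⟨y, rfl⟩ : ∃ y, y ≫ powSnoc (B.pc 1) (n + 1) X = x :=
        ⟨x ≫ inv (powSnoc (B.pc 1) (n + 1) X), by simp⟩
      rw [Category.assoc, powSnoc_powHom, ← Category.assoc] at hx
      obtain ⟨z, hz⟩ := exists_relations_lift (H X hX 1) n _ hx
      have hU : Projective ((B.U 3).obj X) := projective_U hX 2 fun m _ => H X hX m
      obtain ⟨z', rfl⟩ := (ih n (by omega) _ hU).exists_lift z
      obtain ⟨q, hq⟩ := hR X hX (B.relationsIncl X) (B.relationsIncl_mul X)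
      have h1 := IH.eq_zero (y - z' ≫ (pow (B.pc 1) n).map (B.relationsIncl X) ≫
        powSnoc (B.pc 1) n ((B.pc 1).obj X)) (by
          rw [Preadditive.sub_comp, ← hz, Category.assoc, Category.assoc, Category.assoc,
            powSnoc_powHom, reassoc_of% (B.powHom_naturality n (B.relationsIncl X)), sub_self])
      rw [Preadditive.sub_comp, sub_eq_zero] at h1
      have h2 := congr_arg (fun a => a ≫ ((quadraticAlgebra.{w} r).pc (n + 1)).map
        ((quadraticπ.{w} r 1).app X) ≫ ((quadraticAlgebra.{w} r).mul rfl).app X) h1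
      have h3 := powSnoc_quadraticπ r (n + 1) X
      refine (Category.assoc _ _ _).trans ((congr_arg (fun a => y ≫ a) h3).trans
        ((Category.assoc _ _ _).symm.trans (h2.trans ?_)))
      refine (Category.assoc _ _ _).trans ((congr_arg (fun a => _ ≫ a) h3.symm).trans ?_)
      rw [← hq, Functor.map_comp]
      simp only [Category.assoc]
      rw [map_relations_powSnoc, comp_zero, comp_zero]

lemma isIso_quadraticHom {W : ObjectProperty A} [HasCovers W] (hW : ∀ Q, W Q → Projective Q)
    (hr : ∀ X, r.app X ≫ (B.mul (rfl : 1 + 1 = 2)).app X = 0)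
    (hR : ∀ X, Projective X → ∀ {Z : A} (x : Z ⟶ (B.pc 1).obj ((B.pc 1).obj X)),
      x ≫ (B.mul (rfl : 1 + 1 = 2)).app X = 0 → ∃ y, y ≫ r.app X = x)
    (H : ∀ X, Projective X → ∀ n, B.KoszulExactAt X n) (n : ℕ) :
    IsIso ((quadraticHom r hr).app n) := by
  have : ∀ X, IsIso (((quadraticHom r hr).app n).app X) := by
    refine isIso_app_of_projective hW _ fun X hX => ?_
    have h := quadraticAt r hr hR H n X hX
    have h1 : Mono (((quadraticHom r hr).app n).app X) := by
      refine Preadditive.mono_of_cancel_zero _ fun {Z} g hg => ?_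
      obtain ⟨Z', hZ', p, hp⟩ := exists_projective_cover hW Z
      rw [← cancel_epi p, comp_zero]
      have e := Projective.factorThru_comp (p ≫ g) ((quadraticπ.{w} r n).app X)
      rw [← e]
      refine h.eq_zero _ ?_
      rw [← quadraticπ_desc r hr]
      refine (Category.assoc _ _ _).symm.trans ?_
      refine (congr_arg (fun a => a ≫ _) e).trans ?_
      exact (Category.assoc _ _ _).trans ((congr_arg (fun a => p ≫ a) hg).trans comp_zero)
    have h2 : Epi (((quadraticHom r hr).app n).app X) := by
      have := ProjComponents.proj (G := B) n X hX
      obtain ⟨y, hy⟩ := h.exists_lift (𝟙 _)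
      have h3 : (y ≫ (quadraticπ.{w} r n).app X) ≫ ((quadraticHom r hr).app n).app X = 𝟙 _ :=
        (Category.assoc _ _ _).trans
          ((congr_arg (fun a => y ≫ a) (quadraticπ_desc r hr n X)).trans hy)
      exact epi_of_epi_fac h3
    exact isIso_of_mono_of_epi _
  exact NatIso.isIso_of_isIso_app _

end GradedAlgebra

namespace FilteredAlgebra

variable {A : Type u} [Category.{v} A] [Abelian A] [HasCountableCoproducts A]
  {W : ObjectProperty A} [HasCovers W] (F : FilteredAlgebra.{w} W)

lemma mono_fil_map {m n : ℕ} (h : m ⟶ n) {X : A} (hX : Projective X) : Mono ((F.fil.map h).app X) := by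
  obtain ⟨Q, hQ, ⟨e⟩⟩ := exists_retract_of_projective (W := W) hX
  have h1 : Mono ((F.fil.map h).app Q) := by
    have := F.mono m Q hQ
    have h2 := F.map_ι h Q
    exact mono_of_mono_fac h2
  have h3 : (F.fil.map h).app X ≫ (F.fil.obj n).map e.i =
      (F.fil.obj m).map e.i ≫ (F.fil.map h).app Q := ((F.fil.map h).naturality e.i).symm
  have h4 : (F.fil.obj m).map e.i ≫ (F.fil.obj m).map e.r = 𝟙 _ := by
    rw [← Functor.map_comp, e.retract, (F.fil.obj m).map_id]
  have h5 : Mono ((F.fil.obj m).map e.i) := mono_of_mono_fac h4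
  have h6 : Mono ((F.fil.map h).app X ≫ (F.fil.obj n).map e.i) := by
    rw [h3]
    exact mono_comp _ _
  exact mono_of_mono _ ((F.fil.obj n).map e.i)

lemma projComponents_gr (hW : ∀ Q, W Q → Projective Q) (hF : F.gr.IsKoszul W) :
    F.gr.ProjComponents :=
  GradedAlgebra.projComponents_of_total _ fun X hX => by
    obtain ⟨Q, hQ, ⟨e⟩⟩ := exists_retract_of_projective (W := W) hX
    have := hF.projective Q hQ
    exact Retract.projective (e.map (F.gr.total : A ⥤ A))

/-- The central element of degree one of the Rees algebra. -/
noncomputable def reesT (X : A) : X ⟶ (F.fil.obj 1).obj X :=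
  F.one.app X ≫ (F.fil.map (homOfLE (Nat.le_succ 0))).app X

lemma map_reesT_mul {a b : ℕ} (h : a + 1 = b) (X : A) :
    (F.fil.obj a).map (F.reesT X) ≫ (F.mul h).app X =
      (F.fil.map (homOfLE (show a ≤ b by omega))).app X := by
  have h1 := F.map_mul h (add_zero a) h X
  have h2 := F.rees.mul_one a X
  rw [reesT, Functor.map_comp, Category.assoc]
  refine (congr_arg (fun x => (F.fil.obj a).map (F.one.app X) ≫ x) h1).trans ?_
  refine (Category.assoc _ _ _).symm.trans ?_
  exact (congr_arg (fun x => x ≫ _) h2).trans (Category.id_comp _)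

lemma reesT_mul (X : A) : F.reesT ((F.fil.obj 1).obj X) ≫ (F.mul (rfl : 1 + 1 = 2)).app X =
    (F.fil.map (homOfLE (Nat.le_succ 1))).app X := by
  have h1 := F.mul_map (rfl : 0 + 1 + 1 = 2) (zero_add 1) rfl X
  have h2 := F.rees.one_mul 1 X
  refine (Category.assoc _ _ _).trans ?_
  refine (congr_arg (fun x => F.one.app ((F.fil.obj 1).obj X) ≫ x) h1).trans ?_
  refine (Category.assoc _ _ _).symm.trans ?_
  exact (congr_arg (fun x => x ≫ _) h2).trans (Category.id_comp _)

/-- The Rees algebra of a filtered algebra has the associated graded algebra as the quotient by a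
central element. -/
noncomputable def reesCentralQuotient (hW : ∀ Q, W Q → Projective Q) (hF : F.gr.IsKoszul W) :
    GradedAlgebra.CentralQuotient F.rees F.gr where
  π := F.grIdeal.proj
  t := F.reesT
  t_naturality {X Y} f := by
    have h1 := F.one.naturality f
    have h2 := (F.fil.map (homOfLE (Nat.le_succ 0))).naturality f
    dsimp at h1 h2 ⊢
    rw [reesT, reesT, reassoc_of% h1, h2, Category.assoc]
  central X := (F.reesT_mul X).trans (F.map_reesT_mul rfl X).symm
  t_π X := by
    refine (Category.assoc _ _ _).trans ?_
    exact (congr_arg (fun x => F.one.app X ≫ x) (F.fil_map_π (zero_add 1) X)).trans comp_zero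
  mono {a b} h X hX := by
    have := F.mono_fil_map (homOfLE (show a ≤ b by omega)) hX
    have h1 := F.map_reesT_mul h X
    exact h1.symm ▸ this
  lift {a b} h X hX Z x hx := by
    subst h
    have h0 : Mono ((F.fil.map (homOfLE (Nat.le_succ a))).app X) := F.mono_fil_map _ hX
    have h3 : IsColimit (CokernelCofork.ofπ ((F.grIdeal.π (a + 1)).app X)
      (F.fil_map_π (rfl : a + 1 = a + 1) X)) := F.grIdeal.isColimit (a + 1) X
    have h4 := ShortComplex.exact_of_g_is_cokernel
      (ShortComplex.mk ((F.fil.map (homOfLE (Nat.le_succ a))).app X) ((F.grIdeal.π (a + 1)).app X)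
        (F.fil_map_π (rfl : a + 1 = a + 1) X)) h3
    have h5 : Mono (ShortComplex.mk ((F.fil.map (homOfLE (Nat.le_succ a))).app X)
      ((F.grIdeal.π (a + 1)).app X) (F.fil_map_π (rfl : a + 1 = a + 1) X)).f := h0
    refine ⟨h4.lift x hx, ?_⟩
    refine (congr_arg (fun y => _ ≫ y) (F.map_reesT_mul rfl X)).trans ?_
    exact h4.lift_f x hx
  exists_section b X hX := by
    have h1 := F.projComponents_gr hW hF
    have h2 : Projective ((F.gr.pc b).obj X) := GradedAlgebra.ProjComponents.proj b X hX
    let p : (F.fil.obj b).obj X ⟶ (F.gr.pc b).obj X := (F.grIdeal.π b).app X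
    have h3 : Epi p := inferInstanceAs (Epi ((cokernel.π (F.incl b)).app X))
    obtain ⟨s, hs⟩ := h2.factors (𝟙 _) p
    exact ⟨s, hs⟩

lemma gr_koszulExactAt (hW : ∀ Q, W Q → Projective Q) (hF : F.gr.IsKoszul W) {X : A}
    (hX : Projective X) (n : ℕ) : F.gr.KoszulExactAt X n := by
  have := F.projComponents_gr hW hF
  obtain ⟨Q, hQ, ⟨e⟩⟩ := exists_retract_of_projective (W := W) hX
  exact (GradedAlgebra.koszulExactAt_of_isKoszul hF hQ (hW Q hQ) n).of_retract e

lemma rees_projComponents (hW : ∀ Q, W Q → Projective Q) (hF : F.gr.IsKoszul W) :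
    F.rees.ProjComponents :=
  have := F.projComponents_gr hW hF
  (F.reesCentralQuotient hW hF).projComponents

lemma rees_koszulExactAt (hW : ∀ Q, W Q → Projective Q) (hF : F.gr.IsKoszul W) {X : A}
    (hX : Projective X) (n : ℕ) : F.rees.KoszulExactAt X n :=
  have := F.projComponents_gr hW hF
  (F.reesCentralQuotient hW hF).koszulExactAt hX (fun n => F.gr_koszulExactAt hW hF hX n) n

variable {R : A ⥤ A} [PreservesColimitsOfSize.{w, w} R] {r : R ⟶ F.fil.obj 1 ⋙ F.fil.obj 1}

lemma IsRelations.comp_mul (hr : F.IsRelations r) (X : A) :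
    r.app X ≫ (F.mul (rfl : 1 + 1 = 2)).app X = 0 := by
  obtain ⟨Q, hQ, f, hf⟩ := HasCovers.exists_epi (W := W) X
  have : Epi (R.map f) := map_epi_of_cocontinuous.{w} R inferInstance f
  have h1 := (r ≫ F.mul (rfl : 1 + 1 = 2)).naturality f
  obtain ⟨h2, -⟩ := hr Q hQ
  dsimp at h1
  rw [← cancel_epi (R.map f), h1, h2, zero_comp, comp_zero]

lemma IsRelations.exists_lift (hr : F.IsRelations r) {X : A} (hX : Projective X) {Z : A}
    (x : Z ⟶ (F.fil.obj 1).obj ((F.fil.obj 1).obj X))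
    (hx : x ≫ (F.mul (rfl : 1 + 1 = 2)).app X = 0) : ∃ y, y ≫ r.app X = x := by
  obtain ⟨Q, hQ, ⟨e⟩⟩ := exists_retract_of_projective (W := W) hX
  obtain ⟨h2, ⟨h3⟩⟩ := hr Q hQ
  have h4 := (F.mul (rfl : 1 + 1 = 2)).naturality e.i
  obtain ⟨y, hy⟩ := KernelFork.IsLimit.lift' h3 (x ≫ (F.fil.obj 1 ⋙ F.fil.obj 1).map e.i) (by
    refine (Category.assoc _ _ _).trans ((congr_arg (fun a => x ≫ a) h4).trans ?_)
    rw [← Category.assoc, hx, zero_comp])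
  have hy' : y ≫ r.app Q = x ≫ (F.fil.obj 1 ⋙ F.fil.obj 1).map e.i := hy
  refine ⟨y ≫ R.map e.r, ?_⟩
  have h5 : (F.fil.obj 1 ⋙ F.fil.obj 1).map e.i ≫ (F.fil.obj 1 ⋙ F.fil.obj 1).map e.r = 𝟙 _ := by
    rw [← Functor.map_comp, e.retract, (F.fil.obj 1 ⋙ F.fil.obj 1).map_id]
  refine (Category.assoc _ _ _).trans ((congr_arg (fun a => y ≫ a) (r.naturality e.r)).trans ?_)
  refine (Category.assoc _ _ _).symm.trans ((congr_arg (fun a => a ≫ _) hy').trans ?_)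
  refine (Category.assoc _ _ _).trans ((congr_arg (fun a => x ≫ a) h5).trans (Category.comp_id _))

end FilteredAlgebra

section

variable {A : Type u} [Category.{v} A] [Preadditive A]

lemma SplitExact.comp_retract {X Y Z Z' : A} {f : X ⟶ Y} {g : Y ⟶ Z} (h : SplitExact f g)
    {j : Z ⟶ Z'} {r : Z' ⟶ Z} (hj : j ≫ r = 𝟙 Z) : SplitExact f (g ≫ j) := by
  obtain ⟨h0, e, s, h1⟩ := h
  refine ⟨by rw [reassoc_of% h0, zero_comp], e, r ≫ s, ?_⟩
  rw [Category.assoc, reassoc_of% hj, h1]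

lemma SplitExact.comp {X Y Z Z₁ Z₂ V : A} {f₂ : X ⟶ Y} {f₁ : Y ⟶ Z} {g₀ : Z ⟶ V} {g₁ : Z ⟶ Z₁}
    {g₂ : Y ⟶ Z₂} (h₁ : SplitExact f₁ g₁) (h₂ : SplitExact f₂ g₂) (q₁ : V ⟶ Z₁) (h₁' : g₀ ≫ q₁ = g₁)
    (q₂ : V ⟶ Z₂) (h₂' : f₁ ≫ g₀ ≫ q₂ = g₂) (h : (f₂ ≫ f₁) ≫ g₀ = 0) :
    SplitExact (f₂ ≫ f₁) g₀ := by
  obtain ⟨-, e₁, s₁, h₁⟩ := h₁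
  obtain ⟨-, e₂, s₂, h₂⟩ := h₂
  have h3 : e₁ ≫ f₁ = 𝟙 _ - g₀ ≫ q₁ ≫ s₁ := by
    rw [← h₁, ← h₁', Category.assoc, add_sub_cancel_right]
  refine ⟨h, e₁ ≫ e₂, q₁ ≫ s₁ + q₂ ≫ s₂ ≫ f₁ - q₁ ≫ s₁ ≫ g₀ ≫ q₂ ≫ s₂ ≫ f₁, ?_⟩
  have h4 : e₂ ≫ f₂ = 𝟙 _ - f₁ ≫ g₀ ≫ q₂ ≫ s₂ := by
    rw [← h₂, ← h₂']
    simp only [Category.assoc, add_sub_cancel_right]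
  have h5 : e₁ ≫ e₂ ≫ f₂ ≫ f₁ = e₁ ≫ f₁ - (e₁ ≫ f₁) ≫ g₀ ≫ q₂ ≫ s₂ ≫ f₁ := by
    rw [reassoc_of% h4, Preadditive.sub_comp, Preadditive.comp_sub]
    simp only [Category.assoc, Category.id_comp]
  rw [Category.assoc, h5, h3]
  simp only [Preadditive.sub_comp, Preadditive.comp_sub, Preadditive.comp_add, Category.assoc,
    Category.id_comp]
  abel

end

section

variable {A : Type u} [Category.{v} A] [Abelian A]

lemma plus_map_zero (T : Monad A) [PreservesFiniteColimits (T : A ⥤ A)] (X Y : A) :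
    (plus T).map (0 : X ⟶ Y) = 0 := by
  rw [← cancel_epi ((plusπ T).app X), ← NatTrans.naturality, Functor.map_zero, zero_comp, comp_zero]

instance (T : Monad A) [PreservesFiniteColimits (T : A ⥤ A)] : T.free.Additive where
  map_add {X Y f g} := by
    ext
    exact (T : A ⥤ A).map_add

/-- Subbimodules `S n` of a monad such that `S 1` generates a subfunctor `H` of the positive part,
with a quadratic algebra which describes the products of two elements of `S 1`, modulo `H`. -/
structure WordData (T : Monad A) (D : QuadraticData A) {S : ℕ → A ⥤ A}
    (σ : ∀ i, S i ⟶ (T : A ⥤ A)) where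
  σ_zero : ∀ X, (σ 0).app X ≫ (plusπ T).app X = 0
  ρ : S 1 ⟶ D.H
  epi_ρ : ∀ X, Epi (ρ.app X)
  τ : D.H ⟶ plus T
  ρ_τ : ∀ X, ρ.app X ≫ τ.app X = (σ 1).app X ≫ (plusπ T).app X
  ker_ρ : ∀ {X Z : A} (k : Z ⟶ (S 1).obj X), Projective X → k ≫ ρ.app X = 0 →
    ∃ y, k ≫ (σ 1).app X = y ≫ T.η.app X
  proj_H : ∀ X, Projective X → Projective (D.H.obj X)
  retr_τ : ∀ X, Projective X → ∃ e, τ.app X ≫ e = 𝟙 _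
  quot : ∀ X, Projective X → ∃ (Q : A) (q : (plus T).obj X ⟶ Q) (j : D.H₂.obj X ⟶ Q)
    (e : Q ⟶ D.H₂.obj X), τ.app X ≫ q = 0 ∧
    (∀ {Z : A} (x : Z ⟶ (plus T).obj X), x ≫ q = 0 → ∃ y, y ≫ τ.app X = x) ∧
    (S 1).map ((σ 1).app X) ≫ (σ 1).app (T.obj X) ≫ T.μ.app X ≫ (plusπ T).app X ≫ q =
      (S 1).map (ρ.app X) ≫ ρ.app (D.H.obj X) ≫ D.m.app X ≫ j ∧ j ≫ e = 𝟙 _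

namespace WordData

variable {T : Monad A} [PreservesFiniteColimits (T : A ⥤ A)] {D : QuadraticData A} {S : ℕ → A ⥤ A}
  [∀ i, PreservesFiniteColimits (S i)] {σ : ∀ i, S i ⟶ (T : A ⥤ A)} (w : WordData T D σ)

lemma ρ_naturality {X Y : A} (f : X ⟶ Y) :
    (S 1).map f ≫ w.ρ.app Y = w.ρ.app X ≫ D.H.map f := w.ρ.naturality f

lemma σ_naturality (σ : ∀ i, S i ⟶ (T : A ⥤ A)) {X Y : A} (n : ℕ) (f : X ⟶ Y) :
    (S n).map f ≫ (σ n).app Y = (σ n).app X ≫ T.map f := (σ n).naturality f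

/-- The inclusion of the part of weight one, one step further. -/
noncomputable def next (s : Stage T) {P : A} (h : P ⟶ s.Y) : D.H.obj P ⟶ (plus T).obj s.Y :=
  w.τ.app P ≫ (plus T).map h

lemma ρ_next (s : Stage T) {P : A} (h : P ⟶ s.Y) : w.ρ.app P ≫ w.next s h =
    (S 1).map h ≫ (σ 1).app s.Y ≫ (plusπ T).app s.Y := by
  have h1 := (plusπ T).naturality h
  rw [next, ← Category.assoc, w.ρ_τ, Category.assoc, ← h1, reassoc_of% (σ_naturality σ 1 h)]

lemma ρ_next_b (s : Stage T) {P : A} (h : P ⟶ s.Y) :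
    (S 1).map (w.ρ.app P ≫ w.next s h) ≫ (σ 1).app ((plus T).obj s.Y) ≫ s.next.b =
      (S 1).map ((S 1).map h ≫ (σ 1).app s.Y) ≫ (σ 1).app (T.obj s.Y) ≫ T.μ.app s.Y ≫
        (plusπ T).app s.Y -
      (S 1).map (((S 1).map h ≫ (σ 1).app s.Y) ≫ s.b) ≫ (σ 1).app s.Y ≫ (plusπ T).app s.Y := by
  have h1 : T.map ((plusπ T).app s.Y) ≫ s.next.b =
      (T.μ.app s.Y ≫ (plusπ T).app s.Y : T.obj (T.obj s.Y) ⟶ (plus T).obj s.Y) -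
        T.map s.b ≫ (plusπ T).app s.Y :=
    eq_sub_of_add_eq s.plusπ_b_next
  have h2 := σ_naturality σ 1 ((plusπ T).app s.Y)
  rw [ρ_next, ← Category.assoc ((S 1).map h), Functor.map_comp _ _ ((plusπ T).app s.Y),
    Category.assoc ((S 1).map _), reassoc_of% h2, h1, Preadditive.comp_sub, Preadditive.comp_sub,
    Functor.map_comp _ _ s.b, Category.assoc ((S 1).map _) ((S 1).map s.b),
    reassoc_of% (σ_naturality σ 1 s.b)]

lemma exists_bar (s : Stage T) {P : A} (hP : Projective P) (h : P ⟶ s.Y) :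
    ∃ b : D.H.obj P ⟶ cokernel h,
      w.ρ.app P ≫ b = (S 1).map h ≫ (σ 1).app s.Y ≫ s.b ≫ cokernel.π h := by
  have := w.epi_ρ P
  refine ⟨Abelian.epiDesc (w.ρ.app P) _ ?_, Abelian.comp_epiDesc _ _ _⟩
  obtain ⟨y, hy⟩ := w.ker_ρ (kernel.ι (w.ρ.app P)) hP (kernel.condition _)
  have h1 := T.η.naturality h
  dsimp at h1
  rw [reassoc_of% (σ_naturality σ 1 h), reassoc_of% hy, ← reassoc_of% h1, reassoc_of% s.unit,
    cokernel.condition, comp_zero]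

lemma next_retraction (s : Stage T) {P : A} (hP : Projective P) {h : P ⟶ s.Y} {r : s.Y ⟶ P}
    (hr : h ≫ r = 𝟙 P) : ∃ r', w.next s h ≫ r' = 𝟙 _ := by
  obtain ⟨e, he⟩ := w.retr_τ P hP
  refine ⟨(plus T).map r ≫ e, ?_⟩
  rw [next, Category.assoc, ← Functor.map_comp_assoc, hr, (plus T).map_id, Category.id_comp, he]

/-- The product of two elements of weight one, without the part of weight one. -/
noncomputable def lead (T : Monad A) (σ : ∀ i, S i ⟶ (T : A ⥤ A)) {U₁ P : A}
    (x : U₁ ⟶ (S 1).obj P) : (S 1).obj U₁ ⟶ (plus T).obj P :=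
  (S 1).map (x ≫ (σ 1).app P) ≫ (σ 1).app (T.obj P) ≫ T.μ.app P ≫ (plusπ T).app P

lemma lead_map {U₁ P Y : A} (x : U₁ ⟶ (S 1).obj P) (h : P ⟶ Y) :
    lead T σ x ≫ (plus T).map h = (S 1).map (x ≫ (S 1).map h ≫ (σ 1).app Y) ≫
      (σ 1).app (T.obj Y) ≫ T.μ.app Y ≫ (plusπ T).app Y := by
  have h1 := (plusπ T).naturality h
  have h2 := T.μ.naturality h
  dsimp at h1 h2
  rw [lead, Category.assoc, Category.assoc, Category.assoc, ← h1, ← reassoc_of% h2,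
    ← reassoc_of% (σ_naturality σ 1 (T.map h)), ← Functor.map_comp_assoc, Category.assoc,
    σ_naturality σ 1 h]

lemma map_lead {U₁ U₂ P : A} (y : U₂ ⟶ U₁) (x : U₁ ⟶ (S 1).obj P) :
    (S 1).map y ≫ lead T σ x = lead T σ (y ≫ x) := by
  rw [lead, lead, Category.assoc, Functor.map_comp _ y, Category.assoc]

lemma ρ_next_b_comp {s : Stage T} {P Z : A} (h : P ⟶ s.Y) (p : (plus T).obj s.Y ⟶ Z) :
    (S 1).map (w.ρ.app P ≫ w.next s h) ≫ (σ 1).app ((plus T).obj s.Y) ≫ s.next.b ≫ p =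
      lead T σ (𝟙 ((S 1).obj P)) ≫ (plus T).map h ≫ p -
        (S 1).map ((S 1).map h ≫ (σ 1).app s.Y ≫ s.b) ≫ (σ 1).app s.Y ≫ (plusπ T).app s.Y ≫ p := by
  have h1 := congr_arg (fun a => a ≫ p) (w.ρ_next_b s h)
  dsimp only at h1
  rw [Preadditive.sub_comp, ← Category.id_comp ((S 1).map h ≫ (σ 1).app s.Y),
    ← lead_map (T := T) (σ := σ)] at h1
  simp only [Category.assoc, Category.id_comp] at h1
  rw [← h1]
  exact congr_arg (fun a => _ ≫ _ ≫ a) (Category.assoc _ _ _)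

lemma next_b_comp {s : Stage T} {P U₁ Z : A} {h : P ⟶ s.Y} (x : U₁ ⟶ (S 1).obj P)
    (z : U₁ ⟶ P) (hz : z ≫ h = x ≫ (S 1).map h ≫ (σ 1).app s.Y ≫ s.b)
    (p : (plus T).obj s.Y ⟶ Z) (hp : w.next s h ≫ p = 0) :
    (S 1).map (x ≫ w.ρ.app P ≫ w.next s h) ≫ (σ 1).app ((plus T).obj s.Y) ≫ s.next.b ≫ p =
      lead T σ x ≫ (plus T).map h ≫ p := by
  have h2 : (S 1).map (z ≫ h) ≫ (σ 1).app s.Y ≫ (plusπ T).app s.Y ≫ p = 0 := by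
    have h3 := congr_arg (fun a => (S 1).map z ≫ a ≫ p) (w.ρ_next s h)
    simp only [Category.assoc] at h3
    rw [Functor.map_comp, Category.assoc, ← h3, hp, comp_zero, comp_zero]
  rw [Functor.map_comp _ x, Category.assoc, ρ_next_b_comp, Preadditive.comp_sub,
    reassoc_of% (map_lead (T := T) (σ := σ) x), Category.comp_id, ← Functor.map_comp_assoc, ← hz,
    h2, sub_zero]

lemma step {s : Stage T} {P U U₁ U₂ : A} (hY : Projective s.Y) (hP : Projective P)
    (hU₁ : Projective U₁) (hU₂ : Projective U₂) {h : P ⟶ s.Y} {r : s.Y ⟶ P} (hr : h ≫ r = 𝟙 P)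
    {a : U ⟶ P} {a' : P ⟶ U} (ha : a ≫ a' = 𝟙 U) {i : U₁ ⟶ D.H.obj U} {i' : U₂ ⟶ D.H.obj U₁}
    (hi : SplitExact i' (D.H.map i ≫ D.m.app U)) {b : D.H.obj P ⟶ cokernel h}
    (hb : w.ρ.app P ≫ b = (S 1).map h ≫ (σ 1).app s.Y ≫ s.b ≫ cokernel.π h)
    {b' : D.H.obj (D.H.obj P) ⟶ cokernel (w.next s h)}
    (hb' : w.ρ.app (D.H.obj P) ≫ b' = (S 1).map (w.next s h) ≫
      (σ 1).app ((plus T).obj s.Y) ≫ s.next.b ≫ cokernel.π (w.next s h))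
    [D.H.Additive] (H : SplitExact (i ≫ D.H.map a) b) :
    SplitExact (i' ≫ D.H.map (i ≫ D.H.map a)) b' := by
  have := w.epi_ρ
  have hs : cokernel.π h ≫ cokernel.desc h (𝟙 _ - r ≫ h) (by
      rw [Preadditive.comp_sub, reassoc_of% hr, Category.comp_id, sub_self]) = 𝟙 _ - r ≫ h :=
    cokernel.π_desc _ _ _
  have hc : Projective (cokernel h) := by
    refine Retract.projective (Y := s.Y)
     { i := cokernel.desc h (𝟙 _ - r ≫ h) (by
        rw [Preadditive.comp_sub, reassoc_of% hr, Category.comp_id, sub_self])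
       r := cokernel.π h
       retract := ?_ }
    rw [← cancel_epi (cokernel.π h), reassoc_of% hs, Preadditive.sub_comp, Category.assoc,
      cokernel.condition, comp_zero, sub_zero, Category.comp_id, Category.id_comp]
  obtain ⟨i₀, hi₀⟩ := Projective.factors i (w.ρ.app U)
  obtain ⟨i₀', hi₀'⟩ := Projective.factors i' (w.ρ.app U₁)
  set x := i₀ ≫ (S 1).map a with hx
  have hxρ : x ≫ w.ρ.app P = i ≫ D.H.map a := by
    rw [hx, Category.assoc, w.ρ_naturality, reassoc_of% hi₀]
  have hz : (x ≫ (S 1).map h ≫ (σ 1).app s.Y ≫ s.b ≫ r) ≫ h =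
      x ≫ (S 1).map h ≫ (σ 1).app s.Y ≫ s.b := by
    have h1 : (x ≫ (S 1).map h ≫ (σ 1).app s.Y ≫ s.b) ≫ cokernel.π h = 0 := by
      simp only [Category.assoc]
      rw [← hb, reassoc_of% hxρ]
      exact (Category.assoc _ _ _).symm.trans H.1
    have h2 : (x ≫ (S 1).map h ≫ (σ 1).app s.Y ≫ s.b) ≫ (𝟙 _ - r ≫ h) = 0 := by
      rw [← hs]
      exact (Category.assoc _ _ _).symm.trans ((congr_arg (fun a => a ≫ _) h1).trans zero_comp)
    rw [Preadditive.comp_sub, Category.comp_id] at h2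
    rw [eq_comm, ← sub_eq_zero, ← h2]
    simp only [Category.assoc]
  have key : w.ρ.app U₁ ≫ D.H.map (i ≫ D.H.map a) ≫ b' =
      lead T σ x ≫ (plus T).map h ≫ cokernel.π (w.next s h) := by
    rw [← w.next_b_comp x _ hz _ (cokernel.condition _), ← reassoc_of% (w.ρ_naturality), hb',
      ← Functor.map_comp_assoc, ← hxρ, Category.assoc]
  obtain ⟨Q, q, j, e, hq, hq', hj, he⟩ := w.quot P hP
  have hlead : lead T σ x ≫ q = w.ρ.app U₁ ≫ D.H.map i ≫ D.m.app U ≫ D.H₂.map a ≫ j := by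
    have h1 := D.m.naturality a
    dsimp at h1
    rw [lead, Functor.map_comp]
    simp only [Category.assoc]
    rw [hj, ← Functor.map_comp_assoc, hxρ, reassoc_of% (w.ρ_naturality), Functor.map_comp_assoc,
      reassoc_of% h1]
  have hq1 : w.next s h ≫ (plus T).map (cokernel.π h) = 0 := by
    rw [next, Category.assoc, ← Functor.map_comp, cokernel.condition, plus_map_zero, comp_zero]
  have claim₁ : b' ≫ cokernel.desc _ _ hq1 = - D.H.map b ≫ w.τ.app (cokernel h) := by
    have h3 := (plusπ T).naturality (cokernel.π h)
    have h4 : w.ρ.app (D.H.obj P) ≫ b' ≫ cokernel.desc _ _ hq1 = (S 1).map (w.next s h) ≫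
        (σ 1).app ((plus T).obj s.Y) ≫ s.next.b ≫ (plus T).map (cokernel.π h) := by
      refine (Category.assoc _ _ _).symm.trans ((congr_arg (fun a => a ≫ _) hb').trans ?_)
      rw [Category.assoc, Category.assoc, Category.assoc, cokernel.π_desc]
    rw [← cancel_epi (w.ρ.app (D.H.obj P)), ← cancel_epi ((S 1).map (w.ρ.app P)), h4, ← Functor.map_comp_assoc, ρ_next_b_comp, ← Functor.map_comp,
      cokernel.condition, plus_map_zero, comp_zero, zero_sub, ← h3,
      ← reassoc_of% (σ_naturality σ 1 (cokernel.π h)), ← w.ρ_τ, ← Functor.map_comp_assoc]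
    simp only [Category.assoc]
    rw [← hb, Functor.map_comp_assoc, reassoc_of% (w.ρ_naturality b)]
    simp
  obtain ⟨e', he'⟩ := w.retr_τ _ hc
  have hq2 : w.next s h ≫ (plus T).map r ≫ q ≫ e = 0 := by
    rw [next, Category.assoc, ← Functor.map_comp_assoc, hr, (plus T).map_id, Category.id_comp,
      reassoc_of% hq, zero_comp]
  refine SplitExact.comp (H.map D.H) (hi.comp_retract (j := D.H₂.map a) (r := D.H₂.map a')
    (by rw [← Functor.map_comp, ha, D.H₂.map_id])) (- cokernel.desc _ _ hq1 ≫ e') ?_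
    (cokernel.desc _ _ hq2) ?_ ?_
  · rw [Preadditive.comp_neg, reassoc_of% claim₁, Preadditive.neg_comp, Category.assoc, he',
      Category.comp_id, neg_neg]
  · rw [← cancel_epi (w.ρ.app U₁), reassoc_of% key, cokernel.π_desc, ← Functor.map_comp_assoc, hr,
      (plus T).map_id, Category.id_comp, reassoc_of% hlead, he, Category.comp_id, Category.assoc]
  · have h1 : (i₀' ≫ lead T σ x) ≫ q = 0 := by
      rw [Category.assoc, hlead, reassoc_of% hi₀']
      have h2 := congr_arg (fun a' => a' ≫ D.H₂.map a ≫ j) hi.1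
      simpa only [Category.assoc, zero_comp] using h2
    obtain ⟨y, hy⟩ := hq' _ h1
    rw [Category.assoc, ← hi₀', Category.assoc, key, reassoc_of% hy.symm]
    have h2 : w.τ.app P ≫ (plus T).map h ≫ cokernel.π (w.next s h) = 0 :=
      (Category.assoc _ _ _).symm.trans (cokernel.condition (w.next s h))
    rw [h2, comp_zero]

end WordData

end

section

variable {A : Type u} [Category.{v} A] [Abelian A]

lemma SplitExact.of_isZero {X Y Z : A} {f : X ⟶ Y} {e : Y ⟶ X} (h : e ≫ f = 𝟙 Y) (g : Y ⟶ Z)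
    (hZ : IsZero Z) : SplitExact f g :=
  ⟨hZ.eq_of_tgt _ _, e, 0, by rw [comp_zero, add_zero, h]⟩

lemma SplitExact.of_retraction {X Y : A} {h : X ⟶ Y} {r : Y ⟶ X} (hr : h ≫ r = 𝟙 X) :
    SplitExact h (cokernel.π h) :=
  ⟨cokernel.condition h, r, cokernel.desc h (𝟙 _ - r ≫ h) (by
    rw [Preadditive.comp_sub, reassoc_of% hr, Category.comp_id, sub_self]), by
    rw [cokernel.π_desc, add_sub_cancel]⟩

/-- Split exactness of the lowest part of the Koszul resolution. -/
def QuadraticData.IsSplitAt (D : QuadraticData A) (X : A) : Prop :=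
  ∀ n, SplitExact ((D.i (n + 1)).app X) ((D.φ n).app X)

/-- The inclusion of the Koszul dual in the tensor algebra. -/
noncomputable def QuadraticData.uMap (D : QuadraticData A) (X : A) :
    ∀ n, (D.U (n + 1)).obj X ⟶ (pow D.H n).obj X
  | 0 => 𝟙 X
  | n + 1 => (D.i (n + 1)).app X ≫ D.H.map (uMap D X n)

lemma QuadraticData.IsSplitAt.retraction {D : QuadraticData A} {X : A} (hD : D.IsSplitAt X) :
    ∀ n, ∃ r, D.uMap X n ≫ r = 𝟙 _
  | 0 => ⟨𝟙 X, Category.comp_id _⟩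
  | n + 1 => by
    obtain ⟨r, hr⟩ := retraction hD n
    obtain ⟨e, he⟩ := (hD n).exists_retraction
    have h : D.H.map (D.uMap X n) ≫ D.H.map r = 𝟙 _ := by
      rw [← Functor.map_comp, hr, D.H.map_id]
    refine ⟨D.H.map r ≫ e, (Category.assoc _ _ _).trans ?_⟩
    exact (congr_arg (fun a => (D.i (n + 1)).app X ≫ a) ((reassoc_of% h) e)).trans he

namespace WordData

variable {T : Monad A} [PreservesFiniteColimits (T : A ⥤ A)] {D : QuadraticData A} {S : ℕ → A ⥤ A}
  [∀ i, PreservesFiniteColimits (S i)] {σ : ∀ i, S i ⟶ (T : A ⥤ A)} (w : WordData T D σ)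

lemma projective_pow (w : WordData T D σ) {X : A} (hX : Projective X) : ∀ n, Projective ((pow D.H n).obj X)
  | 0 => hX
  | n + 1 => w.proj_H _ (projective_pow w hX n)

lemma projective_U (w : WordData T D σ) {X : A} (hX : Projective X) (hD : D.IsSplitAt X) :
    ∀ n, Projective ((D.U (n + 1)).obj X)
  | 0 => hX
  | n + 1 => by
    obtain ⟨e, he⟩ := (hD n).exists_retraction
    have : Projective ((D.U (n + 1) ⋙ D.H).obj X) := w.proj_H _ (projective_U w hX hD n)
    exact Retract.projective { i := _, r := e, retract := he }

/-- The inclusion of the part of `F₊ⁿ M` generated by products of elements of weight one. -/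
noncomputable def hMap (M : T.Algebra) : ∀ n, (pow D.H n).obj M.A ⟶ (stage M n).Y
  | 0 => 𝟙 M.A
  | n + 1 => w.next (stage M n) (hMap M n)

lemma hMap_retraction {M : T.Algebra} (hM : Projective M.A) : ∀ n, ∃ r, w.hMap M n ≫ r = 𝟙 _
  | 0 => ⟨𝟙 M.A, Category.comp_id _⟩
  | n + 1 => by
    obtain ⟨r, hr⟩ := hMap_retraction hM n
    exact w.next_retraction (stage M n) (w.projective_pow hM n) hr

/-- The map from the Koszul dual to the bar construction. -/
noncomputable def vMap (M : T.Algebra) (n : ℕ) : (D.U (n + 1)).obj M.A ⟶ (stage M n).Y :=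
  D.uMap M.A n ≫ w.hMap M n

lemma vMap_zero (M : T.Algebra) : w.vMap M 0 = 𝟙 M.A := Category.comp_id _

lemma vMap_succ (M : T.Algebra) (n : ℕ) : w.vMap M (n + 1) =
    (D.i (n + 1)).app M.A ≫ D.H.map (w.vMap M n) ≫ w.τ.app (stage M n).Y := by
  have h := w.τ.naturality (w.hMap M n)
  refine (Category.assoc _ _ _).trans ?_
  refine congr_arg (fun a => (D.i (n + 1)).app M.A ≫ a) ?_
  rw [vMap, Functor.map_comp, Category.assoc, h]
  rfl

lemma vMap_retraction {M : T.Algebra} (hM : Projective M.A) (hD : D.IsSplitAt M.A) (n : ℕ) :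
    ∃ r, w.vMap M n ≫ r = 𝟙 _ := by
  obtain ⟨r, hr⟩ := hD.retraction n
  obtain ⟨r', hr'⟩ := w.hMap_retraction hM n
  exact ⟨r' ≫ r, by rw [vMap, Category.assoc, reassoc_of% hr', hr]⟩

lemma exists_splitExact [PreservesProj T] [D.H.Additive] {M : T.Algebra} (hM : Projective M.A)
    (hD : D.IsSplitAt M.A) : ∀ n, ∃ b : D.H.obj ((pow D.H n).obj M.A) ⟶ cokernel (w.hMap M n),
      w.ρ.app _ ≫ b = (S 1).map (w.hMap M n) ≫ (σ 1).app (stage M n).Y ≫ (stage M n).b ≫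
        cokernel.π (w.hMap M n) ∧ SplitExact (D.uMap M.A (n + 1)) b
  | 0 => by
    obtain ⟨b, hb⟩ := w.exists_bar (stage M 0) hM (w.hMap M 0)
    refine ⟨b, hb, ?_⟩
    have hz : IsZero (cokernel (w.hMap M 0)) := by
      refine (IsZero.iff_id_eq_zero _).2 ?_
      rw [← cancel_epi (cokernel.π (w.hMap M 0)), comp_zero, Category.comp_id]
      exact (Category.id_comp (cokernel.π (w.hMap M 0))).symm.trans
        (cokernel.condition (w.hMap M 0))
    obtain ⟨h1, e, s, h2⟩ := hD 0
    have h3 : (D.φ 0).app M.A = 0 := by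
      have h4 : (D.i 0).app M.A = 0 := (D.H.map_isZero (D.U_zero_isZero M.A)).eq_of_tgt _ _
      rw [D.φ_app, h4, Functor.map_zero, zero_comp]
    have h5 : D.uMap M.A 1 = (D.i 1).app M.A :=
      (congr_arg (fun a => _ ≫ a) (D.H.map_id M.A)).trans (Category.comp_id _)
    rw [h3, zero_comp, add_zero] at h2
    exact h5 ▸ SplitExact.of_isZero h2 b hz
  | n + 1 => by
    obtain ⟨b, hb, H⟩ := exists_splitExact hM hD n
    obtain ⟨b', hb'⟩ := w.exists_bar (stage M (n + 1)) (w.projective_pow hM (n + 1))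
      (w.hMap M (n + 1))
    obtain ⟨r, hr⟩ := w.hMap_retraction hM n
    obtain ⟨a', ha⟩ := hD.retraction n
    exact ⟨b', hb', w.step (projective_stage M hM n) (w.projective_pow hM n)
      (w.projective_U hM hD (n + 1)) (w.projective_U hM hD (n + 2)) hr ha (hD (n + 1)) hb hb' H⟩

lemma wordMap_eq_zero (w : WordData T D σ) (M : T.Algebra) :
    ∀ (n : ℕ) (c : Fin n → ℕ), ∑ i, c i < n → wordMap σ M n c = 0
  | 0, _, h => absurd h (by simp)
  | n + 1, c, h => by
    have h3 : ∑ i : Fin n, c i.succ = ∑ i, Fin.tail c i := rfl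
    rw [Fin.sum_univ_succ, h3] at h
    change (S (c 0)).map (wordMap σ M n (Fin.tail c)) ≫ (σ (c 0)).app (stage M n).Y ≫
      (plusπ T).app (stage M n).Y = 0
    by_cases h0 : c 0 = 0
    · rw [h0, w.σ_zero, comp_zero]
    · have : (S (c 0)).Additive := additive_of_preservesFiniteColimits _
      rw [wordMap_eq_zero w M n (Fin.tail c) (by omega), Functor.map_zero, zero_comp]

lemma exists_wordMap (M : T.Algebra) (hM : Projective M.A) :
    ∀ (n : ℕ) (c : Fin n → ℕ), ∑ i, c i = n → ∃ z, z ≫ w.hMap M n = wordMap σ M n c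
  | 0, _, h => ⟨𝟙 M.A, Category.comp_id _⟩
  | n + 1, c, h => by
    have h3 : ∑ i : Fin n, c i.succ = ∑ i, Fin.tail c i := rfl
    rw [Fin.sum_univ_succ, h3] at h
    change ∃ z, z ≫ w.next (stage M n) (w.hMap M n) = (S (c 0)).map (wordMap σ M n (Fin.tail c)) ≫
      (σ (c 0)).app (stage M n).Y ≫ (plusπ T).app (stage M n).Y
    by_cases h0 : c 0 = 0
    · exact ⟨0, by rw [h0, w.σ_zero, comp_zero, zero_comp]⟩
    by_cases h1 : c 0 = 1
    · obtain ⟨z, hz⟩ := exists_wordMap M hM n (Fin.tail c) (by omega)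
      rw [h1]
      refine ⟨(S 1).map z ≫ w.ρ.app _, ?_⟩
      rw [Category.assoc, ρ_next, ← Functor.map_comp_assoc, hz]
    · have : (S (c 0)).Additive := additive_of_preservesFiniteColimits _
      refine ⟨0, ?_⟩
      rw [wordMap_eq_zero w M n (Fin.tail c) (by omega), Functor.map_zero, zero_comp, zero_comp]

lemma exists_lift_hMap {M : T.Algebra} (hM : Projective M.A) (n : ℕ) {Z : T.Algebra}
    (x : Z ⟶ T.free.obj (stage M n).Y) (hx : (barFiltration σ M n n).Factors x) :
    x ≫ T.free.map (cokernel.π (w.hMap M n)) = 0 ∧ ∃ y, y ≫ T.free.map (w.hMap M n) = x := by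
  obtain ⟨r, hr⟩ := w.hMap_retraction hM n
  have h0 : x ≫ T.free.map (cokernel.π (w.hMap M n)) = 0 := by
    refine (kernelSubobject_factors_iff _ _).1 (Subobject.factors_of_le _ (Finset.sup_le
      fun k hk => Finset.sup_le fun c hc => imageSubobject_le_kernelSubobject _ _ ?_) hx)
    rw [Finset.Nat.mem_antidiagonalTuple] at hc
    rw [Finset.mem_range] at hk
    refine (T.free.map_comp _ _).symm.trans ?_
    have h1 : wordMap σ M n c ≫ cokernel.π (w.hMap M n) = 0 := by
      rcases lt_or_eq_of_le (show ∑ i, c i ≤ n by omega) with h | h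
      · rw [w.wordMap_eq_zero M n c h, zero_comp]
      · obtain ⟨z, hz⟩ := w.exists_wordMap M hM n c h
        rw [← hz, Category.assoc, cokernel.condition, comp_zero]
    rw [h1, Functor.map_zero]
  exact ⟨h0, ((SplitExact.of_retraction hr).map T.free).lift x h0⟩

lemma next_bd (s : Stage T) {P : A} (h : P ⟶ s.Y) : w.ρ.app P ≫ w.next s h ≫ s.bd =
    (S 1).map h ≫ (σ 1).app s.Y - (S 1).map h ≫ (σ 1).app s.Y ≫ s.b ≫ T.η.app s.Y := by
  have h1 := congr_arg (fun a => a ≫ s.bd) (w.ρ_next s h)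
  simp only [Category.assoc] at h1
  rw [h1, s.π_bd, Preadditive.comp_sub, Preadditive.comp_sub]
  exact congr_arg (fun a => (S 1).map h ≫ a - _) (Category.comp_id ((σ 1).app s.Y))

lemma next_bd_map (s : Stage T) {P : A} (h : P ⟶ s.Y) {b : D.H.obj P ⟶ cokernel h}
    (hb : w.ρ.app P ≫ b = (S 1).map h ≫ (σ 1).app s.Y ≫ s.b ≫ cokernel.π h) :
    w.next s h ≫ s.bd ≫ T.map (cokernel.π h) = - (b ≫ T.η.app (cokernel h)) := by
  have := w.epi_ρ P
  have h1 := congr_arg (fun a => a ≫ T.map (cokernel.π h)) (w.next_bd s h)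
  have h2 := T.η.naturality (cokernel.π h)
  dsimp only [Functor.id_obj, Functor.id_map] at h2
  have : (S 1).Additive := additive_of_preservesFiniteColimits _
  rw [← cancel_epi (w.ρ.app P), Preadditive.comp_neg, ← Category.assoc _ b, hb]
  rw [Preadditive.sub_comp] at h1
  simp only [Category.assoc] at h1
  rw [h1, ← σ_naturality, ← Functor.map_comp_assoc, cokernel.condition, Functor.map_zero, zero_comp,
    zero_sub, ← h2]
  simp only [Category.assoc]

lemma free_next_d (s : Stage T) {P : A} (h : P ⟶ s.Y) {b : D.H.obj P ⟶ cokernel h}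
    (hb : w.ρ.app P ≫ b = (S 1).map h ≫ (σ 1).app s.Y ≫ s.b ≫ cokernel.π h) :
    T.free.map (w.next s h) ≫ s.dFree ≫ T.free.map (cokernel.π h) = - T.free.map b := by
  apply free_hom_ext
  have h1 := T.η.naturality (w.next s h)
  have h2 := T.η.naturality b
  dsimp only [Functor.id_obj, Functor.id_map] at h1 h2
  have h3 : T.η.app (D.H.obj P) ≫ T.map (w.next s h) ≫ s.d ≫ T.map (cokernel.π h) =
      - (T.η.app (D.H.obj P) ≫ T.map b) := by
    rw [← reassoc_of% h1, ← h2, ← w.next_bd_map s h hb, ← s.η_d,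
      Category.assoc]
  exact h3.trans (Preadditive.comp_neg _ _).symm

lemma factorsWord_of_lift {M : T.Algebra} {n : ℕ} {P Z : A} (hZ : Projective Z)
    {h : P ⟶ (stage M n).Y} (hh : FactorsWord σ M n n h) (z : Z ⟶ D.H.obj P) :
    FactorsWord σ M (n + 1) (n + 1) (z ≫ w.next (stage M n) h) := by
  have := w.epi_ρ P
  obtain ⟨y, hy⟩ := Projective.factors z (w.ρ.app P)
  have h1 : z ≫ w.next (stage M n) h = y ≫ (S 1).map h ≫ (σ 1).app (stage M n).Y ≫
      (plusπ T).app (stage M n).Y := by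
    rw [← hy, Category.assoc, ρ_next]
  exact Eq.mpr (congr_arg (fun a => FactorsWord σ M (n + 1) (n + 1) a) h1)
    (hh.cons σ (add_comm 1 n) y)

lemma factorsWord_hMap (M : T.Algebra) (hM : Projective M.A) :
    ∀ n, FactorsWord σ M n n (w.hMap M n)
  | 0 => FactorsWord.zero _ _
  | n + 1 => by
    have h := w.factorsWord_of_lift (w.projective_pow hM (n + 1)) (factorsWord_hMap M hM n) (𝟙 _)
    exact Eq.mp (congr_arg (fun a => FactorsWord σ M (n + 1) (n + 1) a)
      (Category.id_comp (w.next (stage M n) (w.hMap M n)))) h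

lemma FactorsWord.comp {M : T.Algebra} {n m : ℕ} {Y Z : A} {y : Y ⟶ (stage M n).Y}
    (h : FactorsWord σ M n m y) (z : Z ⟶ Y) : FactorsWord σ M n m (z ≫ y) := by
  obtain ⟨c, p, hc, rfl⟩ := h
  exact ⟨c, z ≫ p, hc, Category.assoc _ _ _⟩

lemma FactorsWord.free {M : T.Algebra} {n m : ℕ} {Z : A} {z : Z ⟶ (stage M n).Y}
    (h : FactorsWord σ M n m z) : (barFiltration σ M n m).Factors (T.free.map z) := by
  obtain ⟨c, p, hc, rfl⟩ := h
  refine Subobject.factors_of_le _ (Finset.le_sup (f := fun k =>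
    (Finset.Nat.antidiagonalTuple n k).sup fun c => imageSubobject (freeWordMap σ M n c))
    (Finset.mem_range.2 (Nat.lt_succ_self m))) ?_
  refine Subobject.factors_of_le _ (Finset.le_sup (f := fun c => imageSubobject (freeWordMap σ M n c))
    (Finset.Nat.mem_antidiagonalTuple.2 hc)) ?_
  rw [T.free.map_comp]
  refine (Subobject.mk_factors_iff _ _).2 ⟨T.free.map p ≫ factorThruImage _, ?_⟩
  refine (Category.assoc _ _ _).trans ?_
  exact congr_arg (fun a => T.free.map p ≫ a) (image.fac _)

lemma free_map_dFree (s : Stage T) {U V P : A} (v' : V ⟶ (plus T).obj s.Y) (a : V ⟶ T.obj U)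
    (v : U ⟶ s.Y) (z : V ⟶ P) (h : P ⟶ s.Y)
    (hv : v' ≫ s.bd = a ≫ T.map v - z ≫ h ≫ T.η.app s.Y) :
    T.free.map v' ≫ s.dFree =
      freeDesc (N := T.free.obj U) a ≫ T.free.map v + (- T.free.map z) ≫ T.free.map h := by
  have h1 := T.μ.naturality v
  have h2 : T.map (T.η.app s.Y) ≫ T.μ.app s.Y = 𝟙 _ := T.right_unit _
  dsimp only [Functor.comp_map] at h1
  have h3 : T.map v' ≫ s.d = T.map a ≫ T.μ.app U ≫ T.map v - T.map z ≫ T.map h := by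
    rw [Stage.d, ← Functor.map_comp_assoc, hv, Functor.map_sub, Preadditive.sub_comp,
      Functor.map_comp, Functor.map_comp, Functor.map_comp]
    refine congr_arg₂ (fun a b => a - b) ?_ ?_
    · exact (Category.assoc _ _ _).trans (congr_arg (fun x => T.map a ≫ x) h1)
    · simp only [Category.assoc]
      exact congr_arg (fun x => T.map z ≫ x)
        ((congr_arg (fun x => T.map h ≫ x) h2).trans (Category.comp_id _))
  rw [Preadditive.neg_comp, ← sub_eq_add_neg]
  ext
  refine h3.trans ?_
  exact congr_arg (fun x => x - T.map z ≫ T.map h) (Category.assoc _ _ _).symm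

lemma exists_free_vMap_d [PreservesProj T] [D.H.Additive] {M : T.Algebra} (hM : Projective M.A)
    (hD : D.IsSplitAt M.A) (n : ℕ) :
    ∃ (x : T.free.obj ((D.U (n + 2)).obj M.A) ⟶ T.free.obj ((D.U (n + 1)).obj M.A))
      (y : T.free.obj ((D.U (n + 2)).obj M.A) ⟶ T.free.obj ((pow D.H n).obj M.A)),
      T.free.map (w.vMap M (n + 1)) ≫ (stage M n).dFree =
        x ≫ T.free.map (w.vMap M n) + y ≫ T.free.map (w.hMap M n) := by
  have := w.epi_ρ
  have hp : Projective ((D.U (n + 2)).obj M.A) := w.projective_U hM hD (n + 1)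
  obtain ⟨b, hb, H⟩ := w.exists_splitExact hM hD n
  obtain ⟨r, hr⟩ := w.hMap_retraction hM n
  obtain ⟨i₀, hi₀⟩ := Projective.factors (P := (D.U (n + 2)).obj M.A)
    (X := D.H.obj ((D.U (n + 1)).obj M.A)) ((D.i (n + 1)).app M.A)
    (w.ρ.app ((D.U (n + 1)).obj M.A))
  obtain ⟨z, hz⟩ := (SplitExact.of_retraction hr).lift
    (i₀ ≫ (S 1).map (D.uMap M.A n ≫ w.hMap M n) ≫ (σ 1).app (stage M n).Y ≫ (stage M n).b) (by
      rw [Functor.map_comp]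
      simp only [Category.assoc]
      rw [← hb, reassoc_of% (w.ρ_naturality (D.uMap M.A n)), reassoc_of% hi₀]
      exact (Category.assoc _ _ _).symm.trans H.1)
  have h1 : w.vMap M (n + 1) = i₀ ≫ w.ρ.app _ ≫ w.next (stage M n) (w.vMap M n) := by
    rw [w.vMap_succ, reassoc_of% hi₀, next, ← w.τ.naturality]
  have h2 : w.vMap M (n + 1) ≫ (stage M n).bd = i₀ ≫ (σ 1).app _ ≫ T.map (w.vMap M n) -
      z ≫ w.hMap M n ≫ T.η.app (stage M n).Y := by
    have h3 : (i₀ ≫ w.ρ.app _ ≫ w.next (stage M n) (w.vMap M n)) ≫ (stage M n).bd =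
        i₀ ≫ (σ 1).app _ ≫ T.map (w.vMap M n) - z ≫ w.hMap M n ≫ T.η.app (stage M n).Y := by
      rw [reassoc_of% hz, Category.assoc, Category.assoc, next_bd, Preadditive.comp_sub,
        σ_naturality]
      rfl
    exact (congr_arg (fun a => a ≫ (stage M n).bd) h1).trans h3
  exact ⟨_, _, free_map_dFree (stage M n) (w.vMap M (n + 1)) (i₀ ≫ (σ 1).app _) (w.vMap M n) z
    (w.hMap M n) (h2.trans (congr_arg (fun x => x - _) (Category.assoc _ _ _).symm))⟩

end WordData

end

section

variable {A : Type u} [Category.{v} A] [Abelian A]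

lemma barComplex_d {T : Monad A} [PreservesFiniteColimits (T : A ⥤ A)] (M : T.Algebra) (n : ℕ) :
    (barComplex M).d (n + 1) n = (stage M n).dFree :=
  ChainComplex.of_d (fun n => T.free.obj (stage M n).Y) (fun n => (stage M n).dFree) n

namespace WordData

variable {T : Monad A} [PreservesFiniteColimits (T : A ⥤ A)] {D : QuadraticData A} {S : ℕ → A ⥤ A}
  [∀ i, PreservesFiniteColimits (S i)] {σ : ∀ i, S i ⟶ (T : A ⥤ A)} (w : WordData T D σ)

/-- The submodules whose sequence is the Koszul complex. -/
noncomputable abbrev koszulSub (σ : ∀ i, S i ⟶ (T : A ⥤ A)) (M : T.Algebra) (n : ℕ) :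
    Subobject ((barComplex M).X n) :=
  subcomplexObj (barComplex M) (fun n => barFiltration σ M n n) n

lemma factorsWord_vMap {M : T.Algebra} (hM : Projective M.A) (n : ℕ) :
    FactorsWord σ M n n (w.vMap M n) :=
  FactorsWord.comp (w.factorsWord_hMap M hM n) _

variable [PreservesProj T] [D.H.Additive]

lemma koszulSub_factors {M : T.Algebra} (hM : Projective M.A)
    (hD : D.IsSplitAt M.A) (n : ℕ) : (koszulSub σ M n).Factors (T.free.map (w.vMap M n)) := by
  refine (Subobject.inf_factors _).2 ⟨FactorsWord.free (w.factorsWord_vMap hM n), ?_⟩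
  refine (pullback_factors _ _ _).2 ?_
  cases n with
  | zero =>
    have h : (barComplex M).d 0 0 = 0 := (barComplex M).shape _ _ (by simp)
    change (barFiltration σ M 0 0).Factors (T.free.map (w.vMap M 0) ≫ (barComplex M).d 0 0)
    rw [h]
    exact (congr_arg (barFiltration σ M 0 0).Factors comp_zero).mpr Subobject.factors_zero
  | succ n =>
    obtain ⟨x, y, h⟩ := w.exists_free_vMap_d hM hD n
    change (barFiltration σ M n n).Factors
      (T.free.map (w.vMap M (n + 1)) ≫ (barComplex M).d (n + 1) n)
    rw [barComplex_d]
    refine (congr_arg (barFiltration σ M n n).Factors h).mpr ?_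
    exact Subobject.factors_add _ _
      (Subobject.factors_of_factors_right _ (FactorsWord.free (w.factorsWord_vMap hM n)))
      (Subobject.factors_of_factors_right _ (FactorsWord.free (w.factorsWord_hMap M hM n)))

lemma exists_lift_vMap {M : T.Algebra} (hM : Projective M.A) (hD : D.IsSplitAt M.A) (n : ℕ)
    {Z : T.Algebra} (x : Z ⟶ T.free.obj (stage M n).Y) (hx : (koszulSub σ M n).Factors x) :
    ∃ y, y ≫ T.free.map (w.vMap M n) = x := by
  have hx' := (Subobject.inf_factors _).1 hx
  cases n with
  | zero =>
    refine ⟨x, ?_⟩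
    have h : T.free.map (w.vMap M 0) = 𝟙 _ :=
      (congr_arg (fun a => T.free.map a) (w.vMap_zero M)).trans (T.free.map_id _)
    exact (congr_arg (fun a => x ≫ a) h).trans (Category.comp_id _)
  | succ n =>
    obtain ⟨-, y, hy⟩ := w.exists_lift_hMap hM (n + 1) x hx'.1
    have h1 : (barFiltration σ M n n).Factors (x ≫ (stage M n).dFree) := by
      rw [← barComplex_d]
      exact (pullback_factors _ _ _).1 hx'.2
    have h2 := (w.exists_lift_hMap hM n _ h1).1
    obtain ⟨b, hb, H⟩ := w.exists_splitExact hM hD n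
    have h3 : y ≫ T.free.map b = 0 := by
      have h4 := congr_arg (fun a => y ≫ a) (w.free_next_d (stage M n) (w.hMap M n) hb)
      have h5 : y ≫ T.free.map (w.next (stage M n) (w.hMap M n)) ≫ (stage M n).dFree ≫
          T.free.map (cokernel.π (w.hMap M n)) = 0 := by
        refine Eq.trans ?_ h2
        refine (Category.assoc _ _ _).symm.trans (Eq.trans ?_ (Category.assoc _ _ _).symm)
        exact congr_arg (fun a => a ≫ _) hy
      exact neg_eq_zero.1 ((Preadditive.comp_neg y (T.free.map b)).symm.trans (h4.symm.trans h5))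
    obtain ⟨z, hz⟩ := (H.map T.free).lift y h3
    refine ⟨z, ?_⟩
    rw [← hy, ← hz]
    exact (congr_arg (fun a => z ≫ a) (T.free.map_comp _ _)).trans (Category.assoc _ _ _).symm

/-- The inclusion of the free module on the Koszul dual in the Koszul complex. -/
noncomputable def toKoszul {M : T.Algebra} (hM : Projective M.A) (hD : D.IsSplitAt M.A) (n : ℕ) :
    T.free.obj ((D.U (n + 1)).obj M.A) ⟶ (koszulSub σ M n : T.Algebra) :=
  (koszulSub σ M n).factorThru _ (w.koszulSub_factors hM hD n)

lemma toKoszul_arrow {M : T.Algebra} (hM : Projective M.A) (hD : D.IsSplitAt M.A) (n : ℕ) :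
    w.toKoszul hM hD n ≫ (koszulSub σ M n).arrow = T.free.map (w.vMap M n) :=
  Subobject.factorThru_arrow _ _ _

lemma isIso_toKoszul {M : T.Algebra} (hM : Projective M.A) (hD : D.IsSplitAt M.A) (n : ℕ) :
    IsIso (w.toKoszul hM hD n) := by
  obtain ⟨r, hr⟩ := w.vMap_retraction hM hD n
  obtain ⟨y, hy⟩ := w.exists_lift_vMap hM hD n _ (Subobject.factors_self (koszulSub σ M n))
  have h1 : y ≫ w.toKoszul hM hD n = 𝟙 _ := by
    rw [← cancel_mono (koszulSub σ M n).arrow, Category.assoc, toKoszul_arrow]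
    exact hy.trans (Category.id_comp _).symm
  refine ⟨y, ?_, h1⟩
  have h2 : T.free.map (w.vMap M n) ≫ T.free.map r = 𝟙 _ := by
    rw [← Functor.map_comp, hr, T.free.map_id]
  have h3 : w.toKoszul hM hD n ≫ y ≫ T.free.map (w.vMap M n) = T.free.map (w.vMap M n) := by
    rw [hy]
    exact w.toKoszul_arrow hM hD n
  have h4 := congr_arg (fun a => a ≫ T.free.map r) h3
  simp only [Category.assoc] at h4
  rw [h2, Category.comp_id] at h4
  exact h4

/-- The value of a Koszul cochain on the Koszul dual. -/
noncomputable def value {M : T.Algebra} (hM : Projective M.A) (hD : D.IsSplitAt M.A)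
    (N : T.Algebra) (n : ℕ) :
    (koszulCochains σ M N).X n →+ ((D.U (n + 1)).obj M.A ⟶ N.A) :=
  AddMonoidHom.mk' (fun f : (koszulSub σ M n : T.Algebra) ⟶ N =>
    T.η.app _ ≫ (w.toKoszul hM hD n ≫ f).f) (fun f g =>
      (congr_arg (fun a : T.free.obj ((D.U (n + 1)).obj M.A) ⟶ N =>
        T.η.app ((D.U (n + 1)).obj M.A) ≫ a.f) (Preadditive.comp_add _ _ _ _ f g)).trans
        (Preadditive.comp_add _ _ _ _ _ _))

lemma value_cobarToKoszul {M : T.Algebra} (hM : Projective M.A) (hD : D.IsSplitAt M.A)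
    (N : T.Algebra) (n : ℕ) (c : (stage M n).Y ⟶ N.A) :
    w.value hM hD N n (cobarToKoszul σ M N n c) = w.vMap M n ≫ c := by
  have h1 : w.toKoszul hM hD n ≫ (koszulSub σ M n).arrow ≫ cobar M N n c =
      freeDesc (w.vMap M n ≫ c) := by
    refine (Category.assoc _ _ _).symm.trans
      ((congr_arg (fun a => a ≫ _) (w.toKoszul_arrow hM hD n)).trans ?_)
    rw [cobar, adj_homEquiv_symm]
    ext
    refine (Category.assoc _ _ _).symm.trans ?_
    exact congr_arg (fun a => a ≫ N.a) (T.map_comp _ _).symm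
  refine (congr_arg (fun a => T.η.app _ ≫ a.f) h1).trans ?_
  exact η_freeDesc _

lemma value_injective {M : T.Algebra} (hM : Projective M.A) (hD : D.IsSplitAt M.A)
    (N : T.Algebra) (n : ℕ) : Function.Injective (w.value hM hD N n) := by
  intro f g h
  change (koszulSub σ M n : T.Algebra) ⟶ N at f g
  have := w.isIso_toKoszul hM hD n
  exact (cancel_epi (w.toKoszul hM hD n)).1 (free_hom_ext h)

lemma exists_vMap_comp (w : WordData T D σ) {M : T.Algebra} (hM : Projective M.A) (hD : D.IsSplitAt M.A)
    (n : ℕ) {N : A} (a : (D.U (n + 1)).obj M.A ⟶ N) :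
    ∃ c, w.vMap M n ≫ c = a := by
  obtain ⟨r, hr⟩ := w.vMap_retraction hM hD n
  exact ⟨r ≫ a, by rw [reassoc_of% hr]⟩

lemma cobarToKoszul_surjective (w : WordData T D σ) {M : T.Algebra} (hM : Projective M.A) (hD : D.IsSplitAt M.A)
    (N : T.Algebra) (n : ℕ) : Function.Surjective (cobarToKoszul σ M N n) := fun f => by
  obtain ⟨c, hc⟩ := w.exists_vMap_comp hM hD n (w.value hM hD N n f)
  exact ⟨c, w.value_injective hM hD N n ((w.value_cobarToKoszul hM hD N n c).trans hc)⟩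

lemma cobarToKoszul_eq_iff (w : WordData T D σ) {M : T.Algebra} (hM : Projective M.A) (hD : D.IsSplitAt M.A)
    (N : T.Algebra) (n : ℕ) (c c' : (stage M n).Y ⟶ N.A) :
    cobarToKoszul σ M N n c = cobarToKoszul σ M N n c' ↔ w.vMap M n ≫ c = w.vMap M n ≫ c' := by
  rw [← (w.value_injective hM hD N n).eq_iff, value_cobarToKoszul, value_cobarToKoszul]

end WordData

end

section

variable {A : Type u} [Category.{v} A] [Abelian A] [HasCountableCoproducts A]

instance hasColimitsOfShape_nat : HasColimitsOfShape ℕ A :=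
  ⟨fun F =>
    have : HasColimit (Discrete.functor fun f : Σ p : ℕ × ℕ, p.1 ⟶ p.2 => F.obj f.1.1) :=
      inferInstance
    hasColimit_of_coequalizer_and_coproduct F⟩

namespace GradedAlgebra

variable (G : GradedAlgebra.{w} A)

lemma ι_zero_plusπ (X : A) : (G.ι 0).app X ≫ (plusπ G.total).app X = 0 := by
  rw [← cancel_epi (G.one.app X), comp_zero, ← Category.assoc, one_ι]
  exact plus_condition _ _

/-- The words in the components of a graded algebra. -/
noncomputable def wordData [G.ProjComponents] : WordData G.total G.quad G.ι where
  σ_zero := G.ι_zero_plusπ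
  ρ := 𝟙 _
  epi_ρ X := inferInstanceAs (Epi (𝟙 ((G.pc 1).obj X)))
  τ := G.ι 1 ≫ plusπ G.total
  ρ_τ X := Category.id_comp _
  ker_ρ {X Z} k _ hk := ⟨0, by
    have h : k = 0 := (Category.comp_id k).symm.trans hk
    rw [h, zero_comp, zero_comp]⟩
  proj_H X hX := ProjComponents.proj 1 X hX
  retr_τ X _ := ⟨G.plusPr X, (Category.assoc _ _ _).trans (G.ι_π_plusPr X)⟩
  quot X _ := by
    let t : (G.pc 1).obj X ⟶ (plus G.total).obj X := (G.ι 1).app X ≫ (plusπ G.total).app X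
    have ht : t ≫ G.plusPr X = 𝟙 _ := (Category.assoc _ _ _).trans (G.ι_π_plusPr X)
    have h0 : G.total.η.app X ≫ G.pr 2 X = 0 := by
      rw [← one_ι, Category.assoc, G.ι_pr_of_ne (by omega), comp_zero]
    have h1 : t ≫ plusDesc G.total (G.pr 2 X) h0 = 0 := by
      rw [Category.assoc, π_plusDesc, G.ι_pr_of_ne (by omega)]
    refine ⟨cokernel t, cokernel.π t, (G.ι 2).app X ≫ (plusπ G.total).app X ≫ cokernel.π t,
      cokernel.desc t _ h1, cokernel.condition t, (SplitExact.of_retraction ht).lift, ?_, ?_⟩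
    · have h2 := congr_arg (fun a => a ≫ (plusπ G.total).app X ≫ cokernel.π t)
        (G.ι_μ X (rfl : 1 + 1 = 2))
      simp only [Category.assoc] at h2
      refine h2.trans (Eq.symm ?_)
      refine (congr_arg (fun a => a ≫ _) ((G.pc 1).map_id _)).trans ?_
      exact (Category.id_comp _).trans (Category.id_comp _)
    · have h2 : ((G.ι 2).app X ≫ (plusπ G.total).app X ≫ cokernel.π t) ≫ cokernel.desc t _ h1 =
          𝟙 ((G.pc 2).obj X) := by
        rw [Category.assoc, Category.assoc, cokernel.π_desc, π_plusDesc, ι_pr]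
      exact h2

lemma isSplitAt_quad {X : A} (H : ∀ n, G.KoszulExactAt X n) : G.quad.IsSplitAt X :=
  fun n => (H n).split_i

end GradedAlgebra

namespace FilteredAlgebra

variable {W : ObjectProperty A} [HasCovers W] (F : FilteredAlgebra.{w} W)

lemma map_map {l m n : ℕ} (h : l ⟶ m) (h' : m ⟶ n) (h'' : l ⟶ n) (X : A) :
    (F.fil.map h).app X ≫ (F.fil.map h').app X = (F.fil.map h'').app X := by
  rw [← NatTrans.comp_app, ← Functor.map_comp]
  rfl

lemma exists_retraction_step (hW : ∀ Q, W Q → Projective Q) (hF : F.gr.IsKoszul W) {X : A}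
    (hX : Projective X) (n : ℕ) :
    ∃ r, (F.fil.map (homOfLE (Nat.le_succ n))).app X ≫ r = 𝟙 ((F.fil.obj n).obj X) := by
  have h1 := (F.reesCentralQuotient hW hF).splitExact_τ (rfl : n + 1 = n + 1) X hX
  have h2 : (F.reesCentralQuotient hW hF).τ (rfl : n + 1 = n + 1) X =
    (F.fil.map (homOfLE (Nat.le_succ n))).app X := F.map_reesT_mul rfl X
  rw [h2] at h1
  have := F.mono_fil_map (homOfLE (Nat.le_succ n)) hX
  exact h1.exists_retraction

/-- The extension of the identity of `F≤ₙ X` to the filtration. -/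
noncomputable def retrSeq {X : A} (r : ∀ n, (F.fil.obj (n + 1)).obj X ⟶ (F.fil.obj n).obj X)
    (n : ℕ) : ∀ m, (F.fil.obj m).obj X ⟶ (F.fil.obj n).obj X
  | 0 => (F.fil.map (homOfLE (Nat.zero_le n))).app X
  | m + 1 => if h : m + 1 ≤ n then (F.fil.map (homOfLE h)).app X else r m ≫ retrSeq r n m

lemma retrSeq_of_le {X : A} (r : ∀ n, (F.fil.obj (n + 1)).obj X ⟶ (F.fil.obj n).obj X)
    (n : ℕ) : ∀ (m) (h : m ≤ n), F.retrSeq r n m = (F.fil.map (homOfLE h)).app X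
  | 0, _ => rfl
  | m + 1, h => dif_pos h

lemma map_retrSeq {X : A} {r : ∀ n, (F.fil.obj (n + 1)).obj X ⟶ (F.fil.obj n).obj X}
    (hr : ∀ n, (F.fil.map (homOfLE (Nat.le_succ n))).app X ≫ r n = 𝟙 _) (n m : ℕ) :
    (F.fil.map (homOfLE (Nat.le_succ m))).app X ≫ F.retrSeq r n (m + 1) = F.retrSeq r n m := by
  by_cases h : m + 1 ≤ n
  · rw [F.retrSeq_of_le r n _ h, F.retrSeq_of_le r n m (by omega)]
    exact F.map_map _ _ _ _
  · have h1 : F.retrSeq r n (m + 1) = r m ≫ F.retrSeq r n m := dif_neg h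
    rw [h1, reassoc_of% (hr m)]

lemma exists_retraction_ι (hW : ∀ Q, W Q → Projective Q) (hF : F.gr.IsKoszul W) {X : A}
    (hX : Projective X) (n : ℕ) : ∃ r, (F.ι n).app X ≫ r = 𝟙 ((F.fil.obj n).obj X) := by
  choose r hr using F.exists_retraction_step hW hF hX
  obtain ⟨hc⟩ := F.isColimit
  let hc' := isColimitOfPreserves ((evaluation A A).obj X) hc
  let c : Cocone (F.fil ⋙ (evaluation A A).obj X) :=
    { pt := (F.fil.obj n).obj X
      ι := NatTrans.ofSequence (F.retrSeq r n) (fun m =>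
        (F.map_retrSeq hr n m).trans (Category.comp_id _).symm) }
  refine ⟨hc'.desc c, (hc'.fac c n).trans ?_⟩
  refine (F.retrSeq_of_le r n n le_rfl).trans ?_
  have h1 : F.fil.map (homOfLE (le_refl n)) = 𝟙 _ := F.fil.map_id n
  exact congr_arg (fun a => a.app X) h1

lemma ι_zero_plusπ (X : A) : (F.ι 0).app X ≫ (plusπ F.T).app X = 0 := by
  have := F.isIso_one
  rw [← cancel_epi (F.one.app X), comp_zero, ← Category.assoc, F.one_cocone]
  exact plus_condition _ _

/-- The projection to a component of the associated graded algebra. -/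
noncomputable def grπ (n : ℕ) (X : A) : (F.fil.obj n).obj X ⟶ (F.gr.pc n).obj X :=
  (F.grIdeal.π n).app X

instance (n : ℕ) (X : A) : Epi (F.grπ n X) := inferInstanceAs (Epi ((F.grIdeal.π n).app X))

lemma map_grπ (n : ℕ) (X : A) :
    (F.fil.map (homOfLE (Nat.le_succ n))).app X ≫ F.grπ (n + 1) X = 0 :=
  F.fil_map_π (rfl : n + 1 = n + 1) X

lemma exists_grπ_desc (n : ℕ) {X Z : A} (f : (F.fil.obj (n + 1)).obj X ⟶ Z)
    (hf : (F.fil.map (homOfLE (Nat.le_succ n))).app X ≫ f = 0) : ∃ j, F.grπ (n + 1) X ≫ j = f :=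
  ⟨_, (CokernelCofork.IsColimit.desc' (F.grIdeal.isColimit (n + 1) X) f hf).2⟩

lemma grπ_mul {i j k : ℕ} (h : i + j = k) (X : A) : (F.fil.obj i).map (F.grπ j X) ≫
    F.grπ i ((F.gr.pc j).obj X) ≫ (F.gr.mul h).app X = (F.mul h).app X ≫ F.grπ k X :=
  F.grIdeal.π_π_mulApp h X

lemma η_retraction {X : A} {n : ℕ} {r : F.T.obj X ⟶ (F.fil.obj (n + 1)).obj X}
    (hr : (F.ι (n + 1)).app X ≫ r = 𝟙 _) : F.T.η.app X ≫ r ≫ F.grπ (n + 1) X = 0 := by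
  have h1 := F.map_ι (homOfLE (Nat.zero_le (n + 1))) X
  have h2 := F.map_map (homOfLE (Nat.zero_le n)) (homOfLE (Nat.le_succ n))
    (homOfLE (Nat.zero_le (n + 1))) X
  rw [← F.one_cocone, Category.assoc, ← reassoc_of% h1, reassoc_of% hr, ← h2, Category.assoc,
    map_grπ, comp_zero, comp_zero]

lemma incl_ι_plusπ (X : A) : (F.incl 1).app X ≫ (F.ι 1).app X ≫ (plusπ F.T).app X = 0 := by
  rw [← Category.assoc]
  exact (congr_arg (fun a => a ≫ _) (F.map_ι (homOfLE (Nat.le_succ 0)) X)).trans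
    (F.ι_zero_plusπ X)

/-- The inclusion of the part of degree one of the associated graded algebra. -/
noncomputable def grPlus : F.gr.pc 1 ⟶ plus F.T :=
  cokernel.desc (F.incl 1) (F.ι 1 ≫ plusπ F.T) (by
    ext X
    exact F.incl_ι_plusπ X)

lemma grπ_grPlus (X : A) : F.grπ 1 X ≫ F.grPlus.app X =
    (F.ι 1).app X ≫ (plusπ F.T).app X := by
  have h : F.grIdeal.π 1 ≫ F.grPlus = F.ι 1 ≫ plusπ F.T := cokernel.π_desc _ _ _
  exact congr_arg (fun a => a.app X) h

lemma exists_retraction_grPlus (hW : ∀ Q, W Q → Projective Q) (hF : F.gr.IsKoszul W) {X : A}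
    (hX : Projective X) : ∃ e, F.grPlus.app X ≫ e = 𝟙 ((F.gr.pc 1).obj X) := by
  obtain ⟨r, hr⟩ := F.exists_retraction_ι hW hF hX 1
  refine ⟨plusDesc F.T (r ≫ F.grπ 1 X) (F.η_retraction hr), ?_⟩
  rw [← cancel_epi (F.grπ 1 X), ← Category.assoc, F.grπ_grPlus, Category.assoc, π_plusDesc,
    reassoc_of% hr, Category.comp_id]

lemma exists_quot (hW : ∀ Q, W Q → Projective Q) (hF : F.gr.IsKoszul W) {X : A}
    (hX : Projective X) :
    ∃ (j : (F.gr.pc 2).obj X ⟶ cokernel (F.grPlus.app X))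
      (e : cokernel (F.grPlus.app X) ⟶ (F.gr.pc 2).obj X),
      F.grπ 2 X ≫ j =
        (F.ι 2).app X ≫ (plusπ F.T).app X ≫ cokernel.π (F.grPlus.app X) ∧ j ≫ e = 𝟙 _ := by
  obtain ⟨r, hr⟩ := F.exists_retraction_ι hW hF hX 2
  have h0 : (F.fil.map (homOfLE (Nat.le_succ 1))).app X ≫ (F.ι 2).app X ≫ (plusπ F.T).app X ≫
      cokernel.π (F.grPlus.app X) = 0 := by
    rw [← Category.assoc, F.map_ι, ← Category.assoc, ← F.grπ_grPlus, Category.assoc,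
      cokernel.condition, comp_zero]
  obtain ⟨j, hj⟩ := F.exists_grπ_desc 1 _ h0
  have h2 : F.grPlus.app X ≫ plusDesc F.T (r ≫ F.grπ 2 X) (F.η_retraction hr) = 0 := by
    rw [← cancel_epi (F.grπ 1 X), ← Category.assoc, F.grπ_grPlus, Category.assoc, π_plusDesc,
      comp_zero, ← F.map_ι (homOfLE (Nat.le_succ 1)), Category.assoc, reassoc_of% hr, map_grπ]
  refine ⟨j, cokernel.desc _ _ h2, hj, ?_⟩
  rw [← cancel_epi (F.grπ 2 X), ← Category.assoc, hj, Category.assoc, Category.assoc,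
    cokernel.π_desc, π_plusDesc, reassoc_of% hr, Category.comp_id]

/-- The words in the filtration steps of a Koszul filtered algebra. -/
noncomputable def wordData (hW : ∀ Q, W Q → Projective Q) (hF : F.gr.IsKoszul W) :
    WordData F.T F.gr.quad F.ι where
  σ_zero := F.ι_zero_plusπ
  ρ := F.grIdeal.π 1
  epi_ρ X := inferInstanceAs (Epi ((F.grIdeal.π 1).app X))
  τ := F.grPlus
  ρ_τ := F.grπ_grPlus
  ker_ρ {X Z} k hX hk := by
    have := F.isIso_one
    obtain ⟨y, hy⟩ := (F.reesCentralQuotient hW hF).lift (zero_add 1) X hX k hk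
    have hy' : y ≫ (F.fil.map (homOfLE (Nat.zero_le 1))).app X = k :=
      (congr_arg (fun a => y ≫ a) (F.map_reesT_mul (zero_add 1) X)).symm.trans hy
    refine ⟨y ≫ (inv F.one).app X, ?_⟩
    have h : (inv F.one).app X ≫ F.one.app X = 𝟙 _ := by
      rw [← NatTrans.comp_app, IsIso.inv_hom_id, NatTrans.id_app]
    rw [← F.one_cocone, Category.assoc, reassoc_of% h, ← hy', Category.assoc]
    exact congr_arg (fun a => y ≫ a) (F.map_ι _ X)
  proj_H X hX := (F.projComponents_gr hW hF).proj 1 X hX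
  retr_τ X hX := F.exists_retraction_grPlus hW hF hX
  quot X hX := by
    obtain ⟨e₀, he₀⟩ := F.exists_retraction_grPlus hW hF hX
    obtain ⟨j, e, hj, he⟩ := F.exists_quot hW hF hX
    refine ⟨_, cokernel.π (F.grPlus.app X), j, e, cokernel.condition _,
      (SplitExact.of_retraction he₀).lift, ?_, he⟩
    have h1 := congr_arg (fun a => a ≫ (plusπ F.T).app X ≫ cokernel.π (F.grPlus.app X))
      (F.mul_cocone (rfl : 1 + 1 = 2) X)
    have h2 := congr_arg (fun a => a ≫ j) (F.grπ_mul (rfl : 1 + 1 = 2) X)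
    simp only [Category.assoc] at h1 h2
    exact h1.symm.trans ((congr_arg (fun a => _ ≫ a) hj.symm).trans h2.symm)

lemma isSplitAt_quad (hW : ∀ Q, W Q → Projective Q) (hF : F.gr.IsKoszul W) {X : A}
    (hX : Projective X) : F.gr.quad.IsSplitAt X :=
  F.gr.isSplitAt_quad fun n => F.gr_koszulExactAt hW hF hX n

lemma preservesProj (hW : ∀ Q, W Q → Projective Q) (hF : F.IsKoszul) : PreservesProj F.T where
  proj X hX := by
    obtain ⟨Q, hQ, ⟨e⟩⟩ := exists_retract_of_projective (W := W) hX
    have := hF.projective Q hQ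
    exact Retract.projective (e.map (F.T : A ⥤ A))

end FilteredAlgebra

end

section

variable {A : Type u} [Category.{v} A] [Abelian A]

lemma homComplex_d_apply {B : Type u} [Category.{v} B] [Abelian B] (C : ChainComplex B ℕ) (N : B)
    (n : ℕ) (f : C.X n ⟶ N) : (homComplex C N).d n (n + 1) f = C.d (n + 1) n ≫ f := by
  have h := CochainComplex.of_d (fun n => AddCommGrpCat.of (C.X n ⟶ N))
    (fun n => AddCommGrpCat.ofHom
      (AddMonoidHom.mk' (fun f => C.d (n + 1) n ≫ f) (fun f g => Preadditive.comp_add _ _ _ _ _ _)))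
    n
  exact ConcreteCategory.congr_hom h f

lemma subcomplex_d_arrow {B : Type u} [Category.{v} B] [Abelian B] (C : ChainComplex B ℕ)
    (Φ : ∀ n, Subobject (C.X n)) (n : ℕ) : (subcomplex C Φ).d (n + 1) n ≫
      (subcomplexObj C Φ n).arrow = (subcomplexObj C Φ (n + 1)).arrow ≫ C.d (n + 1) n := by
  have h := ChainComplex.of_d (fun n => (subcomplexObj C Φ n : B))
    (fun n => (subcomplexObj C Φ n).factorThru _ (subcomplexObj_factors C Φ n))
    n
  refine (congr_arg (fun a => a ≫ (subcomplexObj C Φ n).arrow) h).trans ?_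
  exact Subobject.factorThru_arrow _ _ _

variable {T T' : Monad A} [PreservesFiniteColimits (T : A ⥤ A)]
  [PreservesFiniteColimits (T' : A ⥤ A)]

/-- The differential of the reduced cobar complex. -/
noncomputable def cobarDiff {M N : T.Algebra} {n : ℕ} (c : (stage M n).Y ⟶ N.A) :
    (stage M (n + 1)).Y ⟶ N.A :=
  (stage M n).bd ≫ T.map c ≫ N.a

lemma dFree_cobar {M N : T.Algebra} {n : ℕ} (c : (stage M n).Y ⟶ N.A) :
    (stage M n).dFree ≫ cobar M N n c = cobar M N (n + 1) (cobarDiff c) := by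
  rw [cobar, cobar, adj_homEquiv_symm, adj_homEquiv_symm]
  apply free_hom_ext
  have h1 : T.η.app (stage M (n + 1)).Y ≫ (freeDesc (cobarDiff c)).f = cobarDiff c :=
    η_freeDesc _
  refine Eq.trans ?_ h1.symm
  have h2 : (T.η.app ((plus T).obj (stage M n).Y) ≫ (stage M n).d) ≫ T.map c ≫ N.a =
      cobarDiff c := by
    rw [Stage.η_d]
    rfl
  exact (Category.assoc _ _ _).symm.trans h2

lemma d_cobarToKoszul {S : ℕ → A ⥤ A} (σ : ∀ i, S i ⟶ (T : A ⥤ A)) {M N : T.Algebra} {n : ℕ}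
    (c : (stage M n).Y ⟶ N.A) : (koszulCochains σ M N).d n (n + 1) (cobarToKoszul σ M N n c) =
      cobarToKoszul σ M N (n + 1) (cobarDiff c) := by
  refine (homComplex_d_apply _ _ _ _).trans ?_
  have h1 := subcomplex_d_arrow (barComplex M) (fun n => barFiltration σ M n n) n
  refine (Category.assoc _ _ _).symm.trans ((congr_arg (fun a => a ≫ cobar M N n c) h1).trans ?_)
  refine (Category.assoc _ _ _).trans ?_
  refine congr_arg (fun a => (subcomplexObj (barComplex M) (fun n => barFiltration σ M n n)
    (n + 1)).arrow ≫ a) ?_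
  refine (congr_arg (fun a => a ≫ cobar M N n c) (barComplex_d M n)).trans ?_
  exact dFree_cobar c

lemma cobar_add {M N : T.Algebra} {n : ℕ} (c c' : (stage M n).Y ⟶ N.A) :
    cobar M N n (c + c') = cobar M N n c + cobar M N n c' := by
  rw [cobar, cobar, cobar, adj_homEquiv_symm, adj_homEquiv_symm, adj_homEquiv_symm]
  ext
  change T.map (c + c') ≫ N.a = T.map c ≫ N.a + T.map c' ≫ N.a
  rw [Functor.map_add, Preadditive.add_comp]

lemma cobarToKoszul_add {S : ℕ → A ⥤ A} (σ : ∀ i, S i ⟶ (T : A ⥤ A)) {M N : T.Algebra} {n : ℕ}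
    (c c' : (stage M n).Y ⟶ N.A) : cobarToKoszul σ M N n (c + c') =
      cobarToKoszul σ M N n c + cobarToKoszul σ M N n c' :=
  (congr_arg (fun a => (subcomplexObj (barComplex M) (fun n => barFiltration σ M n n) n).arrow ≫ a)
    (cobar_add c c')).trans (Preadditive.comp_add _ _ _ _ _ _)

lemma stageMap_eq (φ : T ⟶ T') (M : T'.Algebra) : ∀ n, stageMap φ M n =
    stageComp φ (𝟙 ((Monad.algebraFunctorOfMonadHom φ).obj M) : _ ⟶ _).f n
  | 0 => rfl
  | n + 1 => by
    refine (cancel_epi ((plusπ T).app _)).1 ?_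
    refine Eq.trans ?_ (π_stageComp φ _ n).symm
    rw [← stageMap_eq φ M n]
    have h1 := (plusπ T).naturality (stageMap φ M n)
    have h2 : ∀ X, (plusπ T).app X ≫ (plusMap φ).app X = φ.app X ≫ (plusπ T').app X := fun X => by
      have h3 : plusπ T ≫ plusMap φ = φ.toNatTrans ≫ plusπ T' := cokernel.π_desc _ _ _
      exact congr_arg (fun a => a.app X) h3
    refine (Category.assoc _ _ _).symm.trans ((congr_arg (fun a => a ≫ _) h1.symm).trans ?_)
    refine (Category.assoc _ _ _).trans ?_
    exact congr_arg (fun a => T.map (stageMap φ M n) ≫ a) (h2 _)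

/-- Restriction of cobar cochains along a homomorphism of algebras. -/
noncomputable def restrictCochain (φ : T ⟶ T') {M N : T'.Algebra} {n : ℕ}
    (c : (stage M n).Y ⟶ N.A) : (stage ((Monad.algebraFunctorOfMonadHom φ).obj M) n).Y ⟶
      ((Monad.algebraFunctorOfMonadHom φ).obj N).A :=
  stageMap φ M n ≫ c

lemma restrictCochain_add (φ : T ⟶ T') {M N : T'.Algebra} {n : ℕ} (c c' : (stage M n).Y ⟶ N.A) :
    restrictCochain φ (N := N) (c + c') = restrictCochain φ c + restrictCochain φ c' :=
  Preadditive.comp_add _ _ _ _ _ _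

lemma restrictCochain_cobarDiff (φ : T ⟶ T') {M N : T'.Algebra} {n : ℕ}
    (c : (stage M n).Y ⟶ N.A) :
    restrictCochain φ (cobarDiff c) = cobarDiff (restrictCochain φ c) := by
  have h1 := stageComp_bd φ (𝟙 ((Monad.algebraFunctorOfMonadHom φ).obj M)) n
  rw [← stageMap_eq, ← stageMap_eq] at h1
  have h2 := φ.naturality c
  have h3 := congr_arg (fun a => a ≫ T'.map c ≫ N.a) h1
  refine (Category.assoc _ _ _).symm.trans (h3.symm.trans ?_)
  refine (Category.assoc _ _ _).trans ?_
  refine congr_arg (fun a => (stage ((Monad.algebraFunctorOfMonadHom φ).obj M) n).bd ≫ a) ?_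
  change (T.map (stageMap φ M n) ≫ φ.app _) ≫ T'.map c ≫ N.a =
    T.map (stageMap φ M n ≫ c) ≫ φ.app N.A ≫ N.a
  rw [T.map_comp, Category.assoc, Category.assoc, reassoc_of% h2]

end

namespace WordData

variable {A : Type u} [Category.{v} A] [Abelian A] {T T' : Monad A}
  [PreservesFiniteColimits (T : A ⥤ A)] [PreservesFiniteColimits (T' : A ⥤ A)]
  [PreservesProj T] [PreservesProj T'] {D D' : QuadraticData A} [D.H.Additive] [D'.H.Additive]
  {S S' : ℕ → A ⥤ A} [∀ i, PreservesFiniteColimits (S i)] [∀ i, PreservesFiniteColimits (S' i)]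
  {σ : ∀ i, S i ⟶ (T : A ⥤ A)} {σ' : ∀ i, S' i ⟶ (T' : A ⥤ A)}

/-- A homomorphism of algebras which induces a split epimorphism of Koszul duals induces an
injective map of Koszul complexes. -/
lemma exists_koszulCochains_map (w : WordData T D σ) (w' : WordData T' D' σ') (φ : T ⟶ T')
    {M N : T'.Algebra} (hM : Projective M.A) (hD : D.IsSplitAt M.A) (hD' : D'.IsSplitAt M.A)
    (p : ∀ n, (D.U (n + 1)).obj M.A ⟶ (D'.U (n + 1)).obj M.A) (hp : ∀ n, ∃ s, s ≫ p n = 𝟙 _)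
    (h : ∀ n, w.vMap ((Monad.algebraFunctorOfMonadHom φ).obj M) n ≫ stageMap φ M n =
      p n ≫ w'.vMap M n) :
    ∃ ι : koszulCochains σ' M N ⟶ koszulCochains σ ((Monad.algebraFunctorOfMonadHom φ).obj M)
        ((Monad.algebraFunctorOfMonadHom φ).obj N),
      (∀ n, Mono (ι.f n)) ∧ ∀ (n : ℕ) (c : (stage M n).Y ⟶ N.A),
        ι.f n (cobarToKoszul σ' M N n c) = cobarToKoszul σ _ _ n (stageMap φ M n ≫ c) := by
  have hM' : Projective ((Monad.algebraFunctorOfMonadHom φ).obj M).A := hM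
  have key : ∀ (n : ℕ) (c c' : (stage M n).Y ⟶ N.A),
      cobarToKoszul σ _ _ n (restrictCochain φ c) = cobarToKoszul σ _ _ n (restrictCochain φ c') ↔
        cobarToKoszul σ' M N n c = cobarToKoszul σ' M N n c' := fun n c c' => by
    rw [w'.cobarToKoszul_eq_iff hM hD' N n c c']
    refine (w.cobarToKoszul_eq_iff hM' hD _ n _ _).trans ?_
    obtain ⟨s, hs⟩ := hp n
    have e : ∀ c : (stage M n).Y ⟶ N.A,
      w.vMap ((Monad.algebraFunctorOfMonadHom φ).obj M) n ≫ restrictCochain φ c =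
        p n ≫ w'.vMap M n ≫ c := fun c =>
      (Category.assoc _ _ _).symm.trans
        ((congr_arg (fun a => a ≫ c) (h n)).trans (Category.assoc _ _ _))
    constructor
    · intro h1
      have h2 : s ≫ p n ≫ w'.vMap M n ≫ c = s ≫ p n ≫ w'.vMap M n ≫ c' :=
        congr_arg (fun a => s ≫ a) ((e c).symm.trans (h1.trans (e c')))
      rwa [reassoc_of% hs, reassoc_of% hs] at h2
    · intro h1
      exact (e c).trans ((congr_arg (fun a => p n ≫ a) h1).trans (e c').symm)
  have surj := fun n => w'.cobarToKoszul_surjective hM hD' N n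
  let g : ∀ n, (koszulCochains σ' M N).X n → (koszulCochains σ
      ((Monad.algebraFunctorOfMonadHom φ).obj M) ((Monad.algebraFunctorOfMonadHom φ).obj N)).X n :=
    fun n f => cobarToKoszul σ _ _ n (restrictCochain φ (surj n f).choose)
  have hg : ∀ (n : ℕ) (c : (stage M n).Y ⟶ N.A), g n (cobarToKoszul σ' M N n c) =
      cobarToKoszul σ _ _ n (restrictCochain φ c) := fun n c =>
    (key n _ _).2 (surj n (cobarToKoszul σ' M N n c)).choose_spec
  have hadd : ∀ n f f', g n (f + f') = g n f + g n f' := fun n f f' => by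
    obtain ⟨c, rfl⟩ := surj n f
    obtain ⟨c', rfl⟩ := surj n f'
    rw [← cobarToKoszul_add, hg, hg, hg, restrictCochain_add, cobarToKoszul_add]
  let ι : koszulCochains σ' M N ⟶ koszulCochains σ ((Monad.algebraFunctorOfMonadHom φ).obj M)
        ((Monad.algebraFunctorOfMonadHom φ).obj N) :=
    { f := fun n => AddCommGrpCat.ofHom (AddMonoidHom.mk' (g n) (hadd n))
      comm' := by
        rintro n _ rfl
        ext f
        obtain ⟨c, rfl⟩ := surj n f
        change (koszulCochains σ _ _).d n (n + 1) (g n (cobarToKoszul σ' M N n c)) =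
          g (n + 1) ((koszulCochains σ' M N).d n (n + 1) (cobarToKoszul σ' M N n c))
        rw [hg, d_cobarToKoszul, d_cobarToKoszul, hg, restrictCochain_cobarDiff] }
  refine ⟨ι, fun n => (AddCommGrpCat.mono_iff_injective _).2 fun f f' hf => ?_, hg⟩
  obtain ⟨c, rfl⟩ := surj n f
  obtain ⟨c', rfl⟩ := surj n f'
  have hf' : g n (cobarToKoszul σ' M N n c) = g n (cobarToKoszul σ' M N n c') := hf
  rw [hg, hg] at hf'
  exact (key n c c').1 hf'

end WordData

lemma vMap_step {A : Type u} [Category.{v} A] {A₀ A₁ B₀ B₁ C₁ P Q R K L : A}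
    {h : A₀ ⟶ A₁} {i' : A₁ ⟶ B₁} {i : A₀ ⟶ B₀} {x : B₀ ⟶ C₁} {y : C₁ ⟶ B₁}
    (h1 : h ≫ i' = i ≫ x ≫ y) {z : P ⟶ Q} {s : Q ⟶ R} {x' : P ⟶ K} {s' : K ⟶ L} {t : L ⟶ R}
    (h2 : z ≫ s = (x' ≫ s') ≫ t) {v : B₀ ⟶ P} {v' : C₁ ⟶ K} (h4 : v ≫ x' = x ≫ v')
    {u : B₁ ⟶ L} (ih : v' ≫ s' = y ≫ u) :
    (i ≫ v ≫ z) ≫ s = h ≫ i' ≫ u ≫ t := by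
  simp only [Category.assoc] at h2 ⊢
  rw [h2, reassoc_of% h4, reassoc_of% ih, reassoc_of% h1]

namespace FilteredAlgebra

variable {A : Type u} [Category.{v} A] [Abelian A] [HasCountableCoproducts A]
  {W : ObjectProperty A} [HasCovers W] (F : FilteredAlgebra.{w} W) {G : GradedAlgebra.{w} A}
  (Φ : GradedAlgebra.Hom G F.rees)

lemma ι_toAlgebra (n : ℕ) (X : A) :
    (G.ι n).app X ≫ (F.toAlgebra Φ).app X = (Φ.app n).app X ≫ (F.ι n).app X := by
  have h1 := GradedAlgebra.ι_totalMap Φ n X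
  have h2 : (F.rees.ι n).app X ≫ F.reesMap.app X = (F.ι n).app X :=
    congr_arg (fun a => a.app X) (Sigma.ι_desc F.ι n)
  refine (Category.assoc _ _ _).symm.trans ((congr_arg (fun a => a ≫ _) h1).trans ?_)
  exact (Category.assoc _ _ _).trans (congr_arg (fun a => (Φ.app n).app X ≫ a) h2)

/-- The homomorphism of graded algebras to the associated graded algebra. -/
noncomputable abbrev homGr : GradedAlgebra.Hom G F.gr :=
  Φ.comp F.grIdeal.proj

lemma ι_plus_toAlgebra {X Y : A} (s : X ⟶ Y) :
    ((G.ι 1).app X ≫ (plusπ G.total).app X) ≫ (plus G.total).map s ≫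
      (plusMap (F.toAlgebra Φ)).app Y =
    (((F.homGr Φ).app 1).app X ≫ (F.gr.pc 1).map s) ≫ F.grPlus.app Y := by
  have h1 := (plusπ G.total).naturality s
  have h2 : (plusπ G.total).app Y ≫ (plusMap (F.toAlgebra Φ)).app Y =
      (F.toAlgebra Φ).app Y ≫ (plusπ F.T).app Y := by
    have h3 : plusπ G.total ≫ plusMap (F.toAlgebra Φ) =
      (F.toAlgebra Φ).toNatTrans ≫ plusπ F.T := cokernel.π_desc _ _ _
    exact congr_arg (fun a => a.app Y) h3
  have h4 := F.grπ_grPlus Y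
  have h5 : ((F.homGr Φ).app 1).app X ≫ (F.gr.pc 1).map s =
      (G.pc 1).map s ≫ (Φ.app 1).app Y ≫ F.grπ 1 Y := ((F.homGr Φ).naturality 1 s).symm
  rw [h5, Category.assoc, Category.assoc, Category.assoc, h4, ← reassoc_of% (F.ι_toAlgebra Φ 1 Y),
    ← h2, ← reassoc_of% h1, ← reassoc_of% (G.ι_naturality 1 s)]

variable [G.ProjComponents]

lemma vMap_stageMap (hW : ∀ Q, W Q → Projective Q) (hF : F.gr.IsKoszul W) (M : F.T.Algebra) :
    ∀ n, G.wordData.vMap ((Monad.algebraFunctorOfMonadHom (F.toAlgebra Φ)).obj M) n ≫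
      stageMap (F.toAlgebra Φ) M n = GradedAlgebra.homU (F.homGr Φ) (n + 1) M.A ≫
        (F.wordData hW hF).vMap M n
  | 0 => by
    rw [WordData.vMap_zero, WordData.vMap_zero]
    rfl
  | n + 1 => by
    have ih := vMap_stageMap hW hF M n
    have h1 := GradedAlgebra.homU_i (F.homGr Φ) (n + 1) M.A
    have h2 := F.ι_plus_toAlgebra Φ (stageMap (F.toAlgebra Φ) M n)
    have h4 := (F.homGr Φ).naturality 1
      (G.wordData.vMap ((Monad.algebraFunctorOfMonadHom (F.toAlgebra Φ)).obj M) n)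
    refine (congr_arg (fun a => a ≫ stageMap (F.toAlgebra Φ) M (n + 1))
      (WordData.vMap_succ _ _ _)).trans
      (Eq.trans ?_ (congr_arg (fun a => _ ≫ a) (WordData.vMap_succ _ _ _).symm))
    exact vMap_step h1 h2 h4
      (((F.gr.pc 1).map_comp _ _).symm.trans ((congr_arg (fun a => (F.gr.pc 1).map a) ih).trans
        ((F.gr.pc 1).map_comp _ _)))

end FilteredAlgebra

section

variable {A : Type u} [Category.{v} A] [Abelian A] {T : Monad A}
  [PreservesFiniteColimits (T : A ⥤ A)]

lemma free_map_cobar {M N : T.Algebra} {n : ℕ} {X : A} (x : X ⟶ (stage M n).Y)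
    (c : (stage M n).Y ⟶ N.A) : T.free.map x ≫ cobar M N n c = freeDesc (x ≫ c) := by
  rw [cobar, adj_homEquiv_symm]
  ext
  refine (Category.assoc _ _ _).symm.trans ?_
  exact congr_arg (fun a => a ≫ N.a) (T.map_comp _ _).symm

lemma plus_map_eqToHom (M : T.Algebra) {a b : ℕ} (h : a = b) (h₁ : (stage M a).Y = (stage M b).Y)
    (h₂ : (stage M (a + 1)).Y = (stage M (b + 1)).Y) :
    eqToHom h₂ = (plus T).map (eqToHom h₁) := by
  subst h
  exact ((plus T).map_id _).symm

end

lemma neg_eq_pow_smul {X : Type*} [AddCommGroup X] (n : ℕ) (x : X) :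
    -((-1 : ℤ) ^ n • x) = (-1 : ℤ) ^ (n + 1) • x := by
  rw [pow_succ, mul_neg_one, neg_smul]

lemma pow_smul_neg {X : Type*} [AddCommGroup X] (n : ℕ) (x : X) :
    (-1 : ℤ) ^ (n + 1) • -x = (-1 : ℤ) ^ n • x := by
  rw [smul_neg, ← neg_eq_pow_smul, neg_neg]

namespace GradedAlgebra

variable {A : Type u} [Category.{v} A] [Abelian A] [HasCountableCoproducts A]
  (G : GradedAlgebra.{w} A)

instance : G.quad.H.Additive := inferInstanceAs (G.pc 1).Additive

/-- The next step of a map from the Koszul dual to a bar construction. -/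
noncomputable def nextMap (s : Stage G.total) {X : A} {j : ℕ} (p : (G.U (j + 1)).obj X ⟶ s.Y) :
    (G.U (j + 2)).obj X ⟶ (plus G.total).obj s.Y :=
  G.i (j + 1) X ≫ (G.pc 1).map p ≫ (G.ι 1).app s.Y ≫ (plusπ G.total).app s.Y

/-- The action on a map from the Koszul dual to a bar construction. -/
noncomputable def actMap (s : Stage G.total) {X : A} {j : ℕ} (p : (G.U (j + 1)).obj X ⟶ s.Y) :
    (G.U (j + 2)).obj X ⟶ s.Y :=
  G.i (j + 1) X ≫ (G.pc 1).map p ≫ (G.ι 1).app s.Y ≫ s.b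

lemma nextMap_add (s : Stage G.total) {X : A} {j : ℕ} (p q : (G.U (j + 1)).obj X ⟶ s.Y) :
    G.nextMap s (p + q) = G.nextMap s p + G.nextMap s q := by
  rw [nextMap, Functor.map_add, Preadditive.add_comp, Preadditive.comp_add]
  rfl

lemma nextMap_zsmul (s : Stage G.total) {X : A} {j : ℕ} (z : ℤ) (p : (G.U (j + 1)).obj X ⟶ s.Y) :
    G.nextMap s (z • p) = z • G.nextMap s p := by
  rw [nextMap, Functor.map_zsmul, Preadditive.zsmul_comp, Preadditive.comp_zsmul]
  rfl

lemma nextMap_map (s : Stage G.total) {X Z : A} {j : ℕ} (p : (G.U (j + 1)).obj X ⟶ s.Y)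
    (f : s.Y ⟶ Z) : G.nextMap s p ≫ (plus G.total).map f = G.i (j + 1) X ≫ (G.pc 1).map (p ≫ f) ≫
      (G.ι 1).app Z ≫ (plusπ G.total).app Z := by
  have h1 := (plusπ G.total).naturality f
  rw [nextMap, Category.assoc, Category.assoc, Category.assoc, ← h1,
    reassoc_of% (G.ι_naturality 1 f), Functor.map_comp, Category.assoc]

lemma nextMap_bd (s : Stage G.total) {X : A} {j : ℕ} (p : (G.U (j + 1)).obj X ⟶ s.Y) :
    G.nextMap s p ≫ s.bd =
      (G.i (j + 1) X ≫ (G.ι 1).app _) ≫ G.total.map p - G.actMap s p ≫ G.total.η.app s.Y := by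
  rw [nextMap, Category.assoc, Category.assoc, Category.assoc, s.π_bd, Preadditive.comp_sub,
    Preadditive.comp_sub, Preadditive.comp_sub, Category.assoc, ι_naturality, actMap]
  simp only [Category.assoc, Category.comp_id]

lemma actMap_nextMap (s : Stage G.total) {X : A} {j : ℕ} (p : (G.U (j + 1)).obj X ⟶ s.Y) :
    G.actMap s.next (G.nextMap s p) = - G.nextMap s (G.actMap s p) := by
  have h1 : G.total.map ((plusπ G.total).app s.Y) ≫ s.next.b =
      (G.total.μ.app s.Y ≫ (plusπ G.total).app s.Y :
        G.total.obj (G.total.obj s.Y) ⟶ (plus G.total).obj s.Y) -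
        G.total.map s.b ≫ (plusπ G.total).app s.Y :=
    eq_sub_of_add_eq s.plusπ_b_next
  have h2 := G.ι_naturality 1 ((plusπ G.total).app s.Y)
  have h3 := G.i_κ (j + 1) X
  have h4 : (G.pc 1).map (G.i (j + 1) X ≫ (G.pc 1).map p ≫ (G.ι 1).app s.Y) ≫
      (G.ι 1).app (G.total.obj s.Y) ≫ G.total.μ.app s.Y =
      G.κ (rfl : 1 + 1 = 2) (j + 1) X ≫ (G.pc 2).map p ≫ (G.ι 2).app s.Y := by
    rw [κ, Functor.map_comp, Functor.map_comp, Category.assoc, Category.assoc,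
      G.ι_μ s.Y (rfl : 1 + 1 = 2), Category.assoc, ← reassoc_of% (G.mul_naturality (rfl : 1 + 1 = 2) p)]
  have h5 : G.nextMap s p = (G.i (j + 1) X ≫ (G.pc 1).map p ≫ (G.ι 1).app s.Y) ≫
      (plusπ G.total).app s.Y := by
    rw [nextMap]
    simp only [Category.assoc]
  have h6 : G.actMap s p = (G.i (j + 1) X ≫ (G.pc 1).map p ≫ (G.ι 1).app s.Y) ≫ s.b := by
    rw [actMap]
    simp only [Category.assoc]
  have h7 : (G.pc 1).map (G.nextMap s p) ≫ (G.ι 1).app ((plus G.total).obj s.Y) ≫ s.next.b =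
      G.κ (rfl : 1 + 1 = 2) (j + 1) X ≫ (G.pc 2).map p ≫ (G.ι 2).app s.Y ≫
        (plusπ G.total).app s.Y - (G.pc 1).map (G.actMap s p) ≫ (G.ι 1).app s.Y ≫
          (plusπ G.total).app s.Y := by
    rw [h5, h6, Functor.map_comp _ _ ((plusπ G.total).app s.Y), Category.assoc,
      ← reassoc_of% h2, h1, Preadditive.comp_sub, Preadditive.comp_sub,
      Functor.map_comp _ _ s.b, Category.assoc, reassoc_of% (G.ι_naturality 1 s.b), reassoc_of% h4]
  refine (congr_arg (fun a => G.i (j + 2) X ≫ a) h7).trans ?_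
  rw [Preadditive.comp_sub, reassoc_of% h3, zero_comp, zero_sub]
  rfl

/-- The map from the Koszul dual to a bar construction which extends a Koszul cochain. -/
noncomputable def pairMap (N : G.total.Algebra) {X : A} {n : ℕ} (a : (G.U (n + 1)).obj X ⟶ N.A) :
    ∀ m, (G.U (n + m + 1)).obj X ⟶ (stage N m).Y
  | 0 => a
  | m + 1 => G.nextMap (stage N m) (pairMap N a m)

lemma pairMap_add (N : G.total.Algebra) {X : A} {n : ℕ} (a a' : (G.U (n + 1)).obj X ⟶ N.A) :
    ∀ m, G.pairMap N (a + a') m = G.pairMap N a m + G.pairMap N a' m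
  | 0 => rfl
  | m + 1 => (congr_arg (fun x => G.nextMap (stage N m) x) (pairMap_add N a a' m)).trans
    (G.nextMap_add _ _ _)

lemma factorsWord_nextMap {N : G.total.Algebra} {m : ℕ} {X : A} {j : ℕ}
    {p : (G.U (j + 1)).obj X ⟶ (stage N m).Y} (hp : FactorsWord G.ι N m m p) :
    FactorsWord G.ι N (m + 1) (m + 1) (G.nextMap (stage N m) p) :=
  hp.cons G.ι (add_comm 1 m) (G.i (j + 1) X)

lemma FactorsWord.neg {N : G.total.Algebra} {n m : ℕ} {Z : A} {z : Z ⟶ (stage N n).Y}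
    (hz : FactorsWord G.ι N n m z) : FactorsWord G.ι N n m (-z) := by
  obtain ⟨c, p, hc, rfl⟩ := hz
  exact ⟨c, -p, hc, Preadditive.neg_comp _ _⟩

lemma factorsWord_pairMap (N : G.total.Algebra) {X : A} {n : ℕ}
    (a : (G.U (n + 1)).obj X ⟶ N.A) : ∀ m, FactorsWord G.ι N m m (G.pairMap N a m) ∧
      FactorsWord G.ι N m m (G.actMap (stage N m) (G.pairMap N a m))
  | 0 => ⟨⟨fun i => i.elim0, a, rfl, Category.comp_id _⟩,
      ⟨fun i => i.elim0, G.actMap (stage N 0) (G.pairMap N a 0), rfl, Category.comp_id _⟩⟩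
  | m + 1 => by
    obtain ⟨h1, h2⟩ := factorsWord_pairMap N a m
    refine ⟨G.factorsWord_nextMap h1, ?_⟩
    exact Eq.mpr (congr_arg (fun a => FactorsWord G.ι N (m + 1) (m + 1) a)
      (G.actMap_nextMap (stage N m) (G.pairMap N a m))) (FactorsWord.neg G (G.factorsWord_nextMap h2))

lemma koszulSub_factors_pairMap (N : G.total.Algebra) {X : A} {n : ℕ}
    (a : (G.U (n + 1)).obj X ⟶ N.A) (m : ℕ) :
    (WordData.koszulSub G.ι N m).Factors (G.total.free.map (G.pairMap N a m)) := by
  refine (Subobject.inf_factors _).2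
    ⟨WordData.FactorsWord.free (G.factorsWord_pairMap N a m).1, ?_⟩
  refine (pullback_factors _ _ _).2 ?_
  cases m with
  | zero =>
    have h : (barComplex N).d 0 0 = 0 := (barComplex N).shape _ _ (by simp)
    change (barFiltration G.ι N 0 0).Factors
      (G.total.free.map (G.pairMap N a 0) ≫ (barComplex N).d 0 0)
    rw [h]
    exact (congr_arg (barFiltration G.ι N 0 0).Factors comp_zero).mpr Subobject.factors_zero
  | succ m =>
    have h := WordData.free_map_dFree (stage N m) (G.pairMap N a (m + 1))
      (G.i (n + m + 1) X ≫ (G.ι 1).app _) (G.pairMap N a m) (𝟙 _)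
      (G.actMap (stage N m) (G.pairMap N a m)) ((G.nextMap_bd (stage N m) (G.pairMap N a m)).trans
        (congr_arg (fun x => _ - x) (Category.id_comp _).symm))
    change (barFiltration G.ι N m m).Factors
      (G.total.free.map (G.pairMap N a (m + 1)) ≫ (barComplex N).d (m + 1) m)
    rw [barComplex_d]
    refine (congr_arg (barFiltration G.ι N m m).Factors h).mpr ?_
    obtain ⟨h1, h2⟩ := G.factorsWord_pairMap N a m
    exact Subobject.factors_add _ _
      (Subobject.factors_of_factors_right _ (WordData.FactorsWord.free h1))
      (Subobject.factors_of_factors_right _ (WordData.FactorsWord.free h2))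

variable [G.ProjComponents]

lemma vMap_succ (M : G.total.Algebra) (n : ℕ) :
    G.wordData.vMap M (n + 1) = G.nextMap (stage M n) (G.wordData.vMap M n) :=
  G.wordData.vMap_succ M n

lemma vMap_cochainMap (M N : G.total.Algebra) {n : ℕ} (c : (stage M n).Y ⟶ N.A) :
    ∀ m, G.wordData.vMap M (n + m) ≫ cochainMap c m = G.pairMap N (G.wordData.vMap M n ≫ c) m
  | 0 => rfl
  | m + 1 => by
    refine (congr_arg (fun a => a ≫ (plus G.total).map (cochainMap c m))
      (G.vMap_succ M (n + m))).trans ?_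
    refine (G.nextMap_map _ _ _).trans ?_
    rw [vMap_cochainMap M N c m]
    rfl

lemma vMap_succ_act (M N : G.total.Algebra) (n : ℕ) (c : (stage M n).Y ⟶ N.A) :
    G.wordData.vMap M (n + 1) ≫ cochainMap c 1 ≫ actionCochain G.aug N =
      -(G.i (n + 1) M.A ≫ (G.pc 1).map (G.wordData.vMap M n ≫ c) ≫ (G.ι 1).app N.A ≫ N.a) := by
  have h1 : (plusπ G.total).app N.A ≫ actionCochain G.aug N =
      -(N.a - trivialAction G.aug N.A) := by
    refine (Preadditive.comp_neg _ _).trans ?_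
    rw [π_plusDesc]
  have h2 := congr_arg (fun a => a ≫ actionCochain G.aug N) (G.nextMap_map (stage M n)
    (G.wordData.vMap M n) c)
  refine (congr_arg (fun a => a ≫ cochainMap c 1 ≫ actionCochain G.aug N) (G.vMap_succ M n)).trans ?_
  refine (Category.assoc _ _ _).symm.trans (h2.trans ?_)
  have h3 : (G.ι 1).app N.A ≫ (plusπ G.total).app N.A ≫ actionCochain G.aug N =
      -((G.ι 1).app N.A ≫ N.a) := by
    refine (congr_arg (fun a => (G.ι 1).app N.A ≫ a) h1).trans ?_
    rw [Preadditive.comp_neg, Preadditive.comp_sub, G.ι_aug_succ 0, sub_zero]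
  have h4 : (G.i (n + 1) M.A ≫ (G.pc 1).map (G.wordData.vMap M n ≫ c) ≫
      (G.ι 1).app N.A ≫ (plusπ G.total).app N.A) ≫ actionCochain G.aug N =
      G.i (n + 1) M.A ≫ (G.pc 1).map (G.wordData.vMap M n ≫ c) ≫
        (G.ι 1).app N.A ≫ (plusπ G.total).app N.A ≫ actionCochain G.aug N :=
    (Category.assoc _ _ _).trans (congr_arg (fun a => _ ≫ a) ((Category.assoc _ _ _).trans
      (congr_arg (fun a => _ ≫ a) (Category.assoc _ _ _))))
  refine h4.trans ?_
  rw [h3, Preadditive.comp_neg, Preadditive.comp_neg]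

lemma vMap_act_cochainMap (M : G.total.Algebra) : ∀ (n : ℕ)
    (h : (stage M (n + 1)).Y = (stage M (1 + n)).Y), G.wordData.vMap M (n + 1) ≫ eqToHom h ≫
      cochainMap (actionCochain G.aug M) n =
        (-1 : ℤ) ^ (n + 1) • G.actMap (stage M n) (G.wordData.vMap M n)
  | 0, h => by
    have h1 := G.vMap_succ_act M M 0 (𝟙 M.A)
    have h2 : cochainMap (M := M) (N := M) (n := 0) (𝟙 M.A) 1 = 𝟙 _ := (plus G.total).map_id _
    rw [h2, Category.id_comp] at h1
    have h3 : G.wordData.vMap M (0 + 1) ≫ eqToHom h ≫ cochainMap (actionCochain G.aug M) 0 =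
      G.wordData.vMap M (0 + 1) ≫ actionCochain G.aug M :=
        congr_arg (fun a => G.wordData.vMap M (0 + 1) ≫ a) (Category.id_comp _)
    refine h3.trans (h1.trans ?_)
    refine Eq.trans ?_ (neg_eq_pow_smul 0 _)
    have h4 : (-1 : ℤ) ^ 0 • G.actMap (stage M 0) (G.wordData.vMap M 0) =
        G.actMap (stage M 0) (G.wordData.vMap M 0) := one_smul _ _
    exact congr_arg Neg.neg ((congr_arg (fun a => G.i 1 M.A ≫ (G.pc 1).map a ≫ (G.ι 1).app M.A ≫ M.a)
      (Category.comp_id _)).trans h4.symm)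
  | n + 1, h => by
    have h0 : (stage M (n + 1)).Y = (stage M (1 + n)).Y := by rw [add_comm]
    have ih := vMap_act_cochainMap M n h0
    have h1 : eqToHom h ≫ cochainMap (actionCochain G.aug M) (n + 1) =
        (plus G.total).map (eqToHom h0 ≫ cochainMap (actionCochain G.aug M) n) := by
      rw [Functor.map_comp, ← plus_map_eqToHom M (add_comm n 1) h0 h]
      rfl
    refine (congr_arg (fun a => G.wordData.vMap M (n + 2) ≫ a) h1).trans ?_
    refine (congr_arg (fun a => a ≫ (plus G.total).map _) (G.vMap_succ M (n + 1))).trans ?_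
    refine (G.nextMap_map _ _ _).trans ?_
    rw [ih]
    refine (G.nextMap_zsmul (stage M n) _ _).trans ?_
    have h2 := G.actMap_nextMap (stage M n) (G.wordData.vMap M n)
    have h3 : G.actMap (stage M (n + 1)) (G.wordData.vMap M (n + 1)) =
        - G.nextMap (stage M n) (G.actMap (stage M n) (G.wordData.vMap M n)) :=
      (congr_arg (fun a => G.actMap (stage M (n + 1)) a) (G.vMap_succ M n)).trans h2
    refine Eq.trans ?_ (congr_arg (fun a => (-1 : ℤ) ^ (n + 2) • a) h3.symm)
    exact (pow_smul_neg (n + 1) _).symm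

lemma vMap_cobarDiff (M N : G.total.Algebra) (n : ℕ) (c : (stage M n).Y ⟶ N.A) :
    G.wordData.vMap M (n + 1) ≫ cobarDiff c =
      G.i (n + 1) M.A ≫ (G.pc 1).map (G.wordData.vMap M n ≫ c) ≫ (G.ι 1).app N.A ≫ N.a -
        G.actMap (stage M n) (G.wordData.vMap M n) ≫ c := by
  have h1 := G.nextMap_bd (stage M n) (G.wordData.vMap M n)
  have h2 : G.total.η.app (stage M n).Y ≫ G.total.map c ≫ N.a = c := η_freeDesc c
  have h3 : (G.nextMap (stage M n) (G.wordData.vMap M n) ≫ (stage M n).bd) ≫ G.total.map c ≫ N.a =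
      G.i (n + 1) M.A ≫ (G.pc 1).map (G.wordData.vMap M n ≫ c) ≫ (G.ι 1).app N.A ≫ N.a -
        G.actMap (stage M n) (G.wordData.vMap M n) ≫ c := by
    rw [h1, Preadditive.sub_comp, Category.assoc (G.actMap _ _), h2]
    refine congr_arg (fun a => a - _) ?_
    rw [Category.assoc, Category.assoc, ← G.total.map_comp_assoc]
    exact congr_arg (fun a => G.i (n + 1) M.A ≫ a) ((Category.assoc _ _ _).symm.trans
      ((congr_arg (fun a => a ≫ N.a) (G.ι_naturality 1 (G.wordData.vMap M n ≫ c))).trans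
        (Category.assoc _ _ _)))
  refine Eq.trans ?_ h3
  refine (congr_arg (fun a => a ≫ cobarDiff c) (G.vMap_succ M n)).trans ?_
  exact (Category.assoc _ _ _).symm

lemma vMap_differential (M N : G.total.Algebra) (n : ℕ) (c : (stage M n).Y ⟶ N.A) :
    G.wordData.vMap M (n + 1) ≫ cobarDiff c =
      G.wordData.vMap M (n + 1) ≫ cochainMul (add_comm 1 n) (actionCochain G.aug M) c -
        (-1 : ℤ) ^ n • (G.wordData.vMap M (n + 1) ≫ cochainMul rfl c (actionCochain G.aug N)) := by
  have h0 : (stage M (n + 1)).Y = (stage M (1 + n)).Y := by rw [add_comm]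
  have h1 : G.wordData.vMap M (n + 1) ≫ cochainMul (add_comm 1 n) (actionCochain G.aug M) c =
      - (G.actMap (stage M n) (G.wordData.vMap M n) ≫ c) := by
    have e : G.wordData.vMap M (n + 1) ≫ cochainMul (add_comm 1 n) (actionCochain G.aug M) c =
        (-1 : ℤ) ^ (1 * n) • ((G.wordData.vMap M (n + 1) ≫ eqToHom h0 ≫
          cochainMap (actionCochain G.aug M) n) ≫ c) := by
      rw [cochainMul, Preadditive.comp_zsmul, Preadditive.comp_zsmul]
      simp only [Category.assoc]
    rw [e, vMap_act_cochainMap, Preadditive.zsmul_comp, smul_smul, _root_.one_mul, ← pow_add,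
      show n + (n + 1) = 2 * n + 1 by ring, pow_succ, pow_mul]
    simp
  have h2 : G.wordData.vMap M (n + 1) ≫ cochainMul rfl c (actionCochain G.aug N) =
      (-1 : ℤ) ^ n • -(G.i (n + 1) M.A ≫ (G.pc 1).map (G.wordData.vMap M n ≫ c) ≫
        (G.ι 1).app N.A ≫ N.a) := by
    rw [← vMap_succ_act, cochainMul, eqToHom_refl, Category.id_comp, Preadditive.comp_zsmul,
      _root_.mul_one]
  rw [h1, h2, vMap_cobarDiff, smul_smul, ← pow_add, ← two_mul, pow_mul]
  simp only [even_two, Even.neg_pow, one_pow, one_smul, sub_neg_eq_add]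
  abel

end GradedAlgebra

lemma factorThru_eq_add {B : Type u} [Category.{v} B] [Preadditive B] {X Y : B}
    {S : Subobject Y} {f g h : X ⟶ Y} (e : f = g + h) (hf : S.Factors f) (hg : S.Factors g)
    (hh : S.Factors h) : S.factorThru f hf = S.factorThru g hg + S.factorThru h hh := by
  subst e
  rw [← cancel_mono S.arrow, Preadditive.add_comp, Subobject.factorThru_arrow,
    Subobject.factorThru_arrow, Subobject.factorThru_arrow]

lemma freeDesc_zsmul {A : Type u} [Category.{v} A] [Abelian A] {T : Monad A}
    [PreservesFiniteColimits (T : A ⥤ A)] {X : A} {N : T.Algebra} (z : ℤ) (u : X ⟶ N.A) :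
    freeDesc (z • u) = z • freeDesc u :=
  map_zsmul (AddMonoidHom.mk' (fun u : X ⟶ N.A => (freeDesc u : T.free.obj X ⟶ N)) fun a b =>
    free_hom_ext ((η_freeDesc _).trans (Eq.symm ((Preadditive.comp_add _ _ _ _ _ _).trans
      (congr_arg₂ _ (η_freeDesc a) (η_freeDesc b)))))) z u

namespace GradedAlgebra

variable {A : Type u} [Category.{v} A] [Abelian A] [HasCountableCoproducts A]
  (G : GradedAlgebra.{w} A)

/-- The composition of a Koszul cochain, as a map on the Koszul dual, with a map on the Koszul
complex. -/
noncomputable def pairHom {N L : G.total.Algebra} {X : A} {n : ℕ} (a : (G.U (n + 1)).obj X ⟶ N.A)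
    (m : ℕ) (g : (WordData.koszulSub G.ι N m : G.total.Algebra) ⟶ L) :
    G.total.free.obj ((G.U (n + m + 1)).obj X) ⟶ L :=
  (WordData.koszulSub G.ι N m).factorThru _ (G.koszulSub_factors_pairMap N a m) ≫ g

lemma pairHom_add_left {N L : G.total.Algebra} {X : A} {n : ℕ}
    (a a' : (G.U (n + 1)).obj X ⟶ N.A) (m : ℕ)
    (g : (WordData.koszulSub G.ι N m : G.total.Algebra) ⟶ L) :
    G.pairHom (a + a') m g = G.pairHom a m g + G.pairHom a' m g := by
  have h : (WordData.koszulSub G.ι N m).factorThru _ (G.koszulSub_factors_pairMap N (a + a') m) =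
      (WordData.koszulSub G.ι N m).factorThru _ (G.koszulSub_factors_pairMap N a m) +
      (WordData.koszulSub G.ι N m).factorThru _ (G.koszulSub_factors_pairMap N a' m) := by
    exact factorThru_eq_add ((congr_arg (fun x => G.total.free.map x)
      (G.pairMap_add N a a' m)).trans G.total.free.map_add) _ _ _
  exact (congr_arg (fun x => x ≫ g) h).trans (Preadditive.add_comp _ _ _ _ _ _)

lemma pairHom_add_right {N L : G.total.Algebra} {X : A} {n : ℕ}
    (a : (G.U (n + 1)).obj X ⟶ N.A) (m : ℕ)
    (g g' : (WordData.koszulSub G.ι N m : G.total.Algebra) ⟶ L) :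
    G.pairHom a m (g + g') = G.pairHom a m g + G.pairHom a m g' :=
  Preadditive.comp_add _ _ _ _ _ _

lemma pairHom_arrow_cobar {N L : G.total.Algebra} {X : A} {n : ℕ}
    (a : (G.U (n + 1)).obj X ⟶ N.A) (m : ℕ) (c : (stage N m).Y ⟶ L.A) :
    G.pairHom a m ((WordData.koszulSub G.ι N m).arrow ≫ cobar N L m c) =
      freeDesc (G.pairMap N a m ≫ c) :=
  (Category.assoc _ _ _).symm.trans ((congr_arg (fun x => x ≫ cobar N L m c)
    (Subobject.factorThru_arrow _ _ _)).trans (free_map_cobar _ _))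

variable [G.ProjComponents]

/-- The pairing of a Koszul cochain, as a map on the Koszul dual, with a map on the Koszul
complex. -/
noncomputable def pairAux {M : G.total.Algebra} (hM : Projective M.A)
    (hD : G.quad.IsSplitAt M.A) {N L : G.total.Algebra} {n : ℕ}
    (a : (G.U (n + 1)).obj M.A ⟶ N.A) (m : ℕ)
    (g : (WordData.koszulSub G.ι N m : G.total.Algebra) ⟶ L) :
    (WordData.koszulSub G.ι M (n + m) : G.total.Algebra) ⟶ L :=
  have := G.wordData.isIso_toKoszul hM hD (n + m)
  (-1 : ℤ) ^ (n * m) • (inv (G.wordData.toKoszul hM hD (n + m)) ≫ G.pairHom a m g)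

lemma pairAux_add_left {M : G.total.Algebra} (hM : Projective M.A)
    (hD : G.quad.IsSplitAt M.A) {N L : G.total.Algebra} {n : ℕ}
    (a a' : (G.U (n + 1)).obj M.A ⟶ N.A) (m : ℕ)
    (g : (WordData.koszulSub G.ι N m : G.total.Algebra) ⟶ L) :
    G.pairAux hM hD (a + a') m g = G.pairAux hM hD a m g + G.pairAux hM hD a' m g := by
  rw [pairAux, pairHom_add_left, Preadditive.comp_add, smul_add]
  rfl

lemma pairAux_add_right {M : G.total.Algebra} (hM : Projective M.A)
    (hD : G.quad.IsSplitAt M.A) {N L : G.total.Algebra} {n : ℕ}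
    (a : (G.U (n + 1)).obj M.A ⟶ N.A) (m : ℕ)
    (g g' : (WordData.koszulSub G.ι N m : G.total.Algebra) ⟶ L) :
    G.pairAux hM hD a m (g + g') = G.pairAux hM hD a m g + G.pairAux hM hD a m g' := by
  rw [pairAux, pairHom_add_right, Preadditive.comp_add, smul_add]
  rfl

/-- The pairing of Koszul cochains on a projective module. -/
noncomputable def pairing {M : G.total.Algebra} (hM : Projective M.A) (hD : G.quad.IsSplitAt M.A)
    (N L : G.total.Algebra) (n m : ℕ) :
    (koszulCochains G.ι M N).X n →+ (koszulCochains G.ι N L).X m →+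
      (koszulCochains G.ι M L).X (n + m) :=
  AddMonoidHom.mk' (fun f => AddMonoidHom.mk'
    (fun g => G.pairAux hM hD (G.wordData.value hM hD N n f) m g)
    (fun g g' => G.pairAux_add_right hM hD _ m g g'))
    (fun f f' => AddMonoidHom.ext fun g =>
      (congr_arg (fun a => G.pairAux hM hD a m g) (map_add _ f f')).trans
        (G.pairAux_add_left hM hD _ _ m g))

lemma value_pairing {M : G.total.Algebra} (hM : Projective M.A) (hD : G.quad.IsSplitAt M.A)
    (N L : G.total.Algebra) (n m : ℕ) (f : (koszulCochains G.ι M N).X n)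
    (c : (stage N m).Y ⟶ L.A) :
    G.wordData.value hM hD L (n + m) (G.pairing hM hD N L n m f (cobarToKoszul G.ι N L m c)) =
      (-1 : ℤ) ^ (n * m) • (G.pairMap N (G.wordData.value hM hD N n f) m ≫ c) := by
  have := G.wordData.isIso_toKoszul hM hD (n + m)
  have h1 : G.wordData.toKoszul hM hD (n + m) ≫ G.pairAux hM hD (G.wordData.value hM hD N n f) m
      ((WordData.koszulSub G.ι N m).arrow ≫ cobar N L m c) =
      freeDesc ((-1 : ℤ) ^ (n * m) • (G.pairMap N (G.wordData.value hM hD N n f) m ≫ c)) := by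
    rw [pairAux, Preadditive.comp_zsmul, IsIso.hom_inv_id_assoc, freeDesc_zsmul]
    exact congr_arg (fun a => (-1 : ℤ) ^ (n * m) • a) (G.pairHom_arrow_cobar _ _ _)
  exact (congr_arg (fun a => G.total.η.app _ ≫ a.f) h1).trans (η_freeDesc _)

lemma pairing_cobarToKoszul {M : G.total.Algebra} (hM : Projective M.A)
    (hD : G.quad.IsSplitAt M.A) (N L : G.total.Algebra) (n m : ℕ) (c : (stage M n).Y ⟶ N.A)
    (c' : (stage N m).Y ⟶ L.A) :
    G.pairing hM hD N L n m (cobarToKoszul G.ι M N n c) (cobarToKoszul G.ι N L m c') =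
      cobarToKoszul G.ι M L (n + m) (cochainMul rfl c c') := by
  apply G.wordData.value_injective hM hD
  rw [value_pairing, WordData.value_cobarToKoszul, WordData.value_cobarToKoszul,
    ← vMap_cochainMap, cochainMul, eqToHom_refl, Category.id_comp, Preadditive.comp_zsmul,
    Category.assoc]

/-- The Koszul complex of a module over a Koszul algebra has a product. -/
theorem exists_pairing (H : ∀ X, Projective X → ∀ n, G.KoszulExactAt X n) :
    ∃ pairing : ∀ (M N L : G.total.Algebra) {n m k : ℕ}, n + m = k →
        ((koszulCochains G.ι M N).X n →+ (koszulCochains G.ι N L).X m →+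
          (koszulCochains G.ι M L).X k),
      ∀ M N : G.total.Algebra, Projective M.A →
        (∀ n, Function.Surjective (cobarToKoszul G.ι M N n)) ∧
        (∀ (L : G.total.Algebra) {n m k : ℕ} (h : n + m = k)
          (c : (stage M n).Y ⟶ N.A) (c' : (stage N m).Y ⟶ L.A),
          pairing M N L h (cobarToKoszul G.ι M N n c) (cobarToKoszul G.ι N L m c') =
            cobarToKoszul G.ι M L k (cochainMul h c c')) ∧
        ∀ (n : ℕ) (f : (koszulCochains G.ι M N).X n),
          (koszulCochains G.ι M N).d n (n + 1) f =
            pairing M M N (add_comm 1 n) (koszulElement G.ι G.aug M) f -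
            (-1 : ℤ) ^ n • pairing M N N rfl f (koszulElement G.ι G.aug N) := by
  classical
  have hD : ∀ {X : A}, Projective X → G.quad.IsSplitAt X := fun hX => G.isSplitAt_quad (H _ hX)
  refine ⟨fun M N L {n m k} h => h ▸ (if hM : Projective M.A then
    G.pairing hM (hD hM) N L n m else 0), fun M N hM => ?_⟩
  have surj : ∀ n, Function.Surjective (cobarToKoszul G.ι M N n) :=
    G.wordData.cobarToKoszul_surjective hM (hD hM) N
  have hp : ∀ (N L : G.total.Algebra) {n m k : ℕ} (h : n + m = k)
      (c : (stage M n).Y ⟶ N.A) (c' : (stage N m).Y ⟶ L.A),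
      (h ▸ (if hM : Projective M.A then G.pairing hM (hD hM) N L n m else 0) :
        (koszulCochains G.ι M N).X n →+ (koszulCochains G.ι N L).X m →+
          (koszulCochains G.ι M L).X k) (cobarToKoszul G.ι M N n c)
        (cobarToKoszul G.ι N L m c') = cobarToKoszul G.ι M L k (cochainMul h c c') := by
    rintro N L n m _ rfl c c'
    dsimp only
    rw [dif_pos hM]
    exact G.pairing_cobarToKoszul hM (hD hM) N L n m c c'
  refine ⟨surj, fun L _ _ _ => hp N L, fun n f => ?_⟩
  obtain ⟨c, rfl⟩ := surj n f
  have h1 := hp M N (add_comm 1 n) (actionCochain G.aug M) c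
  have h2 := hp N N (rfl : n + 1 = n + 1) c (actionCochain G.aug N)
  refine Eq.trans ?_ (congr_arg₂ (fun a b => a - (-1 : ℤ) ^ n • b) h1 h2).symm
  rw [d_cobarToKoszul]
  apply G.wordData.value_injective hM (hD hM)
  rw [map_sub, map_zsmul]
  rw [WordData.value_cobarToKoszul, WordData.value_cobarToKoszul, WordData.value_cobarToKoszul]
  exact G.vMap_differential M N n c

end GradedAlgebra

namespace GradedAlgebra

variable {A : Type u} [Category.{v} A] [Abelian A] [HasCountableCoproducts A]
  (G : GradedAlgebra.{w} A)

lemma nextMap_zero (s : Stage G.total) {X : A} {j : ℕ} :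
    G.nextMap s (0 : (G.U (j + 1)).obj X ⟶ s.Y) = 0 := by
  rw [nextMap, Functor.map_zero, zero_comp]
  exact comp_zero

lemma koszulIncl_nextMap (M : G.total.Algebra) (n : ℕ) :
    G.koszulIncl M (n + 1) = G.nextMap (stage M n) (G.koszulIncl M n) := rfl

lemma actMap_koszulIncl (X : A) : ∀ n, G.actMap (stage ((trivialModule G.aug).obj X) n)
    (G.koszulIncl ((trivialModule G.aug).obj X) n) = 0
  | 0 => by
    have h : (G.ι 1).app X ≫ trivialAction G.aug X = 0 := G.ι_aug_succ 0 X
    have h1 : G.i 1 X ≫ (G.pc 1).map (𝟙 X) ≫ (G.ι 1).app X ≫ trivialAction G.aug X = 0 := by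
      rw [h, comp_zero, comp_zero]
    exact h1
  | n + 1 => by
    refine (congr_arg (fun a => G.actMap (stage ((trivialModule G.aug).obj X) (n + 1)) a)
      (G.koszulIncl_nextMap _ n)).trans ((G.actMap_nextMap _ _).trans ?_)
    refine (congr_arg (fun a => -G.nextMap (stage ((trivialModule G.aug).obj X) n) a)
      (actMap_koszulIncl X n)).trans ?_
    rw [nextMap_zero, neg_zero]
    rfl

lemma koszulIncl_bd_aug (X : A) (n : ℕ) : G.koszulIncl ((trivialModule G.aug).obj X) (n + 1) ≫
    (stage ((trivialModule G.aug).obj X) n).bd ≫ trivialAction G.aug _ = 0 := by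
  have h1 := G.nextMap_bd (stage ((trivialModule G.aug).obj X) n) (G.koszulIncl _ n)
  have h2 := ε_naturality G.aug (G.koszulIncl ((trivialModule G.aug).obj X) n)
  have h3 : (G.ι 1).app ((G.U (n + 1)).obj X) ≫ trivialAction G.aug _ = 0 := G.ι_aug_succ 0 _
  refine (congr_arg (fun a => a ≫ (stage ((trivialModule G.aug).obj X) n).bd ≫
    trivialAction G.aug _) (G.koszulIncl_nextMap _ n)).trans ?_
  refine (Category.assoc _ _ _).symm.trans ((congr_arg (fun a => a ≫ _) h1).trans ?_)
  rw [actMap_koszulIncl, zero_comp, sub_zero]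
  refine (Category.assoc _ _ _).trans ((congr_arg (fun a => _ ≫ a) h2).trans ?_)
  refine (Category.assoc _ _ _).trans ((congr_arg (fun a => _ ≫ a)
    ((Category.assoc _ _ _).symm.trans ((congr_arg (fun a => a ≫ _) h3).trans zero_comp))).trans
      comp_zero)

variable {G} [G.ProjComponents] {X : A}

lemma extOf_cocycleHom_eq (hX : Projective X) (H : ∀ n, G.KoszulExactAt X n) {n : ℕ} {N : A}
    (c c' : (stage ((trivialModule G.aug).obj X) n).Y ⟶ N) (h h')
    (hc : G.koszulIncl ((trivialModule G.aug).obj X) n ≫ c = G.koszulIncl _ n ≫ c') :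
    extOf (cocycleHom G.aug c h) = extOf (cocycleHom G.aug c' h') := by
  have h1 : extOf (cocycleHom G.aug c h - cocycleHom G.aug c' h') = 0 := by
    refine extOf_eq_zero hX H _ ?_
    exact (Preadditive.comp_sub _ _ _).trans (sub_eq_zero.2 hc)
  have h2 := extOf_add (cocycleHom G.aug c h - cocycleHom G.aug c' h') (cocycleHom G.aug c' h')
  rw [sub_add_cancel, h1, zero_add] at h2
  exact h2

/-- A retraction of the bar construction on the Koszul dual. -/
noncomputable def retr (H : ∀ n, G.KoszulExactAt X n) (n : ℕ) :
    (stage ((trivialModule G.aug).obj X) n).Y ⟶ (G.U (n + 1)).obj X :=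
  (exists_koszulRetr ((trivialModule G.aug).obj X) n fun m _ => H m).choose

lemma koszulIncl_retr (H : ∀ n, G.KoszulExactAt X n) (n : ℕ) :
    G.koszulIncl ((trivialModule G.aug).obj X) n ≫ retr H n = 𝟙 _ :=
  (exists_koszulRetr ((trivialModule G.aug).obj X) n fun m _ => H m).choose_spec.incl

lemma koszulIncl_retr_comp (H : ∀ n, G.KoszulExactAt X n) (n : ℕ) {N : A}
    (a : (G.U (n + 1)).obj X ⟶ N) :
    G.koszulIncl ((trivialModule G.aug).obj X) n ≫ retr H n ≫ a = a :=
  (Category.assoc _ _ _).symm.trans ((congr_arg (fun x => x ≫ a) (koszulIncl_retr H n)).trans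
    (Category.id_comp a))

lemma bd_retr (H : ∀ n, G.KoszulExactAt X n) (n : ℕ) {N : A} (a : (G.U (n + 1)).obj X ⟶ N) :
    (stage ((trivialModule G.aug).obj X) n).bd ≫ trivialAction G.aug _ ≫ retr H n ≫ a = 0 := by
  have h := (exists_koszulRetr ((trivialModule G.aug).obj X) n fun m _ => H m).choose_spec.cocycle rfl
  refine Stage.bd_ε G.aug _ _ ((ε_naturality G.aug _).trans ?_)
  refine (Category.assoc _ _ _).symm.trans ((congr_arg (fun x => x ≫ a) h.symm).trans ?_)
  exact Category.assoc _ _ _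

/-- The extension class given by a map out of the Koszul dual. -/
noncomputable def koszulExt (hX : Projective X) (H : ∀ n, G.KoszulExactAt X n) (n : ℕ) (N : A) :
    ((G.U (n + 1)).obj X ⟶ N) →+
      Abelian.Ext.{max u v} ((trivialModule G.aug).obj X) ((trivialModule G.aug).obj N) n :=
  AddMonoidHom.mk' (fun a => extOf (cocycleHom G.aug (retr H n ≫ a) (bd_retr H n a)))
    fun a a' => by
      have h : (stage ((trivialModule G.aug).obj X) n).bd ≫ trivialAction G.aug _ ≫
          (retr H n ≫ a + retr H n ≫ a') = 0 := by
        rw [← Preadditive.comp_add]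
        exact bd_retr H n _
      rw [← extOf_cocycleHom_add G.aug _ _ _ _ h]
      exact extOf_cocycleHom_eq hX H _ _ _ _ (by rw [Preadditive.comp_add])

lemma koszulExt_koszulIncl (hX : Projective X) (H : ∀ n, G.KoszulExactAt X n) {n : ℕ} {N : A}
    (c : (stage ((trivialModule G.aug).obj X) n).Y ⟶ N) (h) :
    koszulExt hX H n N (G.koszulIncl ((trivialModule G.aug).obj X) n ≫ c) =
      extOf (cocycleHom G.aug c h) :=
  extOf_cocycleHom_eq hX H _ _ _ _ (koszulIncl_retr_comp H n _)

lemma koszulExt_injective (hX : Projective X) (H : ∀ n, G.KoszulExactAt X n) (n : ℕ) (N : A) :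
    Function.Injective (koszulExt hX H n N) := by
  rw [injective_iff_map_eq_zero]
  intro a ha
  have h1 := koszulIncl_retr_comp H n a
  cases n with
  | zero =>
    have h2 : retr H 0 ≫ a = 0 := (extOf_cocycleHom_zero_iff G.aug _ _).1 ha
    rw [← h1, h2]
    exact comp_zero
  | succ n =>
    obtain ⟨u, hu⟩ := (extOf_cocycleHom_succ_iff G.aug (M := (trivialModule G.aug).obj X)
      hX _ (bd_retr H (n + 1) a)).1 ha
    rw [← h1, hu]
    refine Eq.trans ?_ ((congr_arg (fun x => x ≫ u) (G.koszulIncl_bd_aug X n)).trans zero_comp)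
    exact ((Category.assoc _ _ _).trans (congr_arg (fun x => _ ≫ x) (Category.assoc _ _ _))).symm

lemma koszulExt_surjective (hX : Projective X) (H : ∀ n, G.KoszulExactAt X n) (n : ℕ) (N : A) :
    Function.Surjective (koszulExt hX H n N) := fun x => by
  obtain ⟨c, h, rfl⟩ := exists_cocycleHom G.aug (M := (trivialModule G.aug).obj X) hX x
  exact ⟨_, koszulExt_koszulIncl hX H c h⟩

/-- Extensions of trivial modules are maps out of the Koszul dual. -/
noncomputable def koszulExtEquiv (hX : Projective X) (H : ∀ n, G.KoszulExactAt X n) (n : ℕ)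
    (N : A) : ((G.U (n + 1)).obj X ⟶ N) ≃+
      Abelian.Ext.{max u v} ((trivialModule G.aug).obj X) ((trivialModule G.aug).obj N) n :=
  AddEquiv.ofBijective (koszulExt hX H n N) ⟨koszulExt_injective hX H n N, koszulExt_surjective hX H n N⟩

lemma koszulExt_comp_mk₀ (hX : Projective X) (H : ∀ n, G.KoszulExactAt X n) (n : ℕ) {N N' : A}
    (a : (G.U (n + 1)).obj X ⟶ N) (f : N ⟶ N') :
    (koszulExt hX H n N a).comp (Abelian.Ext.mk₀ ((trivialModule G.aug).map f)) (add_zero n) =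
      koszulExt hX H n N' (a ≫ f) := by
  have h : (stage ((trivialModule G.aug).obj X) n).bd ≫ trivialAction G.aug _ ≫
      (retr H n ≫ a) ≫ f = 0 := by
    rw [Category.assoc]
    exact bd_retr H n (a ≫ f)
  refine (extOf_comp _ _).trans ?_
  refine Eq.trans ?_ (extOf_cocycleHom_eq hX H ((retr H n ≫ a) ≫ f) _ h (bd_retr H n (a ≫ f))
    (by rw [Category.assoc]))
  exact congr_arg extOf (by ext; rfl)

lemma koszulIncl_stageComp_aux {C : Type u} [Category.{v} C] {P Q R S S' V R' R'' Q' Q'' P' W W' : C}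
    {i : P ⟶ Q} {k : Q ⟶ R} {ι : R ⟶ S} {π : S ⟶ S'} {s : S' ⟶ V} {t : S ⟶ R'} {f : R' ⟶ R''}
    {π' : R'' ⟶ V} (h2 : π ≫ s = t ≫ f ≫ π') {b : R ⟶ Q'} {ι' : Q' ⟶ R'} (h3 : b ≫ ι' = ι ≫ t)
    {g : Q' ⟶ Q''} {ι'' : Q'' ⟶ R''} (h4 : ι' ≫ f = g ≫ ι'') {g' : Q ⟶ P'} {kb : P' ⟶ Q''}
    (h5 : (k ≫ b) ≫ g = g' ≫ kb) {h : P ⟶ W} {i' : W ⟶ W'} {k' : W' ⟶ Q''}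
    (h6 : i ≫ g' ≫ kb = h ≫ i' ≫ k') :
    (i ≫ k ≫ ι ≫ π) ≫ s = h ≫ i' ≫ k' ≫ ι'' ≫ π' := by
  simp only [Category.assoc] at *
  rw [h2, ← reassoc_of% h3, reassoc_of% h4, reassoc_of% h5, reassoc_of% h6]

lemma koszulIncl_stageComp {B G : GradedAlgebra.{w} A} (ψ : B.total ⟶ G.total)
    (α : B.pc 1 ⟶ G.pc 1) (hψ : ∀ Y, (B.ι 1).app Y ≫ ψ.app Y = α.app Y ≫ (G.ι 1).app Y)
    (M : B.total.Algebra) (M' : G.total.Algebra) (f : M.A ⟶ M'.A)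
    (u : ∀ n, (B.U n).obj M.A ⟶ (G.U n).obj M.A) (hu₁ : u 1 = 𝟙 M.A)
    (hu : ∀ n, u (n + 1) ≫ G.i n M.A = B.i n M.A ≫ α.app _ ≫ (G.pc 1).map (u n)) : ∀ n,
    B.koszulIncl M n ≫ stageComp ψ f n =
      (u (n + 1) ≫ (G.U (n + 1)).map f) ≫ G.koszulIncl M' n
  | 0 => (Category.id_comp f).trans ((Category.id_comp f).symm.trans ((congr_arg (fun a => a ≫ f)
      hu₁.symm).trans (Category.comp_id _).symm))
  | n + 1 => by
    have ih := koszulIncl_stageComp ψ α hψ M M' f u hu₁ hu n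
    have h1 := hu (n + 1)
    have h7 := G.i_naturality (n + 1) f
    have h6 : B.i (n + 1) M.A ≫ α.app ((B.U (n + 1)).obj M.A) ≫
        (G.pc 1).map ((u (n + 1) ≫ (G.U (n + 1)).map f) ≫ G.koszulIncl M' n) =
        (u (n + 2) ≫ (G.U (n + 2)).map f) ≫ G.i (n + 1) M'.A ≫
          (G.pc 1).map (G.koszulIncl M' n) := by
      rw [Functor.map_comp, Functor.map_comp, Category.assoc, Category.assoc, reassoc_of% h7,
        reassoc_of% h1]
    have h5 : (B.pc 1).map (B.koszulIncl M n ≫ stageComp ψ f n) ≫ α.app _ = _ := α.naturality _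
    rw [Functor.map_comp, ih] at h5
    exact koszulIncl_stageComp_aux (i := B.i (n + 1) M.A)
      (h := u (n + 2) ≫ (G.U (n + 2)).map f) (i' := G.i (n + 1) M'.A)
      (k' := (G.pc 1).map (G.koszulIncl M' n)) (π_stageComp ψ (M := M) (M' := M') f n)
      (B.ι_naturality 1 (stageComp ψ (M := M) (M' := M') f n)).symm
      (hψ (stage M' n).Y) h5 h6

lemma mk₀_comp_koszulExt (hX : Projective X) (H : ∀ n, G.KoszulExactAt X n) {X' : A}
    (hX' : Projective X') (H' : ∀ n, G.KoszulExactAt X' n) (f : X ⟶ X') (n : ℕ) {N : A}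
    (a : (G.U (n + 1)).obj X' ⟶ N) :
    (Abelian.Ext.mk₀ ((trivialModule G.aug).map f)).comp (koszulExt hX' H' n N a) (zero_add n) =
      koszulExt hX H n N ((G.U (n + 1)).map f ≫ a) := by
  have h1 := koszulIncl_stageComp (𝟙 G.total) (𝟙 (G.pc 1))
    (fun Y => (Category.comp_id _).trans (Category.id_comp _).symm) ((trivialModule G.aug).obj X)
    ((trivialModule G.aug).obj X') f (fun n => 𝟙 _) rfl (fun n => by
      rw [(G.pc 1).map_id, NatTrans.id_app, Category.id_comp, Category.comp_id]
      exact (Category.comp_id _).symm) n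
  let k := syzMap ((trivialModule G.aug).map f) n ≫
    cocycleHom G.aug (retr H' n ≫ a) (bd_retr H' n a)
  refine (mk₀_comp_extOf _ _ _).trans (Eq.trans (koszulExt_koszulIncl hX H k.f
    (cocycle_condition G.aug k)).symm (congr_arg _ ?_))
  refine (Category.assoc _ _ _).symm.trans ((congr_arg (fun x => x ≫ retr H' n ≫ a) h1).trans ?_)
  refine (Category.assoc _ _ _).trans ((congr_arg (fun x => _ ≫ x)
    (koszulIncl_retr_comp H' n a)).trans ?_)
  exact congr_arg (fun x => x ≫ a) (Category.id_comp _)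

lemma map_koszulExt {B G : GradedAlgebra.{w} A} [B.ProjComponents] [G.ProjComponents]
    (hX : Projective X) (H : ∀ n, G.KoszulExactAt X n)
    (H' : ∀ n, B.KoszulExactAt X n) (φ : Hom B G) (ψ : B.total ⟶ G.total) (hψ : ψ = totalMap φ)
    (h : ψ ≫ G.aug = B.aug) (n : ℕ) {N : A} (a : (G.U (n + 1)).obj X ⟶ N) :
    (Abelian.Ext.mk₀ (trivialModuleIso ψ h X).hom).comp
      (((koszulExt hX H n N a).mapExactFunctor (Monad.algebraFunctorOfMonadHom ψ)).comp
        (Abelian.Ext.mk₀ (trivialModuleIso ψ h N).inv) (add_zero n)) (zero_add n) =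
      koszulExt hX H' n N (homU φ (n + 1) X ≫ a) := by
  have h1 := koszulIncl_stageComp ψ (φ.app 1) (fun Y => hψ ▸ ι_totalMap φ 1 Y)
    ((trivialModule B.aug).obj X) ((trivialModule G.aug).obj X) (𝟙 X) (fun n => homU φ n X) rfl
    (fun n => homU_i φ n X) n
  let k := (syzComp ψ (trivialModuleIso ψ h X).hom n ≫ (Monad.algebraFunctorOfMonadHom ψ).map
    (cocycleHom G.aug (retr H n ≫ a) (bd_retr H n a))) ≫ (trivialModuleIso ψ h N).inv
  have h2 : koszulExt hX H n N a = extOf (cocycleHom G.aug (retr H n ≫ a) (bd_retr H n a)) := rfl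
  rw [← Abelian.Ext.comp_assoc_of_third_deg_zero, h2, mapExactFunctor_extOf, extOf_comp]
  refine (Eq.trans (koszulExt_koszulIncl hX H' k.f (cocycle_condition B.aug k)).symm
    (congr_arg _ ?_))
  let j := stageComp ψ (M := (trivialModule B.aug).obj X) (M' := (trivialModule G.aug).obj X) (𝟙 X) n
  have h3 : k.f = j ≫ retr H n ≫ a := Category.comp_id (j ≫ retr H n ≫ a)
  refine (congr_arg (fun x => _ ≫ x) h3).trans ?_
  refine (Category.assoc _ _ _).symm.trans ((congr_arg (fun x => x ≫ retr H n ≫ a) h1).trans ?_)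
  refine (Category.assoc _ _ _).trans ((congr_arg (fun x => _ ≫ x)
    (koszulIncl_retr_comp H n a)).trans ?_)
  exact congr_arg (fun x => x ≫ a) ((congr_arg (fun x => homU φ (n + 1) X ≫ x)
    ((G.U (n + 1)).map_id X)).trans (Category.comp_id _))

end GradedAlgebra

lemma shortExact_of_evaluation {C : Type*} {D : Type*} [Category C] [Category D] [Abelian D]
    (S : ShortComplex (C ⥤ D)) (h : ∀ X, (S.map ((evaluation C D).obj X)).ShortExact) :
    S.ShortExact where
  exact := by
    rw [ShortComplex.exact_iff_isZero_homology, Functor.isZero_iff]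
    intro X
    exact ((ShortComplex.exact_iff_isZero_homology _).1 (h X).exact).of_iso
      (S.mapHomologyIso ((evaluation C D).obj X)).symm
  mono_f := (NatTrans.mono_iff_mono_app _).2 fun X => (h X).mono_f
  epi_g := (NatTrans.epi_iff_epi_app _).2 fun X => (h X).epi_g

namespace GradedAlgebra

variable {A : Type u} [Category.{v} A] [Abelian A] [HasCountableCoproducts A]
  {B G : GradedAlgebra.{w} A}

namespace CentralQuotient

variable (D : CentralQuotient B G) {X : A}

/-- The factorization of the map given by the central element through the Koszul dual of the
quotient. -/
noncomputable def connecting (S : ∀ n, D.SplitAt X n) (n : ℕ) :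
    (G.U (n + 1)).obj X ⟶ (B.U (n + 2)).obj X :=
  (S n).exists_section.choose ≫ D.σ (n + 1) X

lemma cancel_homU (S : ∀ n, D.SplitAt X n) (n : ℕ) {Z : A} {f g : (G.U (n + 1)).obj X ⟶ Z}
    (h : homU D.π (n + 1) X ≫ f = homU D.π (n + 1) X ≫ g) : f = g := by
  obtain ⟨s, hs⟩ := (S n).exists_section
  have := congr_arg (fun a => s ≫ a) h
  rwa [reassoc_of% hs, reassoc_of% hs] at this

variable (S : ∀ n, D.SplitAt X n) (n : ℕ)

lemma homU_connecting : homU D.π (n + 1) X ≫ D.connecting S n = D.σ (n + 1) X := by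
  obtain ⟨y, hy⟩ := (S n).splitExact.lift
    (𝟙 _ - homU D.π (n + 1) X ≫ (S n).exists_section.choose) (by
      rw [Preadditive.sub_comp, Category.assoc, (S n).exists_section.choose_spec, Category.comp_id,
        Category.id_comp, sub_self])
  have h := congr_arg (fun a => a ≫ D.σ (n + 1) X) hy
  simp only [Category.assoc, σ_σ, comp_zero, Preadditive.sub_comp, Category.id_comp] at h
  exact (sub_eq_zero.1 h.symm).symm

lemma connecting_homU : D.connecting S n ≫ homU D.π (n + 2) X = 0 := by
  rw [connecting, Category.assoc, σ_π, comp_zero]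

lemma connecting_naturality {X' : A} (S' : ∀ n, D.SplitAt X' n) (f : X ⟶ X') :
    (G.U (n + 1)).map f ≫ D.connecting S' n = D.connecting S n ≫ (B.U (n + 2)).map f := by
  apply D.cancel_homU S n
  rw [← reassoc_of% (homU_naturality D.π f (n + 1)), homU_connecting,
    reassoc_of% (D.homU_connecting S n), σ_naturality]

lemma exists_connecting_retraction (hX : Projective X)
    (hG : ∀ m, Projective ((G.U (m + 1)).obj X)) :
    ∃ e, D.connecting S n ≫ e = 𝟙 _ := by
  obtain ⟨h0, e, s, h1⟩ := (S (n + 1)).splitExact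
  refine ⟨e ≫ homU D.π (n + 1) X, ?_⟩
  have h2 := congr_arg (fun a => D.connecting S n ≫ a) h1
  simp only [Preadditive.comp_add, Category.comp_id] at h2
  rw [reassoc_of% (D.connecting_homU S n), zero_comp, add_zero, ← D.homU_connecting S n] at h2
  obtain ⟨t, ht⟩ := (S n).exists_section
  have h3 := D.exact_σ hX hG n ((D.connecting S n ≫ e ≫ homU D.π (n + 1) X - 𝟙 _) ≫ t) (by
    rw [← D.homU_connecting S n, Category.assoc, reassoc_of% ht, Preadditive.sub_comp,
      Category.id_comp]
    simp only [Category.assoc]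
    rw [h2, sub_self])
  rw [Category.assoc, ht, Category.comp_id] at h3
  exact sub_eq_zero.1 h3

/-- The retraction on the Koszul dual of the quotient given by an augmentation. -/
noncomputable def augRetraction (e : B.pc 1 ⟶ 𝟭 A) (n : ℕ) (X : A) :
    (B.U (n + 2)).obj X ⟶ (G.U (n + 1)).obj X :=
  B.i (n + 1) X ≫ e.app _ ≫ homU D.π (n + 1) X

lemma augRetraction_naturality (e : B.pc 1 ⟶ 𝟭 A) {X' : A} (f : X ⟶ X') :
    (B.U (n + 2)).map f ≫ D.augRetraction e n X' = D.augRetraction e n X ≫ (G.U (n + 1)).map f := by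
  have h := e.naturality ((B.U (n + 1)).map f)
  dsimp at h
  rw [augRetraction, augRetraction, reassoc_of% (B.i_naturality (n + 1) f), reassoc_of% h,
    homU_naturality]
  simp only [Category.assoc]

lemma connecting_augRetraction (e : B.pc 1 ⟶ 𝟭 A) (he : ∀ Y, D.t Y ≫ e.app Y = 𝟙 Y) :
    D.connecting S n ≫ D.augRetraction e n X = 𝟙 _ := by
  apply D.cancel_homU S n
  have h := e.naturality (D.σ n X)
  dsimp at h
  rw [← Category.assoc, homU_connecting, augRetraction, ← Category.assoc, σ_i,
    Preadditive.sub_comp, ← Category.assoc (D.t _), he, Category.assoc, reassoc_of% h, σ_π,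
    comp_zero, comp_zero, sub_zero, Category.comp_id]
  exact Category.id_comp _

end CentralQuotient

section Cohomology

variable {P : Type u'} [Category.{v'} P] (E : P ⥤ A)

variable [B.ProjComponents] [G.ProjComponents] (hE : ∀ Q, Projective (E.obj Q))
  (HB : ∀ Q n, B.KoszulExactAt (E.obj Q) n) (HG : ∀ Q n, G.KoszulExactAt (E.obj Q) n)

/-- The map of extension groups induced by a map of Koszul duals. -/
noncomputable def extMap {n m : ℕ} {X : A} (hX : Projective X) (HB : ∀ n, B.KoszulExactAt X n)
    (HG : ∀ n, G.KoszulExactAt X n) (t : (B.U (m + 1)).obj X ⟶ (G.U (n + 1)).obj X) (N : A) :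
    Abelian.Ext.{max u v} ((trivialModule G.aug).obj X) ((trivialModule G.aug).obj N) n →+
      Abelian.Ext.{max u v} ((trivialModule B.aug).obj X) ((trivialModule B.aug).obj N) m :=
  ((koszulExt hX HB m N).comp (AddMonoidHom.mk' (fun a : (G.U (n + 1)).obj X ⟶ N => t ≫ a)
    (fun a a' => Preadditive.comp_add _ _ _ _ _ _))).comp
      (koszulExtEquiv hX HG n N).symm.toAddMonoidHom

lemma extMap_koszulExt {n m : ℕ} {X : A} (hX : Projective X) (HB : ∀ n, B.KoszulExactAt X n)
    (HG : ∀ n, G.KoszulExactAt X n) (t : (B.U (m + 1)).obj X ⟶ (G.U (n + 1)).obj X) {N : A}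
    (a : (G.U (n + 1)).obj X ⟶ N) :
    extMap hX HB HG t N (koszulExt hX HG n N a) = koszulExt hX HB m N (t ≫ a) :=
  congr_arg (fun a => koszulExt hX HB m N (t ≫ a))
    ((koszulExtEquiv hX HG n N).symm_apply_apply a)

/-- The map of cohomology induced by a natural map of Koszul duals. -/
noncomputable def cohomologyOf {n m : ℕ} (t : E ⋙ B.U (m + 1) ⟶ E ⋙ G.U (n + 1)) :
    E.op ⋙ cohomology G.aug n ⟶ E.op ⋙ cohomology B.aug m where
  app Q :=
    { app N := AddCommGrpCat.ofHom (extMap (hE Q.unop) (HB Q.unop) (HG Q.unop) (t.app Q.unop) N)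
      naturality N N' f := by
        ext x
        obtain ⟨a, rfl⟩ := koszulExt_surjective (hE Q.unop) (HG Q.unop) n N x
        change extMap (hE Q.unop) (HB Q.unop) (HG Q.unop) (t.app Q.unop) N'
          ((koszulExt (hE Q.unop) (HG Q.unop) n N a).comp
            (Abelian.Ext.mk₀ ((trivialModule G.aug).map f)) (add_zero n)) =
          (extMap (hE Q.unop) (HB Q.unop) (HG Q.unop) (t.app Q.unop) N
            (koszulExt (hE Q.unop) (HG Q.unop) n N a)).comp
              (Abelian.Ext.mk₀ ((trivialModule B.aug).map f)) (add_zero m)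
        rw [koszulExt_comp_mk₀, extMap_koszulExt, extMap_koszulExt, koszulExt_comp_mk₀,
          Category.assoc] }
  naturality Q Q' f := by
    ext N x
    obtain ⟨a, rfl⟩ := koszulExt_surjective (hE Q.unop) (HG Q.unop) n N x
    change extMap (hE Q'.unop) (HB Q'.unop) (HG Q'.unop) (t.app Q'.unop) N
      ((Abelian.Ext.mk₀ ((trivialModule G.aug).map (E.map f.unop))).comp
        (koszulExt (hE Q.unop) (HG Q.unop) n N a) (zero_add n)) =
      (Abelian.Ext.mk₀ ((trivialModule B.aug).map (E.map f.unop))).comp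
        (extMap (hE Q.unop) (HB Q.unop) (HG Q.unop) (t.app Q.unop) N
          (koszulExt (hE Q.unop) (HG Q.unop) n N a)) (zero_add m)
    have h := t.naturality f.unop
    dsimp at h
    rw [mk₀_comp_koszulExt (hE Q'.unop) (HG Q'.unop), extMap_koszulExt, extMap_koszulExt,
      mk₀_comp_koszulExt (hE Q'.unop) (HB Q'.unop), reassoc_of% h]

/-- An element of the cohomology of a Koszul algebra. -/
noncomputable def cohomologyElement {n : ℕ} (Q : P) (N : A)
    (a : (G.U (n + 1)).obj (E.obj Q) ⟶ N) :
    (((E.op ⋙ cohomology G.aug n).obj (op Q)).obj N : Type _) :=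
  koszulExt (hE Q) (HG Q) n N a

lemma cohomologyElement_bijective (n : ℕ) (Q : P) (N : A) :
    Function.Bijective (cohomologyElement E hE HG (n := n) Q N) :=
  (koszulExtEquiv (hE Q) (HG Q) n N).bijective

lemma cohomologyOf_apply {n m : ℕ} (t : E ⋙ B.U (m + 1) ⟶ E ⋙ G.U (n + 1)) (Q : P) (N : A)
    (a : (G.U (n + 1)).obj (E.obj Q) ⟶ N) :
    ((cohomologyOf E hE HB HG t).app (op Q)).app N (cohomologyElement E hE HG Q N a) =
      cohomologyElement E hE HB Q N (t.app Q ≫ a) :=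
  extMap_koszulExt _ _ _ _ _

lemma cohomologyMap_apply (φ : Hom B G) (ψ : B.total ⟶ G.total) (hψ : ψ = totalMap φ)
    (h : ψ ≫ G.aug = B.aug) (n : ℕ) (Q : P) (N : A) (a : (G.U (n + 1)).obj (E.obj Q) ⟶ N) :
    ((Functor.whiskerLeft E.op (cohomologyMap ψ h n)).app (op Q)).app N
      (cohomologyElement E hE HG Q N a) =
      cohomologyElement E hE HB Q N (homU φ (n + 1) (E.obj Q) ≫ a) :=
  map_koszulExt (hE Q) (HG Q) (HB Q) φ ψ hψ h n a

lemma cohomology_hom_ext {n : ℕ} {K : Pᵒᵖ ⥤ A ⥤ AddCommGrpCat.{max u v}}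
    {f g : E.op ⋙ cohomology G.aug n ⟶ K}
    (h : ∀ (Q : P) (N : A) (a : (G.U (n + 1)).obj (E.obj Q) ⟶ N),
      (f.app (op Q)).app N (cohomologyElement E hE HG Q N a) =
        (g.app (op Q)).app N (cohomologyElement E hE HG Q N a)) : f = g := by
  ext Q N x
  obtain ⟨a, rfl⟩ := (cohomologyElement_bijective E hE HG n Q.unop N).2 x
  exact h Q.unop N a

lemma CentralQuotient.exists_shortExact (hE : ∀ Q, Projective (E.obj Q))
    (HB : ∀ Q n, B.KoszulExactAt (E.obj Q) n) (HG : ∀ Q n, G.KoszulExactAt (E.obj Q) n)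
    (D : CentralQuotient B G) (ψ : B.total ⟶ G.total)
    (hψ : ψ = totalMap D.π) (h : ψ ≫ G.aug = B.aug) :
    IsIso (Functor.whiskerLeft E.op (cohomologyMap ψ h 0)) ∧
    ∃ (κ : ∀ n, E.op ⋙ cohomology B.aug (n + 1) ⟶ E.op ⋙ cohomology G.aug n)
      (hκ : ∀ n, Functor.whiskerLeft E.op (cohomologyMap ψ h (n + 1)) ≫ κ n = 0),
      (∀ n, (ShortComplex.mk _ (κ n) (hκ n)).ShortExact) ∧
      ((∃ e : B.pc 1 ⟶ 𝟭 A, ∀ Y, D.t Y ≫ e.app Y = 𝟙 Y) →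
        ∀ n, Nonempty (ShortComplex.mk _ (κ n) (hκ n)).Splitting) := by
  have hG : ∀ Q m, Projective ((G.U (m + 1)).obj (E.obj Q)) := fun Q m =>
    projective_U (hE Q) m fun m _ => HG Q m
  have S : ∀ Q n, D.SplitAt (E.obj Q) n := fun Q => D.splitAt (hG Q)
  let k (n : ℕ) : E ⋙ G.U (n + 1) ⟶ E ⋙ B.U (n + 2) :=
    { app Q := D.connecting (S Q) n
      naturality Q Q' f := D.connecting_naturality (S Q) n (S Q') (E.map f) }
  have bB : ∀ n Q N, Function.Bijective (cohomologyElement E hE HB (n := n) Q N) :=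
    cohomologyElement_bijective E hE HB
  have bG : ∀ n Q N, Function.Bijective (cohomologyElement E hE HG (n := n) Q N) :=
    cohomologyElement_bijective E hE HG
  let m (n : ℕ) := Functor.whiskerLeft E.op (cohomologyMap ψ h n)
  have hm : ∀ (n : ℕ) (Q : P) (N : A) (a : (G.U (n + 1)).obj (E.obj Q) ⟶ N),
      ((m n).app (op Q)).app N (cohomologyElement E hE HG Q N a) =
        cohomologyElement E hE HB Q N (homU D.π (n + 1) (E.obj Q) ≫ a) :=
    cohomologyMap_apply E hE HB HG D.π ψ hψ h
  let κ (n : ℕ) := cohomologyOf E hE HG HB (k n)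
  have hk : ∀ (n : ℕ) (Q : P) (N : A) (a : (B.U (n + 2)).obj (E.obj Q) ⟶ N),
      ((κ n).app (op Q)).app N (cohomologyElement E hE HB Q N a) =
        cohomologyElement E hE HG Q N (D.connecting (S Q) n ≫ a) := fun n =>
    cohomologyOf_apply E hE HG HB (k n)
  have hκ : ∀ n, m (n + 1) ≫ κ n = 0 := fun n => by
    refine cohomology_hom_ext E hE HG fun Q N a => ?_
    refine (congr_arg (fun x => ((κ n).app (op Q)).app N x) (hm (n + 1) Q N a)).trans ?_
    refine (hk n Q N _).trans ?_
    rw [reassoc_of% (D.connecting_homU (S Q) n), zero_comp]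
    exact map_zero (koszulExt (hE Q) (HG Q) n N)
  have exact : ∀ n, (ShortComplex.mk (m (n + 1)) (κ n) (hκ n)).ShortExact := fun n => by
    refine shortExact_of_evaluation _ fun Q => shortExact_of_evaluation _ fun N =>
      { exact := (ShortComplex.ab_exact_iff _).2 fun x hx => ?_
        mono_f := (AddCommGrpCat.mono_iff_injective _).2 fun x y hxy => ?_
        epi_g := (AddCommGrpCat.epi_iff_surjective _).2 fun x => ?_ }
    · obtain ⟨a, rfl⟩ := (bB _ Q.unop N).2 x
      have h1 := (hk n Q.unop N a).symm.trans hx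
      have h2 : D.connecting (S Q.unop) n ≫ a = 0 :=
        (bG _ Q.unop N).1 (h1.trans (map_zero (koszulExt (hE Q.unop) (HG Q.unop) n N)).symm)
      obtain ⟨h3, e, s, h4⟩ := (S Q.unop (n + 1)).splitExact
      refine ⟨cohomologyElement E hE HG Q.unop N (s ≫ a), (hm _ _ _ _).trans ?_⟩
      refine congr_arg _ ?_
      rw [← D.homU_connecting (S Q.unop) n] at h4
      have h5 := congr_arg (fun x => x ≫ a) h4
      simp only [Preadditive.add_comp, Category.assoc, Category.id_comp] at h5
      rw [h2, comp_zero, comp_zero, zero_add] at h5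
      exact h5
    · obtain ⟨a, rfl⟩ := (bG _ Q.unop N).2 x
      obtain ⟨b, rfl⟩ := (bG _ Q.unop N).2 y
      have h1 := (bB _ Q.unop N).1 ((hm _ _ _ _).symm.trans (hxy.trans (hm _ _ _ _)))
      exact congr_arg _ (D.cancel_homU (S Q.unop) (n + 1) h1)
    · obtain ⟨a, rfl⟩ := (bG _ Q.unop N).2 x
      obtain ⟨e, he⟩ := D.exists_connecting_retraction (S Q.unop) n (hE Q.unop) (hG Q.unop)
      refine ⟨cohomologyElement E hE HB Q.unop N (e ≫ a), (hk _ _ _ _).trans ?_⟩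
      rw [reassoc_of% he]
  refine ⟨?_, κ, hκ, exact, ?_⟩
  · have : ∀ Q, IsIso ((m 0).app Q) := fun Q => by
      have : ∀ N, IsIso (((m 0).app Q).app N) := fun N => by
        refine (ConcreteCategory.isIso_iff_bijective _).2 ⟨fun x y hxy => ?_, fun x => ?_⟩
        · obtain ⟨a, rfl⟩ := (bG _ Q.unop N).2 x
          obtain ⟨b, rfl⟩ := (bG _ Q.unop N).2 y
          have h1 := (bB _ Q.unop N).1 ((hm _ _ _ _).symm.trans (hxy.trans (hm _ _ _ _)))
          exact congr_arg _ (D.cancel_homU (S Q.unop) 0 h1)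
        · obtain ⟨a, rfl⟩ := (bB _ Q.unop N).2 x
          refine ⟨cohomologyElement E hE HG (n := 0) Q.unop N a, (hm 0 _ _ _).trans ?_⟩
          exact congr_arg _ (Category.id_comp a)
      exact NatIso.isIso_of_isIso_app _
    exact NatIso.isIso_of_isIso_app _
  · rintro ⟨e, he⟩ n
    let ρ : E ⋙ B.U (n + 2) ⟶ E ⋙ G.U (n + 1) :=
      { app Q := D.augRetraction e n (E.obj Q)
        naturality Q Q' f := D.augRetraction_naturality n e (E.map f) }
    have := (exact n).mono_f
    refine ⟨ShortComplex.Splitting.ofExactOfSection _ (exact n).exact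
      (cohomologyOf E hE HB HG ρ) ?_ (exact n).mono_f⟩
    refine cohomology_hom_ext E hE HG fun Q N a => ?_
    refine (congr_arg (fun x => ((κ n).app (op Q)).app N x)
      (cohomologyOf_apply E hE HB HG ρ Q N a)).trans ?_
    refine (hk n Q N _).trans ?_
    refine congr_arg (cohomologyElement E hE HG Q N) ?_
    exact (Category.assoc _ _ _).symm.trans ((congr_arg (fun x => x ≫ a)
      (D.connecting_augRetraction (S Q) n e he)).trans (Category.id_comp a))

end Cohomology

end GradedAlgebra

section Models

variable {P : Type u} [Category.{w} P] [Preadditive P] [HasCoproducts.{w} P]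

lemma surjective_of_epi {X Y : Model P} (f : X ⟶ Y) [Epi f] (Q : Pᵒᵖ) :
    Function.Surjective (f.hom.app Q) := by
  have h : Epi f.hom := by
    let p : Y ⟶ ⟨cokernel f.hom, ObjectProperty.prop_cokernel (P := IsModel P) f.hom X.property
      Y.property⟩ := ObjectProperty.homMk (cokernel.π f.hom)
    have hp : p = 0 := by
      rw [← cancel_epi f, comp_zero]
      ext : 1
      exact cokernel.condition f.hom
    exact Preadditive.epi_of_cokernel_zero (congr_arg (fun a => a.hom) hp)
  exact (AddCommGrpCat.epi_iff_surjective _).1 inferInstance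

instance (Q : P) : Projective ((embedding P).obj Q) where
  factors {X Y} f e he := by
    obtain ⟨x, hx⟩ := surjective_of_epi e (op Q) (f.hom.app (op Q) (𝟙 Q))
    refine ⟨ofElement x, hom_ext_embedding ?_⟩
    refine Eq.trans ?_ hx
    exact congr_arg (e.hom.app (op Q)) (ofElement_apply_id x)

lemma projective_of_representables (Q : Model P) (h : representables P Q) : Projective Q := by
  obtain ⟨R, ⟨e⟩⟩ := h
  exact Projective.of_iso e inferInstance

lemma ofElement_comp {Q : P} {X Y : Model P} (x : X.obj.obj (op Q)) (f : X ⟶ Y) :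
    ofElement x ≫ f = ofElement (f.hom.app (op Q) x) :=
  hom_ext_embedding ((congr_arg (f.hom.app (op Q)) (ofElement_apply_id x)).trans
    (ofElement_apply_id _).symm)

lemma embedding_map_ofElement {Q R : P} {X : Model P} (a : R ⟶ Q) (x : X.obj.obj (op Q)) :
    (embedding P).map a ≫ ofElement x = ofElement (X.obj.map a.op x) :=
  hom_ext_embedding ((congr_arg (fun a => X.obj.map (Quiver.Hom.op a) x) (Category.id_comp a)).trans
    (ofElement_apply_id _).symm)

lemma ofElement_add {Q : P} {X : Model P} (x y : X.obj.obj (op Q)) :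
    ofElement (x + y) = ofElement x + ofElement y :=
  hom_ext_embedding ((ofElement_apply_id _).trans
    (congr_arg₂ _ (ofElement_apply_id x) (ofElement_apply_id y)).symm)

variable [IsBoundedTheory P]

instance small_model_hom (X Y : Model P) : Small.{w} (X ⟶ Y) := by
  obtain ⟨Q, e, he⟩ := exists_epi X
  refine small_of_injective (β := Y.obj.obj (op Q)) (f := fun f => (e ≫ f).hom.app (op Q) (𝟙 Q))
    fun f g h => ?_
  exact (cancel_epi e).1 (hom_ext_embedding h)

variable (K : P ⥤ Model P)

/-- The presheaf of maps out of the values of a functor. -/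
noncomputable def homPresheaf (N : Model P) : Pᵒᵖ ⥤ AddCommGrpCat.{w} where
  obj Q := AddCommGrpCat.of (Shrink.{w} (K.obj Q.unop ⟶ N))
  map {Q R} a := AddCommGrpCat.ofHom (Shrink.addEquiv.symm.toAddMonoidHom.comp
    ((AddMonoidHom.mk' (fun f : K.obj Q.unop ⟶ N => K.map a.unop ≫ f)
      (fun f g => Preadditive.comp_add _ _ _ _ _ _)).comp Shrink.addEquiv.toAddMonoidHom))
  map_id Q := by
    refine AddCommGrpCat.hom_ext (AddMonoidHom.ext fun x => ?_)
    obtain ⟨f, rfl⟩ := (equivShrink _).surjective x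
    change equivShrink _ (K.map (𝟙 _) ≫ (equivShrink _).symm (equivShrink _ f)) = equivShrink _ f
    rw [Equiv.symm_apply_apply, K.map_id, Category.id_comp]
  map_comp {Q R S} a b := by
    refine AddCommGrpCat.hom_ext (AddMonoidHom.ext fun x => ?_)
    obtain ⟨f, rfl⟩ := (equivShrink _).surjective x
    change equivShrink _ (K.map (b.unop ≫ a.unop) ≫ (equivShrink _).symm (equivShrink _ f)) =
      equivShrink _ (K.map b.unop ≫ (equivShrink _).symm (equivShrink _ (K.map a.unop ≫
        (equivShrink _).symm (equivShrink _ f))))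
    rw [Equiv.symm_apply_apply, Equiv.symm_apply_apply, K.map_comp, Category.assoc]

/-- An element of the presheaf of maps out of the values of a functor. -/
noncomputable def homElement {N : Model P} {Q : P} : (K.obj Q ⟶ N) ≃+ (homPresheaf K N).obj (op Q) :=
  Shrink.addEquiv.symm

lemma map_homElement {N : Model P} {Q R : P} (a : R ⟶ Q) (f : K.obj Q ⟶ N) :
    (homPresheaf K N).map a.op (homElement K f) = homElement K (K.map a ≫ f) := by
  change equivShrink _ (K.map a ≫ (equivShrink _).symm (equivShrink _ f)) = equivShrink _ _
  rw [Equiv.symm_apply_apply]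

/-- A functor on the theory which sends coproducts to coproducts. -/
def PreservesSums : Prop := ∀ (N : Model P) (J : Type w) (p : J → P),
  Function.Bijective (fun (f : K.obj (∐ p) ⟶ N) (j : J) => K.map (Sigma.ι p j) ≫ f)

variable {K}

lemma isModel_homPresheaf (hK : PreservesSums K) (N : Model P) : IsModel P (homPresheaf K N) := fun J p => by
  constructor
  · intro x y h
    obtain ⟨f, rfl⟩ := (homElement K).surjective x
    obtain ⟨g, rfl⟩ := (homElement K).surjective y
    refine congr_arg _ ((hK N J p).1 (funext fun j => ?_))
    have h1 := congr_fun h j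
    dsimp only at h1 ⊢
    rw [map_homElement, map_homElement] at h1
    exact (homElement K).injective h1
  · intro x
    obtain ⟨f, hf⟩ := (hK N J p).2 fun j => (homElement K).symm (x j)
    refine ⟨homElement K f, funext fun j => ?_⟩
    have h1 := congr_fun hf j
    dsimp only at h1 ⊢
    rw [map_homElement, h1, AddEquiv.apply_symm_apply]

/-- The functor of maps out of the values of a functor. -/
noncomputable def homModel (hK : PreservesSums K) : Model P ⥤ Model P where
  obj N := ⟨homPresheaf K N, isModel_homPresheaf hK N⟩
  map {N N'} g := ObjectProperty.homMk
    { app Q := AddCommGrpCat.ofHom ((homElement K).toAddMonoidHom.comp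
        ((AddMonoidHom.mk' (fun f : K.obj Q.unop ⟶ N => f ≫ g)
          (fun f f' => Preadditive.add_comp _ _ _ _ _ _)).comp (homElement K).symm.toAddMonoidHom))
      naturality Q R a := by
        refine AddCommGrpCat.hom_ext (AddMonoidHom.ext fun x => ?_)
        obtain ⟨f, rfl⟩ := (homElement K).surjective x
        change homElement K ((homElement K).symm ((homPresheaf K N).map a.unop.op
          (homElement K f)) ≫ g) = (homPresheaf K N').map a.unop.op
            (homElement K ((homElement K).symm (homElement K f) ≫ g))
        rw [map_homElement, map_homElement, AddEquiv.symm_apply_apply, AddEquiv.symm_apply_apply,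
          Category.assoc] }
  map_id N := by
    ext Q x
    obtain ⟨f, rfl⟩ := (homElement K).surjective x
    change homElement K ((homElement K).symm (homElement K f) ≫ 𝟙 N) = homElement K f
    rw [AddEquiv.symm_apply_apply, Category.comp_id]
  map_comp {N N' N''} g g' := by
    ext Q x
    obtain ⟨f, rfl⟩ := (homElement K).surjective x
    change homElement K ((homElement K).symm (homElement K f) ≫ g ≫ g') =
      homElement K ((homElement K).symm (homElement K ((homElement K).symm
        (homElement K f) ≫ g)) ≫ g')
    rw [AddEquiv.symm_apply_apply, AddEquiv.symm_apply_apply, Category.assoc]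

variable (hK : PreservesSums K)

lemma homModel_map_homElement {N N' : Model P} (g : N ⟶ N') {Q : P} (f : K.obj Q ⟶ N) :
    ((homModel hK).map g).hom.app (op Q) (homElement K f) = homElement K (f ≫ g) := by
  change homElement K ((homElement K).symm (homElement K f) ≫ g) = _
  rw [AddEquiv.symm_apply_apply]

/-- Maps out of a value of a functor, as maps out of a representable model. -/
noncomputable def homModelEquiv (Q : P) (N : Model P) :
    (K.obj Q ⟶ N) ≃ ((embedding P).obj Q ⟶ (homModel hK).obj N) where
  toFun f := ofElement (X := (homModel hK).obj N) (homElement K f)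
  invFun g := (homElement K).symm (g.hom.app (op Q) (𝟙 Q))
  left_inv f := (congr_arg (homElement K).symm (ofElement_apply_id _)).trans
    ((homElement K).symm_apply_apply f)
  right_inv g := hom_ext_embedding ((ofElement_apply_id _).trans
    ((homElement K).apply_symm_apply _))

lemma homModelEquiv_comp (Q : P) {N N' : Model P} (f : K.obj Q ⟶ N) (g : N ⟶ N') :
    homModelEquiv hK Q N' (f ≫ g) = homModelEquiv hK Q N f ≫ (homModel hK).map g := by
  refine Eq.trans ?_ (ofElement_comp _ _).symm
  exact congr_arg (ofElement (X := (homModel hK).obj N')) (homModel_map_homElement hK g f).symm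

lemma homModel_isRightAdjoint : (homModel hK).IsRightAdjoint := by
  refine Functor.isRightAdjoint_of_leftAdjointObjIsDefined_eq_top ?_
  ext X
  simp only [Pi.top_apply, Prop.top_eq_true, iff_true]
  have h1 : ∀ Q : P, (homModel hK).leftAdjointObjIsDefined ((embedding P).obj Q) := fun Q =>
    let c : ((homModel hK) ⋙ coyoneda.obj (op ((embedding P).obj Q))).CorepresentableBy (K.obj Q) :=
      { homEquiv {N} := homModelEquiv hK Q N
        homEquiv_comp g f := homModelEquiv_comp hK Q f g }
    c.isCorepresentable
  obtain ⟨Q₀, e, he⟩ := exists_epi X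
  obtain ⟨Q₁, e', he'⟩ := exists_epi (kernel e)
  let S : ShortComplex (Model P) := ShortComplex.mk (e' ≫ kernel.ι e) e (by simp)
  have h2 : Epi (kernel.lift S.g S.f S.zero) := by
    have : kernel.lift S.g S.f S.zero = e' := by
      rw [← cancel_mono (kernel.ι e)]
      exact kernel.lift_ι _ _ _
    rw [this]
    exact he'
  have h3 : S.Exact := (ShortComplex.exact_iff_epi_kernel_lift S).2 h2
  have : Epi S.g := he
  refine Functor.leftAdjointObjIsDefined_of_isColimit h3.gIsCokernel ?_
  rintro (_ | _)
  · exact h1 Q₁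
  · exact h1 Q₀

end Models

section Extension

variable {P : Type u} [Category.{w} P] [Preadditive P] [HasCoproducts.{w} P] [IsBoundedTheory P]
  {K : P ⥤ Model P} (hK : PreservesSums K)

section

variable {S : Model P ⥤ Model P} [S.Additive] (k : K ⟶ embedding P ⋙ S)

/-- The natural map to the model of maps out of the values of a functor which is induced by a
transformation. -/
noncomputable def toHomModel : 𝟭 (Model P) ⟶ S ⋙ homModel hK where
  app X := ObjectProperty.homMk
    { app Q := AddCommGrpCat.ofHom (AddMonoidHom.mk'
        (fun x : X.obj.obj (op Q.unop) => homElement K (k.app Q.unop ≫ S.map (ofElement x)))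
        (fun x y => by
          rw [ofElement_add, S.map_add, Preadditive.comp_add, map_add]
          rfl))
      naturality Q R a := by
        refine AddCommGrpCat.hom_ext (AddMonoidHom.ext fun x => ?_)
        change X.obj.obj (op Q.unop) at x
        change homElement K (k.app R.unop ≫ S.map (ofElement (X.obj.map a.unop.op x))) =
          (homPresheaf K (S.obj X)).map a.unop.op (homElement K (k.app Q.unop ≫ S.map (ofElement x)))
        rw [map_homElement, ← embedding_map_ofElement, S.map_comp]
        have h : K.map a.unop ≫ k.app Q.unop = k.app R.unop ≫ S.map ((embedding P).map a.unop) :=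
          k.naturality a.unop
        rw [reassoc_of% h] }
  naturality X Y f := by
    ext Q x
    change X.obj.obj (op Q.unop) at x
    refine Eq.trans ?_ (homModel_map_homElement hK (S.map f)
      (k.app Q.unop ≫ S.map (ofElement x))).symm
    change homElement K (k.app Q.unop ≫ S.map (ofElement (f.hom.app (op Q.unop) x))) = _
    rw [← ofElement_comp, S.map_comp, Category.assoc]

lemma toHomModel_app_embedding (Q : P) :
    (toHomModel hK k).app ((embedding P).obj Q) = homModelEquiv hK Q _ (k.app Q) := by
  refine hom_ext_embedding (Eq.trans ?_ (ofElement_apply_id _).symm)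
  change homElement K (k.app Q ≫ S.map (ofElement (X := (embedding P).obj Q) (𝟙 Q))) =
    homElement K (k.app Q)
  have h : ofElement (X := (embedding P).obj Q) (𝟙 Q) = 𝟙 _ :=
    hom_ext_embedding (ofElement_apply_id _)
  rw [h, S.map_id]
  exact congr_arg _ (Category.comp_id _)

/-- A functor on the theory which sends coproducts to coproducts extends to a functor on models
which preserves colimits, and so do transformations. -/
lemma exists_extension (hK : PreservesSums K) : ∃ (R : Model P ⥤ Model P)
    (_ : PreservesColimitsOfSize.{w, w} R) (r : R ⟶ S)
    (e : ∀ Q, K.obj Q ≅ R.obj ((embedding P).obj Q)),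
    ∀ Q, (e Q).hom ≫ r.app ((embedding P).obj Q) = k.app Q := by
  have := homModel_isRightAdjoint hK
  let adj := Adjunction.ofIsRightAdjoint (homModel hK)
  let R := (homModel hK).leftAdjoint
  let u := toHomModel hK k
  let r : R ⟶ S :=
    { app X := (adj.homEquiv X (S.obj X)).symm (u.app X)
      naturality X Y f := by
        rw [← adj.homEquiv_naturality_left_symm, ← adj.homEquiv_naturality_right_symm]
        exact congr_arg _ (u.naturality f) }
  let a (Q : P) : K.obj Q ⟶ R.obj ((embedding P).obj Q) :=
    (homModelEquiv hK Q _).symm (adj.unit.app ((embedding P).obj Q))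
  have ha : ∀ (Q : P) {N : Model P} (f : R.obj ((embedding P).obj Q) ⟶ N),
      homModelEquiv hK Q N (a Q ≫ f) = adj.homEquiv _ _ f := fun Q N f => by
    rw [homModelEquiv_comp, adj.homEquiv_unit]
    exact congr_arg (fun x => x ≫ _) ((homModelEquiv hK Q _).apply_symm_apply _)
  let b (Q : P) : R.obj ((embedding P).obj Q) ⟶ K.obj Q :=
    (adj.homEquiv _ _).symm (homModelEquiv hK Q _ (𝟙 _))
  have hb : ∀ Q, adj.homEquiv _ _ (b Q) = homModelEquiv hK Q _ (𝟙 _) := fun Q =>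
    Equiv.apply_symm_apply _ _
  have hab : ∀ Q, a Q ≫ b Q = 𝟙 _ := fun Q =>
    (homModelEquiv hK Q _).injective ((ha Q (b Q)).trans (hb Q))
  have hba : ∀ Q, b Q ≫ a Q = 𝟙 _ := fun Q => (adj.homEquiv _ _).injective (by
    rw [adj.homEquiv_naturality_right, hb, ← homModelEquiv_comp, ← ha Q (𝟙 _), Category.id_comp,
      Category.comp_id])
  refine ⟨R, adj.leftAdjoint_preservesColimits, r, fun Q => ⟨a Q, b Q, hab Q, hba Q⟩, fun Q => ?_⟩
  refine (homModelEquiv hK Q _).injective ((ha Q _).trans ?_)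
  exact ((adj.homEquiv _ _).apply_symm_apply _).trans (toHomModel_app_embedding hK k Q)

end

section

variable {S S₂ : Model P ⥤ Model P} (m : S ⟶ S₂)

lemma preservesSums_embedding_comp (S : Model P ⥤ Model P) [PreservesColimitsOfSize.{w, w} S] :
    PreservesSums (embedding P ⋙ S) := fun N J p => by
  let c := isColimitOfPreserves S (isColimitEmbedding p)
  refine ⟨fun f g h => c.hom_ext fun ⟨j⟩ => congr_fun h j, fun g => ?_⟩
  refine ⟨c.desc ⟨N, Discrete.natTrans fun ⟨j⟩ => g j⟩, funext fun j => ?_⟩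
  exact c.fac ⟨N, Discrete.natTrans fun ⟨j⟩ => g j⟩ ⟨j⟩

/-- The kernels of a transformation at the representable models. -/
noncomputable def kernelFunctor : P ⥤ Model P where
  obj Q := kernel (m.app ((embedding P).obj Q))
  map a := kernel.map _ _ (S.map ((embedding P).map a)) (S₂.map ((embedding P).map a))
    (m.naturality _).symm
  map_id Q := by
    rw [← cancel_mono (kernel.ι _)]
    simp
  map_comp a b := by
    rw [← cancel_mono (kernel.ι _)]
    simp

/-- The inclusion of the kernels of a transformation. -/
noncomputable def kernelFunctorι : kernelFunctor m ⟶ embedding P ⋙ S where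
  app Q := kernel.ι (m.app ((embedding P).obj Q))
  naturality Q R a := kernel.lift_ι _ _ _

lemma preservesSums_kernelFunctor [PreservesColimitsOfSize.{w, w} S]
    [PreservesColimitsOfSize.{w, w} S₂]
    (hs : ∀ Q, ∃ s, s ≫ m.app ((embedding P).obj Q) = 𝟙 _) : PreservesSums (kernelFunctor m) := by
  choose s hs using hs
  let k (Q : P) : (kernelFunctor m).obj Q ⟶ S.obj ((embedding P).obj Q) := (kernelFunctorι m).app Q
  have hk : ∀ {Q R : P} (a : Q ⟶ R),
      (kernelFunctor m).map a ≫ k R = k Q ≫ S.map ((embedding P).map a) :=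
    fun a => (kernelFunctorι m).naturality a
  have hkm : ∀ Q, k Q ≫ m.app ((embedding P).obj Q) = 0 := fun Q => kernel.condition _
  let ρ (Q : P) : S.obj ((embedding P).obj Q) ⟶ (kernelFunctor m).obj Q :=
    kernel.lift _ (𝟙 _ - m.app _ ≫ s Q) (by
      rw [Preadditive.sub_comp, Category.assoc, hs, Category.comp_id, Category.id_comp, sub_self])
  have hρ : ∀ Q, ρ Q ≫ k Q = 𝟙 _ - m.app _ ≫ s Q := fun Q => kernel.lift_ι _ _ _
  have hkρ : ∀ Q, k Q ≫ ρ Q = 𝟙 _ := fun Q => by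
    have : Mono (k Q) := inferInstanceAs (Mono (kernel.ι _))
    rw [← cancel_mono (k Q), Category.assoc, hρ, Preadditive.comp_sub, reassoc_of% (hkm Q),
      zero_comp, sub_zero, Category.comp_id, Category.id_comp]
  intro N J p
  constructor
  · intro f f' h
    have hd : ∀ j, (kernelFunctor m).map (Sigma.ι p j) ≫ (f - f') = 0 := fun j => by
      rw [Preadditive.comp_sub, sub_eq_zero]
      exact congr_fun h j
    have h1 : ∀ j, S.map ((embedding P).map (Sigma.ι p j)) ≫ ρ _ ≫ (f - f') =
        m.app _ ≫ s _ ≫ S.map ((embedding P).map (Sigma.ι p j)) ≫ ρ _ ≫ (f - f') := fun j => by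
      have h2 : (ρ (p j) ≫ k (p j)) ≫ S.map ((embedding P).map (Sigma.ι p j)) ≫ ρ _ ≫ (f - f') =
          0 := by
        rw [Category.assoc, ← reassoc_of% (hk (Sigma.ι p j)), reassoc_of% (hkρ _), hd, comp_zero]
      rw [hρ, Preadditive.sub_comp, Category.id_comp, sub_eq_zero, Category.assoc] at h2
      exact h2
    obtain ⟨g, hg⟩ := (preservesSums_embedding_comp S₂ N J p).2
      fun j => s _ ≫ S.map ((embedding P).map (Sigma.ι p j)) ≫ ρ _ ≫ (f - f')
    have hg' : ∀ j, S₂.map ((embedding P).map (Sigma.ι p j)) ≫ g = _ := fun j => congr_fun hg j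
    have h3 : m.app _ ≫ g = ρ _ ≫ (f - f') := by
      refine (preservesSums_embedding_comp S N J p).1 (funext fun j => ?_)
      change S.map ((embedding P).map (Sigma.ι p j)) ≫ _ =
        S.map ((embedding P).map (Sigma.ι p j)) ≫ _
      rw [h1, ← hg' j, m.naturality_assoc]
    rw [← sub_eq_zero, ← Category.id_comp (f - f'), ← hkρ, Category.assoc, ← h3,
      reassoc_of% (hkm _), zero_comp]
  · intro f
    obtain ⟨g, hg⟩ := (preservesSums_embedding_comp S N J p).2 fun j => ρ _ ≫ f j
    refine ⟨k _ ≫ g, funext fun j => ?_⟩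
    have hg' : S.map ((embedding P).map (Sigma.ι p j)) ≫ g = ρ _ ≫ f j := congr_fun hg j
    dsimp only
    rw [reassoc_of% (hk (Sigma.ι p j)), hg', reassoc_of% (hkρ _)]

/-- The kernel of a transformation of bimodules which is a split epimorphism at the representable
models. -/
lemma exists_kernel_bimodule [PreservesColimitsOfSize.{w, w} S] [S.Additive]
    [PreservesColimitsOfSize.{w, w} S₂]
    (hs : ∀ Q, ∃ s, s ≫ m.app ((embedding P).obj Q) = 𝟙 _) :
    ∃ (R : Model P ⥤ Model P) (_ : PreservesColimitsOfSize.{w, w} R) (r : R ⟶ S),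
      ∀ Q, representables P Q → ∃ h : r.app Q ≫ m.app Q = 0,
        Nonempty (IsLimit (KernelFork.ofι (r.app Q) h)) := by
  obtain ⟨R, hR, r, e, he⟩ := exists_extension (kernelFunctorι m) (preservesSums_kernelFunctor m hs)
  refine ⟨R, hR, r, ?_⟩
  rintro X ⟨Q, ⟨i⟩⟩
  let e' : kernel (m.app ((embedding P).obj Q)) ≅ R.obj X := (e Q) ≪≫ R.mapIso i
  have h1 : e'.hom ≫ r.app X = kernel.ι (m.app ((embedding P).obj Q)) ≫ S.map i.hom := by
    change ((e Q).hom ≫ R.map i.hom) ≫ r.app X = _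
    rw [Category.assoc, r.naturality]
    exact (Category.assoc _ _ _).symm.trans (congr_arg (fun x => x ≫ S.map i.hom) (he Q))
  have h0 : r.app X ≫ m.app X = 0 := by
    rw [← cancel_epi e'.hom, reassoc_of% h1, m.naturality, kernel.condition_assoc, zero_comp,
      comp_zero]
  exact ⟨h0, ⟨IsKernel.ofIso _ (kernelIsKernel (m.app ((embedding P).obj Q))) _ (S.mapIso i)
    (S₂.mapIso i) e' (m.naturality i.hom) h1⟩⟩

end

end Extension

namespace FilteredAlgebra

lemma epi_toAlgebra {A : Type u} [Category.{v} A] [Abelian A] [HasCountableCoproducts A]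
    {W : ObjectProperty A} [HasCovers W] (F : FilteredAlgebra.{w} W) {G : GradedAlgebra.{w} A}
    (Φ : GradedAlgebra.Hom G F.rees) (h : ∀ n, IsIso (Φ.app n)) (X : A) :
    Epi ((F.toAlgebra Φ).app X) := by
  refine ⟨fun {Z} a b hab => ?_⟩
  have := hasColimitsOfShape_nat (A := A)
  have hc : IsColimit (((evaluation A A).obj X).mapCocone (Cocone.mk (F.T : A ⥤ A) F.cocone)) :=
    isColimitOfPreserves _ F.isColimit.some
  refine hc.hom_ext fun n => ?_
  change (F.ι n).app X ≫ a = (F.ι n).app X ≫ b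
  have h1 := F.ι_toAlgebra Φ n X
  have := h n
  rw [← cancel_epi ((Φ.app n).app X)]
  refine (Category.assoc _ _ _).symm.trans (Eq.trans ?_ (Category.assoc _ _ _))
  refine (congr_arg (fun x => x ≫ a) h1).symm.trans (Eq.trans ?_ (congr_arg (fun x => x ≫ b) h1))
  exact (Category.assoc _ _ _).trans ((congr_arg (fun x => _ ≫ x) hab).trans
    (Category.assoc _ _ _).symm)

lemma exists_isRelations {P : Type u} [Category.{w} P] [Preadditive P] [HasCoproducts.{w} P]
    [IsBoundedTheory P] (F : FilteredAlgebra.{w} (representables P)) (hF : F.IsKoszul) :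
    ∃ (R : Model P ⥤ Model P) (_ : PreservesColimitsOfSize.{w, w} R)
      (r : R ⟶ F.fil.obj 1 ⋙ F.fil.obj 1), F.IsRelations r := by
  refine exists_kernel_bimodule (F.mul (rfl : 1 + 1 = 2)) fun Q => ?_
  exact GradedAlgebra.exists_mul_lift (B := F.rees)
    (F.rees_koszulExactAt projective_of_representables hF.gr inferInstance 0) 1 (𝟙 _)

/-- A retraction of `1 ∈ F≤₁` which is induced by an augmentation. -/
lemma exists_retraction_reesT {A : Type u} [Category.{v} A] [Abelian A] [HasCountableCoproducts A]
    {W : ObjectProperty A} [HasCovers W] (F : FilteredAlgebra.{w} W) (ε : F.T ⟶ Monad.id A) :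
    ∃ e : F.fil.obj 1 ⟶ 𝟭 A, ∀ X, F.reesT X ≫ e.app X = 𝟙 X := by
  refine ⟨F.ι 1 ≫ ε.toNatTrans, fun X => ?_⟩
  have h1 := F.map_ι (homOfLE (Nat.le_succ 0)) X
  have h2 := F.one_cocone X
  have h3 : F.T.η.app X ≫ ε.app X = 𝟙 X := ε.app_η X
  refine Eq.trans ?_ h3
  rw [← h2, ← h1, reesT]
  simp only [Category.assoc]
  rfl

end FilteredAlgebra

end Koszul

open Koszul

theorem mainTheorem6 {P : Type u} [Category.{w} P] [Preadditive P] [HasCoproducts.{w} P]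
    [IsBoundedTheory P] (F : FilteredAlgebra.{w} (representables P)) (hF : F.IsKoszul) :
    (∃ (R : Model P ⥤ Model P) (_ : PreservesColimitsOfSize.{w, w} R)
      (r : R ⟶ F.fil.obj 1 ⋙ F.fil.obj 1), F.IsRelations r) ∧
    ∀ (R : Model P ⥤ Model P) [PreservesColimitsOfSize.{w, w} R]
      (r : R ⟶ F.fil.obj 1 ⋙ F.fil.obj 1), F.IsRelations r →
      ∃ Φ : GradedAlgebra.Hom (quadraticAlgebra.{w} r) F.rees,
        quadraticAlgebra.gen.{w} r ≫ Φ.app 1 = 𝟙 (F.fil.obj 1) ∧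
        (∀ Φ' : GradedAlgebra.Hom (quadraticAlgebra.{w} r) F.rees,
          quadraticAlgebra.gen.{w} r ≫ Φ'.app 1 = 𝟙 (F.fil.obj 1) → Φ' = Φ) ∧
        (∀ n, IsIso (Φ.app n)) ∧
        (quadraticAlgebra.{w} r).IsKoszul (representables P) ∧
        ((∀ X : Model P, Epi ((F.toAlgebra Φ).app X)) ∧
          IsIso (grCohomologyMap F Φ 0) ∧
          ∃ (κ : ∀ n, theoryCohomology (quadraticAlgebra.{w} r).aug (n + 1) ⟶
              theoryCohomology F.gr.aug n)
            (hκ : ∀ n, grCohomologyMap F Φ (n + 1) ≫ κ n = 0),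
            (∀ n, (ShortComplex.mk (grCohomologyMap F Φ (n + 1)) (κ n) (hκ n)).ShortExact) ∧
            (Nonempty (F.T ⟶ Monad.id (Model P)) → ∀ n, Nonempty
              (ShortComplex.mk (grCohomologyMap F Φ (n + 1)) (κ n) (hκ n)).Splitting)) ∧
        (∀ M N : F.T.Algebra, Projective M.A →
          (∀ n, Function.Surjective (cobarToKoszul F.ι M N n)) ∧
          ∃ ι : koszulCochains F.ι M N ⟶ koszulCochains (quadraticAlgebra.{w} r).ι
              ((Monad.algebraFunctorOfMonadHom (F.toAlgebra Φ)).obj M)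
              ((Monad.algebraFunctorOfMonadHom (F.toAlgebra Φ)).obj N),
            (∀ n, Mono (ι.f n)) ∧
            ∀ (n : ℕ) (c : (stage M n).Y ⟶ N.A), ι.f n (cobarToKoszul F.ι M N n c) =
              cobarToKoszul (quadraticAlgebra.{w} r).ι _ _ n
                (stageMap (F.toAlgebra Φ) M n ≫ c)) ∧
        ∃ pairing : ∀ (M N L : (quadraticAlgebra.{w} r).total.Algebra) {n m k : ℕ}, n + m = k →
            ((koszulCochains (quadraticAlgebra.{w} r).ι M N).X n →+
              (koszulCochains (quadraticAlgebra.{w} r).ι N L).X m →+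
              (koszulCochains (quadraticAlgebra.{w} r).ι M L).X k),
          ∀ M N : (quadraticAlgebra.{w} r).total.Algebra, Projective M.A →
            (∀ n, Function.Surjective (cobarToKoszul (quadraticAlgebra.{w} r).ι M N n)) ∧
            (∀ (L : (quadraticAlgebra.{w} r).total.Algebra) {n m k : ℕ} (h : n + m = k)
              (c : (stage M n).Y ⟶ N.A) (c' : (stage N m).Y ⟶ L.A),
              pairing M N L h (cobarToKoszul (quadraticAlgebra.{w} r).ι M N n c)
                  (cobarToKoszul (quadraticAlgebra.{w} r).ι N L m c') =
                cobarToKoszul (quadraticAlgebra.{w} r).ι M L k (cochainMul h c c')) ∧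
            ∀ (n : ℕ) (f : (koszulCochains (quadraticAlgebra.{w} r).ι M N).X n),
              (koszulCochains (quadraticAlgebra.{w} r).ι M N).d n (n + 1) f =
                pairing M M N (add_comm 1 n)
                  (koszulElement (quadraticAlgebra.{w} r).ι (quadraticAlgebra.{w} r).aug M) f -
                (-1 : ℤ) ^ n • pairing M N N rfl f
                  (koszulElement (quadraticAlgebra.{w} r).ι (quadraticAlgebra.{w} r).aug N) := by
  have hW : ∀ Q, representables P Q → Projective Q := projective_of_representables
  have hE : ∀ Q, Projective ((embedding P).obj Q) := fun Q => inferInstance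
  have := F.projComponents_gr hW hF.gr
  have hgr : ∀ X, Projective X → ∀ n, F.gr.KoszulExactAt X n := fun X hX =>
    F.gr_koszulExactAt hW hF.gr hX
  refine ⟨F.exists_isRelations hF, fun R _ r hr => ?_⟩
  have := F.rees_projComponents hW hF.gr
  obtain ⟨Φ, hgen, hΦ⟩ : ∃ Φ : GradedAlgebra.Hom (quadraticAlgebra.{w} r) F.rees,
      quadraticAlgebra.gen.{w} r ≫ Φ.app 1 = 𝟙 (F.fil.obj 1) ∧ ∀ n, IsIso (Φ.app n) :=
    ⟨GradedAlgebra.quadraticHom (B := F.rees) r hr.comp_mul,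
      GradedAlgebra.gen_quadraticHom (B := F.rees) r hr.comp_mul,
      GradedAlgebra.isIso_quadraticHom (B := F.rees) r hW hr.comp_mul
        (fun X hX Z x hx => hr.exists_lift F hX x hx)
        fun X hX => F.rees_koszulExactAt hW hF.gr hX⟩
  let D := (F.reesCentralQuotient hW hF.gr).transport Φ hΦ
  have := D.projComponents
  have hT : ∀ X, Projective X → ∀ n, (quadraticAlgebra.{w} r).KoszulExactAt X n :=
    fun X hX => D.koszulExactAt hX (hgr X hX)
  refine ⟨Φ, hgen, fun Φ' h => GradedAlgebra.quadraticHom_unique (B := F.rees) r h hgen, hΦ,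
    GradedAlgebra.isKoszul_of_koszulExactAt hW fun Q hQ => hT Q (hW Q hQ),
    ⟨F.epi_toAlgebra Φ hΦ, ?_⟩, fun M N hM => ?_, GradedAlgebra.exists_pairing _ hT⟩
  · obtain ⟨h0, κ, hκ, h1, h2⟩ := D.exists_shortExact (embedding P) hE (fun Q => hT _ (hE Q))
      (fun Q => hgr _ (hE Q)) (F.toGr Φ) (GradedAlgebra.totalMap_comp Φ F.grIdeal.proj).symm
      (F.toGr_aug Φ)
    refine ⟨h0, κ, hκ, h1, fun ⟨ε⟩ => h2 ?_⟩
    obtain ⟨e, he⟩ := F.exists_retraction_reesT ε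
    refine ⟨Φ.app 1 ≫ e, fun Y => ?_⟩
    refine Eq.trans ?_ (he Y)
    refine (Category.assoc _ _ _).trans (congr_arg (fun x => F.reesT Y ≫ x) ?_)
    exact IsIso.inv_hom_id_assoc ((Φ.app 1).app Y) (e.app Y)
  · have := F.preservesProj hW hF
    have hsF := F.isSplitAt_quad hW hF.gr hM
    refine ⟨(F.wordData hW hF.gr).cobarToKoszul_surjective hM hsF N, ?_⟩
    have hP : ∀ m, Projective ((F.gr.U (m + 1)).obj M.A) := fun m =>
      GradedAlgebra.projective_U hM m fun m _ => hgr M.A hM m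
    exact WordData.exists_koszulCochains_map (quadraticAlgebra.{w} r).wordData
      (F.wordData hW hF.gr) (F.toAlgebra Φ) hM
      ((quadraticAlgebra.{w} r).isSplitAt_quad (hT M.A hM)) hsF
      (fun n => GradedAlgebra.homU (F.homGr Φ) (n + 1) M.A)
      (fun n => (D.splitAt hP n).exists_section) (F.vMap_stageMap Φ hW hF.gr M)
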